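/- **Setting.** Let $\mathcal X$ be a compact Polish space with a finite Borel measure $\mu$, let $m\ge1$, and let $\Theta\subset\mathbb R^d$ be compact and connected in the sense that any two of its points can be joined by a path in $\Theta$ of length at most a fixed $L<\infty$. For $\theta\in\Theta$ let $(X_k,Y_k)_k$ be a hidden Markov model: the hidden chain $X_k\in\mathcal X$ has transition densities $q_\theta(x,x')$ with respect to $\mu$, and the observation $Y_k\in\mathbb R^m$ depends only on $X_k$, with conditional density $g_\theta(y|x)$ with respect to Lebesgue measure $\nu$. Let $\overline{\mathbb P}_\theta$ be the law of the stationary two-sided model and let $E_{\theta^*}$ be expectation under $\overline{\mathbb P}_{\theta^*}$, where $\theta^*$ is the true parameter; $Y$ denotes a single observation. $B^r_y$ is the closed Euclidean ball of radius $r$ around $y$. Assume: * (A1) $\theta^*$ is in the interior of $\Theta$, and for $\theta\in\Theta$ the law of $(Y_k)_{k\in\mathbb Z}$ under $\overline{\mathbb P}_\theta$ equals that under $\overline{\mathbb P}_{\theta^*}$ if and only if $\theta=\theta^*$. * (A2) $\theta\mapsto q_\theta(x,x')$ and $\theta\mapsto g_\theta(y|x)$ are three times continuously differentiable (in a neighbourhood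 of each point of $\Theta$) for all $x,x',y$. * (A3) There are $\underline c_1,\overline c_1\in(0,\infty)$ with $\underline c_1\le q_\theta(x,x')\le\overline c_1$ and $g_\theta(y|x)\le\overline c_1$ for all $\theta\in\Theta$, $x,x',y$. * (A4) $|\nabla_\theta\log q_\theta(x,x')|$ and $|\nabla^2_\theta\log q_\theta(x,x')|$ are bounded uniformly in $\theta\in\Theta$, $x,x'$. * (A5) $0<\int g_\theta(y|x)\,\mu(dx)<\infty$ for all $\theta\in\Theta$ and $y$. * (A6) $g_\theta(y|x)>0$ for all $\theta\in\Theta$, $x,y$, and for every $K>0$ and each $(j,p)\in\{(1,3),(2,2),(3,1)\}$, $E_{\theta^*}\big[\sup_{\theta\in\Theta,\,x\in\mathcal X,\,z\in B^K_0}\|\nabla_\theta^j\log g_\theta(Y+z|x)\|^{p}\big]<\infty$. * (A7) $g_\theta(\cdot|x)$ and $\nabla_\theta g_\theta(\cdot|x)$ are differentiable and there is $R>0$ such that for all $0<\epsilon\le R$ the expectations $E_{\theta^*}\big[\sup_{x,\theta,z\in B_0^\epsilon}\big|\nabla_z g_\theta(Y+z|x)/g_\theta(Y|x)\big|^2\big]$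 and $E_{\theta^*}\big[\sup_{x,\theta,z\in B_0^\epsilon}\big|\nabla_z\nabla_\theta g_\theta(Y+z|x)/g_\theta(Y|x)\big|^2\big]$ are finite. * (A8) The same as (A7) with twice differentiability and with $\nabla_z^2$ in place of $\nabla_z$. For $\epsilon>0$ let $g^\epsilon_\theta(y|x)=\nu(B^\epsilon_y)^{-1}\int_{B^\epsilon_y}g_\theta(y'|x)\,\nu(dy')$, let $g^0_\theta=g_\theta$, and for $\epsilon\ge0$ let $p^\epsilon_\theta(y_1,\dots,y_n|x_0)=\int\prod_{k=1}^n q_\theta(x_{k-1},x_k)g^\epsilon_\theta(y_k|x_k)\,\mu(dx_{1:n})$. The ABC maximum likelihood estimator with tolerance $\epsilon$ is any maximiser $\hat\theta^\epsilon_n$ over $\Theta$ of the probability $\mathbb P_\theta(Y_1\in B^\epsilon_{\hat Y_1},\dots,Y_n\in B^\epsilon_{\hat Y_n})$, where $\hat Y_1,\hat Y_2,\dots$ are the data and the initial law of $X_0$ in the likelihood is arbitrary. **Theorem.** For every $\epsilon\ge0$ there is a function $l^\epsilon:\Theta\to\mathbb R$, twice continuously differentiable on the interior of $\Theta$, such that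 for every $x\in\mathcal X$, $\overline{\mathbb P}_{\theta^*}$-almost surely, uniformly in $\theta\in\Theta$, $$\tfrac1n\big(\log p^\epsilon_\theta(\hat Y_1,\dots,\hat Y_n|x)-\log p^\epsilon_{\theta^*}(\hat Y_1,\dots,\hat Y_n|x)\big)\to l^\epsilon(\theta).$$ If moreover $\nabla^2_\theta l^0(\theta^*)$ is strictly negative definite, then for all sufficiently small $\epsilon>0$ the surface $l^\epsilon$ has a unique maximiser $\theta^{*,\epsilon}$ in $\Theta$; for every initial law of $X_0$ the ABC maximum likelihood estimator $\hat\theta_n^\epsilon$ converges to $\theta^{*,\epsilon}$, $\overline{\mathbb P}_{\theta^*}$-almost surely; and $$|\theta^{*,\epsilon}-\theta^*|=O(\epsilon^2)\qquad(\epsilon\to0).$$ -/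

import Mathlib

open MeasureTheory Filter Topology Set
open scoped ENNReal NNReal

noncomputable section

/-- Real coordinate space with its Euclidean norm. -/
abbrev Euc (n : ℕ) : Type := EuclideanSpace ℝ (Fin n)

/-- `E[F] < ∞` for a nonnegative function `F`, without presupposing that `F` (typically a supremum
over an uncountable family) is measurable: `F` has an integrable measurable majorant. For
measurable `F` this is `∫⁻ y, F y ∂ρ < ∞`. -/
def FiniteMean {S : Type*} [MeasurableSpace S] (ρ : Measure S) (F : S → ℝ≥0∞) : Prop :=
  ∃ B : S → ℝ≥0∞, Measurable B ∧ (∀ s, F s ≤ B s) ∧ ∫⁻ s, B s ∂ρ < ∞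

/-- The predecessor in the path `x, w 0, w 1, …` of its `k`-th entry `w k`. -/
def prevState {𝒳 : Type*} {n : ℕ} (x : 𝒳) (w : Fin n → 𝒳) (k : Fin n) : 𝒳 :=
  (Fin.cons x w : Fin (n + 1) → 𝒳) k.castSucc

/-- A parametrised family of hidden Markov models with hidden states in `𝒳`, observations in `ℝᵐ`
and parameters in a set `Θ ⊆ ℝᵈ`. The transition kernels have densities `q θ x ·` with respect to
the finite measure `μ`, the conditional laws of the observations have densities `g θ · x` with
respect to Lebesgue measure. Values of `q` and `g` at parameters outside `Θ` only serve to give a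
meaning to derivatives at boundary points of `Θ`. -/
structure HMMFamily (𝒳 : Type*) [MeasurableSpace 𝒳] (d m : ℕ) where
  /-- the parameter set -/
  Θ : Set (Euc d)
  /-- the dominating measure on the hidden state space -/
  μ : Measure 𝒳
  /-- `q θ x x'`: density of the transition from `x` to `x'` -/
  q : Euc d → 𝒳 → 𝒳 → ℝ
  /-- `g θ y x`: density at `y` of the observation given the hidden state `x` -/
  g : Euc d → Euc m → 𝒳 → ℝ
  compact_param : IsCompact Θ
  /-- connectedness: any two parameters are joined within `Θ` by a path of length at most `L` -/
  connected_param : ∃ L : ℝ≥0, ∀ a ∈ Θ, ∀ b ∈ Θ, ∃ γ : ℝ → Euc d,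
    LipschitzOnWith L γ (Icc 0 1) ∧ MapsTo γ (Icc 0 1) Θ ∧ γ 0 = a ∧ γ 1 = b
  finite_dominating : IsFiniteMeasure μ
  measurable_q : ∀ θ ∈ Θ, Measurable (Function.uncurry (q θ))
  measurable_g : ∀ θ ∈ Θ, Measurable (Function.uncurry (g θ))
  q_nonneg : ∀ θ ∈ Θ, ∀ x x', 0 ≤ q θ x x'
  g_nonneg : ∀ θ ∈ Θ, ∀ y x, 0 ≤ g θ y x
  lintegral_q : ∀ θ ∈ Θ, ∀ x, ∫⁻ x', ENNReal.ofReal (q θ x x') ∂μ = 1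
  lintegral_g : ∀ θ ∈ Θ, ∀ x, ∫⁻ y, ENNReal.ofReal (g θ y x) = 1

namespace HMMFamily

variable {𝒳 : Type*} [MeasurableSpace 𝒳] {d m : ℕ} (M : HMMFamily 𝒳 d m)

/-! ### Laws -/

/-- The joint law of `X₀` and `(X₁, Y₁), …, (Xₙ, Yₙ)` under the parameter `θ`, when `X₀` has the
law `π₀`. -/
def jointLaw (θ : Euc d) (π₀ : Measure 𝒳) (n : ℕ) : Measure (𝒳 × (Fin n → 𝒳 × Euc m)) :=
  (π₀.prod (Measure.pi fun _ => M.μ.prod volume)).withDensity fun p =>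
    ∏ k : Fin n, ENNReal.ofReal (M.q θ (prevState p.1 (fun j => (p.2 j).1) k) (p.2 k).1) *
      ENNReal.ofReal (M.g θ (p.2 k).2 (p.2 k).1)

/-- `P` is the law of the two-sided stationary hidden Markov model `(X_k, Y_k)`, `k ∈ ℤ`, with
parameter `θ`: its finite-dimensional distributions over every time window are those of the model
started from one and the same (hence invariant) distribution `π`. -/
def IsStationaryLaw (θ : Euc d) (P : Measure (ℤ → 𝒳 × Euc m)) : Prop :=
  ∃ π : Measure 𝒳, IsProbabilityMeasure π ∧ ∀ (a : ℤ) (n : ℕ),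
    P.map (fun ω => ((ω a).1, fun k : Fin n => ω (a + 1 + (k : ℤ)))) = M.jointLaw θ π n

/-- The law of a single observation when the two-sided process has the law `P`. -/
def obsLaw (P : Measure (ℤ → 𝒳 × Euc m)) : Measure (Euc m) :=
  P.map fun ω => (ω 0).2

/-- The data `Y₁, …, Yₙ`. -/
def data (n : ℕ) (ω : ℤ → 𝒳 × Euc m) : Fin n → Euc m :=
  fun k => (ω ((k : ℤ) + 1)).2

/-! ### Assumptions

Bounds on derivatives are in operator norms, which in finite dimension are equivalent to the
Euclidean and Frobenius norms. `P θ` is the stationary law of the model with parameter `θ`, `ρ` is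
the law of an observation under the true parameter. -/

/-- The true parameter is interior and identifiable from the law of the observed process. -/
def A1 (P : Euc d → Measure (ℤ → 𝒳 × Euc m)) (θs : Euc d) : Prop :=
  θs ∈ interior M.Θ ∧ ∀ θ ∈ M.Θ,
    (θ = θs ↔ (P θ).map (fun ω k => (ω k).2) = (P θs).map (fun ω k => (ω k).2))

/-- The densities are three times continuously differentiable in the parameter. -/
def A2 : Prop :=
  (∀ x x', ∀ θ ∈ M.Θ, ContDiffAt ℝ 3 (fun t => M.q t x x') θ) ∧
  (∀ y x, ∀ θ ∈ M.Θ, ContDiffAt ℝ 3 (fun t => M.g t y x) θ)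

def A3 : Prop :=
  ∃ c C : ℝ, 0 < c ∧ 0 < C ∧ ∀ θ ∈ M.Θ, ∀ x x', ∀ y,
    c ≤ M.q θ x x' ∧ M.q θ x x' ≤ C ∧ M.g θ y x ≤ C

def A4 : Prop :=
  ∃ C : ℝ, 0 < C ∧ ∀ θ ∈ M.Θ, ∀ x x',
    ‖iteratedFDeriv ℝ 1 (fun t => Real.log (M.q t x x')) θ‖ ≤ C ∧
    ‖iteratedFDeriv ℝ 2 (fun t => Real.log (M.q t x x')) θ‖ ≤ C

def A5 : Prop :=
  ∀ θ ∈ M.Θ, ∀ y, 0 < ∫⁻ x, ENNReal.ofReal (M.g θ y x) ∂M.μ ∧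
    ∫⁻ x, ENNReal.ofReal (M.g θ y x) ∂M.μ < ∞

/-- `sup_θ sup_x sup_{|z| ≤ K} ‖∇_θ^j log g_θ(y + z | x)‖^p`. -/
def supLogDeriv (j p : ℕ) (K : ℝ) (y : Euc m) : ℝ≥0∞ :=
  ⨆ θ ∈ M.Θ, ⨆ x : 𝒳, ⨆ z ∈ Metric.closedBall (0 : Euc m) K,
    ENNReal.ofReal (‖iteratedFDeriv ℝ j (fun t => Real.log (M.g t (y + z) x)) θ‖ ^ p)

/-- Moment bounds on the first three derivatives of `log g`, which presuppose `0 < g`. -/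
def A6 (ρ : Measure (Euc m)) : Prop :=
  (∀ θ ∈ M.Θ, ∀ y x, 0 < M.g θ y x) ∧ ∀ K : ℝ, 0 < K →
    FiniteMean ρ (M.supLogDeriv 1 3 K) ∧
    FiniteMean ρ (M.supLogDeriv 2 2 K) ∧
    FiniteMean ρ (M.supLogDeriv 3 1 K)

/-- The gradient `∇_θ g_θ(y | x)`. -/
def gradG (θ : Euc d) (x : 𝒳) (y : Euc m) : Euc d →L[ℝ] ℝ :=
  fderiv ℝ (fun t => M.g t y x) θ

/-- First order Lipschitz condition in the observation, for `g` and for `∇_θ g`. -/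
def A7 (ρ : Measure (Euc m)) : Prop :=
  (∀ θ ∈ M.Θ, ∀ x, Differentiable ℝ (fun y => M.g θ y x) ∧ Differentiable ℝ (M.gradG θ x)) ∧
  ∃ R : ℝ, 0 < R ∧ ∀ ε : ℝ, 0 < ε → ε ≤ R →
    FiniteMean ρ (fun y => ⨆ x : 𝒳, ⨆ θ ∈ M.Θ, ⨆ z ∈ Metric.closedBall (0 : Euc m) ε,
      ENNReal.ofReal ((‖fderiv ℝ (fun y' => M.g θ y' x) (y + z)‖ / M.g θ y x) ^ 2)) ∧
    FiniteMean ρ (fun y => ⨆ x : 𝒳, ⨆ θ ∈ M.Θ, ⨆ z ∈ Metric.closedBall (0 : Euc m) ε,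
      ENNReal.ofReal ((‖fderiv ℝ (M.gradG θ x) (y + z)‖ / M.g θ y x) ^ 2))

/-- Second order Lipschitz condition in the observation, for `g` and for `∇_θ g`. -/
def A8 (ρ : Measure (Euc m)) : Prop :=
  (∀ θ ∈ M.Θ, ∀ x, Differentiable ℝ (fderiv ℝ (fun y => M.g θ y x)) ∧
    Differentiable ℝ (fderiv ℝ (M.gradG θ x))) ∧
  ∃ R : ℝ, 0 < R ∧ ∀ ε : ℝ, 0 < ε → ε ≤ R →
    FiniteMean ρ (fun y => ⨆ x : 𝒳, ⨆ θ ∈ M.Θ, ⨆ z ∈ Metric.closedBall (0 : Euc m) ε,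
      ENNReal.ofReal
        ((‖iteratedFDeriv ℝ 2 (fun y' => M.g θ y' x) (y + z)‖ / M.g θ y x) ^ 2)) ∧
    FiniteMean ρ (fun y => ⨆ x : 𝒳, ⨆ θ ∈ M.Θ, ⨆ z ∈ Metric.closedBall (0 : Euc m) ε,
      ENNReal.ofReal ((‖iteratedFDeriv ℝ 2 (M.gradG θ x) (y + z)‖ / M.g θ y x) ^ 2))

/-! ### Perturbed likelihoods, limit surfaces, the ABC maximum likelihood estimator -/

/-- The density `g_θ^ε(y | x)` of the perturbed observation: the average of `g_θ(· | x)` over the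
closed `ε`-ball around `y`; for `ε = 0` the original density. -/
def pertG (ε : ℝ) (θ : Euc d) (y : Euc m) (x : 𝒳) : ℝ :=
  if ε = 0 then M.g θ y x else ⨍ y' in Metric.closedBall y ε, M.g θ y' x

/-- The likelihood `p_θ^ε(y₁, …, yₙ | X₀ = x)` of the perturbed model. -/
def likelihood (ε : ℝ) (θ : Euc d) (x : 𝒳) {n : ℕ} (y : Fin n → Euc m) : ℝ :=
  ∫ w : Fin n → 𝒳, ∏ k : Fin n, (M.q θ (prevState x w k) (w k) * M.pertG ε θ (y k) (w k))
    ∂(Measure.pi fun _ => M.μ)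

/-- `l` is the limiting relative mean log likelihood surface for the tolerance `ε`, for data with
the law `P` and the true parameter `θs`: for every initial state, almost surely,
`n⁻¹ (log p_θ^ε(Y₁, …, Yₙ | x) - log p_θs^ε(Y₁, …, Yₙ | x)) → l θ` uniformly in `θ ∈ Θ`. -/
def IsLimitSurface (P : Measure (ℤ → 𝒳 × Euc m)) (θs : Euc d) (ε : ℝ) (l : Euc d → ℝ) : Prop :=
  ∀ x : 𝒳, ∀ᵐ ω ∂P, TendstoUniformlyOn
    (fun (n : ℕ) (θ : Euc d) => (n : ℝ)⁻¹ *
      (Real.log (M.likelihood ε θ x (data n ω)) - Real.log (M.likelihood ε θs x (data n ω))))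
    l atTop M.Θ

/-- `P_θ(Y₁ ∈ B(y₁, ε), …, Yₙ ∈ B(yₙ, ε))` when `X₀` has the law `π₀`. -/
def abcLikelihood (ε : ℝ) (π₀ : Measure 𝒳) (θ : Euc d) {n : ℕ} (y : Fin n → Euc m) : ℝ≥0∞ :=
  M.jointLaw θ π₀ n {p | ∀ k, (p.2 k).2 ∈ Metric.closedBall (y k) ε}

/-- `t` is an ABC maximum likelihood estimate for the data `y`. -/
def IsABCMLE (ε : ℝ) (π₀ : Measure 𝒳) {n : ℕ} (y : Fin n → Euc m) (t : Euc d) : Prop :=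
  t ∈ M.Θ ∧ ∀ θ ∈ M.Θ, M.abcLikelihood ε π₀ θ y ≤ M.abcLikelihood ε π₀ t y

/-- `t` is the asymptotic value of the ABC maximum likelihood estimator with tolerance `ε`: for
every initial distribution, almost surely, the estimates converge to `t`. -/
def IsABCMLELimit (P : Measure (ℤ → 𝒳 × Euc m)) (ε : ℝ) (t : Euc d) : Prop :=
  ∀ π₀ : Measure 𝒳, IsProbabilityMeasure π₀ → ∀ᵐ ω ∂P, ∀ est : ℕ → Euc d,
    (∀ n, M.IsABCMLE ε π₀ (data n ω) (est n)) → Tendsto est atTop (𝓝 t)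

end HMMFamily

/-- `t` is the only maximiser of `l` on `S`. -/
def IsUniqueMaxOn {α : Type*} (l : α → ℝ) (S : Set α) (t : α) : Prop :=
  t ∈ S ∧ ∀ s ∈ S, s ≠ t → l s < l t

end

set_option linter.unusedSectionVars false
set_option maxSynthPendingDepth 3

noncomputable section

section WeightedAverage

variable {Z : Type*} [MeasurableSpace Z] {F : Type*} [NormedAddCommGroup F] [NormedSpace ℝ F]

/-- Bounded strongly measurable functions. -/
structure BddMeas (f : Z → F) : Prop where
  meas : StronglyMeasurable f
  bdd : ∃ B, ∀ z, ‖f z‖ ≤ B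

namespace BddMeas

variable {f g : Z → F} {a b : Z → ℝ} {μ : Measure Z} [IsFiniteMeasure μ]

lemma integrable (hf : BddMeas f) : Integrable f μ := by
  obtain ⟨B, hB⟩ := hf.bdd
  exact Integrable.of_bound hf.meas.aestronglyMeasurable B (ae_of_all _ hB)

lemma const (v : F) : BddMeas (fun _ : Z => v) := ⟨stronglyMeasurable_const, ‖v‖, fun _ => le_rfl⟩

lemma add (hf : BddMeas f) (hg : BddMeas g) : BddMeas (fun z => f z + g z) := by
  obtain ⟨B, hB⟩ := hf.bdd
  obtain ⟨B', hB'⟩ := hg.bdd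
  exact ⟨hf.meas.add hg.meas, B + B', fun z => (norm_add_le _ _).trans (add_le_add (hB z) (hB' z))⟩

lemma sub (hf : BddMeas f) (hg : BddMeas g) : BddMeas (fun z => f z - g z) := by
  obtain ⟨B, hB⟩ := hf.bdd
  obtain ⟨B', hB'⟩ := hg.bdd
  exact ⟨hf.meas.sub hg.meas, B + B', fun z => (norm_sub_le _ _).trans (add_le_add (hB z) (hB' z))⟩

lemma smul (ha : BddMeas a) (hf : BddMeas f) : BddMeas (fun z => a z • f z) := by
  obtain ⟨B, hB⟩ := hf.bdd
  obtain ⟨B', hB'⟩ := ha.bdd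
  refine ⟨ha.meas.smul hf.meas, B' * B, fun z => ?_⟩
  rw [norm_smul]
  exact mul_le_mul (hB' z) (hB z) (norm_nonneg _) ((norm_nonneg _).trans (hB' z))

lemma mul (ha : BddMeas a) (hb : BddMeas b) : BddMeas (fun z => a z * b z) := ha.smul hb

end BddMeas

/-- Strictly positive bounded measurable weight functions. -/
structure IsWeight (a : Z → ℝ) : Prop extends BddMeas a where
  pos : ∀ z, 0 < a z

namespace IsWeight

variable {a b : Z → ℝ} {μ : Measure Z} [IsFiniteMeasure μ] [NeZero μ]

lemma mul (ha : IsWeight a) (hb : IsWeight b) : IsWeight (fun z => a z * b z) :=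
  ⟨ha.toBddMeas.mul hb.toBddMeas, fun z => mul_pos (ha.pos z) (hb.pos z)⟩

lemma integral_pos (ha : IsWeight a) : 0 < ∫ z, a z ∂μ := by
  rw [integral_pos_iff_support_of_nonneg (fun z => (ha.pos z).le) ha.integrable]
  have : Function.support a = univ := by
    ext z; simp [(ha.pos z).ne']
  rw [this]
  exact Measure.measure_univ_pos.2 (NeZero.ne μ)

lemma one : IsWeight (fun _ : Z => (1 : ℝ)) := ⟨BddMeas.const _, fun _ => one_pos⟩

end IsWeight

lemma weight_ratio_le_of_le {a b : Z → ℝ} {μ : Measure Z} [IsFiniteMeasure μ] {K : ℝ}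
    (ha : BddMeas a) (hb : BddMeas b) (h : ∀ z, a z ≤ K * b z) :
    ∫ z, a z ∂μ ≤ K * ∫ z, b z ∂μ := by
  rw [← integral_const_mul]
  exact integral_mono ha.integrable (hb.integrable.const_mul K) h

/-- The average of `f` with respect to the weight `a`. -/
def wavg (μ : Measure Z) (a : Z → ℝ) (f : Z → F) : F := (∫ z, a z ∂μ)⁻¹ • ∫ z, a z • f z ∂μ

variable {μ : Measure Z} [IsFiniteMeasure μ] [NeZero μ] {a a' : Z → ℝ} {f g : Z → F}

lemma wavg_add (ha : IsWeight a) (hf : BddMeas f) (hg : BddMeas g) :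
    wavg μ a (fun z => f z + g z) = wavg μ a f + wavg μ a g := by
  simp only [wavg, smul_add]
  rw [integral_add (ha.smul hf).integrable (ha.smul hg).integrable, smul_add]

lemma wavg_sub (ha : IsWeight a) (hf : BddMeas f) (hg : BddMeas g) :
    wavg μ a (fun z => f z - g z) = wavg μ a f - wavg μ a g := by
  simp only [wavg, smul_sub]
  rw [integral_sub (ha.smul hf).integrable (ha.smul hg).integrable, smul_sub]

lemma wavg_const [CompleteSpace F] (ha : IsWeight a) (v : F) : wavg μ a (fun _ => v) = v := by
  simp only [wavg]
  rw [integral_smul_const, smul_smul, inv_mul_cancel₀ ha.integral_pos.ne', one_smul]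

lemma norm_wavg_le (ha : IsWeight a) {B : ℝ} (h : ∀ z, ‖f z‖ ≤ B) : ‖wavg μ a f‖ ≤ B := by
  have hp := ha.integral_pos (μ := μ)
  have : ‖∫ z, a z • f z ∂μ‖ ≤ ∫ z, a z * B ∂μ := by
    refine norm_integral_le_of_norm_le (ha.integrable.mul_const B) (ae_of_all _ fun z => ?_)
    rw [norm_smul, Real.norm_of_nonneg (ha.pos z).le]
    exact mul_le_mul_of_nonneg_left (h z) (ha.pos z).le
  rw [integral_mul_const] at this
  rw [wavg, norm_smul, norm_inv, Real.norm_of_nonneg hp.le, inv_mul_le_iff₀ hp]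
  exact this

lemma norm_integral_sub_integral_le {r₁ r₂ : Z → ℝ} (h₁ : BddMeas r₁) (h₂ : BddMeas r₂)
    (p₁ : ∀ z, 0 ≤ r₁ z) (p₂ : ∀ z, 0 ≤ r₂ z) {t : ℝ} (e₁ : ∫ z, r₁ z ∂μ = t)
    (e₂ : ∫ z, r₂ z ∂μ = t) [CompleteSpace F] (hf : BddMeas f) {o : ℝ}
    (ho : ∀ z w, ‖f z - f w‖ ≤ o) :
    ‖(∫ z, r₁ z • f z ∂μ) - ∫ z, r₂ z • f z ∂μ‖ ≤ t * o := by
  have ht : 0 ≤ t := e₁ ▸ integral_nonneg p₁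
  have step (w : Z) : ‖(∫ z, r₁ z • f z ∂μ) - t • f w‖ ≤ t * o := by
    have e : (∫ z, r₁ z • f z ∂μ) - t • f w = ∫ z, r₁ z • (f z - f w) ∂μ := by
      simp only [smul_sub]
      rw [integral_sub (h₁.smul hf).integrable (h₁.smul (BddMeas.const _)).integrable,
        integral_smul_const, e₁]
    rw [e, ← e₁, ← integral_mul_const]
    refine norm_integral_le_of_norm_le (h₁.integrable.mul_const o) (ae_of_all _ fun z => ?_)
    rw [norm_smul, Real.norm_of_nonneg (p₁ z)]
    exact mul_le_mul_of_nonneg_left (ho z w) (p₁ z)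
  have key : ‖∫ w, r₂ w • ((∫ z, r₁ z • f z ∂μ) - t • f w) ∂μ‖ ≤ t * (t * o) := by
    have e : t * (t * o) = ∫ w, r₂ w * (t * o) ∂μ := by rw [integral_mul_const, e₂]
    rw [e]
    refine norm_integral_le_of_norm_le (h₂.integrable.mul_const _) (ae_of_all _ fun w => ?_)
    rw [norm_smul, Real.norm_of_nonneg (p₂ w)]
    exact mul_le_mul_of_nonneg_left (step w) (p₂ w)
  have e : ∫ w, r₂ w • ((∫ z, r₁ z • f z ∂μ) - t • f w) ∂μ =
      t • ((∫ z, r₁ z • f z ∂μ) - ∫ z, r₂ z • f z ∂μ) := by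
    simp only [smul_sub]
    rw [integral_sub (h₂.smul (BddMeas.const _)).integrable
      (h₂.smul ((BddMeas.const t).smul hf)).integrable, integral_smul_const, e₂]
    congr 1
    rw [← integral_smul]
    congr 1 with w
    rw [smul_comm]
  rw [e, norm_smul, Real.norm_of_nonneg ht] at key
  rcases ht.eq_or_lt with h0 | h0
  · have z₁ : ∀ᵐ z ∂μ, r₁ z = 0 :=
      (integral_eq_zero_iff_of_nonneg p₁ h₁.integrable).1 (e₁.trans h0.symm)
    have z₂ : ∀ᵐ z ∂μ, r₂ z = 0 :=
      (integral_eq_zero_iff_of_nonneg p₂ h₂.integrable).1 (e₂.trans h0.symm)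
    have i₁ : ∫ z, r₁ z • f z ∂μ = 0 := by
      refine integral_eq_zero_of_ae ?_
      filter_upwards [z₁] with z hz
      simp [hz]
    have i₂ : ∫ z, r₂ z • f z ∂μ = 0 := by
      refine integral_eq_zero_of_ae ?_
      filter_upwards [z₂] with z hz
      simp [hz]
    simp [i₁, i₂, ← h0]
  · exact le_of_mul_le_mul_left key h0

/-- If two normalised weights have the common lower bound `k`, then the corresponding averages of a
function of oscillation at most `o` differ by at most `(1 - ∫ k) o`. -/
lemma norm_wavg_sub_wavg_le [CompleteSpace F] (ha : IsWeight a) (ha' : IsWeight a') {k : Z → ℝ}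
    (hk : BddMeas k) (h : ∀ z, k z ≤ (∫ z, a z ∂μ)⁻¹ * a z)
    (h' : ∀ z, k z ≤ (∫ z, a' z ∂μ)⁻¹ * a' z) (hf : BddMeas f) {o : ℝ}
    (ho : ∀ z w, ‖f z - f w‖ ≤ o) :
    ‖wavg μ a f - wavg μ a' f‖ ≤ (1 - ∫ z, k z ∂μ) * o := by
  have key (b : Z → ℝ) (hb : IsWeight b) (hbk : ∀ z, k z ≤ (∫ z, b z ∂μ)⁻¹ * b z) :
      BddMeas (fun z => (∫ z, b z ∂μ)⁻¹ * b z - k z) ∧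
      ∫ z, ((∫ z, b z ∂μ)⁻¹ * b z - k z) ∂μ = 1 - ∫ z, k z ∂μ ∧
      wavg μ b f = ∫ z, ((∫ z, b z ∂μ)⁻¹ * b z - k z) • f z ∂μ + ∫ z, k z • f z ∂μ := by
    have hb1 : BddMeas (fun z => (∫ z, b z ∂μ)⁻¹ * b z) := (BddMeas.const _).mul hb.toBddMeas
    refine ⟨hb1.sub hk, ?_, ?_⟩
    · rw [integral_sub hb1.integrable hk.integrable, integral_const_mul,
        inv_mul_cancel₀ hb.integral_pos.ne']
    · rw [← integral_add ((hb1.sub hk).smul hf).integrable (hk.smul hf).integrable, wavg,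
        ← integral_smul]
      congr 1 with z
      rw [← add_smul, sub_add_cancel, smul_smul]
  obtain ⟨b1, e1, w1⟩ := key a ha h
  obtain ⟨b2, e2, w2⟩ := key a' ha' h'
  rw [w1, w2, add_sub_add_right_eq_sub]
  exact norm_integral_sub_integral_le b1 b2 (fun z => sub_nonneg.2 (h z))
    (fun z => sub_nonneg.2 (h' z)) e1 e2 hf ho

/-- Averages with respect to comparable weights. -/
lemma norm_wavg_sub_wavg_le_of_tilt [CompleteSpace F] (ha : IsWeight a) (ha' : IsWeight a') {E : ℝ}
    (hE : 0 ≤ E) (h : ∀ z w, a z * a' w ≤ (1 + E) * (a' z * a w)) (hf : BddMeas f) {o : ℝ}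
    (ho : ∀ z w, ‖f z - f w‖ ≤ o) : ‖wavg μ a' f - wavg μ a f‖ ≤ (1 - (1 + E)⁻¹) * o := by
  have hp := ha.integral_pos (μ := μ)
  have hp' := ha'.integral_pos (μ := μ)
  have hE1 : 0 < 1 + E := by linarith
  have hb1 : BddMeas (fun z => (1 + E)⁻¹ * ((∫ z, a z ∂μ)⁻¹ * a z)) :=
    (BddMeas.const _).mul ((BddMeas.const _).mul ha.toBddMeas)
  have hint (z : Z) : a z * ∫ w, a' w ∂μ ≤ (1 + E) * a' z * ∫ w, a w ∂μ := by
    rw [← integral_const_mul]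
    refine weight_ratio_le_of_le ((BddMeas.const _).mul ha'.toBddMeas) ha.toBddMeas fun w => ?_
    linarith [h z w]
  have h1 : ∀ z, (1 + E)⁻¹ * ((∫ z, a z ∂μ)⁻¹ * a z) ≤ (∫ z, a' z ∂μ)⁻¹ * a' z := fun z => by
    rw [inv_mul_le_iff₀ hE1, inv_mul_le_iff₀ hp]
    have := hint z
    rw [← le_div_iff₀ hp'] at this
    refine this.trans (le_of_eq ?_)
    field_simp
  have h2 : ∀ z, (1 + E)⁻¹ * ((∫ z, a z ∂μ)⁻¹ * a z) ≤ (∫ z, a z ∂μ)⁻¹ * a z := fun z => by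
    have : 0 ≤ (∫ z, a z ∂μ)⁻¹ * a z := mul_nonneg (inv_nonneg.2 hp.le) (ha.pos z).le
    rw [inv_mul_le_iff₀ hE1]
    nlinarith
  have := norm_wavg_sub_wavg_le ha' ha hb1 h1 h2 hf ho
  rwa [integral_const_mul, integral_const_mul, inv_mul_cancel₀ hp.ne', mul_one] at this

lemma wavg_mono {f g : Z → ℝ} (ha : IsWeight a) (hf : BddMeas f) (hg : BddMeas g)
    (h : ∀ z, f z ≤ g z) : wavg μ a f ≤ wavg μ a g := by
  refine mul_le_mul_of_nonneg_left ?_ (inv_nonneg.2 (ha.integral_pos.le))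
  exact integral_mono (ha.smul hf).integrable (ha.smul hg).integrable fun z =>
    mul_le_mul_of_nonneg_left (h z) (ha.pos z).le

/-! ### Averages along a transition density which is bounded above and below -/

variable {q : Z → Z → ℝ} {r r' : Z → ℝ} {c C : ℝ}

/-- `q` is jointly measurable and takes values in `[c, C]`. -/
structure IsMixing (c C : ℝ) (q : Z → Z → ℝ) : Prop where
  meas : Measurable (Function.uncurry q)
  pos : 0 < c
  lower : ∀ x z, c ≤ q x z
  upper : ∀ x z, q x z ≤ C

namespace IsMixing

lemma weight (hq : IsMixing c C q) (x : Z) : IsWeight (q x) where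
  meas := (hq.meas.comp measurable_prodMk_left).stronglyMeasurable
  bdd := ⟨C, fun z => by
    rw [Real.norm_of_nonneg (hq.pos.le.trans (hq.lower x z))]; exact hq.upper x z⟩
  pos z := hq.pos.trans_le (hq.lower x z)

lemma le [Nonempty Z] (hq : IsMixing c C q) : c ≤ C :=
  let x := Classical.arbitrary Z
  (hq.lower x x).trans (hq.upper x x)

lemma upper_pos [Nonempty Z] (hq : IsMixing c C q) : 0 < C := hq.pos.trans_le hq.le

lemma rho_nonneg [Nonempty Z] (hq : IsMixing c C q) : 0 ≤ 1 - c / C := by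
  rw [sub_nonneg, div_le_one hq.upper_pos]; exact hq.le

lemma rho_lt_one [Nonempty Z] (hq : IsMixing c C q) : 1 - c / C < 1 := by
  have := div_pos hq.pos hq.upper_pos
  linarith

/-- Doeblin contraction of the oscillation. -/
lemma norm_wavg_sub_le [CompleteSpace F] (hq : IsMixing c C q) (hr : IsWeight r) (hf : BddMeas f)
    {o : ℝ} (ho : ∀ z w, ‖f z - f w‖ ≤ o) (x x' : Z) :
    ‖wavg μ (fun z => q x z * r z) f - wavg μ (fun z => q x' z * r z) f‖ ≤ (1 - c / C) * o := by
  have : Nonempty Z := ⟨x⟩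
  have hC := hq.upper_pos
  have hp := hr.integral_pos (μ := μ)
  have hk : BddMeas (fun z => c / C * ((∫ z, r z ∂μ)⁻¹ * r z)) :=
    (BddMeas.const _).mul ((BddMeas.const _).mul hr.toBddMeas)
  have low (x : Z) (z : Z) : c / C * ((∫ z, r z ∂μ)⁻¹ * r z) ≤
      (∫ z, q x z * r z ∂μ)⁻¹ * (q x z * r z) := by
    have hpx := ((hq.weight x).mul hr).integral_pos (μ := μ)
    have up : ∫ z, q x z * r z ∂μ ≤ C * ∫ z, r z ∂μ :=
      weight_ratio_le_of_le ((hq.weight x).mul hr).toBddMeas hr.toBddMeas fun z =>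
        mul_le_mul_of_nonneg_right (hq.upper x z) (hr.pos z).le
    have e1 : c / C * ((∫ z, r z ∂μ)⁻¹ * r z) = (C * ∫ z, r z ∂μ)⁻¹ * (c * r z) := by
      field_simp
    rw [e1]
    exact mul_le_mul (inv_anti₀ hpx up) (mul_le_mul_of_nonneg_right (hq.lower x z) (hr.pos z).le)
      (mul_nonneg hq.pos.le (hr.pos z).le) (inv_nonneg.2 hpx.le)
  have := norm_wavg_sub_wavg_le ((hq.weight x).mul hr) ((hq.weight x').mul hr) hk (low x) (low x')
    hf ho
  rwa [integral_const_mul, integral_const_mul, inv_mul_cancel₀ hp.ne', mul_one] at this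

/-- Contraction of the relative oscillation of ratios. -/
lemma ratio_le (hq : IsMixing c C q) (hr : IsWeight r) (hr' : IsWeight r') {E : ℝ}
    (h : ∀ z w, r' z * r w ≤ (1 + E) * (r' w * r z)) (hE : 0 ≤ E) (x x' : Z) :
    (∫ z, q x z * r' z ∂μ) * (∫ z, q x' z * r z ∂μ) ≤
      (1 + (1 - c / C) * E) * ((∫ z, q x' z * r' z ∂μ) * ∫ z, q x z * r z ∂μ) := by
  have : Nonempty Z := ⟨x⟩
  set f : Z → ℝ := fun z => r' z / r z with hfdef
  have hfm : StronglyMeasurable f := hr'.meas.div₀ hr.meas (fun z => (hr.pos z).ne')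
  have hfpos : ∀ z, 0 < f z := fun z => div_pos (hr'.pos z) (hr.pos z)
  have hfle : ∀ z w, f z ≤ (1 + E) * f w := fun z w => by
    simp only [hfdef]
    rw [div_le_iff₀ (hr.pos z), mul_div_assoc', div_mul_eq_mul_div, le_div_iff₀ (hr.pos w)]
    linarith [h z w]
  have hf : BddMeas f := ⟨hfm, (1 + E) * f x, fun z => by
    rw [Real.norm_of_nonneg (hfpos z).le]; exact hfle z x⟩
  have hbdd : BddBelow (range f) := ⟨0, by rintro _ ⟨z, rfl⟩; exact (hfpos z).le⟩
  set m := ⨅ z, f z with hm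
  have hmle : ∀ z, m ≤ f z := fun z => ciInf_le hbdd z
  have hlem : ∀ z, f z ≤ (1 + E) * m := fun z => by
    have hE1 : 0 < 1 + E := by linarith
    rw [← div_le_iff₀' hE1]
    exact le_ciInf fun w => by rw [div_le_iff₀' hE1]; exact hfle z w
  have hosc : ∀ z w, ‖f z - f w‖ ≤ E * m := fun z w => by
    rw [Real.norm_eq_abs, abs_le]
    constructor <;> linarith [hmle z, hmle w, hlem z, hlem w]
  have av (x : Z) : wavg μ (fun z => q x z * r z) f =
      (∫ z, q x z * r z ∂μ)⁻¹ * ∫ z, q x z * r' z ∂μ := by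
    simp only [wavg, smul_eq_mul]
    congr 2 with z
    simp only [hfdef]
    have := (hr.pos z).ne'
    field_simp
  have hdiff := hq.norm_wavg_sub_le (μ := μ) hr hf hosc x x'
  have hml : m ≤ wavg μ (fun z => q x' z * r z) f := by
    have := wavg_mono (μ := μ) ((hq.weight x').mul hr) (BddMeas.const m) hf hmle
    rwa [wavg_const ((hq.weight x').mul hr)] at this
  have hfin : wavg μ (fun z => q x z * r z) f ≤
      (1 + (1 - c / C) * E) * wavg μ (fun z => q x' z * r z) f := by
    have h1 := (abs_le.1 hdiff).2
    have h2 : (1 - c / C) * (E * m) ≤ (1 - c / C) * E * wavg μ (fun z => q x' z * r z) f := by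
      rw [← mul_assoc]
      exact mul_le_mul_of_nonneg_left hml (mul_nonneg hq.rho_nonneg hE)
    linarith
  have p1 := ((hq.weight x).mul hr).integral_pos (μ := μ)
  have p2 := ((hq.weight x').mul hr).integral_pos (μ := μ)
  rw [av, av, inv_mul_le_iff₀ p1] at hfin
  have := mul_le_mul_of_nonneg_right hfin p2.le
  refine this.trans (le_of_eq ?_)
  field_simp

end IsMixing

end WeightedAverage


/-- The left shift of sequences. -/
def seqShift {α : Type*} (y : ℕ → α) : ℕ → α := fun k => y (k + 1)

lemma measurable_seqShift {α : Type*} [MeasurableSpace α] :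
    Measurable (seqShift : (ℕ → α) → ℕ → α) :=
  measurable_pi_lambda _ fun k => measurable_pi_apply (k + 1)

/-- The solution of `X₀ = X0`, `X_{n+1}(y) = Z_n(y) + α X_n(shift y)`. -/
def shiftSum {𝒴 : Type*} (α : ℝ) (X0 : (ℕ → 𝒴) → ℝ) (Z : ℕ → (ℕ → 𝒴) → ℝ) : ℕ → (ℕ → 𝒴) → ℝ
  | 0, y => X0 y
  | n + 1, y => Z n y + α * shiftSum α X0 Z n (seqShift y)

lemma shiftSum_nonneg {𝒴 : Type*} {α : ℝ} {X0 : (ℕ → 𝒴) → ℝ} {Z : ℕ → (ℕ → 𝒴) → ℝ} (hα : 0 ≤ α)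
    (h0 : ∀ y, 0 ≤ X0 y) (hZ : ∀ n y, 0 ≤ Z n y) (n : ℕ) (y : ℕ → 𝒴) :
    0 ≤ shiftSum α X0 Z n y := by
  induction n generalizing y with
  | zero => exact h0 y
  | succ n ih => exact add_nonneg (hZ n y) (mul_nonneg hα (ih _))

lemma measurable_shiftSum {𝒴 : Type*} [MeasurableSpace 𝒴] {α : ℝ} {X0 : (ℕ → 𝒴) → ℝ}
    {Z : ℕ → (ℕ → 𝒴) → ℝ} (h0 : Measurable X0) (hZ : ∀ n, Measurable (Z n)) (n : ℕ) :
    Measurable (shiftSum α X0 Z n) := by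
  induction n with
  | zero => exact h0
  | succ n ih => exact (hZ n).add ((ih.comp measurable_seqShift).const_mul α)

section WavgMeasurable

variable {α Z : Type*} [MeasurableSpace α] [MeasurableSpace Z] {F : Type*} [NormedAddCommGroup F]
  [NormedSpace ℝ F] {μ : Measure Z} [IsFiniteMeasure μ]

lemma stronglyMeasurable_wavg {a : α → Z → ℝ} {f : α → Z → F}
    (ha : StronglyMeasurable fun p : α × Z => a p.1 p.2)
    (hf : StronglyMeasurable fun p : α × Z => f p.1 p.2) :
    StronglyMeasurable fun t => wavg μ (a t) (f t) :=
  (ha.integral_prod_right (ν := μ)).inv₀.smul ((ha.smul hf).integral_prod_right (ν := μ))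

end WavgMeasurable

section Steps

variable {Z : Type*} [MeasurableSpace Z] {μ : Measure Z} [IsFiniteMeasure μ] [NeZero μ]
  {F : Type*} [NormedAddCommGroup F] [NormedSpace ℝ F] [CompleteSpace F]
  {q : Z → Z → ℝ} {c C : ℝ} {r r' : Z → ℝ}

/-- The weight functions `r`, `r'` are proportional up to relative errors in `[1, 1 + E]`. -/
def RatioBound (r r' : Z → ℝ) (E : ℝ) : Prop := ∀ z w, r' z * r w ≤ (1 + E) * (r' w * r z)

lemma RatioBound.mono {E E' : ℝ} (hr : IsWeight r) (hr' : IsWeight r') (h : RatioBound r r' E)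
    (hE : E ≤ E') : RatioBound r r' E' := fun z w =>
  (h z w).trans (mul_le_mul_of_nonneg_right (by linarith) (mul_pos (hr'.pos w) (hr.pos z)).le)

lemma RatioBound.mul {r₁ r₁' r₂ r₂' : Z → ℝ} {E₁ E₂ : ℝ} (h₁ : IsWeight r₁) (h₁' : IsWeight r₁')
    (h₂ : IsWeight r₂) (h₂' : IsWeight r₂') (b₁ : RatioBound r₁ r₁' E₁) (b₂ : RatioBound r₂ r₂' E₂)
    (hE₁ : 0 ≤ E₁) :
    RatioBound (fun z => r₁ z * r₂ z) (fun z => r₁' z * r₂' z) (E₁ + E₂ + E₁ * E₂) := fun z w => by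
  have := mul_le_mul (b₁ z w) (b₂ z w) (mul_pos (h₂'.pos z) (h₂.pos w)).le
    (mul_nonneg (by linarith) (mul_pos (h₁'.pos w) (h₁.pos z)).le)
  linarith

/-- Averages with weights `q x · r` and `q x · r'` of a function of oscillation `o` differ by at
most `T o`. -/
def AvgClose (μ : Measure Z) (F : Type*) [NormedAddCommGroup F] [NormedSpace ℝ F]
    (q : Z → Z → ℝ) (r r' : Z → ℝ) (T : ℝ) : Prop :=
  ∀ (f : Z → F) (o : ℝ), BddMeas f → (∀ z w, ‖f z - f w‖ ≤ o) → ∀ x,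
    ‖wavg μ (fun z => q x z * r' z) f - wavg μ (fun z => q x z * r z) f‖ ≤ T * o

lemma RatioBound.avgClose (hq : IsMixing c C q) (hr : IsWeight r) (hr' : IsWeight r') {E : ℝ}
    (hE : 0 ≤ E) (h : RatioBound r r' E) : AvgClose μ F q r r' E := fun f o hf ho x => by
  have hsymm : ∀ z w, r z * r' w ≤ (1 + E) * (r' z * r w) := fun z w => by
    linarith [h w z]
  have := norm_wavg_sub_wavg_le_of_tilt (μ := μ) ((hq.weight x).mul hr) ((hq.weight x).mul hr') hE
    (fun z w => by
      have := mul_le_mul_of_nonneg_left (hsymm z w)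
        (mul_pos ((hq.weight x).pos z) ((hq.weight x).pos w)).le
      linarith) hf ho
  refine this.trans (mul_le_mul_of_nonneg_right ?_ ((norm_nonneg _).trans (ho x x)))
  have h1 : 0 < 1 + E := by linarith
  have h2 : (1 + E) * (1 + E)⁻¹ = 1 := mul_inv_cancel₀ h1.ne'
  have h3 : 0 < (1 + E)⁻¹ := inv_pos.2 h1
  nlinarith

lemma avgClose_one (hq : IsMixing c C q) (hr : IsWeight r) (hr' : IsWeight r') {T : ℝ}
    (hT : 1 ≤ T) : AvgClose μ F q r r' T := fun f o hf ho x => by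
  have := norm_wavg_sub_wavg_le (μ := μ) (k := fun _ => 0) ((hq.weight x).mul hr')
    ((hq.weight x).mul hr) (BddMeas.const 0)
    (fun z => mul_nonneg (inv_nonneg.2 ((hq.weight x).mul hr').integral_pos.le)
      (((hq.weight x).mul hr').pos z).le)
    (fun z => mul_nonneg (inv_nonneg.2 ((hq.weight x).mul hr).integral_pos.le)
      (((hq.weight x).mul hr).pos z).le) hf ho
  refine this.trans (mul_le_mul_of_nonneg_right ?_ ((norm_nonneg _).trans (ho x x)))
  simpa using hT

lemma RatioBound.integral (hq : IsMixing c C q) (hr : IsWeight r) (hr' : IsWeight r') {E : ℝ}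
    (h : RatioBound r r' E) (hE : 0 ≤ E) :
    RatioBound (fun x => ∫ z, q x z * r z ∂μ) (fun x => ∫ z, q x z * r' z ∂μ)
      ((1 - c / C) * E) :=
  fun x x' => hq.ratio_le hr hr' h hE x x'

lemma IsMixing.integral_le_mul (hq : IsMixing c C q) (hr : IsWeight r) (x x' : Z) :
    ∫ z, q x z * r z ∂μ ≤ C / c * ∫ z, q x' z * r z ∂μ := by
  refine weight_ratio_le_of_le ((hq.weight x).mul hr).toBddMeas ((hq.weight x').mul hr).toBddMeas
    fun z => ?_
  rw [← mul_assoc]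
  refine mul_le_mul_of_nonneg_right ?_ (hr.pos z).le
  rw [div_mul_eq_mul_div, le_div_iff₀ hq.pos]
  exact mul_le_mul (hq.upper x z) (hq.lower x' z) hq.pos.le
    ((hq.pos.le.trans (hq.lower x z)).trans (hq.upper x z))

section First

variable {s s' : Z → Z → F} {D D' : Z → F} {b o σ d T : ℝ}

lemma score_step_diff (hq : IsMixing c C q) (hr : IsWeight r) (hr' : IsWeight r')
    (hs : ∀ x, BddMeas (s x)) (hs' : ∀ x, BddMeas (s' x)) (hD : BddMeas D) (hD' : BddMeas D')
    (hT : AvgClose μ F q r r' T) (hb : ∀ x z, ‖s x z‖ ≤ b) (ho : ∀ z w, ‖D z - D w‖ ≤ o)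
    (hσ : ∀ x z, ‖s' x z - s x z‖ ≤ σ) (x : Z) :
    ‖wavg μ (fun z => q x z * r' z) (fun z => s' x z + D' z) -
      wavg μ (fun z => q x z * r z) (fun z => s x z + D z) -
      wavg μ (fun z => q x z * r' z) (fun z => D' z - D z)‖ ≤ T * (2 * b + o) + σ := by
  have w' := (hq.weight x).mul hr'
  have e : wavg μ (fun z => q x z * r' z) (fun z => s' x z + D' z) -
      wavg μ (fun z => q x z * r z) (fun z => s x z + D z) -
      wavg μ (fun z => q x z * r' z) (fun z => D' z - D z) =
      (wavg μ (fun z => q x z * r' z) (fun z => s x z + D z) -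
        wavg μ (fun z => q x z * r z) (fun z => s x z + D z)) +
      wavg μ (fun z => q x z * r' z) (fun z => s' x z - s x z) := by
    rw [wavg_add w' (hs' x) hD', wavg_sub w' hD' hD, wavg_sub w' (hs' x) (hs x)]
    conv_rhs => rw [wavg_add w' (hs x) hD]
    abel
  rw [e]
  refine (norm_add_le _ _).trans (add_le_add (hT _ _ ((hs x).add hD) (fun z w => ?_) x)
    (norm_wavg_le w' (hσ x)))
  calc ‖s x z + D z - (s x w + D w)‖ = ‖s x z - s x w + (D z - D w)‖ := by congr 1; abel
    _ ≤ ‖s x z‖ + ‖s x w‖ + ‖D z - D w‖ :=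
      (norm_add_le _ _).trans (add_le_add_left (norm_sub_le _ _) _)
    _ ≤ 2 * b + o := by linarith [hb x z, hb x w, ho z w]

lemma score_step_osc (hq : IsMixing c C q) (hr : IsWeight r) (hr' : IsWeight r')
    (hs : ∀ x, BddMeas (s x)) (hs' : ∀ x, BddMeas (s' x)) (hD : BddMeas D) (hD' : BddMeas D')
    (hT : AvgClose μ F q r r' T) (hb : ∀ x z, ‖s x z‖ ≤ b) (ho : ∀ z w, ‖D z - D w‖ ≤ o)
    (hσ : ∀ x z, ‖s' x z - s x z‖ ≤ σ) (hd : ∀ z w, ‖(D' z - D z) - (D' w - D w)‖ ≤ d)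
    (x x' : Z) :
    ‖(wavg μ (fun z => q x z * r' z) (fun z => s' x z + D' z) -
        wavg μ (fun z => q x z * r z) (fun z => s x z + D z)) -
      (wavg μ (fun z => q x' z * r' z) (fun z => s' x' z + D' z) -
        wavg μ (fun z => q x' z * r z) (fun z => s x' z + D z))‖ ≤
      2 * (T * (2 * b + o) + σ) + (1 - c / C) * d := by
  have h1 := score_step_diff hq hr hr' hs hs' hD hD' hT hb ho hσ x
  have h2 := score_step_diff hq hr hr' hs hs' hD hD' hT hb ho hσ x'
  have h3 := hq.norm_wavg_sub_le (μ := μ) hr' (hD'.sub hD) hd x x'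
  refine norm_le_of_eq_add3 ?_ h1 h2 h3
  abel
where
  norm_le_of_eq_add3 {v a b e : F} {α γ : ℝ} (h : v = a - b + e) (ha : ‖a‖ ≤ α) (hb : ‖b‖ ≤ α)
      (he : ‖e‖ ≤ γ) : ‖v‖ ≤ 2 * α + γ := by
    rw [h]
    have h1 := norm_add_le (a - b) e
    have h2 := norm_sub_le a b
    linarith

lemma score_step_incr (hq : IsMixing c C q) (hr : IsWeight r) (hr' : IsWeight r')
    (hs : ∀ x, BddMeas (s x)) (hs' : ∀ x, BddMeas (s' x)) (hD : BddMeas D) (hD' : BddMeas D')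
    (hT : AvgClose μ F q r r' T) (hb : ∀ x z, ‖s x z‖ ≤ b) (ho : ∀ z w, ‖D z - D w‖ ≤ o)
    (hσ : ∀ x z, ‖s' x z - s x z‖ ≤ σ) (hd : ∀ z w, ‖(D' z - D z) - (D' w - D w)‖ ≤ d)
    (x x' : Z) :
    ‖(wavg μ (fun z => q x z * r' z) (fun z => s' x z + D' z) - D' x') -
      (wavg μ (fun z => q x z * r z) (fun z => s x z + D z) - D x')‖ ≤
      T * (2 * b + o) + σ + d := by
  have h1 := score_step_diff hq hr hr' hs hs' hD hD' hT hb ho hσ x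
  have w' := (hq.weight x).mul hr'
  have h2 : ‖wavg μ (fun z => q x z * r' z) (fun z => (D' z - D z) - (D' x' - D x'))‖ ≤ d :=
    norm_wavg_le w' fun z => hd z x'
  rw [wavg_sub w' (hD'.sub hD) (BddMeas.const _), wavg_const w'] at h2
  refine le_trans (le_of_eq ?_) ((norm_add_le _ _).trans (add_le_add h1 h2))
  congr 1
  abel

lemma score_osc (hq : IsMixing c C q) (hr : IsWeight r)
    (hs : ∀ x, BddMeas (s x)) (hD : BddMeas D) (hb : ∀ x z, ‖s x z‖ ≤ b)
    (ho : ∀ z w, ‖D z - D w‖ ≤ o) (x x' : Z) :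
    ‖wavg μ (fun z => q x z * r z) (fun z => s x z + D z) -
      wavg μ (fun z => q x' z * r z) (fun z => s x' z + D z)‖ ≤ 2 * b + (1 - c / C) * o := by
  have w (x) := (hq.weight x).mul hr
  rw [wavg_add (w x) (hs x) hD, wavg_add (w x') (hs x') hD, add_sub_add_comm]
  have h1 := norm_wavg_le (μ := μ) (w x) (hb x)
  have h2 := norm_wavg_le (μ := μ) (w x') (hb x')
  refine (norm_add_le _ _).trans (add_le_add ((norm_sub_le _ _).trans (by linarith)) ?_)
  exact hq.norm_wavg_sub_le hr hD ho x x'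

lemma score_incr (hq : IsMixing c C q) (hr : IsWeight r)
    (hs : ∀ x, BddMeas (s x)) (hD : BddMeas D) (hb : ∀ x z, ‖s x z‖ ≤ b)
    (ho : ∀ z w, ‖D z - D w‖ ≤ o) (x x' : Z) :
    ‖wavg μ (fun z => q x z * r z) (fun z => s x z + D z) - D x'‖ ≤ b + o := by
  have w := (hq.weight x).mul hr
  have h2 : ‖wavg μ (fun z => q x z * r z) (fun z => s x z + D z - D x')‖ ≤ b + o :=
    norm_wavg_le w fun z => by
      rw [add_sub_assoc]
      exact (norm_add_le _ _).trans (add_le_add (hb x z) (ho z x'))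
  rwa [wavg_sub w ((hs x).add hD) (BddMeas.const _), wavg_const w] at h2

end First

/-! ### Second order -/

variable {F₂ : Type*} [NormedAddCommGroup F₂] [NormedSpace ℝ F₂] [CompleteSpace F₂]

/-- A bilinear map of norm at most one. -/
structure IsTensor (B : F →L[ℝ] F →L[ℝ] F₂) : Prop where
  norm_le : ∀ u v, ‖B u v‖ ≤ ‖u‖ * ‖v‖

lemma BddMeas.tensor {B : F →L[ℝ] F →L[ℝ] F₂} (hB : IsTensor B) {f g : Z → F} (hf : BddMeas f)
    (hg : BddMeas g) : BddMeas (fun z => B (f z) (g z)) := by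
  obtain ⟨b, hb⟩ := hf.bdd
  obtain ⟨b', hb'⟩ := hg.bdd
  refine ⟨B.continuous₂.comp_stronglyMeasurable (hf.meas.prodMk hg.meas), b * b', fun z => ?_⟩
  exact (hB.norm_le _ _).trans
    (mul_le_mul (hb z) (hb' z) (norm_nonneg _) ((norm_nonneg _).trans (hb z)))

lemma IsTensor.norm_sq_le {B : F →L[ℝ] F →L[ℝ] F₂} (hB : IsTensor B) {u : F} {β : ℝ}
    (hu : ‖u‖ ≤ β) : ‖B u u‖ ≤ β ^ 2 := by
  rw [sq]
  exact (hB.norm_le u u).trans (mul_le_mul hu hu (norm_nonneg _) ((norm_nonneg _).trans hu))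

lemma IsTensor.norm_sub_le {B : F →L[ℝ] F →L[ℝ] F₂} (hB : IsTensor B) {u v : F} {β d : ℝ}
    (hu : ‖u‖ ≤ β) (hv : ‖v‖ ≤ β) (hd : ‖u - v‖ ≤ d) : ‖B u u - B v v‖ ≤ 2 * β * d := by
  have e : B u u - B v v = B (u - v) u + B v (u - v) := by
    simp
  rw [e]
  have h0 := norm_add_le (B (u - v) u) (B v (u - v))
  have h3 := hB.norm_le (u - v) u
  have h4 := hB.norm_le v (u - v)
  have h1 := mul_le_mul hd hu (norm_nonneg _) ((norm_nonneg _).trans hd)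
  have h2 := mul_le_mul hv hd (norm_nonneg _) ((norm_nonneg _).trans hv)
  linarith

/-- The covariance of `f` with respect to the weight `a`, for the bilinear map `B`. -/
def wcov (μ : Measure Z) (B : F →L[ℝ] F →L[ℝ] F₂) (a : Z → ℝ) (f : Z → F) : F₂ :=
  wavg μ a (fun z => B (f z) (f z)) - B (wavg μ a f) (wavg μ a f)

lemma wavg_clm {a : Z → ℝ} {f : Z → F} (ha : IsWeight a) (hf : BddMeas f) (L : F →L[ℝ] F₂) :
    wavg μ a (fun z => L (f z)) = L (wavg μ a f) := by
  simp only [wavg, map_smul]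
  rw [← L.integral_comp_comm (ha.smul hf).integrable]
  simp

lemma wcov_sub_const {B : F →L[ℝ] F →L[ℝ] F₂} (hB : IsTensor B) {a : Z → ℝ} {f : Z → F}
    (ha : IsWeight a) (hf : BddMeas f) (v : F) :
    wcov μ B a (fun z => f z - v) = wcov μ B a f := by
  have h1 : wavg μ a (fun z => B (f z) v) = B (wavg μ a f) v := wavg_clm ha hf (B.flip v)
  have h2 : wavg μ a (fun z => B v (f z)) = B v (wavg μ a f) := wavg_clm ha hf (B v)
  have hc : BddMeas (fun _ : Z => v) := BddMeas.const v
  have hm : wavg μ a (fun z => f z - v) = wavg μ a f - v := by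
    rw [wavg_sub ha hf hc, wavg_const ha]
  have e : (fun z => B (f z - v) (f z - v)) = fun z =>
      (B (f z) (f z) - B (f z) v) - (B v (f z) - B v v) := by
    funext z
    simp only [map_sub, sub_apply]
    abel
  rw [wcov, wcov, hm, e, wavg_sub ha ((hf.tensor hB hf).sub (hf.tensor hB hc))
    ((hc.tensor hB hf).sub (hc.tensor hB hc)), wavg_sub ha (hf.tensor hB hf) (hf.tensor hB hc),
    wavg_sub ha (hc.tensor hB hf) (hc.tensor hB hc), h1, h2, wavg_const ha]
  simp only [map_sub, sub_apply]
  abel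

lemma norm_wcov_le {B : F →L[ℝ] F →L[ℝ] F₂} (hB : IsTensor B) {a : Z → ℝ} {f : Z → F}
    (ha : IsWeight a) {β : ℝ} (h : ∀ z, ‖f z‖ ≤ β) : ‖wcov μ B a f‖ ≤ 2 * β ^ 2 := by
  have h1 : ‖wavg μ a (fun z => B (f z) (f z))‖ ≤ β ^ 2 :=
    norm_wavg_le ha fun z => hB.norm_sq_le (h z)
  have h2 : ‖B (wavg μ a f) (wavg μ a f)‖ ≤ β ^ 2 := hB.norm_sq_le (norm_wavg_le ha h)
  have h3 := _root_.norm_sub_le (wavg μ a (fun z => B (f z) (f z))) (B (wavg μ a f) (wavg μ a f))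
  rw [wcov]
  linarith

lemma norm_wcov_sub_le (hq : IsMixing c C q) (hr : IsWeight r) (hr' : IsWeight r')
    {B : F →L[ℝ] F →L[ℝ] F₂} (hB : IsTensor B)
    {f f' : Z → F} (hf : BddMeas f) (hf' : BddMeas f') {β d T : ℝ}
    (hb : ∀ z, ‖f z‖ ≤ β) (hb' : ∀ z, ‖f' z‖ ≤ β) (hd : ∀ z, ‖f' z - f z‖ ≤ d)
    (hT₁ : AvgClose μ F q r r' T) (hT₂ : AvgClose μ F₂ q r r' T) (x : Z) :
    ‖wcov μ B (fun z => q x z * r' z) f' - wcov μ B (fun z => q x z * r z) f‖ ≤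
      4 * β * d + 6 * T * β ^ 2 := by
  have w := (hq.weight x).mul hr
  have w' := (hq.weight x).mul hr'
  set m := wavg μ (fun z => q x z * r z) f with hmdef
  set m' := wavg μ (fun z => q x z * r' z) f' with hmdef'
  set a₁ := wavg μ (fun z => q x z * r' z) (fun z => B (f' z) (f' z)) with ha₁
  set a₂ := wavg μ (fun z => q x z * r' z) (fun z => B (f z) (f z)) with ha₂
  set a₃ := wavg μ (fun z => q x z * r z) (fun z => B (f z) (f z)) with ha₃
  have hβ : 0 ≤ β := (norm_nonneg _).trans (hb x)
  have h1 : ‖a₁ - a₂‖ ≤ 2 * β * d := by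
    rw [ha₁, ha₂, ← wavg_sub w' (hf'.tensor hB hf') (hf.tensor hB hf)]
    exact norm_wavg_le w' fun z => hB.norm_sub_le (hb' z) (hb z) (hd z)
  have hff (z) : ‖B (f z) (f z)‖ ≤ β ^ 2 := hB.norm_sq_le (hb z)
  have h2 : ‖a₂ - a₃‖ ≤ T * (2 * β ^ 2) :=
    hT₂ (fun z => B (f z) (f z)) (2 * β ^ 2) (hf.tensor hB hf) (fun z z' => by
      have := _root_.norm_sub_le (B (f z) (f z)) (B (f z') (f z'))
      linarith [hff z, hff z']) x
  have h3 : ‖wavg μ (fun z => q x z * r' z) f - m‖ ≤ T * (2 * β) :=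
    hT₁ f (2 * β) hf (fun z z' => by
      have := _root_.norm_sub_le (f z) (f z')
      linarith [hb z, hb z']) x
  have h4 : ‖m' - wavg μ (fun z => q x z * r' z) f‖ ≤ d := by
    rw [← wavg_sub w' hf' hf]
    exact norm_wavg_le w' hd
  have h5 : ‖m' - m‖ ≤ d + T * (2 * β) := by
    have := norm_add_le (m' - wavg μ (fun z => q x z * r' z) f)
      (wavg μ (fun z => q x z * r' z) f - m)
    rw [sub_add_sub_cancel] at this
    linarith
  have h6 : ‖B m' m' - B m m‖ ≤ 2 * β * (d + T * (2 * β)) :=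
    hB.norm_sub_le (norm_wavg_le w' hb') (norm_wavg_le w hb) h5
  have e : wcov μ B (fun z => q x z * r' z) f' - wcov μ B (fun z => q x z * r z) f =
      (a₁ - a₂) + (a₂ - a₃) - (B m' m' - B m m) := by
    simp only [wcov, ha₁, ha₃, hmdef, hmdef']; abel
  rw [e]
  have h7 := _root_.norm_sub_le ((a₁ - a₂) + (a₂ - a₃)) (B m' m' - B m m)
  have h8 := norm_add_le (a₁ - a₂) (a₂ - a₃)
  nlinarith

section Second

variable {s : Z → Z → F} {D D' : Z → F} {s₂ : Z → Z → F₂} {H H' : Z → F₂}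
  {b o β d T e oh h : ℝ} {B : F →L[ℝ] F →L[ℝ] F₂}

/-- One step of the recursion for second derivatives of log-likelihoods. -/
def hessStep (μ : Measure Z) (B : F →L[ℝ] F →L[ℝ] F₂) (q : Z → Z → ℝ) (r : Z → ℝ)
    (s : Z → Z → F) (D : Z → F) (s₂ : Z → Z → F₂) (H : Z → F₂) (x : Z) : F₂ :=
  wavg μ (fun z => q x z * r z) (fun z => s₂ x z + H z) +
    wcov μ B (fun z => q x z * r z) (fun z => s x z + D z)

lemma norm_wcov_score_le (hB : IsTensor B) (hq : IsMixing c C q) (hr : IsWeight r)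
    (hs : ∀ x, BddMeas (s x)) (hD : BddMeas D) (hb : ∀ x z, ‖s x z‖ ≤ b)
    (ho : ∀ z w, ‖D z - D w‖ ≤ o) (x : Z) :
    ‖wcov μ B (fun z => q x z * r z) (fun z => s x z + D z)‖ ≤ 2 * (b + o) ^ 2 := by
  have w := (hq.weight x).mul hr
  rw [← wcov_sub_const hB w ((hs x).add hD) (D x)]
  refine norm_wcov_le hB w fun z => ?_
  rw [add_sub_assoc]
  exact (norm_add_le _ _).trans (add_le_add (hb x z) (ho z x))

lemma hess_osc (hB : IsTensor B) (hq : IsMixing c C q) (hr : IsWeight r)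
    (hs : ∀ x, BddMeas (s x)) (hD : BddMeas D) (hb : ∀ x z, ‖s x z‖ ≤ b)
    (ho : ∀ z w, ‖D z - D w‖ ≤ o) (hs₂ : ∀ x, BddMeas (s₂ x)) (hH : BddMeas H)
    (he : ∀ x z, ‖s₂ x z‖ ≤ e) (hoh : ∀ z w, ‖H z - H w‖ ≤ oh) (x x' : Z) :
    ‖hessStep μ B q r s D s₂ H x - hessStep μ B q r s D s₂ H x'‖ ≤
      2 * e + 4 * (b + o) ^ 2 + (1 - c / C) * oh := by
  have h1 := score_osc (μ := μ) hq hr hs₂ hH he hoh x x'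
  have h2 := norm_wcov_score_le (μ := μ) hB hq hr hs hD hb ho x
  have h3 := norm_wcov_score_le (μ := μ) hB hq hr hs hD hb ho x'
  rw [hessStep, hessStep, add_sub_add_comm]
  refine (norm_add_le _ _).trans ?_
  have := _root_.norm_sub_le (wcov μ B (fun z => q x z * r z) (fun z => s x z + D z))
    (wcov μ B (fun z => q x' z * r z) (fun z => s x' z + D z))
  linarith

lemma hess_incr (hB : IsTensor B) (hq : IsMixing c C q) (hr : IsWeight r)
    (hs : ∀ x, BddMeas (s x)) (hD : BddMeas D) (hb : ∀ x z, ‖s x z‖ ≤ b)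
    (ho : ∀ z w, ‖D z - D w‖ ≤ o) (hs₂ : ∀ x, BddMeas (s₂ x)) (hH : BddMeas H)
    (he : ∀ x z, ‖s₂ x z‖ ≤ e) (hoh : ∀ z w, ‖H z - H w‖ ≤ oh) (x x' : Z) :
    ‖hessStep μ B q r s D s₂ H x - H x'‖ ≤ e + oh + 2 * (b + o) ^ 2 := by
  have h1 := score_incr (μ := μ) hq hr hs₂ hH he hoh x x'
  have h2 := norm_wcov_score_le (μ := μ) hB hq hr hs hD hb ho x
  rw [hessStep, add_sub_right_comm]
  exact (norm_add_le _ _).trans (add_le_add h1 h2)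

lemma norm_wcov_score_sub_le (hB : IsTensor B) (hq : IsMixing c C q) (hr : IsWeight r)
    (hr' : IsWeight r')
    (hs : ∀ x, BddMeas (s x)) (hD : BddMeas D) (hD' : BddMeas D')
    (hT₁ : AvgClose μ F q r r' T) (hT₂ : AvgClose μ F₂ q r r' T) (hb : ∀ x z, ‖s x z‖ ≤ b)
    (ho : ∀ z w, ‖D z - D w‖ ≤ o) (ho' : ∀ z w, ‖D' z - D' w‖ ≤ o)
    (hd : ∀ z w, ‖(D' z - D z) - (D' w - D w)‖ ≤ d) (x : Z) :
    ‖wcov μ B (fun z => q x z * r' z) (fun z => s x z + D' z) -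
      wcov μ B (fun z => q x z * r z) (fun z => s x z + D z)‖ ≤
      4 * (b + o) * d + 6 * T * (b + o) ^ 2 := by
  have w := (hq.weight x).mul hr
  have w' := (hq.weight x).mul hr'
  have hc (v : F) : BddMeas (fun _ : Z => v) := BddMeas.const v
  rw [← wcov_sub_const hB w ((hs x).add hD) (D x), ← wcov_sub_const hB w' ((hs x).add hD') (D' x)]
  refine norm_wcov_sub_le hq hr hr' hB (((hs x).add hD).sub (hc _)) (((hs x).add hD').sub (hc _))
    (fun z => ?_) (fun z => ?_) (fun z => ?_) hT₁ hT₂ x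
  · rw [add_sub_assoc]
    exact (norm_add_le _ _).trans (add_le_add (hb x z) (ho z x))
  · rw [add_sub_assoc]
    exact (norm_add_le _ _).trans (add_le_add (hb x z) (ho' z x))
  · refine le_trans (le_of_eq ?_) (hd z x)
    congr 1; abel

lemma hess_step_osc (hB : IsTensor B) (hq : IsMixing c C q) (hr : IsWeight r)
    (hr' : IsWeight r')
    (hs : ∀ x, BddMeas (s x)) (hD : BddMeas D) (hD' : BddMeas D')
    (hT₁ : AvgClose μ F q r r' T) (hT₂ : AvgClose μ F₂ q r r' T) (hb : ∀ x z, ‖s x z‖ ≤ b)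
    (ho : ∀ z w, ‖D z - D w‖ ≤ o) (ho' : ∀ z w, ‖D' z - D' w‖ ≤ o)
    (hd : ∀ z w, ‖(D' z - D z) - (D' w - D w)‖ ≤ d)
    (hs₂ : ∀ x, BddMeas (s₂ x)) (hH : BddMeas H) (hH' : BddMeas H')
    (he : ∀ x z, ‖s₂ x z‖ ≤ e) (hoh : ∀ z w, ‖H z - H w‖ ≤ oh)
    (hh : ∀ z w, ‖(H' z - H z) - (H' w - H w)‖ ≤ h) (x x' : Z) :
    ‖(hessStep μ B q r' s D' s₂ H' x - hessStep μ B q r s D s₂ H x) -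
      (hessStep μ B q r' s D' s₂ H' x' - hessStep μ B q r s D s₂ H x')‖ ≤
      2 * (T * (2 * e + oh) + 4 * (b + o) * d + 6 * T * (b + o) ^ 2) + (1 - c / C) * h := by
  have h1 := score_step_osc hq hr hr' hs₂ hs₂ hH hH' hT₂ he hoh (σ := 0) (by simp) hh x x'
  have h2 := norm_wcov_score_sub_le hB hq hr hr' hs hD hD' hT₁ hT₂ hb ho ho' hd x
  have h3 := norm_wcov_score_sub_le hB hq hr hr' hs hD hD' hT₁ hT₂ hb ho ho' hd x'
  simp only [hessStep]
  set A := wavg μ (fun z => q x z * r z) (fun z => s₂ x z + H z)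
  set A' := wavg μ (fun z => q x z * r' z) (fun z => s₂ x z + H' z)
  set A₁ := wavg μ (fun z => q x' z * r z) (fun z => s₂ x' z + H z)
  set A₁' := wavg μ (fun z => q x' z * r' z) (fun z => s₂ x' z + H' z)
  set K := wcov μ B (fun z => q x z * r z) (fun z => s x z + D z)
  set K' := wcov μ B (fun z => q x z * r' z) (fun z => s x z + D' z)
  set K₁ := wcov μ B (fun z => q x' z * r z) (fun z => s x' z + D z)
  set K₁' := wcov μ B (fun z => q x' z * r' z) (fun z => s x' z + D' z)
  have e1 : A' + K' - (A + K) - (A₁' + K₁' - (A₁ + K₁)) =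
    (A' - A - (A₁' - A₁)) + ((K' - K) - (K₁' - K₁)) := by abel
  rw [e1]
  have h4 := norm_add_le (A' - A - (A₁' - A₁)) ((K' - K) - (K₁' - K₁))
  have h5 := _root_.norm_sub_le (K' - K) (K₁' - K₁)
  linarith

lemma hess_step_incr (hB : IsTensor B) (hq : IsMixing c C q) (hr : IsWeight r)
    (hr' : IsWeight r')
    (hs : ∀ x, BddMeas (s x)) (hD : BddMeas D) (hD' : BddMeas D')
    (hT₁ : AvgClose μ F q r r' T) (hT₂ : AvgClose μ F₂ q r r' T) (hb : ∀ x z, ‖s x z‖ ≤ b)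
    (ho : ∀ z w, ‖D z - D w‖ ≤ o) (ho' : ∀ z w, ‖D' z - D' w‖ ≤ o)
    (hd : ∀ z w, ‖(D' z - D z) - (D' w - D w)‖ ≤ d)
    (hs₂ : ∀ x, BddMeas (s₂ x)) (hH : BddMeas H) (hH' : BddMeas H')
    (he : ∀ x z, ‖s₂ x z‖ ≤ e) (hoh : ∀ z w, ‖H z - H w‖ ≤ oh)
    (hh : ∀ z w, ‖(H' z - H z) - (H' w - H w)‖ ≤ h) (x x' : Z) :
    ‖(hessStep μ B q r' s D' s₂ H' x - H' x') - (hessStep μ B q r s D s₂ H x - H x')‖ ≤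
      T * (2 * e + oh) + 4 * (b + o) * d + 6 * T * (b + o) ^ 2 + h := by
  have h1 := score_step_incr hq hr hr' hs₂ hs₂ hH hH' hT₂ he hoh (σ := 0) (by simp) hh x x'
  have h2 := norm_wcov_score_sub_le hB hq hr hr' hs hD hD' hT₁ hT₂ hb ho ho' hd x
  simp only [hessStep]
  set A := wavg μ (fun z => q x z * r z) (fun z => s₂ x z + H z)
  set A' := wavg μ (fun z => q x z * r' z) (fun z => s₂ x z + H' z)
  set K := wcov μ B (fun z => q x z * r z) (fun z => s x z + D z)
  set K' := wcov μ B (fun z => q x z * r' z) (fun z => s x z + D' z)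
  have e1 : A' + K' - H' x' - (A + K - H x') = (A' - H' x' - (A - H x')) + (K' - K) := by abel
  rw [e1]
  have h4 := norm_add_le (A' - H' x' - (A - H x')) (K' - K)
  linarith

end Second

end Steps


section Recursions

variable {𝒳 𝒴 : Type*} [MeasurableSpace 𝒳] [MeasurableSpace 𝒴]
  {F : Type*} [NormedAddCommGroup F] [NormedSpace ℝ F] [CompleteSpace F]
  {F₂ : Type*} [NormedAddCommGroup F₂] [NormedSpace ℝ F₂] [CompleteSpace F₂]

/-- The likelihood of the first `n` observations in `y`, starting from the hidden state `x`. -/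
def lik (μ : Measure 𝒳) (q : 𝒳 → 𝒳 → ℝ) (G : 𝒴 → 𝒳 → ℝ) : ℕ → (ℕ → 𝒴) → 𝒳 → ℝ
  | 0, _, _ => 1
  | n + 1, y, x => ∫ z, q x z * (G (y 0) z * lik μ q G n (seqShift y) z) ∂μ

/-- The first derivative of the log-likelihood, if `s` is that of `log (q · G)`. -/
def score (μ : Measure 𝒳) (q : 𝒳 → 𝒳 → ℝ) (G : 𝒴 → 𝒳 → ℝ) (s : 𝒴 → 𝒳 → 𝒳 → F) :
    ℕ → (ℕ → 𝒴) → 𝒳 → F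
  | 0, _, _ => 0
  | n + 1, y, x => wavg μ (fun z => q x z * (G (y 0) z * lik μ q G n (seqShift y) z))
      (fun z => s (y 0) x z + score μ q G s n (seqShift y) z)

/-- The second derivative of the log-likelihood, if `s`, `s₂` are those of `log (q · G)`. -/
def hess (μ : Measure 𝒳) (B : F →L[ℝ] F →L[ℝ] F₂) (q : 𝒳 → 𝒳 → ℝ) (G : 𝒴 → 𝒳 → ℝ)
    (s : 𝒴 → 𝒳 → 𝒳 → F) (s₂ : 𝒴 → 𝒳 → 𝒳 → F₂) : ℕ → (ℕ → 𝒴) → 𝒳 → F₂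
  | 0, _, _ => 0
  | n + 1, y, x => hessStep μ B q (fun z => G (y 0) z * lik μ q G n (seqShift y) z) (s (y 0))
      (score μ q G s n (seqShift y)) (s₂ (y 0)) (hess μ B q G s s₂ n (seqShift y)) x

/-- Positive emission densities bounded by `A`. -/
structure IsEmission (A : ℝ) (G : 𝒴 → 𝒳 → ℝ) : Prop where
  meas : Measurable (Function.uncurry G)
  pos : ∀ y x, 0 < G y x
  le : ∀ y x, G y x ≤ A

/-- Measurable functions of `(y, x, z)` bounded by a function of `y`. -/
structure IsScore (b : 𝒴 → ℝ) (s : 𝒴 → 𝒳 → 𝒳 → F) : Prop where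
  meas : StronglyMeasurable fun p : 𝒴 × 𝒳 × 𝒳 => s p.1 p.2.1 p.2.2
  le : ∀ y x z, ‖s y x z‖ ≤ b y

variable {μ : Measure 𝒳} [IsFiniteMeasure μ] [NeZero μ] {q : 𝒳 → 𝒳 → ℝ} {c C A : ℝ}
  {G G' : 𝒴 → 𝒳 → ℝ} {s s' : 𝒴 → 𝒳 → 𝒳 → F} {s₂ : 𝒴 → 𝒳 → 𝒳 → F₂} {b e η σ : 𝒴 → ℝ}
  {B : F →L[ℝ] F →L[ℝ] F₂}

lemma IsEmission.weight (hG : IsEmission A G) (y : 𝒴) : IsWeight (G y) where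
  meas := (hG.meas.comp measurable_prodMk_left).stronglyMeasurable
  bdd := ⟨A, fun z => by rw [Real.norm_of_nonneg (hG.pos y z).le]; exact hG.le y z⟩
  pos := hG.pos y

lemma IsScore.bddMeas (hs : IsScore b s) (y : 𝒴) (x : 𝒳) : BddMeas (s y x) :=
  ⟨hs.meas.comp_measurable (measurable_const.prodMk (measurable_const.prodMk measurable_id)),
    b y, hs.le y x⟩

lemma stronglyMeasurable_weight_lik (hq : IsMixing c C q) (hG : IsEmission A G) {n : ℕ}
    (h : StronglyMeasurable fun p : (ℕ → 𝒴) × 𝒳 => lik μ q G n p.1 p.2) :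
    StronglyMeasurable fun p : ((ℕ → 𝒴) × 𝒳) × 𝒳 =>
      q p.1.2 p.2 * (G (p.1.1 0) p.2 * lik μ q G n (seqShift p.1.1) p.2) := by
  have h1 : Measurable fun p : ((ℕ → 𝒴) × 𝒳) × 𝒳 => q p.1.2 p.2 :=
    hq.meas.comp ((measurable_snd.comp measurable_fst).prodMk measurable_snd)
  have h0 : Measurable fun p : ((ℕ → 𝒴) × 𝒳) × 𝒳 => (p.1.1 0, p.2) :=
    ((measurable_pi_apply 0).comp (measurable_fst.comp measurable_fst)).prodMk measurable_snd
  have h2 : Measurable fun p : ((ℕ → 𝒴) × 𝒳) × 𝒳 => G (p.1.1 0) p.2 := hG.meas.comp h0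
  have hm : Measurable fun p : ((ℕ → 𝒴) × 𝒳) × 𝒳 => (seqShift p.1.1, p.2) :=
    (measurable_seqShift.comp (measurable_fst.comp measurable_fst)).prodMk measurable_snd
  have h3 := h.comp_measurable hm
  exact h1.stronglyMeasurable.mul (h2.stronglyMeasurable.mul h3)

lemma stronglyMeasurable_lik (hq : IsMixing c C q) (hG : IsEmission A G) (n : ℕ) :
    StronglyMeasurable fun p : (ℕ → 𝒴) × 𝒳 => lik μ q G n p.1 p.2 := by
  induction n with
  | zero => exact stronglyMeasurable_const
  | succ n ih => exact (stronglyMeasurable_weight_lik hq hG ih).integral_prod_right (ν := μ)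

lemma lik_pos_and_le (hq : IsMixing c C q) (hG : IsEmission A G) (n : ℕ) (y : ℕ → 𝒴) (x : 𝒳) :
    0 < lik μ q G n y x ∧ lik μ q G n y x ≤ (C * A * μ.real univ) ^ n := by
  induction n generalizing y x with
  | zero => simp [lik]
  | succ n ih =>
    have : Nonempty 𝒳 := ⟨x⟩
    have hw : IsWeight (lik μ q G n (seqShift y)) :=
      ⟨⟨(stronglyMeasurable_lik hq hG n).comp_measurable measurable_prodMk_left,
        (C * A * μ.real univ) ^ n, fun z => by
        rw [Real.norm_of_nonneg (ih _ z).1.le]; exact (ih _ z).2⟩, fun z => (ih _ z).1⟩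
    have hw2 := (hq.weight x).mul ((hG.weight (y 0)).mul hw)
    refine ⟨hw2.integral_pos, ?_⟩
    have hle : lik μ q G (n + 1) y x ≤ ∫ _, C * A * (C * A * μ.real univ) ^ n ∂μ := by
      refine integral_mono hw2.integrable (integrable_const _) fun z => ?_
      simp only
      rw [← mul_assoc]
      have hA : 0 < A := (hG.pos (y 0) z).trans_le (hG.le (y 0) z)
      exact mul_le_mul (mul_le_mul (hq.upper x z) (hG.le _ z) (hG.pos _ z).le hq.upper_pos.le)
        (ih _ z).2 (ih _ z).1.le (mul_pos hq.upper_pos hA).le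
    refine hle.trans (le_of_eq ?_)
    rw [integral_const, smul_eq_mul]
    ring

lemma isWeight_lik (hq : IsMixing c C q) (hG : IsEmission A G) (n : ℕ) (y : ℕ → 𝒴) :
    IsWeight (lik μ q G n y) :=
  ⟨⟨(stronglyMeasurable_lik hq hG n).comp_measurable measurable_prodMk_left,
    (C * A * μ.real univ) ^ n, fun z => by
      rw [Real.norm_of_nonneg (lik_pos_and_le hq hG n y z).1.le]
      exact (lik_pos_and_le hq hG n y z).2⟩, fun z => (lik_pos_and_le hq hG n y z).1⟩

lemma isWeight_emission_lik (hq : IsMixing c C q) (hG : IsEmission A G) (n : ℕ) (y : ℕ → 𝒴) :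
    IsWeight (fun z => G (y 0) z * lik μ q G n (seqShift y) z) :=
  (hG.weight (y 0)).mul (isWeight_lik hq hG n _)

lemma lik_le_mul (hq : IsMixing c C q) (hG : IsEmission A G) (n : ℕ) (y : ℕ → 𝒴) (x x' : 𝒳) :
    lik μ q G n y x ≤ C / c * lik μ q G n y x' := by
  have : Nonempty 𝒳 := ⟨x⟩
  cases n with
  | zero =>
    simp only [lik, mul_one]
    rw [one_le_div hq.pos]; exact hq.le
  | succ n => exact hq.integral_le_mul (isWeight_emission_lik hq hG n y) x x'

/-! ### The recursion for the score -/

lemma stronglyMeasurable_score_integrand (hs : IsScore b s) {f : (ℕ → 𝒴) × 𝒳 → F}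
    (hf : StronglyMeasurable f) :
    StronglyMeasurable fun p : ((ℕ → 𝒴) × 𝒳) × 𝒳 =>
      s (p.1.1 0) p.1.2 p.2 + f (seqShift p.1.1, p.2) :=
  (hs.meas.comp_measurable (g := fun p : ((ℕ → 𝒴) × 𝒳) × 𝒳 => (p.1.1 0, p.1.2, p.2))
    (((measurable_pi_apply 0).comp (measurable_fst.comp measurable_fst)).prodMk
      ((measurable_snd.comp measurable_fst).prodMk measurable_snd))).add
  (hf.comp_measurable ((measurable_seqShift.comp (measurable_fst.comp measurable_fst)).prodMk
    measurable_snd))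

lemma stronglyMeasurable_score (hq : IsMixing c C q) (hG : IsEmission A G) (hs : IsScore b s)
    (n : ℕ) : StronglyMeasurable fun p : (ℕ → 𝒴) × 𝒳 => score μ q G s n p.1 p.2 := by
  induction n with
  | zero => exact stronglyMeasurable_const
  | succ n ih =>
    exact stronglyMeasurable_wavg (α := (ℕ → 𝒴) × 𝒳)
      (a := fun p z => q p.2 z * (G (p.1 0) z * lik μ q G n (seqShift p.1) z))
      (f := fun p z => s (p.1 0) p.2 z + score μ q G s n (seqShift p.1) z)
      (stronglyMeasurable_weight_lik hq hG (stronglyMeasurable_lik hq hG n))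
      (stronglyMeasurable_score_integrand hs ih)

/-- A bound for the score. -/
def scoreBound (b : 𝒴 → ℝ) : ℕ → (ℕ → 𝒴) → ℝ := shiftSum 1 (fun _ => 0) fun _ y => b (y 0)

lemma norm_score_le (hq : IsMixing c C q) (hG : IsEmission A G) (hs : IsScore b s)
    (n : ℕ) (y : ℕ → 𝒴) (x : 𝒳) : ‖score μ q G s n y x‖ ≤ scoreBound b n y := by
  induction n generalizing y x with
  | zero => simp [score, scoreBound, shiftSum]
  | succ n ih =>
    refine norm_wavg_le ((hq.weight x).mul (isWeight_emission_lik hq hG n y)) fun z => ?_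
    rw [scoreBound, shiftSum, one_mul]
    exact (norm_add_le _ _).trans (add_le_add (hs.le _ _ _) (ih _ _))

lemma bddMeas_score (hq : IsMixing c C q) (hG : IsEmission A G) (hs : IsScore b s)
    (n : ℕ) (y : ℕ → 𝒴) : BddMeas (score μ q G s n y) :=
  ⟨(stronglyMeasurable_score hq hG hs n).comp_measurable measurable_prodMk_left,
    scoreBound b n y, norm_score_le hq hG hs n y⟩

/-- A bound for the oscillation of the score. -/
def scoreOsc (ρ : ℝ) (b : 𝒴 → ℝ) : ℕ → (ℕ → 𝒴) → ℝ :=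
  shiftSum ρ (fun _ => 0) fun _ y => 2 * b (y 0)

lemma scoreOsc_nonneg {ρ : ℝ} (hρ : 0 ≤ ρ) (hb : ∀ y, 0 ≤ b y) (n : ℕ) (y : ℕ → 𝒴) :
    0 ≤ scoreOsc ρ b n y :=
  shiftSum_nonneg hρ (fun _ => le_rfl) (fun _ y => mul_nonneg two_pos.le (hb (y 0))) n y

lemma scoreOsc_le_succ {ρ : ℝ} (hρ : 0 ≤ ρ) (hb : ∀ y, 0 ≤ b y) (n : ℕ) (y : ℕ → 𝒴) :
    scoreOsc ρ b n y ≤ scoreOsc ρ b (n + 1) y := by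
  induction n generalizing y with
  | zero => exact scoreOsc_nonneg hρ hb 1 y
  | succ n ih => exact add_le_add_right (mul_le_mul_of_nonneg_left (ih _) hρ) _

lemma norm_score_sub_le (hq : IsMixing c C q) (hG : IsEmission A G) (hs : IsScore b s)
    (n : ℕ) (y : ℕ → 𝒴) (x x' : 𝒳) :
    ‖score μ q G s n y x - score μ q G s n y x'‖ ≤ scoreOsc (1 - c / C) b n y := by
  induction n generalizing y x x' with
  | zero => simp [score, scoreOsc, shiftSum]
  | succ n ih =>
    exact score_osc hq (isWeight_emission_lik hq hG n y) (hs.bddMeas _) (bddMeas_score hq hG hs n _)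
      (hs.le _) (ih _) x x'

lemma norm_score_incr_le (hq : IsMixing c C q) (hG : IsEmission A G) (hs : IsScore b s)
    (n : ℕ) (y : ℕ → 𝒴) (x : 𝒳) :
    ‖score μ q G s (n + 1) y x - score μ q G s n (seqShift y) x‖ ≤
      b (y 0) + scoreOsc (1 - c / C) b n (seqShift y) :=
  score_incr hq (isWeight_emission_lik hq hG n y) (hs.bddMeas _) (bddMeas_score hq hG hs n _)
    (hs.le _) (norm_score_sub_le hq hG hs n _) x x

/-! ### The recursion for the second derivative -/

lemma stronglyMeasurable_hess (hq : IsMixing c C q) (hG : IsEmission A G) (hs : IsScore b s)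
    (hs₂ : IsScore e s₂) (n : ℕ) :
    StronglyMeasurable fun p : (ℕ → 𝒴) × 𝒳 => hess μ B q G s s₂ n p.1 p.2 := by
  induction n with
  | zero => exact stronglyMeasurable_const
  | succ n ih =>
    have hw := stronglyMeasurable_weight_lik hq hG (stronglyMeasurable_lik (μ := μ) hq hG n)
    have hf := stronglyMeasurable_score_integrand hs (stronglyMeasurable_score (μ := μ) hq hG hs n)
    have h1 := stronglyMeasurable_wavg (μ := μ) (α := (ℕ → 𝒴) × 𝒳)
      (a := fun p z => q p.2 z * (G (p.1 0) z * lik μ q G n (seqShift p.1) z))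
      (f := fun p z => s₂ (p.1 0) p.2 z + hess μ B q G s s₂ n (seqShift p.1) z)
      hw (stronglyMeasurable_score_integrand hs₂ ih)
    have h2 := stronglyMeasurable_wavg (μ := μ) (α := (ℕ → 𝒴) × 𝒳)
      (a := fun p z => q p.2 z * (G (p.1 0) z * lik μ q G n (seqShift p.1) z))
      (f := fun p z => s (p.1 0) p.2 z + score μ q G s n (seqShift p.1) z) hw hf
    have h3 := stronglyMeasurable_wavg (μ := μ) (α := (ℕ → 𝒴) × 𝒳)
      (a := fun p z => q p.2 z * (G (p.1 0) z * lik μ q G n (seqShift p.1) z))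
      (f := fun p z => B (s (p.1 0) p.2 z + score μ q G s n (seqShift p.1) z)
        (s (p.1 0) p.2 z + score μ q G s n (seqShift p.1) z)) hw
        (B.continuous₂.comp_stronglyMeasurable (hf.prodMk hf))
    exact h1.add (h3.sub (B.continuous₂.comp_stronglyMeasurable (h2.prodMk h2)))

/-- A bound for the second derivative. -/
def hessBound (b e : 𝒴 → ℝ) : ℕ → (ℕ → 𝒴) → ℝ :=
  shiftSum 1 (fun _ => 0) fun n y => e (y 0) + 2 * (b (y 0) + scoreBound b n (seqShift y)) ^ 2

lemma norm_hess_le (hB : IsTensor B) (hq : IsMixing c C q) (hG : IsEmission A G) (hs : IsScore b s)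
    (hs₂ : IsScore e s₂) (n : ℕ) (y : ℕ → 𝒴) (x : 𝒳) :
    ‖hess μ B q G s s₂ n y x‖ ≤ hessBound b e n y := by
  induction n generalizing y x with
  | zero => simp [hess, hessBound, shiftSum]
  | succ n ih =>
    have w := (hq.weight x).mul (isWeight_emission_lik (μ := μ) hq hG n y)
    have h1 := norm_wavg_le (μ := μ) (B := e (y 0) + hessBound b e n (seqShift y)) w (fun z =>
      (norm_add_le _ _).trans (add_le_add (hs₂.le (y 0) x z) (ih (seqShift y) z)))
    have h2 := norm_wcov_le (μ := μ) (β := b (y 0) + scoreBound b n (seqShift y)) hB w (fun z =>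
      (norm_add_le _ _).trans (add_le_add (hs.le (y 0) x z)
        (norm_score_le (μ := μ) hq hG hs n (seqShift y) z)))
    rw [hess, hessStep]
    refine (norm_add_le _ _).trans ((add_le_add h1 h2).trans (le_of_eq ?_))
    rw [hessBound, shiftSum]
    ring

lemma bddMeas_hess (hB : IsTensor B) (hq : IsMixing c C q) (hG : IsEmission A G) (hs : IsScore b s)
    (hs₂ : IsScore e s₂) (n : ℕ) (y : ℕ → 𝒴) : BddMeas (hess μ B q G s s₂ n y) :=
  ⟨(stronglyMeasurable_hess hq hG hs hs₂ n).comp_measurable measurable_prodMk_left,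
    hessBound b e n y, norm_hess_le hB hq hG hs hs₂ n y⟩

/-- A bound for the oscillation of the second derivative. -/
def hessOsc (ρ : ℝ) (b e : 𝒴 → ℝ) : ℕ → (ℕ → 𝒴) → ℝ :=
  shiftSum ρ (fun _ => 0) fun n y => 2 * e (y 0) + 4 * (b (y 0) + scoreOsc ρ b n (seqShift y)) ^ 2

lemma norm_hess_sub_le (hB : IsTensor B) (hq : IsMixing c C q) (hG : IsEmission A G)
    (hs : IsScore b s) (hs₂ : IsScore e s₂) (n : ℕ) (y : ℕ → 𝒴) (x x' : 𝒳) :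
    ‖hess μ B q G s s₂ n y x - hess μ B q G s s₂ n y x'‖ ≤ hessOsc (1 - c / C) b e n y := by
  induction n generalizing y x x' with
  | zero => simp [hess, hessOsc, shiftSum]
  | succ n ih =>
    exact hess_osc hB hq (isWeight_emission_lik hq hG n y) (hs.bddMeas _)
      (bddMeas_score hq hG hs n _) (hs.le _) (norm_score_sub_le hq hG hs n _) (hs₂.bddMeas _)
      (bddMeas_hess hB hq hG hs hs₂ n _) (hs₂.le _) (ih _) x x'

lemma norm_hess_incr_le (hB : IsTensor B) (hq : IsMixing c C q) (hG : IsEmission A G)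
    (hs : IsScore b s) (hs₂ : IsScore e s₂) (n : ℕ) (y : ℕ → 𝒴) (x : 𝒳) :
    ‖hess μ B q G s s₂ (n + 1) y x - hess μ B q G s s₂ n (seqShift y) x‖ ≤
      e (y 0) + hessOsc (1 - c / C) b e n (seqShift y) +
        2 * (b (y 0) + scoreOsc (1 - c / C) b n (seqShift y)) ^ 2 :=
  hess_incr hB hq (isWeight_emission_lik hq hG n y) (hs.bddMeas _)
      (bddMeas_score hq hG hs n _) (hs.le _) (norm_score_sub_le hq hG hs n _) (hs₂.bddMeas _)
      (bddMeas_hess hB hq hG hs hs₂ n _) (hs₂.le _) (norm_hess_sub_le hB hq hG hs hs₂ n _) x x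

/-! ### Forgetting of the horizon -/

lemma ratioBound_horizon (hq : IsMixing c C q) (hG : IsEmission A G) (n : ℕ) (y : ℕ → 𝒴) :
    RatioBound (lik μ q G n y) (lik μ q G (n + 1) y) ((1 - c / C) ^ n * (C / c - 1)) := by
  induction n generalizing y with
  | zero =>
    intro z w
    have := lik_le_mul (μ := μ) hq hG 1 y z w
    rw [pow_zero, one_mul, add_sub_cancel]
    simpa [lik] using this
  | succ n ih =>
    intro z w
    have : Nonempty 𝒳 := ⟨z⟩
    have hE : 0 ≤ (1 - c / C) ^ n * (C / c - 1) := by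
      refine mul_nonneg (pow_nonneg hq.rho_nonneg _) ?_
      rw [sub_nonneg, one_le_div hq.pos]; exact hq.le
    have h := RatioBound.mul (hG.weight (y 0)) (hG.weight (y 0)) (isWeight_lik (μ := μ) hq hG n (seqShift y))
      (isWeight_lik hq hG (n + 1) (seqShift y)) (E₁ := 0) (fun z w => by linarith) (ih _) le_rfl
    rw [zero_mul, add_zero, zero_add] at h
    have := h.integral (μ := μ) hq (isWeight_emission_lik hq hG n y)
      (isWeight_emission_lik hq hG (n + 1) y) hE z w
    rw [pow_succ', mul_assoc]
    exact this

/-- The relative error made by replacing the horizon `n + 1` by `n`. -/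
def horizonRate (c C : ℝ) (n : ℕ) : ℝ := (1 - c / C) ^ n * (C / c - 1)

lemma IsMixing.horizonRate_nonneg [Nonempty 𝒳] (hq : IsMixing c C q) (n : ℕ) :
    0 ≤ horizonRate c C n := by
  refine mul_nonneg (pow_nonneg hq.rho_nonneg _) ?_
  rw [sub_nonneg, one_le_div hq.pos]; exact hq.le

lemma ratioBound_horizon_weight (hq : IsMixing c C q) (hG : IsEmission A G) (n : ℕ)
    (y : ℕ → 𝒴) :
    RatioBound (fun z => G (y 0) z * lik μ q G n (seqShift y) z)
      (fun z => G (y 0) z * lik μ q G (n + 1) (seqShift y) z) (horizonRate c C n) := by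
  have h := RatioBound.mul (hG.weight (y 0)) (hG.weight (y 0)) (isWeight_lik (μ := μ) hq hG n (seqShift y))
    (isWeight_lik hq hG (n + 1) (seqShift y)) (E₁ := 0) (fun z w => by linarith)
    (ratioBound_horizon hq hG n _) le_rfl
  rwa [zero_mul, add_zero, zero_add] at h

lemma abs_log_incr_sub_le (hq : IsMixing c C q) (hG : IsEmission A G) (n : ℕ) (y : ℕ → 𝒴)
    (x : 𝒳) :
    |(Real.log (lik μ q G (n + 2) y x) - Real.log (lik μ q G (n + 1) (seqShift y) x)) -
      (Real.log (lik μ q G (n + 1) y x) - Real.log (lik μ q G n (seqShift y) x))| ≤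
      horizonRate c C n := by
  have : Nonempty 𝒳 := ⟨x⟩
  set E := horizonRate c C n with hEdef
  have hE : 0 ≤ E := hq.horizonRate_nonneg n
  have hr := ratioBound_horizon (μ := μ) hq hG n (seqShift y)
  have p (n : ℕ) (y : ℕ → 𝒴) := (lik_pos_and_le (μ := μ) hq hG n y x).1
  have w (n : ℕ) := ((hq.weight x).mul (isWeight_emission_lik (μ := μ) hq hG n y))
  have up : lik μ q G (n + 2) y x * lik μ q G n (seqShift y) x ≤
      (1 + E) * (lik μ q G (n + 1) (seqShift y) x * lik μ q G (n + 1) y x) := by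
    have := weight_ratio_le_of_le (μ := μ)
      ((BddMeas.const (lik μ q G n (seqShift y) x)).mul (w (n + 1)).toBddMeas)
      (w n).toBddMeas (K := (1 + E) * lik μ q G (n + 1) (seqShift y) x) (fun z => by
        have h1 := mul_le_mul_of_nonneg_left (hr z x) (((hq.weight x).mul (hG.weight (y 0))).pos z).le
        simp only [horizonRate, hEdef] at h1 ⊢
        linarith)
    rw [integral_const_mul] at this
    calc _ = lik μ q G n (seqShift y) x * lik μ q G (n + 2) y x := mul_comm _ _
      _ ≤ _ := this
      _ = _ := by rw [mul_assoc]; rfl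
  have low : lik μ q G (n + 1) (seqShift y) x * lik μ q G (n + 1) y x ≤
      (1 + E) * (lik μ q G (n + 2) y x * lik μ q G n (seqShift y) x) := by
    have := weight_ratio_le_of_le (μ := μ)
      ((BddMeas.const (lik μ q G (n + 1) (seqShift y) x)).mul (w n).toBddMeas)
      (w (n + 1)).toBddMeas (K := (1 + E) * lik μ q G n (seqShift y) x) (fun z => by
        have h1 := mul_le_mul_of_nonneg_left (hr x z) (((hq.weight x).mul (hG.weight (y 0))).pos z).le
        simp only [horizonRate, hEdef] at h1 ⊢
        linarith)
    rw [integral_const_mul] at this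
    calc _ ≤ _ := this
      _ = (1 + E) * (lik μ q G n (seqShift y) x * lik μ q G (n + 2) y x) := by
        rw [mul_assoc]; rfl
      _ = _ := by rw [mul_comm (lik μ q G n (seqShift y) x)]
  have hE1 : 0 < 1 + E := by linarith
  have hlog : Real.log (1 + E) ≤ E := by
    have := Real.log_le_sub_one_of_pos hE1; linarith
  have l1 := Real.log_le_log (mul_pos (p _ _) (p _ _)) up
  have l2 := Real.log_le_log (mul_pos (p _ _) (p _ _)) low
  rw [Real.log_mul (p _ _).ne' (p _ _).ne', Real.log_mul hE1.ne' (mul_pos (p _ _) (p _ _)).ne',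
    Real.log_mul (p _ _).ne' (p _ _).ne'] at l1 l2
  rw [abs_le]
  constructor <;> linarith

/-- A bound for the oscillation of the effect of the horizon on the score. -/
def scoreForget (c C : ℝ) (b : 𝒴 → ℝ) : ℕ → (ℕ → 𝒴) → ℝ :=
  shiftSum (1 - c / C) (fun y => 2 * b (y 0)) fun n y =>
    2 * (horizonRate c C n * (2 * b (y 0) + scoreOsc (1 - c / C) b n (seqShift y)))

lemma norm_score_forget (hq : IsMixing c C q) (hG : IsEmission A G) (hs : IsScore b s)
    (n : ℕ) (y : ℕ → 𝒴) (x x' : 𝒳) :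
    ‖(score μ q G s (n + 1) y x - score μ q G s n y x) -
      (score μ q G s (n + 1) y x' - score μ q G s n y x')‖ ≤ scoreForget c C b n y := by
  have : Nonempty 𝒳 := ⟨x⟩
  induction n generalizing y x x' with
  | zero =>
    have := norm_score_sub_le (μ := μ) hq hG hs 1 y x x'
    simpa [score, scoreOsc, scoreForget, shiftSum] using this
  | succ n ih =>
    have := score_step_osc (μ := μ) hq (isWeight_emission_lik (μ := μ) hq hG n y)
      (isWeight_emission_lik (μ := μ) hq hG (n + 1) y) (hs.bddMeas (y 0)) (hs.bddMeas (y 0))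
      (bddMeas_score hq hG hs n (seqShift y)) (bddMeas_score hq hG hs (n + 1) (seqShift y))
      ((ratioBound_horizon_weight hq hG n y).avgClose hq (isWeight_emission_lik (μ := μ) hq hG n y)
        (isWeight_emission_lik (μ := μ) hq hG (n + 1) y) (hq.horizonRate_nonneg n)) (hs.le _)
      (norm_score_sub_le hq hG hs n _) (σ := 0) (by simp) (ih _) x x'
    rw [add_zero] at this
    exact this

lemma norm_score_incr_forget (hq : IsMixing c C q) (hG : IsEmission A G) (hs : IsScore b s)
    (n : ℕ) (y : ℕ → 𝒴) (x : 𝒳) :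
    ‖(score μ q G s (n + 2) y x - score μ q G s (n + 1) (seqShift y) x) -
      (score μ q G s (n + 1) y x - score μ q G s n (seqShift y) x)‖ ≤
      horizonRate c C n * (2 * b (y 0) + scoreOsc (1 - c / C) b n (seqShift y)) +
        scoreForget c C b n (seqShift y) := by
  have : Nonempty 𝒳 := ⟨x⟩
  have := score_step_incr (μ := μ) hq (isWeight_emission_lik (μ := μ) hq hG n y)
      (isWeight_emission_lik (μ := μ) hq hG (n + 1) y) (hs.bddMeas (y 0)) (hs.bddMeas (y 0))
      (bddMeas_score (μ := μ) hq hG hs n (seqShift y)) (bddMeas_score (μ := μ) hq hG hs (n + 1) (seqShift y))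
      ((ratioBound_horizon_weight (μ := μ) hq hG n y).avgClose hq (isWeight_emission_lik (μ := μ) hq hG n y)
        (isWeight_emission_lik (μ := μ) hq hG (n + 1) y) (hq.horizonRate_nonneg n)) (hs.le _)
      (norm_score_sub_le (μ := μ) hq hG hs n _) (σ := 0) (by simp) (norm_score_forget hq hG hs n _) x x
  rw [add_zero] at this
  exact this

/-- The effect of one step on the difference of second derivatives for consecutive horizons. -/
def hessForgetStep (c C : ℝ) (b e : 𝒴 → ℝ) (n : ℕ) (y : ℕ → 𝒴) : ℝ :=
  horizonRate c C n * (2 * e (y 0) + hessOsc (1 - c / C) b e n (seqShift y)) +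
    4 * (b (y 0) + scoreOsc (1 - c / C) b (n + 1) (seqShift y)) * scoreForget c C b n (seqShift y) +
    6 * horizonRate c C n * (b (y 0) + scoreOsc (1 - c / C) b (n + 1) (seqShift y)) ^ 2

/-- A bound for the oscillation of the effect of the horizon on the second derivative. -/
def hessForget (c C : ℝ) (b e : 𝒴 → ℝ) : ℕ → (ℕ → 𝒴) → ℝ :=
  shiftSum (1 - c / C) (fun y => 2 * e (y 0) + 4 * b (y 0) ^ 2) fun n y =>
    2 * hessForgetStep c C b e n y

lemma norm_hess_forget (hB : IsTensor B) (hq : IsMixing c C q) (hG : IsEmission A G)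
    (hs : IsScore b s) (hs₂ : IsScore e s₂) (n : ℕ) (y : ℕ → 𝒴) (x x' : 𝒳) :
    ‖(hess μ B q G s s₂ (n + 1) y x - hess μ B q G s s₂ n y x) -
      (hess μ B q G s s₂ (n + 1) y x' - hess μ B q G s s₂ n y x')‖ ≤ hessForget c C b e n y := by
  have : Nonempty 𝒳 := ⟨x⟩
  have hb : ∀ y, 0 ≤ b y := fun y => (norm_nonneg _).trans (hs.le y x x)
  induction n generalizing y x x' with
  | zero =>
    have := norm_hess_sub_le (μ := μ) hB hq hG hs hs₂ 1 y x x'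
    simpa [hess, hessOsc, scoreOsc, hessForget, shiftSum] using this
  | succ n ih =>
    have hr := (ratioBound_horizon_weight (μ := μ) hq hG n y)
    exact hess_step_osc hB hq (isWeight_emission_lik hq hG n y)
      (isWeight_emission_lik hq hG (n + 1) y) (hs.bddMeas (y 0))
      (bddMeas_score hq hG hs n (seqShift y)) (bddMeas_score hq hG hs (n + 1) (seqShift y))
      (hr.avgClose hq (isWeight_emission_lik hq hG n y)
        (isWeight_emission_lik hq hG (n + 1) y) (hq.horizonRate_nonneg n))
      (hr.avgClose hq (isWeight_emission_lik hq hG n y)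
        (isWeight_emission_lik hq hG (n + 1) y) (hq.horizonRate_nonneg n)) (hs.le _)
      (fun z w => (norm_score_sub_le hq hG hs n _ z w).trans
        (scoreOsc_le_succ hq.rho_nonneg hb n _))
      (norm_score_sub_le hq hG hs (n + 1) _) (norm_score_forget hq hG hs n _)
      (hs₂.bddMeas _) (bddMeas_hess hB hq hG hs hs₂ n _) (bddMeas_hess hB hq hG hs hs₂ (n + 1) _)
      (hs₂.le _) (norm_hess_sub_le hB hq hG hs hs₂ n _) (ih _) x x'

lemma norm_hess_incr_forget (hB : IsTensor B) (hq : IsMixing c C q) (hG : IsEmission A G)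
    (hs : IsScore b s) (hs₂ : IsScore e s₂) (n : ℕ) (y : ℕ → 𝒴) (x : 𝒳) :
    ‖(hess μ B q G s s₂ (n + 2) y x - hess μ B q G s s₂ (n + 1) (seqShift y) x) -
      (hess μ B q G s s₂ (n + 1) y x - hess μ B q G s s₂ n (seqShift y) x)‖ ≤
      hessForgetStep c C b e n y + hessForget c C b e n (seqShift y) := by
  have : Nonempty 𝒳 := ⟨x⟩
  have hb : ∀ y, 0 ≤ b y := fun y => (norm_nonneg _).trans (hs.le y x x)
  have hr := (ratioBound_horizon_weight (μ := μ) hq hG n y)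
  exact hess_step_incr hB hq (isWeight_emission_lik hq hG n y)
      (isWeight_emission_lik hq hG (n + 1) y) (hs.bddMeas (y 0))
      (bddMeas_score hq hG hs n (seqShift y)) (bddMeas_score hq hG hs (n + 1) (seqShift y))
      (hr.avgClose hq (isWeight_emission_lik hq hG n y)
        (isWeight_emission_lik hq hG (n + 1) y) (hq.horizonRate_nonneg n))
      (hr.avgClose hq (isWeight_emission_lik hq hG n y)
        (isWeight_emission_lik hq hG (n + 1) y) (hq.horizonRate_nonneg n)) (hs.le _)
      (fun z w => (norm_score_sub_le hq hG hs n _ z w).trans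
        (scoreOsc_le_succ hq.rho_nonneg hb n _))
      (norm_score_sub_le hq hG hs (n + 1) _) (norm_score_forget hq hG hs n _)
      (hs₂.bddMeas _) (bddMeas_hess hB hq hG hs hs₂ n _) (bddMeas_hess hB hq hG hs hs₂ (n + 1) _)
      (hs₂.le _) (norm_hess_sub_le hB hq hG hs hs₂ n _) (norm_hess_forget hB hq hG hs hs₂ n _) x x

/-! ### Dependence on the emission densities -/

/-- A bound for the relative change of the likelihood, as a function of the initial state, under a
perturbation of the emission densities. -/
def likPert (c C : ℝ) (η : 𝒴 → ℝ) : ℕ → (ℕ → 𝒴) → ℝ :=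
  shiftSum (1 - c / C) (fun _ => 0) fun _ y => (C / c) ^ 2 * η (y 0)

lemma likPert_nonneg [Nonempty 𝒳] (hq : IsMixing c C q) (hη : ∀ y, 0 ≤ η y) (n : ℕ)
    (y : ℕ → 𝒴) : 0 ≤ likPert c C η n y :=
  shiftSum_nonneg hq.rho_nonneg (fun _ => le_rfl)
    (fun _ y => mul_nonneg (sq_nonneg _) (hη (y 0))) n y

lemma ratioBound_lik_trivial (hq : IsMixing c C q) (hG : IsEmission A G) (hG' : IsEmission A G')
    (n : ℕ) (y : ℕ → 𝒴) :
    RatioBound (lik μ q G n y) (lik μ q G' n y) ((C / c) ^ 2 - 1) := fun z w => by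
  have h1 := lik_le_mul (μ := μ) hq hG n y w z
  have h2 := lik_le_mul (μ := μ) hq hG' n y z w
  have := mul_le_mul h2 h1 (isWeight_lik hq hG n y |>.pos w).le
    ((isWeight_lik hq hG' n y |>.pos z).le.trans h2)
  nlinarith

lemma ratioBound_lik_step (hq : IsMixing c C q) (hG : IsEmission A G) (hG' : IsEmission A G')
    (hη : ∀ y, 0 ≤ η y) (h : ∀ y, η y < 1 → RatioBound (G y) (G' y) (η y)) {n : ℕ} {y : ℕ → 𝒴}
    (ih : RatioBound (lik μ q G n (seqShift y)) (lik μ q G' n (seqShift y))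
      (likPert c C η n (seqShift y))) (hy : η (y 0) < 1) [Nonempty 𝒳] :
    ∃ E, 0 ≤ E ∧ E ≤ likPert c C η n (seqShift y) + (C / c) ^ 2 * η (y 0) ∧
      RatioBound (fun z => G (y 0) z * lik μ q G n (seqShift y) z)
      (fun z => G' (y 0) z * lik μ q G' n (seqShift y) z) E := by
  have hCc : 1 ≤ C / c := by rw [one_le_div hq.pos]; exact hq.le
  set E₂ := min (likPert c C η n (seqShift y)) ((C / c) ^ 2 - 1)
  have hE₂ : 0 ≤ E₂ := le_min (likPert_nonneg hq hη n _) (by nlinarith)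
  have hr : RatioBound (lik μ q G n (seqShift y)) (lik μ q G' n (seqShift y)) E₂ := by
    rcases min_choice (likPert c C η n (seqShift y)) ((C / c) ^ 2 - 1) with h' | h' <;>
      simp only [E₂, h']
    · exact ih
    · exact ratioBound_lik_trivial hq hG hG' n _
  refine ⟨η (y 0) + E₂ + η (y 0) * E₂, by have := hη (y 0); positivity, ?_,
    RatioBound.mul (hG.weight _) (hG'.weight _) (isWeight_lik hq hG n _) (isWeight_lik hq hG' n _)
      (h _ hy) hr (hη _)⟩
  have h1 : E₂ ≤ likPert c C η n (seqShift y) := min_le_left _ _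
  have h2 : E₂ ≤ (C / c) ^ 2 - 1 := min_le_right _ _
  nlinarith [hη (y 0)]

lemma ratioBound_lik (hq : IsMixing c C q) (hG : IsEmission A G) (hG' : IsEmission A G')
    (hη : ∀ y, 0 ≤ η y) (h : ∀ y, η y < 1 → RatioBound (G y) (G' y) (η y)) (n : ℕ) (y : ℕ → 𝒴) :
    RatioBound (lik μ q G n y) (lik μ q G' n y) (likPert c C η n y) := by
  induction n generalizing y with
  | zero => intro z w; simp [lik, likPert, shiftSum]
  | succ n ih =>
    intro z w
    have : Nonempty 𝒳 := ⟨z⟩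
    have hlp := likPert_nonneg hq hη n (seqShift y)
    by_cases hy : η (y 0) < 1
    · obtain ⟨E, hE, hle, hE'⟩ := ratioBound_lik_step hq hG hG' hη h (ih (seqShift y)) hy
      refine ((hE'.integral (μ := μ) hq (isWeight_emission_lik hq hG n y)
        (isWeight_emission_lik hq hG' n y) hE).mono (isWeight_lik hq hG (n + 1) y)
        (isWeight_lik hq hG' (n + 1) y) ?_) z w
      have h1 := mul_le_mul_of_nonneg_left hle hq.rho_nonneg
      have h2 := mul_nonneg (sq_nonneg (C / c)) (hη (y 0))
      have h3 := hq.rho_lt_one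
      rw [likPert, shiftSum]
      change (1 - c / C) * E ≤ (C / c) ^ 2 * η (y 0) +
        (1 - c / C) * likPert c C η n (seqShift y)
      nlinarith
    · refine (ratioBound_lik_trivial hq hG hG' (n + 1) y).mono (isWeight_lik hq hG (n + 1) y)
        (isWeight_lik hq hG' (n + 1) y) ?_ z w
      have h2 := mul_le_mul_of_nonneg_left (not_lt.1 hy) (sq_nonneg (C / c))
      have h3 := mul_nonneg hq.rho_nonneg hlp
      change (C / c) ^ 2 - 1 ≤ (C / c) ^ 2 * η (y 0) +
        (1 - c / C) * likPert c C η n (seqShift y)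
      linarith

/-- A bound for the relative change of the posterior weights. -/
def weightPert (c C : ℝ) (η : 𝒴 → ℝ) (n : ℕ) (y : ℕ → 𝒴) : ℝ :=
  likPert c C η n (seqShift y) + (C / c) ^ 2 * η (y 0)

lemma avgClose_pert (hq : IsMixing c C q) (hG : IsEmission A G) (hG' : IsEmission A G')
    (hη : ∀ y, 0 ≤ η y) (h : ∀ y, η y < 1 → RatioBound (G y) (G' y) (η y)) (n : ℕ) (y : ℕ → 𝒴)
    [Nonempty 𝒳] :
    AvgClose μ F q (fun z => G (y 0) z * lik μ q G n (seqShift y) z)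
      (fun z => G' (y 0) z * lik μ q G' n (seqShift y) z) (weightPert c C η n y) := by
  have hlp := likPert_nonneg hq hη n (seqShift y)
  by_cases hy : η (y 0) < 1
  · obtain ⟨E, hE, hle, hE'⟩ :=
      ratioBound_lik_step (μ := μ) hq hG hG' hη h (ratioBound_lik hq hG hG' hη h n (seqShift y)) hy
    exact (hE'.mono (isWeight_emission_lik hq hG n y) (isWeight_emission_lik hq hG' n y)
      hle).avgClose hq (isWeight_emission_lik hq hG n y) (isWeight_emission_lik hq hG' n y)
      (hE.trans hle)
  · refine avgClose_one hq (isWeight_emission_lik hq hG n y) (isWeight_emission_lik hq hG' n y) ?_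
    have hCc : 1 ≤ C / c := by rw [one_le_div hq.pos]; exact hq.le
    have h2 := mul_le_mul_of_nonneg_left (not_lt.1 hy) (sq_nonneg (C / c))
    rw [weightPert]
    nlinarith

/-- A bound for the change of the score, as a function of the initial state, under a perturbation
of the emission densities. -/
def scorePert (c C : ℝ) (b η σ : 𝒴 → ℝ) : ℕ → (ℕ → 𝒴) → ℝ :=
  shiftSum (1 - c / C) (fun _ => 0) fun n y =>
    2 * (weightPert c C η n y * (2 * b (y 0) + scoreOsc (1 - c / C) b n (seqShift y)) + σ (y 0))

variable {b' : 𝒴 → ℝ}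

lemma norm_score_pert (hq : IsMixing c C q) (hG : IsEmission A G) (hG' : IsEmission A G')
    (hs : IsScore b s) (hs' : IsScore b' s')
    (hη : ∀ y, 0 ≤ η y) (h : ∀ y, η y < 1 → RatioBound (G y) (G' y) (η y))
    (hσ : ∀ y x z, ‖s' y x z - s y x z‖ ≤ σ y) (n : ℕ) (y : ℕ → 𝒴) (x x' : 𝒳) :
    ‖(score μ q G' s' n y x - score μ q G s n y x) -
      (score μ q G' s' n y x' - score μ q G s n y x')‖ ≤ scorePert c C b η σ n y := by
  have : Nonempty 𝒳 := ⟨x⟩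
  induction n generalizing y x x' with
  | zero => simp [score, scorePert, shiftSum]
  | succ n ih =>
    exact score_step_osc hq (isWeight_emission_lik hq hG n y)
      (isWeight_emission_lik hq hG' n y) (hs.bddMeas (y 0)) (hs'.bddMeas (y 0))
      (bddMeas_score hq hG hs n (seqShift y)) (bddMeas_score hq hG' hs' n (seqShift y))
      (avgClose_pert hq hG hG' hη h n y) (hs.le _)
      (norm_score_sub_le hq hG hs n _) (hσ _) (ih _) x x'

lemma norm_score_incr_pert (hq : IsMixing c C q) (hG : IsEmission A G) (hG' : IsEmission A G')
    (hs : IsScore b s) (hs' : IsScore b' s')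
    (hη : ∀ y, 0 ≤ η y) (h : ∀ y, η y < 1 → RatioBound (G y) (G' y) (η y))
    (hσ : ∀ y x z, ‖s' y x z - s y x z‖ ≤ σ y) (n : ℕ) (y : ℕ → 𝒴) (x : 𝒳) :
    ‖(score μ q G' s' (n + 1) y x - score μ q G' s' n (seqShift y) x) -
      (score μ q G s (n + 1) y x - score μ q G s n (seqShift y) x)‖ ≤
      weightPert c C η n y * (2 * b (y 0) + scoreOsc (1 - c / C) b n (seqShift y)) + σ (y 0) +
        scorePert c C b η σ n (seqShift y) := by
  have : Nonempty 𝒳 := ⟨x⟩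
  exact score_step_incr hq (isWeight_emission_lik hq hG n y)
      (isWeight_emission_lik hq hG' n y) (hs.bddMeas (y 0)) (hs'.bddMeas (y 0))
      (bddMeas_score hq hG hs n (seqShift y)) (bddMeas_score hq hG' hs' n (seqShift y))
      (avgClose_pert hq hG hG' hη h n y) (hs.le _)
      (norm_score_sub_le hq hG hs n _) (hσ _) (norm_score_pert hq hG hG' hs hs' hη h hσ n _) x x

end Recursions


section Differentiation

variable {Z : Type*} [MeasurableSpace Z] {μ : Measure Z} [IsFiniteMeasure μ] [NeZero μ]
  {V : Type*} [NormedAddCommGroup V] [NormedSpace ℝ V]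

/-- The tensor product of linear forms. -/
def formTensor (V : Type*) [NormedAddCommGroup V] [NormedSpace ℝ V] :
    (V →L[ℝ] ℝ) →L[ℝ] (V →L[ℝ] ℝ) →L[ℝ] (V →L[ℝ] V →L[ℝ] ℝ) :=
  ContinuousLinearMap.smulRightL ℝ V (V →L[ℝ] ℝ)

lemma formTensor_apply (u v : V →L[ℝ] ℝ) : formTensor V u v = u.smulRight v := rfl

lemma isTensor_formTensor : IsTensor (formTensor V) :=
  ⟨fun u v => (ContinuousLinearMap.norm_smulRight_apply u v).le⟩

/-- A family of weights on `Z`, smooth in a parameter, with first and second logarithmic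
derivatives `s` and `s₂`. -/
structure SmoothWeights (O : Set V) (A S S₂ : ℝ) (a : V → Z → ℝ) (s : V → Z → V →L[ℝ] ℝ)
    (s₂ : V → Z → V →L[ℝ] V →L[ℝ] ℝ) : Prop where
  isOpen : IsOpen O
  weight : ∀ θ ∈ O, IsWeight (a θ)
  le : ∀ θ ∈ O, ∀ z, a θ z ≤ A
  meas : ∀ θ ∈ O, StronglyMeasurable (s θ)
  bound : ∀ θ ∈ O, ∀ z, ‖s θ z‖ ≤ S
  meas₂ : ∀ θ ∈ O, StronglyMeasurable (s₂ θ)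
  bound₂ : ∀ θ ∈ O, ∀ z, ‖s₂ θ z‖ ≤ S₂
  deriv : ∀ θ ∈ O, ∀ z, HasFDerivAt (fun t => a t z) (a θ z • s θ z) θ
  deriv₂ : ∀ θ ∈ O, ∀ z, HasFDerivAt (fun t => s t z) (s₂ θ z) θ

namespace SmoothWeights

variable {O : Set V} {A S S₂ : ℝ} {a : V → Z → ℝ} {s : V → Z → V →L[ℝ] ℝ}
  {s₂ : V → Z → V →L[ℝ] V →L[ℝ] ℝ} {θ : V}

lemma bddMeas (h : SmoothWeights O A S S₂ a s s₂) (hθ : θ ∈ O) : BddMeas (s θ) :=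
  ⟨h.meas θ hθ, S, h.bound θ hθ⟩

lemma bddMeas₂ (h : SmoothWeights O A S S₂ a s s₂) (hθ : θ ∈ O) : BddMeas (s₂ θ) :=
  ⟨h.meas₂ θ hθ, S₂, h.bound₂ θ hθ⟩

lemma hasFDerivAt_integral (h : SmoothWeights O A S S₂ a s s₂) (hθ : θ ∈ O) :
    HasFDerivAt (fun t => ∫ z, a t z ∂μ) ((∫ z, a θ z ∂μ) • wavg μ (a θ) (s θ)) θ := by
  have key := hasFDerivAt_integral_of_dominated_of_fderiv_le (μ := μ) (𝕜 := ℝ) (s := O)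
    (F := fun t z => a t z) (F' := fun t z => a t z • s t z) (x₀ := θ) (bound := fun _ => A * S)
    (h.isOpen.mem_nhds hθ)
    (by filter_upwards [h.isOpen.mem_nhds hθ] with t ht using
          (h.weight t ht).meas.aestronglyMeasurable)
    (h.weight θ hθ).integrable
    ((h.weight θ hθ).toBddMeas.smul (h.bddMeas hθ)).meas.aestronglyMeasurable
    (ae_of_all _ fun z t ht => by
      rw [norm_smul, Real.norm_of_nonneg ((h.weight t ht).pos z).le]
      exact mul_le_mul (h.le t ht z) (h.bound t ht z) (norm_nonneg _)
        (((h.weight t ht).pos z).le.trans (h.le t ht z)))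
    (integrable_const _) (ae_of_all _ fun z t ht => h.deriv t ht z)
  rwa [wavg, smul_smul, mul_inv_cancel₀ (h.weight θ hθ).integral_pos.ne', one_smul]

lemma hasFDerivAt_wavg (h : SmoothWeights O A S S₂ a s s₂) (hθ : θ ∈ O) :
    HasFDerivAt (fun t => wavg μ (a t) (s t))
      (wavg μ (a θ) (s₂ θ) + wcov μ (formTensor V) (a θ) (s θ)) θ := by
  have hb := ((h.weight θ hθ).toBddMeas.smul (((h.bddMeas₂ hθ).add
    ((h.bddMeas hθ).tensor (isTensor_formTensor (V := V)) (h.bddMeas hθ)))))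
  have key := hasFDerivAt_integral_of_dominated_of_fderiv_le (μ := μ) (𝕜 := ℝ) (s := O)
    (F := fun t z => a t z • s t z)
    (F' := fun t z => a t z • (s₂ t z + formTensor V (s t z) (s t z))) (x₀ := θ)
    (bound := fun _ => A * (S₂ + S ^ 2))
    (h.isOpen.mem_nhds hθ)
    (by filter_upwards [h.isOpen.mem_nhds hθ] with t ht using
          ((h.weight t ht).toBddMeas.smul (h.bddMeas ht)).meas.aestronglyMeasurable)
    ((h.weight θ hθ).toBddMeas.smul (h.bddMeas hθ)).integrable
    hb.meas.aestronglyMeasurable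
    (ae_of_all _ fun z t ht => by
      rw [norm_smul, Real.norm_of_nonneg ((h.weight t ht).pos z).le]
      exact mul_le_mul (h.le t ht z) ((norm_add_le _ _).trans (add_le_add (h.bound₂ t ht z)
        (isTensor_formTensor.norm_sq_le (h.bound t ht z)))) (norm_nonneg _)
        (((h.weight t ht).pos z).le.trans (h.le t ht z)))
    (integrable_const _) (ae_of_all _ fun z t ht => by
      have := (h.deriv t ht z).smul (h.deriv₂ t ht z)
      refine this.congr_fderiv ?_
      rw [smul_add, formTensor_apply]
      congr 1
      ext; simp [mul_assoc])
  have hI := (h.weight θ hθ).integral_pos (μ := μ)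
  have hinv := (hasDerivAt_inv hI.ne').comp_hasFDerivAt θ (h.hasFDerivAt_integral (μ := μ) hθ)
  have hfin := hinv.smul key
  have e1 : ∫ z, a θ z • s θ z ∂μ = (∫ z, a θ z ∂μ) • wavg μ (a θ) (s θ) := by
    rw [wavg, smul_smul, mul_inv_cancel₀ hI.ne', one_smul]
  have e2 : (∫ z, a θ z ∂μ)⁻¹ • ∫ z, a θ z • (s₂ θ z + formTensor V (s θ z) (s θ z)) ∂μ =
      wavg μ (a θ) (s₂ θ) + wavg μ (a θ) (fun z => formTensor V (s θ z) (s θ z)) :=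
    wavg_add (h.weight θ hθ) (h.bddMeas₂ hθ)
      ((h.bddMeas hθ).tensor (isTensor_formTensor (V := V)) (h.bddMeas hθ))
  refine hfin.congr_fderiv ?_
  rw [Function.comp_apply, e2, wcov, add_sub_assoc', sub_eq_add_neg]
  congr 1
  rw [e1, formTensor_apply]
  ext v w
  simp
  field_simp

end SmoothWeights

variable {𝒳 𝒴 : Type*} [MeasurableSpace 𝒳] [MeasurableSpace 𝒴]

/-- A family of hidden Markov models, smooth in the parameter, with first and second logarithmic
derivatives of `q · G` given by `s`, `s₂`. -/
structure SmoothFamily (O : Set V) (c C A : ℝ) (b e : 𝒴 → ℝ) (q : V → 𝒳 → 𝒳 → ℝ)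
    (G : V → 𝒴 → 𝒳 → ℝ) (s : V → 𝒴 → 𝒳 → 𝒳 → V →L[ℝ] ℝ)
    (s₂ : V → 𝒴 → 𝒳 → 𝒳 → V →L[ℝ] V →L[ℝ] ℝ) : Prop where
  isOpen : IsOpen O
  mixing : ∀ θ ∈ O, IsMixing c C (q θ)
  emission : ∀ θ ∈ O, IsEmission A (G θ)
  isScore : ∀ θ ∈ O, IsScore b (s θ)
  isScore₂ : ∀ θ ∈ O, IsScore e (s₂ θ)
  deriv : ∀ θ ∈ O, ∀ y x z,
    HasFDerivAt (fun t => q t x z * G t y z) ((q θ x z * G θ y z) • s θ y x z) θ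
  deriv₂ : ∀ θ ∈ O, ∀ y x z, HasFDerivAt (fun t => s t y x z) (s₂ θ y x z) θ

namespace SmoothFamily

variable {μ : Measure 𝒳} [IsFiniteMeasure μ] [NeZero μ] {O : Set V} {c C A : ℝ} {b e : 𝒴 → ℝ}
  {q : V → 𝒳 → 𝒳 → ℝ} {G : V → 𝒴 → 𝒳 → ℝ} {s : V → 𝒴 → 𝒳 → 𝒳 → V →L[ℝ] ℝ}
  {s₂ : V → 𝒴 → 𝒳 → 𝒳 → V →L[ℝ] V →L[ℝ] ℝ} {θ : V}

lemma smoothWeights_of (h : SmoothFamily O c C A b e q G s s₂) (n : ℕ) (y : ℕ → 𝒴) (x : 𝒳)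
    (h1 : ∀ θ ∈ O, ∀ z, HasFDerivAt (fun t => lik μ (q t) (G t) n (seqShift y) z)
      (lik μ (q θ) (G θ) n (seqShift y) z • score μ (q θ) (G θ) (s θ) n (seqShift y) z) θ)
    (h2 : ∀ θ ∈ O, ∀ z, HasFDerivAt (fun t => score μ (q t) (G t) (s t) n (seqShift y) z)
      (hess μ (formTensor V) (q θ) (G θ) (s θ) (s₂ θ) n (seqShift y) z) θ) :
    SmoothWeights O (C * A * (C * A * μ.real univ) ^ n)
      (b (y 0) + scoreBound b n (seqShift y)) (e (y 0) + hessBound b e n (seqShift y))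
      (fun t z => q t x z * (G t (y 0) z * lik μ (q t) (G t) n (seqShift y) z))
      (fun t z => s t (y 0) x z + score μ (q t) (G t) (s t) n (seqShift y) z)
      (fun t z => s₂ t (y 0) x z +
        hess μ (formTensor V) (q t) (G t) (s t) (s₂ t) n (seqShift y) z) where
  isOpen := h.isOpen
  weight t ht := ((h.mixing t ht).weight x).mul
    (isWeight_emission_lik (h.mixing t ht) (h.emission t ht) n y)
  le t ht z := by
    have : Nonempty 𝒳 := ⟨x⟩
    have hG := h.emission t ht
    have hq := h.mixing t ht
    have hl := lik_pos_and_le (μ := μ) hq hG n (seqShift y) z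
    have hA : 0 < A := (hG.pos (y 0) z).trans_le (hG.le (y 0) z)
    rw [← mul_assoc]
    exact mul_le_mul (mul_le_mul (hq.upper x z) (hG.le _ z) (hG.pos _ z).le hq.upper_pos.le)
      hl.2 hl.1.le (mul_pos hq.upper_pos hA).le
  meas t ht := (((h.isScore t ht).bddMeas (y 0) x).add
    (bddMeas_score (h.mixing t ht) (h.emission t ht) (h.isScore t ht) n _)).meas
  bound t ht z := (norm_add_le _ _).trans (add_le_add ((h.isScore t ht).le _ _ _)
    (norm_score_le (h.mixing t ht) (h.emission t ht) (h.isScore t ht) n _ _))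
  meas₂ t ht := (((h.isScore₂ t ht).bddMeas (y 0) x).add
    (bddMeas_hess isTensor_formTensor (h.mixing t ht) (h.emission t ht) (h.isScore t ht)
      (h.isScore₂ t ht) n _)).meas
  bound₂ t ht z := (norm_add_le _ _).trans (add_le_add ((h.isScore₂ t ht).le _ _ _)
    (norm_hess_le isTensor_formTensor (h.mixing t ht) (h.emission t ht) (h.isScore t ht)
      (h.isScore₂ t ht) n _ _))
  deriv t ht z := by
    have := (h.deriv t ht (y 0) x z).mul (h1 t ht z)
    simp only [← mul_assoc]
    refine this.congr_fderiv ?_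
    ext v
    simp
    ring
  deriv₂ t ht z := (h.deriv₂ t ht _ _ _).add (h2 t ht z)

lemma hasFDerivAt_lik_and_score (h : SmoothFamily O c C A b e q G s s₂) (n : ℕ) (y : ℕ → 𝒴) :
    ∀ θ ∈ O, ∀ x, HasFDerivAt (fun t => lik μ (q t) (G t) n y x)
        (lik μ (q θ) (G θ) n y x • score μ (q θ) (G θ) (s θ) n y x) θ ∧
      HasFDerivAt (fun t => score μ (q t) (G t) (s t) n y x)
        (hess μ (formTensor V) (q θ) (G θ) (s θ) (s₂ θ) n y x) θ := by
  induction n generalizing y with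
  | zero =>
    intro θ _ x
    simp only [lik, score, hess, smul_zero]
    exact ⟨hasFDerivAt_const _ _, hasFDerivAt_const _ _⟩
  | succ n ih =>
    intro θ hθ x
    have hw := h.smoothWeights_of n y x (fun t ht z => (ih _ t ht z).1)
      (fun t ht z => (ih _ t ht z).2)
    exact ⟨hw.hasFDerivAt_integral hθ, hw.hasFDerivAt_wavg hθ⟩

lemma hasFDerivAt_log_lik (h : SmoothFamily O c C A b e q G s s₂) (n : ℕ) (y : ℕ → 𝒴)
    (hθ : θ ∈ O) (x : 𝒳) :
    HasFDerivAt (fun t => Real.log (lik μ (q t) (G t) n y x))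
      (score μ (q θ) (G θ) (s θ) n y x) θ := by
  have hp := (lik_pos_and_le (μ := μ) (h.mixing θ hθ) (h.emission θ hθ) n y x).1
  have := (h.hasFDerivAt_lik_and_score (μ := μ) n y θ hθ x).1.log hp.ne'
  rwa [smul_smul, inv_mul_cancel₀ hp.ne', one_smul] at this

lemma hasFDerivAt_score (h : SmoothFamily O c C A b e q G s s₂) (n : ℕ) (y : ℕ → 𝒴)
    (hθ : θ ∈ O) (x : 𝒳) :
    HasFDerivAt (fun t => score μ (q t) (G t) (s t) n y x)
        (hess μ (formTensor V) (q θ) (G θ) (s θ) (s₂ θ) n y x) θ :=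
  (h.hasFDerivAt_lik_and_score n y θ hθ x).2

end SmoothFamily

end Differentiation

section Convergence

variable {Z : Type*} [MeasurableSpace Z] {μ : Measure Z} [IsFiniteMeasure μ] [NeZero μ]
  {F : Type*} [NormedAddCommGroup F] [NormedSpace ℝ F] [CompleteSpace F]
  {F₂ : Type*} [NormedAddCommGroup F₂] [NormedSpace ℝ F₂] [CompleteSpace F₂]
  {B : F →L[ℝ] F →L[ℝ] F₂}
  {ι : Type*} {l : Filter ι} [l.IsCountablyGenerated]

lemma tendsto_integral_of_bddMeas {f : ι → Z → F} {f₀ : Z → F} {K : ℝ} (hf : ∀ k, BddMeas (f k))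
    (hK : ∀ k z, ‖f k z‖ ≤ K) (hl : ∀ z, Tendsto (fun k => f k z) l (𝓝 (f₀ z))) :
    Tendsto (fun k => ∫ z, f k z ∂μ) l (𝓝 (∫ z, f₀ z ∂μ)) :=
  tendsto_integral_filter_of_dominated_convergence (fun _ => K)
    (Eventually.of_forall fun k => (hf k).meas.aestronglyMeasurable)
    (Eventually.of_forall fun k => ae_of_all _ (hK k)) (integrable_const _) (ae_of_all _ hl)

lemma tendsto_wavg {a : ι → Z → ℝ} {a₀ : Z → ℝ} {f : ι → Z → F} {f₀ : Z → F} {A K : ℝ}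
    (ha : ∀ k, IsWeight (a k)) (ha₀ : IsWeight a₀) (hA : ∀ k z, a k z ≤ A)
    (hf : ∀ k, BddMeas (f k)) (hK : ∀ k z, ‖f k z‖ ≤ K)
    (hla : ∀ z, Tendsto (fun k => a k z) l (𝓝 (a₀ z)))
    (hlf : ∀ z, Tendsto (fun k => f k z) l (𝓝 (f₀ z))) :
    Tendsto (fun k => wavg μ (a k) (f k)) l (𝓝 (wavg μ a₀ f₀)) := by
  have hA' (k) (z) : ‖a k z‖ ≤ A := by rw [Real.norm_of_nonneg ((ha k).pos z).le]; exact hA k z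
  refine Tendsto.smul (Tendsto.inv₀ ?_ ha₀.integral_pos.ne') ?_
  · exact tendsto_integral_of_bddMeas (fun k => (ha k).toBddMeas) hA' hla
  · refine tendsto_integral_of_bddMeas (K := A * K) (fun k => (ha k).toBddMeas.smul (hf k))
      (fun k z => ?_) (fun z => (hla z).smul (hlf z))
    rw [norm_smul]
    exact mul_le_mul (hA' k z) (hK k z) (norm_nonneg _) ((norm_nonneg _).trans (hA' k z))

lemma tendsto_wcov (hB : IsTensor B) {a : ι → Z → ℝ} {a₀ : Z → ℝ} {f : ι → Z → F} {f₀ : Z → F}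
    {A K : ℝ} (ha : ∀ k, IsWeight (a k)) (ha₀ : IsWeight a₀) (hA : ∀ k z, a k z ≤ A)
    (hf : ∀ k, BddMeas (f k)) (hK : ∀ k z, ‖f k z‖ ≤ K)
    (hla : ∀ z, Tendsto (fun k => a k z) l (𝓝 (a₀ z)))
    (hlf : ∀ z, Tendsto (fun k => f k z) l (𝓝 (f₀ z))) :
    Tendsto (fun k => wcov μ B (a k) (f k)) l (𝓝 (wcov μ B a₀ f₀)) := by
  have hBc (f g : ι → F) (f₀ g₀ : F) (hf : Tendsto f l (𝓝 f₀)) (hg : Tendsto g l (𝓝 g₀)) :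
      Tendsto (fun k => B (f k) (g k)) l (𝓝 (B f₀ g₀)) :=
    (B.continuous₂.tendsto (f₀, g₀)).comp (hf.prodMk_nhds hg)
  have h1 := tendsto_wavg (μ := μ) ha ha₀ hA hf hK hla hlf
  exact (tendsto_wavg (μ := μ) ha ha₀ hA (fun k => (hf k).tensor hB (hf k))
    (fun k z => hB.norm_sq_le (hK k z)) hla
    (fun z => hBc _ _ _ _ (hlf z) (hlf z))).sub (hBc _ _ _ _ h1 h1)

variable {𝒳 𝒴 : Type*} [MeasurableSpace 𝒳] [MeasurableSpace 𝒴]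
  {μ : Measure 𝒳} [IsFiniteMeasure μ] [NeZero μ] {c C A : ℝ} {b e : 𝒴 → ℝ}
  {q : ι → 𝒳 → 𝒳 → ℝ} {G : ι → 𝒴 → 𝒳 → ℝ} {s : ι → 𝒴 → 𝒳 → 𝒳 → F}
  {s₂ : ι → 𝒴 → 𝒳 → 𝒳 → F₂}
  {q₀ : 𝒳 → 𝒳 → ℝ} {G₀ : 𝒴 → 𝒳 → ℝ} {s₀ : 𝒴 → 𝒳 → 𝒳 → F} {s₂₀ : 𝒴 → 𝒳 → 𝒳 → F₂}

lemma lik_weight_le {q : 𝒳 → 𝒳 → ℝ} {G : 𝒴 → 𝒳 → ℝ} (hq : IsMixing c C q)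
    (hG : IsEmission A G) (n : ℕ) (y : ℕ → 𝒴) (x z : 𝒳) :
    q x z * (G (y 0) z * lik μ q G n (seqShift y) z) ≤ C * A * (C * A * μ.real univ) ^ n := by
  have : Nonempty 𝒳 := ⟨x⟩
  have hl := lik_pos_and_le (μ := μ) hq hG n (seqShift y) z
  have hA : 0 < A := (hG.pos (y 0) z).trans_le (hG.le (y 0) z)
  rw [← mul_assoc]
  exact mul_le_mul (mul_le_mul (hq.upper x z) (hG.le _ z) (hG.pos _ z).le hq.upper_pos.le)
    hl.2 hl.1.le (mul_pos hq.upper_pos hA).le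

lemma tendsto_lik (hq : ∀ k, IsMixing c C (q k)) (hG : ∀ k, IsEmission A (G k))
    (hlq : ∀ x z, Tendsto (fun k => q k x z) l (𝓝 (q₀ x z)))
    (hlG : ∀ y z, Tendsto (fun k => G k y z) l (𝓝 (G₀ y z))) (n : ℕ) (y : ℕ → 𝒴) (x : 𝒳) :
    Tendsto (fun k => lik μ (q k) (G k) n y x) l (𝓝 (lik μ q₀ G₀ n y x)) := by
  induction n generalizing y x with
  | zero => exact tendsto_const_nhds
  | succ n ih =>
    have w (k) := ((hq k).weight x).mul (isWeight_emission_lik (μ := μ) (hq k) (hG k) n y)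
    refine tendsto_integral_of_bddMeas (K := C * A * (C * A * μ.real univ) ^ n)
      (fun k => (w k).toBddMeas) (fun k z => ?_)
      (fun z => (hlq x z).mul ((hlG (y 0) z).mul (ih _ z)))
    rw [Real.norm_of_nonneg ((w k).pos z).le]
    exact lik_weight_le (hq k) (hG k) n y x z

lemma tendsto_score (hq : ∀ k, IsMixing c C (q k)) (hG : ∀ k, IsEmission A (G k))
    (hs : ∀ k, IsScore b (s k)) (hq₀ : IsMixing c C q₀) (hG₀ : IsEmission A G₀)
    (hlq : ∀ x z, Tendsto (fun k => q k x z) l (𝓝 (q₀ x z)))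
    (hlG : ∀ y z, Tendsto (fun k => G k y z) l (𝓝 (G₀ y z)))
    (hls : ∀ y x z, Tendsto (fun k => s k y x z) l (𝓝 (s₀ y x z)))
    (n : ℕ) (y : ℕ → 𝒴) (x : 𝒳) :
    Tendsto (fun k => score μ (q k) (G k) (s k) n y x) l (𝓝 (score μ q₀ G₀ s₀ n y x)) := by
  induction n generalizing y x with
  | zero => exact tendsto_const_nhds
  | succ n ih =>
    refine tendsto_wavg (A := C * A * (C * A * μ.real univ) ^ n)
      (K := b (y 0) + scoreBound b n (seqShift y))
      (fun k => ((hq k).weight x).mul (isWeight_emission_lik (μ := μ) (hq k) (hG k) n y))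
      ((hq₀.weight x).mul (isWeight_emission_lik hq₀ hG₀ n y))
      (fun k z => lik_weight_le (hq k) (hG k) n y x z)
      (fun k => ((hs k).bddMeas _ _).add (bddMeas_score (hq k) (hG k) (hs k) n _))
      (fun k z => (norm_add_le _ _).trans (add_le_add ((hs k).le _ _ _)
        (norm_score_le (hq k) (hG k) (hs k) n _ _)))
      (fun z => (hlq x z).mul ((hlG (y 0) z).mul (tendsto_lik hq hG hlq hlG n _ z)))
      (fun z => (hls _ _ _).add (ih _ z))

lemma tendsto_hess (hB : IsTensor B) (hq : ∀ k, IsMixing c C (q k))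
    (hG : ∀ k, IsEmission A (G k))
    (hs : ∀ k, IsScore b (s k)) (hs₂ : ∀ k, IsScore e (s₂ k))
    (hq₀ : IsMixing c C q₀) (hG₀ : IsEmission A G₀)
    (hlq : ∀ x z, Tendsto (fun k => q k x z) l (𝓝 (q₀ x z)))
    (hlG : ∀ y z, Tendsto (fun k => G k y z) l (𝓝 (G₀ y z)))
    (hls : ∀ y x z, Tendsto (fun k => s k y x z) l (𝓝 (s₀ y x z)))
    (hls₂ : ∀ y x z, Tendsto (fun k => s₂ k y x z) l (𝓝 (s₂₀ y x z)))
    (n : ℕ) (y : ℕ → 𝒴) (x : 𝒳) :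
    Tendsto (fun k => hess μ B (q k) (G k) (s k) (s₂ k) n y x) l
      (𝓝 (hess μ B q₀ G₀ s₀ s₂₀ n y x)) := by
  induction n generalizing y x with
  | zero => exact tendsto_const_nhds
  | succ n ih =>
    have w (k) := ((hq k).weight x).mul (isWeight_emission_lik (μ := μ) (hq k) (hG k) n y)
    have w₀ := (hq₀.weight x).mul (isWeight_emission_lik (μ := μ) hq₀ hG₀ n y)
    have lw (z) := (hlq x z).mul ((hlG (y 0) z).mul (tendsto_lik (μ := μ) hq hG hlq hlG n
      (seqShift y) z))
    have lf (z) := (hls (y 0) x z).add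
      (tendsto_score (μ := μ) hq hG hs hq₀ hG₀ hlq hlG hls n (seqShift y) z)
    have mf (k) := ((hs k).bddMeas (y 0) x).add
      (bddMeas_score (μ := μ) (hq k) (hG k) (hs k) n (seqShift y))
    have bf (k z) : ‖s k (y 0) x z + score μ (q k) (G k) (s k) n (seqShift y) z‖ ≤
        b (y 0) + scoreBound b n (seqShift y) :=
      (norm_add_le _ _).trans (add_le_add ((hs k).le _ _ _)
        (norm_score_le (hq k) (hG k) (hs k) n _ _))
    refine Tendsto.add ?_ (tendsto_wcov hB w w₀ (fun k z => lik_weight_le (hq k) (hG k) n y x z)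
      mf bf lw lf)
    refine tendsto_wavg w w₀ (fun k z => lik_weight_le (hq k) (hG k) n y x z)
      (K := e (y 0) + hessBound b e n (seqShift y))
      (fun k => ((hs₂ k).bddMeas _ _).add (bddMeas_hess hB (hq k) (hG k) (hs k) (hs₂ k) n _))
      (fun k z => (norm_add_le _ _).trans (add_le_add ((hs₂ k).le _ _ _)
        (norm_hess_le hB (hq k) (hG k) (hs k) (hs₂ k) n _ _))) lw
      (fun z => (hls₂ _ _ _).add (ih _ z))

end Convergence


section Rates

variable {𝒴 : Type*} [MeasurableSpace 𝒴] {Q : Measure (ℕ → 𝒴)} {κ : ℝ}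
  {X X' : ℕ → (ℕ → 𝒴) → ℝ}

/-- Nonnegative functions with means of order `κⁿ`. -/
structure MeanRate (Q : Measure (ℕ → 𝒴)) (κ : ℝ) (X : ℕ → (ℕ → 𝒴) → ℝ) : Prop where
  meas : ∀ n, Measurable (X n)
  nonneg : ∀ n y, 0 ≤ X n y
  int : ∀ n, Integrable (X n) Q
  rate : ∃ A, ∀ n, ∫ y, X n y ∂Q ≤ A * κ ^ n

/-- Nonnegative functions with second moments of order `κⁿ`. -/
structure SqRate (Q : Measure (ℕ → 𝒴)) (κ : ℝ) (X : ℕ → (ℕ → 𝒴) → ℝ) : Prop where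
  meas : ∀ n, Measurable (X n)
  nonneg : ∀ n y, 0 ≤ X n y
  sq : MeanRate Q κ (fun n y => X n y ^ 2)

namespace MeanRate

lemma mono (h : MeanRate Q κ X) (hm : ∀ n, Measurable (X' n)) (hn : ∀ n y, 0 ≤ X' n y)
    (hle : ∀ n y, X' n y ≤ X n y) : MeanRate Q κ X' where
  meas := hm
  nonneg := hn
  int n := (h.int n).mono' (hm n).aestronglyMeasurable (ae_of_all _ fun y => by
    rw [Real.norm_of_nonneg (hn n y)]; exact hle n y)
  rate := by
    obtain ⟨A, hA⟩ := h.rate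
    refine ⟨A, fun n => (integral_mono_of_nonneg (ae_of_all _ (hn n)) (h.int n)
      (ae_of_all _ (hle n))).trans (hA n)⟩

lemma add (h : MeanRate Q κ X) (h' : MeanRate Q κ X') :
    MeanRate Q κ (fun n y => X n y + X' n y) where
  meas n := (h.meas n).add (h'.meas n)
  nonneg n y := add_nonneg (h.nonneg n y) (h'.nonneg n y)
  int n := (h.int n).add (h'.int n)
  rate := by
    obtain ⟨A, hA⟩ := h.rate
    obtain ⟨A', hA'⟩ := h'.rate
    refine ⟨A + A', fun n => ?_⟩
    rw [integral_add (h.int n) (h'.int n)]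
    linarith [hA n, hA' n]

/-- Multiplication by constants of order `λⁿ`. -/
lemma mul_rate (h : MeanRate Q 1 X) {t : ℕ → ℝ} {M : ℝ} (ht : ∀ n, 0 ≤ t n)
    (hle : ∀ n, t n ≤ M * κ ^ n) : MeanRate Q κ (fun n y => t n * X n y) where
  meas n := (h.meas n).const_mul _
  nonneg n y := mul_nonneg (ht n) (h.nonneg n y)
  int n := (h.int n).const_mul _
  rate := by
    obtain ⟨A, hA⟩ := h.rate
    refine ⟨M * A, fun n => ?_⟩
    rw [integral_const_mul]
    have h1 : ∫ y, X n y ∂Q ≤ A := by simpa using hA n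
    have h0 : 0 ≤ ∫ y, X n y ∂Q := integral_nonneg (h.nonneg n)
    calc t n * ∫ y, X n y ∂Q ≤ M * κ ^ n * A :=
          mul_le_mul (hle n) h1 h0 ((ht n).trans (hle n))
      _ = M * A * κ ^ n := by ring

lemma const_mul (h : MeanRate Q κ X) {t : ℝ} (ht : 0 ≤ t) :
    MeanRate Q κ (fun n y => t * X n y) where
  meas n := (h.meas n).const_mul _
  nonneg n y := mul_nonneg ht (h.nonneg n y)
  int n := (h.int n).const_mul _
  rate := by
    obtain ⟨A, hA⟩ := h.rate
    refine ⟨t * A, fun n => ?_⟩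
    rw [integral_const_mul, mul_assoc]
    exact mul_le_mul_of_nonneg_left (hA n) ht

lemma comp_seqShift (h : MeanRate Q κ X) (hS : MeasurePreserving seqShift Q Q) :
    MeanRate Q κ (fun n y => X n (seqShift y)) where
  meas n := (h.meas n).comp measurable_seqShift
  nonneg n y := h.nonneg n _
  int n := hS.integrable_comp_of_integrable (h.int n)
  rate := by
    obtain ⟨A, hA⟩ := h.rate
    refine ⟨A, fun n => ?_⟩
    have := integral_map (μ := Q) (φ := seqShift) hS.measurable.aemeasurable
      (f := X n) (by rw [hS.map_eq]; exact (h.meas n).aestronglyMeasurable)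
    rw [hS.map_eq] at this
    rw [← this]
    exact hA n

lemma shiftSum {α : ℝ} {X0 : (ℕ → 𝒴) → ℝ} (hS : MeasurePreserving seqShift Q Q)
    (h : MeanRate Q κ X) (hα : 0 ≤ α) (hακ : α < κ)
    (m0 : Measurable X0) (n0 : ∀ y, 0 ≤ X0 y) (i0 : Integrable X0 Q) :
    MeanRate Q κ (shiftSum α X0 X) := by
  have hκ : 0 < κ := hα.trans_lt hακ
  have hm := measurable_shiftSum (α := α) m0 h.meas
  have hstep (n : ℕ) (hi : Integrable (_root_.shiftSum α X0 X n) Q) :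
      Integrable (_root_.shiftSum α X0 X (n + 1)) Q ∧
      ∫ y, _root_.shiftSum α X0 X (n + 1) y ∂Q =
        ∫ y, X n y ∂Q + α * ∫ y, _root_.shiftSum α X0 X n y ∂Q := by
    have hi' : Integrable (fun y => α * _root_.shiftSum α X0 X n (seqShift y)) Q :=
      (hS.integrable_comp_of_integrable hi).const_mul α
    refine ⟨(h.int n).add hi', ?_⟩
    have := integral_map (μ := Q) (φ := seqShift) hS.measurable.aemeasurable
      (f := _root_.shiftSum α X0 X n) (by rw [hS.map_eq]; exact (hm n).aestronglyMeasurable)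
    rw [hS.map_eq] at this
    rw [this, ← integral_const_mul, ← integral_add (h.int n) hi']
    rfl
  have hi (n : ℕ) : Integrable (_root_.shiftSum α X0 X n) Q := by
    induction n with
    | zero => exact i0
    | succ n ih => exact (hstep n ih).1
  obtain ⟨A, hA⟩ := h.rate
  refine ⟨hm, shiftSum_nonneg hα n0 h.nonneg, hi, ∫ y, X0 y ∂Q + max A 0 / (κ - α), fun n => ?_⟩
  have hd : 0 < κ - α := sub_pos.2 hακ
  induction n with
  | zero =>
    have : 0 ≤ max A 0 / (κ - α) := div_nonneg (le_max_right _ _) hd.le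
    simpa [_root_.shiftSum] using this
  | succ n ih =>
    rw [(hstep n (hi n)).2]
    have h1 : ∫ y, X n y ∂Q ≤ max A 0 * κ ^ n :=
      (hA n).trans (mul_le_mul_of_nonneg_right (le_max_left _ _) (pow_pos hκ n).le)
    have h2 := mul_le_mul_of_nonneg_left ih hα
    have h3 : 0 ≤ ∫ y, X0 y ∂Q := integral_nonneg n0
    have h4 : (κ - α) * (max A 0 / (κ - α)) = max A 0 := mul_div_cancel₀ _ hd.ne'
    have h5 : 0 ≤ (κ - α) * ∫ y, X0 y ∂Q := mul_nonneg hd.le h3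
    have h6 : max A 0 + α * (∫ y, X0 y ∂Q + max A 0 / (κ - α)) ≤
        κ * (∫ y, X0 y ∂Q + max A 0 / (κ - α)) := by linarith
    have h7 := mul_le_mul_of_nonneg_right h6 (pow_pos hκ n).le
    rw [pow_succ]
    linarith

lemma of_fst {f : 𝒴 → ℝ} (hf : Measurable f) (h0 : ∀ y, 0 ≤ f y)
    (hi : Integrable (fun y : ℕ → 𝒴 => f (y 0)) Q) : MeanRate Q 1 (fun _ y => f (y 0)) where
  meas _ := hf.comp (measurable_pi_apply 0)
  nonneg _ y := h0 _
  int _ := hi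
  rate := ⟨∫ y, f (y 0) ∂Q, fun n => by simp⟩

end MeanRate

namespace SqRate

lemma add (h : SqRate Q κ X) (h' : SqRate Q κ X') : SqRate Q κ (fun n y => X n y + X' n y) where
  meas n := (h.meas n).add (h'.meas n)
  nonneg n y := add_nonneg (h.nonneg n y) (h'.nonneg n y)
  sq := ((h.sq.const_mul two_pos.le).add (h'.sq.const_mul two_pos.le)).mono
    (fun n => ((h.meas n).add (h'.meas n)).pow_const 2) (fun _ _ => sq_nonneg _)
    fun n y => by nlinarith [sq_nonneg (X n y - X' n y)]

lemma const_mul (h : SqRate Q κ X) {t : ℝ} (ht : 0 ≤ t) :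
    SqRate Q κ (fun n y => t * X n y) where
  meas n := (h.meas n).const_mul _
  nonneg n y := mul_nonneg ht (h.nonneg n y)
  sq := by
    simp only [mul_pow]
    exact h.sq.const_mul (sq_nonneg t)

lemma comp_seqShift (h : SqRate Q κ X) (hS : MeasurePreserving seqShift Q Q) :
    SqRate Q κ (fun n y => X n (seqShift y)) where
  meas n := (h.meas n).comp measurable_seqShift
  nonneg n y := h.nonneg n _
  sq := h.sq.comp_seqShift hS

lemma mul_rate (h : SqRate Q 1 X) {t : ℕ → ℝ} {M : ℝ} (ht : ∀ n, 0 ≤ t n)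
    (hle : ∀ n, t n ≤ M * κ ^ n) : SqRate Q (κ ^ 2) (fun n y => t n * X n y) where
  meas n := (h.meas n).const_mul _
  nonneg n y := mul_nonneg (ht n) (h.nonneg n y)
  sq := by
    simp only [mul_pow]
    refine h.sq.mul_rate (M := M ^ 2) (fun n => sq_nonneg _) fun n => ?_
    calc t n ^ 2 ≤ (M * κ ^ n) ^ 2 := pow_le_pow_left₀ (ht n) (hle n) 2
      _ = M ^ 2 * (κ ^ 2) ^ n := by ring

/-- Products of functions of bounded second moments and of functions with decaying ones. -/
lemma mul (h : SqRate Q 1 X) (h' : SqRate Q (κ ^ 2) X') (hκ : 0 < κ) :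
    MeanRate Q κ (fun n y => X n y * X' n y) where
  meas n := (h.meas n).mul (h'.meas n)
  nonneg n y := mul_nonneg (h.nonneg n y) (h'.nonneg n y)
  int n := ((h.sq.int n).add (h'.sq.int n)).mono' ((h.meas n).mul (h'.meas n)).aestronglyMeasurable
    (ae_of_all _ fun y => by
      rw [Real.norm_of_nonneg (mul_nonneg (h.nonneg n y) (h'.nonneg n y))]
      simp only [Pi.add_apply]
      nlinarith [sq_nonneg (X n y - X' n y), sq_nonneg (X n y), sq_nonneg (X' n y)])
  rate := by
    obtain ⟨A, hA⟩ := h.sq.rate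
    obtain ⟨A', hA'⟩ := h'.sq.rate
    refine ⟨A + A', fun n => ?_⟩
    have hp := pow_pos hκ n
    have hle : ∫ y, X n y * X' n y ∂Q ≤
        ∫ y, (κ ^ n * X n y ^ 2 + (κ ^ n)⁻¹ * X' n y ^ 2) ∂Q := by
      refine integral_mono_of_nonneg
        (ae_of_all _ fun y => mul_nonneg (h.nonneg n y) (h'.nonneg n y))
        (((h.sq.int n).const_mul _).add ((h'.sq.int n).const_mul _)) (ae_of_all _ fun y => ?_)
      have e : κ ^ n * X n y ^ 2 + (κ ^ n)⁻¹ * X' n y ^ 2 - X n y * X' n y =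
          (κ ^ n)⁻¹ * ((κ ^ n * X n y - X' n y / 2) ^ 2 + 3 / 4 * X' n y ^ 2) := by
        field_simp; ring
      have : 0 ≤ (κ ^ n)⁻¹ * ((κ ^ n * X n y - X' n y / 2) ^ 2 + 3 / 4 * X' n y ^ 2) := by
        positivity
      simp only
      linarith
    rw [integral_add ((h.sq.int n).const_mul _) ((h'.sq.int n).const_mul _), integral_const_mul,
      integral_const_mul] at hle
    refine hle.trans ?_
    have h1 : ∫ y, X n y ^ 2 ∂Q ≤ A := by simpa using hA n
    have h2 := mul_le_mul_of_nonneg_left h1 hp.le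
    have h3 := mul_le_mul_of_nonneg_left (hA' n) (inv_pos.2 hp).le
    have h4 : (κ ^ n)⁻¹ * (A' * (κ ^ 2) ^ n) = A' * κ ^ n := by
      rw [← pow_mul, mul_comm 2 n, pow_mul]; field_simp
    linarith

lemma meanRate [IsProbabilityMeasure Q] (h : SqRate Q (κ ^ 2) X) (hκ : 0 < κ) :
    MeanRate Q κ X := by
  have h1 : SqRate Q 1 (fun (_ : ℕ) (_ : ℕ → 𝒴) => (1 : ℝ)) :=
    ⟨fun _ => measurable_const, fun _ _ => zero_le_one, fun _ => measurable_const,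
      fun _ _ => by norm_num, fun _ => by simp, 1, fun n => by simp⟩
  simpa using h1.mul h hκ

lemma shiftSum {α : ℝ} {X0 : (ℕ → 𝒴) → ℝ} (hS : MeasurePreserving seqShift Q Q)
    (h : SqRate Q κ X) (hα : 0 ≤ α) (hα1 : α < 1) (hακ : α < κ)
    (m0 : Measurable X0) (n0 : ∀ y, 0 ≤ X0 y) (i0 : Integrable (fun y => X0 y ^ 2) Q) :
    SqRate Q κ (shiftSum α X0 X) := by
  have hm := measurable_shiftSum (α := α) m0 h.meas
  have h1 : 0 < 1 - α := by linarith
  refine ⟨hm, shiftSum_nonneg hα n0 h.nonneg, ?_⟩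
  refine ((h.sq.const_mul (t := (1 - α)⁻¹) (by positivity)).shiftSum hS hα hακ (m0.pow_const 2)
    (fun _ => sq_nonneg _) i0).mono (fun n => (hm n).pow_const 2) (fun _ _ => sq_nonneg _) ?_
  intro n
  induction n with
  | zero => intro y; exact le_rfl
  | succ n ih =>
    intro y
    have h2 := mul_le_mul_of_nonneg_left (ih (seqShift y)) hα
    simp only [_root_.shiftSum]
    refine le_trans ?_ (add_le_add_right h2 _)
    set u := X n y
    set v := _root_.shiftSum α X0 X n (seqShift y)
    have e : (1 - α)⁻¹ * u ^ 2 + α * v ^ 2 - (u + α * v) ^ 2 =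
        (1 - α)⁻¹ * (α * (u - (1 - α) * v) ^ 2) := by
      field_simp; ring
    have : 0 ≤ (1 - α)⁻¹ * (α * (u - (1 - α) * v) ^ 2) := by positivity
    linarith

lemma of_fst {f : 𝒴 → ℝ} (hf : Measurable f) (h0 : ∀ y, 0 ≤ f y)
    (hi : Integrable (fun y : ℕ → 𝒴 => f (y 0) ^ 2) Q) : SqRate Q 1 (fun _ y => f (y 0)) :=
  ⟨fun _ => hf.comp (measurable_pi_apply 0), fun _ _ => h0 _,
    MeanRate.of_fst (hf.pow_const 2) (fun _ => sq_nonneg _) hi⟩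

end SqRate

/-! ### Moments of the bounds for scores and second derivatives -/

/-- Moment conditions on the bounds `b`, `e` for the first and second derivatives. -/
structure Moments (Q : Measure (ℕ → 𝒴)) (b e : 𝒴 → ℝ) : Prop where
  meas : Measurable b
  nonneg : ∀ y, 0 ≤ b y
  int : Integrable (fun y : ℕ → 𝒴 => b (y 0) ^ 2) Q
  meas₂ : Measurable e
  nonneg₂ : ∀ y, 0 ≤ e y
  int₂ : Integrable (fun y : ℕ → 𝒴 => e (y 0)) Q

variable [IsProbabilityMeasure Q] {b e : 𝒴 → ℝ} {c C : ℝ}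

namespace Moments

lemma sqRate_b (h : Moments Q b e) : SqRate Q 1 (fun _ y => b (y 0)) :=
  SqRate.of_fst h.meas h.nonneg h.int

lemma meanRate_e (h : Moments Q b e) : MeanRate Q 1 (fun _ y => e (y 0)) :=
  MeanRate.of_fst h.meas₂ h.nonneg₂ h.int₂

lemma scoreOsc {ρ : ℝ} (h : Moments Q b e) (hS : MeasurePreserving seqShift Q Q) (hρ : 0 ≤ ρ)
    (hρ1 : ρ < 1) : SqRate Q 1 (scoreOsc ρ b) :=
  SqRate.shiftSum hS (h.sqRate_b.const_mul two_pos.le) hρ hρ1 hρ1 measurable_const (fun _ => le_rfl)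
    (by simp)

lemma scoreOsc_succ {ρ : ℝ} (h : Moments Q b e) (hS : MeasurePreserving seqShift Q Q) (hρ : 0 ≤ ρ)
    (hρ1 : ρ < 1) : SqRate Q 1 (fun n => _root_.scoreOsc ρ b (n + 1)) :=
  (h.sqRate_b.const_mul two_pos.le).add
    (((h.scoreOsc hS hρ hρ1).comp_seqShift hS).const_mul hρ)

lemma hessOsc {ρ : ℝ} (h : Moments Q b e) (hS : MeasurePreserving seqShift Q Q) (hρ : 0 ≤ ρ)
    (hρ1 : ρ < 1) : MeanRate Q 1 (hessOsc ρ b e) :=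
  MeanRate.shiftSum hS ((h.meanRate_e.const_mul two_pos.le).add
    ((h.sqRate_b.add ((h.scoreOsc hS hρ hρ1).comp_seqShift hS)).sq.const_mul (by norm_num)))
    hρ hρ1 measurable_const (fun _ => le_rfl) (by simp)

variable {κ : ℝ}

lemma scoreForget (h : Moments Q b e) (hS : MeasurePreserving seqShift Q Q)
    (hρ : 0 ≤ 1 - c / C) (hc : 0 ≤ C / c - 1) (hκ : 0 < κ) (hκ1 : κ < 1)
    (hρκ : 1 - c / C < κ ^ 2) : SqRate Q (κ ^ 2) (scoreForget c C b) := by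
  have hκ2 : κ ^ 2 < 1 := by nlinarith
  have hρ1 : 1 - c / C < 1 := hρκ.trans hκ2
  refine SqRate.shiftSum hS (SqRate.const_mul (SqRate.mul_rate (M := C / c - 1)
    ((h.sqRate_b.const_mul two_pos.le).add ((h.scoreOsc hS hρ hρ1).comp_seqShift hS))
    (fun n => mul_nonneg (pow_nonneg hρ n) hc) (fun n => ?_)) two_pos.le) hρ hρ1 hρκ
    ((h.meas.comp (measurable_pi_apply 0)).const_mul 2)
    (fun y => mul_nonneg two_pos.le (h.nonneg _)) ?_
  · rw [mul_comm]
    exact mul_le_mul_of_nonneg_left (pow_le_pow_left₀ hρ (by nlinarith) n) hc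
  · simp only [mul_pow]
    exact h.int.const_mul _

lemma horizonRate_le (hρ : 0 ≤ 1 - c / C) (hc : 0 ≤ C / c - 1) (hκ : 0 < κ) (hκ1 : κ < 1)
    (hρκ : 1 - c / C < κ ^ 2) (n : ℕ) : horizonRate c C n ≤ (C / c - 1) * κ ^ n := by
  rw [horizonRate, mul_comm]
  exact mul_le_mul_of_nonneg_left (pow_le_pow_left₀ hρ (by nlinarith) n) hc

lemma hessForgetStep (h : Moments Q b e) (hS : MeasurePreserving seqShift Q Q)
    (hρ : 0 ≤ 1 - c / C) (hc : 0 ≤ C / c - 1) (hκ : 0 < κ) (hκ1 : κ < 1)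
    (hρκ : 1 - c / C < κ ^ 2) : MeanRate Q κ (hessForgetStep c C b e) := by
  have hκ2 : κ ^ 2 < 1 := by nlinarith
  have hρ1 : 1 - c / C < 1 := hρκ.trans hκ2
  have hr (n) : 0 ≤ horizonRate c C n := mul_nonneg (pow_nonneg hρ n) hc
  have hle := horizonRate_le hρ hc hκ hκ1 hρκ
  have hB := h.sqRate_b.add ((h.scoreOsc_succ hS hρ hρ1).comp_seqShift hS)
  have h1 := ((h.meanRate_e.const_mul two_pos.le).add
    ((h.hessOsc hS hρ hρ1).comp_seqShift hS)).mul_rate hr hle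
  have h2 := (hB.const_mul (t := 4) (by norm_num)).mul
    ((h.scoreForget hS hρ hc hκ hκ1 hρκ).comp_seqShift hS) hκ
  have h3 := hB.sq.mul_rate (t := fun n => 6 * horizonRate c C n) (M := 6 * (C / c - 1)) (κ := κ)
    (fun n => mul_nonneg (by norm_num) (hr n)) (fun n => by linarith [hle n])
  exact (h1.add h2).add h3

/-- Geometric decay, in the mean, of the effect of the horizon on first and second derivatives. -/
lemma exists_rate (h : Moments Q b e) (hS : MeasurePreserving seqShift Q Q)
    (hρ : 0 ≤ 1 - c / C) (hρ1 : 1 - c / C < 1) (hc : 0 ≤ C / c - 1) :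
    ∃ κ, 0 < κ ∧ κ < 1 ∧
      MeanRate Q κ (fun n y => horizonRate c C n *
        (2 * b (y 0) + _root_.scoreOsc (1 - c / C) b n (seqShift y)) +
        _root_.scoreForget c C b n (seqShift y)) ∧
      MeanRate Q κ (fun n y => _root_.hessForgetStep c C b e n y +
        hessForget c C b e n (seqShift y)) := by
  set ρ := 1 - c / C with hρdef
  obtain ⟨κ, hκdef⟩ : ∃ κ, κ = (1 + ρ) / 2 := ⟨_, rfl⟩
  have hκ : 0 < κ := by linarith
  have hκ1 : κ < 1 := by linarith
  have hρκ : ρ < κ ^ 2 := by nlinarith [mul_pos (sub_pos.2 hρ1) (sub_pos.2 hρ1)]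
  have hρκ' : ρ < κ := by nlinarith
  refine ⟨κ, hκ, hκ1, ?_, ?_⟩
  · have h1 := MeanRate.mul_rate (Q := Q) (SqRate.meanRate (κ := 1) (by
      simpa using (h.sqRate_b.const_mul two_pos.le).add
        ((h.scoreOsc hS hρ hρ1).comp_seqShift hS)) one_pos)
      (fun n => mul_nonneg (pow_nonneg hρ n) hc) (horizonRate_le hρ hc hκ hκ1 hρκ)
    exact h1.add (((h.scoreForget hS hρ hc hκ hκ1 hρκ).meanRate hκ).comp_seqShift hS)
  · have h1 := h.hessForgetStep hS hρ hc hκ hκ1 hρκ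
    refine h1.add (MeanRate.comp_seqShift (MeanRate.shiftSum hS (h1.const_mul two_pos.le) hρ hρκ'
      (((h.meas₂.comp (measurable_pi_apply 0)).const_mul 2).add
        (((h.meas.comp (measurable_pi_apply 0)).pow_const 2).const_mul 4))
      (fun y => ?_) ((h.int₂.const_mul 2).add (h.int.const_mul 4))) hS)
    have h1 := h.nonneg₂ (y 0)
    positivity

end Moments

/-! ### The effect of perturbations -/

lemma shiftSum_smul {α t : ℝ} {Z : ℕ → (ℕ → 𝒴) → ℝ} (n : ℕ) (y : ℕ → 𝒴) :
    shiftSum α (fun _ => 0) (fun n y => t * Z n y) n y = t * shiftSum α (fun _ => 0) Z n y := by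
  induction n generalizing y with
  | zero => simp [shiftSum]
  | succ n ih => simp only [shiftSum, ih]; ring

lemma likPert_smul (t : ℝ) (β : 𝒴 → ℝ) (n : ℕ) (y : ℕ → 𝒴) :
    likPert c C (fun y => t * β y) n y = t * likPert c C β n y := by
  rw [likPert, likPert, ← shiftSum_smul]
  congr 1
  funext n y
  ring

lemma weightPert_smul (t : ℝ) (β : 𝒴 → ℝ) (n : ℕ) (y : ℕ → 𝒴) :
    weightPert c C (fun y => t * β y) n y = t * weightPert c C β n y := by
  rw [weightPert, weightPert, likPert_smul]; ring

lemma scorePert_smul (t : ℝ) (β σ : 𝒴 → ℝ) (n : ℕ) (y : ℕ → 𝒴) :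
    scorePert c C b (fun y => t * β y) (fun y => t * σ y) n y = t * scorePert c C b β σ n y := by
  rw [scorePert, scorePert, ← shiftSum_smul]
  congr 1
  funext n y
  rw [weightPert_smul]
  ring

lemma Moments.meanRate_pert (h : Moments Q b e) (hS : MeasurePreserving seqShift Q Q)
    (hρ : 0 ≤ 1 - c / C) (hρ1 : 1 - c / C < 1) {β σ : 𝒴 → ℝ} (hβ : Measurable β)
    (β0 : ∀ y, 0 ≤ β y) (hβi : Integrable (fun y : ℕ → 𝒴 => β (y 0) ^ 2) Q) (hσ : Measurable σ)
    (σ0 : ∀ y, 0 ≤ σ y) (hσi : Integrable (fun y : ℕ → 𝒴 => σ (y 0)) Q) :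
    MeanRate Q 1 (fun n y => weightPert c C β n y *
      (2 * b (y 0) + _root_.scoreOsc (1 - c / C) b n (seqShift y)) + σ (y 0) +
        scorePert c C b β σ n (seqShift y)) := by
  have hb := (SqRate.of_fst hβ β0 hβi).const_mul (sq_nonneg (C / c))
  have hl : SqRate Q 1 (likPert c C β) :=
    SqRate.shiftSum hS hb hρ hρ1 hρ1 measurable_const (fun _ => le_rfl) (by simp)
  have hw : SqRate Q 1 (weightPert c C β) := (hl.comp_seqShift hS).add hb
  have h2 := (h.sqRate_b.const_mul two_pos.le).add ((h.scoreOsc hS hρ hρ1).comp_seqShift hS)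
  have h1 := (hw.mul (κ := 1) (by simpa using h2) one_pos).add (MeanRate.of_fst hσ σ0 hσi)
  refine h1.add (MeanRate.comp_seqShift (MeanRate.shiftSum hS (h1.const_mul two_pos.le) hρ hρ1
    measurable_const (fun _ => le_rfl) (by simp)) hS)

end Rates


section GeometricLimits

variable {E : Type*} [NormedAddCommGroup E] [CompleteSpace E]

lemma norm_sub_limUnder_le {f : ℕ → E} {A κ : ℝ} (hκ1 : κ < 1)
    (h : ∀ n, ‖f (n + 1) - f n‖ ≤ A * κ ^ n) (n : ℕ) :
    ‖f n - limUnder atTop f‖ ≤ A * κ ^ n / (1 - κ) := by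
  have h' : ∀ n, dist (f n) (f (n + 1)) ≤ A * κ ^ n := fun n => by
    rw [dist_comm, dist_eq_norm]; exact h n
  have hc := (cauchySeq_of_le_geometric κ A hκ1 h').tendsto_limUnder
  rw [← dist_eq_norm]
  exact dist_le_of_le_geometric_of_tendsto κ A hκ1 h' hc n

lemma tendsto_rate {A κ : ℝ} (hκ : 0 ≤ κ) (hκ1 : κ < 1) :
    Tendsto (fun n : ℕ => A * κ ^ n / (1 - κ)) atTop (𝓝 0) := by
  have := ((tendsto_pow_atTop_nhds_zero_of_lt_one hκ hκ1).const_mul A).div_const (1 - κ)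
  simpa using this

lemma tendsto_of_uniform_approx {ι : Type*} {l : Filter ι} {f : ι → E} {f₀ : E} {g : ℕ → ι → E}
    {g₀ : ℕ → E} {r : ℕ → ℝ} (hr : Tendsto r atTop (𝓝 0)) (h : ∀ n k, ‖g n k - f k‖ ≤ r n)
    (h₀ : ∀ n, ‖g₀ n - f₀‖ ≤ r n) (hg : ∀ n, Tendsto (g n) l (𝓝 (g₀ n))) :
    Tendsto f l (𝓝 f₀) := by
  rw [Metric.tendsto_nhds]
  intro ε hε
  obtain ⟨n, hn⟩ := (hr.eventually (gt_mem_nhds (show (0 : ℝ) < ε / 3 by positivity))).exists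
  filter_upwards [(Metric.tendsto_nhds.1 (hg n)) (ε / 3) (by positivity)] with k hk
  rw [dist_eq_norm] at hk ⊢
  have e : f k - f₀ = -(g n k - f k) + (g n k - g₀ n) + (g₀ n - f₀) := by abel
  rw [e]
  have h1 := norm_add_le (-(g n k - f k) + (g n k - g₀ n)) (g₀ n - f₀)
  have h2 := norm_add_le (-(g n k - f k)) (g n k - g₀ n)
  rw [norm_neg] at h2
  linarith [h n k, h₀ n]

end GeometricLimits

section MeanIncrements

variable {𝒳 𝒴 : Type*} [MeasurableSpace 𝒳] [MeasurableSpace 𝒴]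
  {F : Type*} [NormedAddCommGroup F] [NormedSpace ℝ F] [CompleteSpace F]
  {F₂ : Type*} [NormedAddCommGroup F₂] [NormedSpace ℝ F₂] [CompleteSpace F₂]

/-- The contribution of the first observation to the log-likelihood. -/
def logIncr (μ : Measure 𝒳) (q : 𝒳 → 𝒳 → ℝ) (G : 𝒴 → 𝒳 → ℝ) (x : 𝒳) (n : ℕ) (y : ℕ → 𝒴) : ℝ :=
  Real.log (lik μ q G (n + 1) y x) - Real.log (lik μ q G n (seqShift y) x)

/-- The contribution of the first observation to the score. -/
def scoreIncr (μ : Measure 𝒳) (q : 𝒳 → 𝒳 → ℝ) (G : 𝒴 → 𝒳 → ℝ) (s : 𝒴 → 𝒳 → 𝒳 → F) (x : 𝒳)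
    (n : ℕ) (y : ℕ → 𝒴) : F :=
  score μ q G s (n + 1) y x - score μ q G s n (seqShift y) x

/-- The contribution of the first observation to the second derivative of the log-likelihood. -/
def hessIncr (μ : Measure 𝒳) (B : F →L[ℝ] F →L[ℝ] F₂) (q : 𝒳 → 𝒳 → ℝ) (G : 𝒴 → 𝒳 → ℝ)
    (s : 𝒴 → 𝒳 → 𝒳 → F) (s₂ : 𝒴 → 𝒳 → 𝒳 → F₂) (x : 𝒳) (n : ℕ) (y : ℕ → 𝒴) : F₂ :=
  hess μ B q G s s₂ (n + 1) y x - hess μ B q G s s₂ n (seqShift y) x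

/-- The limit of the mean contribution of an observation to the relative log-likelihood. -/
def limValue (Q : Measure (ℕ → 𝒴)) (μ : Measure 𝒳) (q : 𝒳 → 𝒳 → ℝ) (G : 𝒴 → 𝒳 → ℝ)
    (q' : 𝒳 → 𝒳 → ℝ) (G' : 𝒴 → 𝒳 → ℝ) (x : 𝒳) : ℝ :=
  limUnder atTop fun n => ∫ y, (logIncr μ q G x n y - logIncr μ q' G' x n y) ∂Q

/-- The limit of the mean contribution of an observation to the score. -/
def limScore (Q : Measure (ℕ → 𝒴)) (μ : Measure 𝒳) (q : 𝒳 → 𝒳 → ℝ) (G : 𝒴 → 𝒳 → ℝ)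
    (s : 𝒴 → 𝒳 → 𝒳 → F) (x : 𝒳) : F :=
  limUnder atTop fun n => ∫ y, scoreIncr μ q G s x n y ∂Q

/-- The limit of the mean contribution of an observation to the second derivative. -/
def limHess (Q : Measure (ℕ → 𝒴)) (μ : Measure 𝒳) (B : F →L[ℝ] F →L[ℝ] F₂) (q : 𝒳 → 𝒳 → ℝ)
    (G : 𝒴 → 𝒳 → ℝ) (s : 𝒴 → 𝒳 → 𝒳 → F) (s₂ : 𝒴 → 𝒳 → 𝒳 → F₂) (x : 𝒳) : F₂ :=
  limUnder atTop fun n => ∫ y, hessIncr μ B q G s s₂ x n y ∂Q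

variable {Q : Measure (ℕ → 𝒴)} [IsProbabilityMeasure Q] {μ : Measure 𝒳} [IsFiniteMeasure μ]
  [NeZero μ] {q q' : 𝒳 → 𝒳 → ℝ} {c C A : ℝ}
  {G G' : 𝒴 → 𝒳 → ℝ} {s s' : 𝒴 → 𝒳 → 𝒳 → F} {s₂ : 𝒴 → 𝒳 → 𝒳 → F₂} {b e η σ : 𝒴 → ℝ}
  {B : F →L[ℝ] F →L[ℝ] F₂} {x : 𝒳}

lemma measurable_lik (hq : IsMixing c C q) (hG : IsEmission A G) (n : ℕ) (x : 𝒳) :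
    Measurable fun y => lik μ q G n y x :=
  ((stronglyMeasurable_lik hq hG n).comp_measurable measurable_prodMk_right).measurable

lemma measurable_logIncr (hq : IsMixing c C q) (hG : IsEmission A G) (n : ℕ) (x : 𝒳) :
    Measurable (logIncr μ q G x n) :=
  (measurable_lik hq hG (n + 1) x).log.sub
    ((measurable_lik hq hG n x).comp measurable_seqShift).log

lemma stronglyMeasurable_scoreIncr (hq : IsMixing c C q) (hG : IsEmission A G)
    (hs : IsScore b s) (n : ℕ) (x : 𝒳) : StronglyMeasurable (scoreIncr μ q G s x n) :=
  ((stronglyMeasurable_score hq hG hs (n + 1)).comp_measurable measurable_prodMk_right).sub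
    ((stronglyMeasurable_score hq hG hs n).comp_measurable
      (measurable_seqShift.prodMk measurable_const))

lemma stronglyMeasurable_hessIncr (hq : IsMixing c C q) (hG : IsEmission A G)
    (hs : IsScore b s) (hs₂ : IsScore e s₂) (n : ℕ) (x : 𝒳) :
    StronglyMeasurable (hessIncr μ B q G s s₂ x n) :=
  ((stronglyMeasurable_hess hq hG hs hs₂ (n + 1)).comp_measurable measurable_prodMk_right).sub
    ((stronglyMeasurable_hess hq hG hs hs₂ n).comp_measurable
      (measurable_seqShift.prodMk measurable_const))

/-! ### Values -/

lemma abs_logIncr_sub_log_le (hq : IsMixing c C q) (hG : IsEmission A G) (n : ℕ) (y : ℕ → 𝒴)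
    (x : 𝒳) :
    logIncr μ q G x n y ≤ Real.log (∫ z, G (y 0) z ∂μ) + Real.log (C ^ 2 / c) ∧
      Real.log (∫ z, G (y 0) z ∂μ) + Real.log (c ^ 2 / C) ≤ logIncr μ q G x n y := by
  have : Nonempty 𝒳 := ⟨x⟩
  have hc := hq.pos
  have hC := hq.upper_pos
  have w := hG.weight (y 0)
  have hg := w.integral_pos (μ := μ)
  have ww := (hq.weight x).mul (isWeight_emission_lik (μ := μ) hq hG n y)
  have p (n : ℕ) (y : ℕ → 𝒴) (x : 𝒳) := (lik_pos_and_le (μ := μ) hq hG n y x).1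
  have up : lik μ q G (n + 1) y x ≤ C ^ 2 / c * lik μ q G n (seqShift y) x * ∫ z, G (y 0) z ∂μ := by
    refine weight_ratio_le_of_le ww.toBddMeas w.toBddMeas fun z => ?_
    have h1 := lik_le_mul (μ := μ) hq hG n (seqShift y) z x
    calc q x z * (G (y 0) z * lik μ q G n (seqShift y) z)
        ≤ C * (G (y 0) z * (C / c * lik μ q G n (seqShift y) x)) :=
          mul_le_mul (hq.upper x z) (mul_le_mul_of_nonneg_left h1 (w.pos z).le)
            (mul_pos (w.pos z) (p _ _ _)).le hC.le
      _ = _ := by ring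
  have low : c ^ 2 / C * lik μ q G n (seqShift y) x * ∫ z, G (y 0) z ∂μ ≤
      lik μ q G (n + 1) y x := by
    rw [← integral_const_mul]
    refine integral_mono (w.integrable.const_mul _) ww.integrable fun z => ?_
    have h1 := lik_le_mul (μ := μ) hq hG n (seqShift y) x z
    have h2 : c / C * lik μ q G n (seqShift y) x ≤ lik μ q G n (seqShift y) z := by
      rw [div_mul_eq_mul_div, div_le_iff₀ hC, mul_comm _ C]
      rw [div_mul_eq_mul_div, le_div_iff₀ hc] at h1
      linarith
    calc c ^ 2 / C * lik μ q G n (seqShift y) x * G (y 0) z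
        = c * (G (y 0) z * (c / C * lik μ q G n (seqShift y) x)) := by ring
      _ ≤ q x z * (G (y 0) z * lik μ q G n (seqShift y) z) :=
          mul_le_mul (hq.lower x z) (mul_le_mul_of_nonneg_left h2 (w.pos z).le)
            (mul_pos (w.pos z) (mul_pos (div_pos hc hC) (p _ _ _))).le
            (hc.le.trans (hq.lower x z))
  have p1 := p (n + 1) y x
  have p0 := p n (seqShift y) x
  have k1 : 0 < C ^ 2 / c := by positivity
  have k2 : 0 < c ^ 2 / C := by positivity
  have l1 := Real.log_le_log p1 up
  have l2 := Real.log_le_log (mul_pos (mul_pos k2 p0) hg) low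
  rw [Real.log_mul (mul_pos k1 p0).ne' hg.ne', Real.log_mul k1.ne' p0.ne'] at l1
  rw [Real.log_mul (mul_pos k2 p0).ne' hg.ne', Real.log_mul k2.ne' p0.ne'] at l2
  rw [logIncr]
  constructor <;> linarith

/-- If two emission densities differ by a factor in `[exp (-t), exp t]`, then the increments of the
log-likelihoods have bounded differences. -/
lemma abs_logIncr_sub_le (hq : IsMixing c C q) (hG : IsEmission A G) (hq' : IsMixing c C q')
    (hG' : IsEmission A G') (n : ℕ) (y : ℕ → 𝒴) (x : 𝒳) {t : ℝ}
    (h : ∀ z, G (y 0) z ≤ Real.exp t * G' (y 0) z) (h' : ∀ z, G' (y 0) z ≤ Real.exp t * G (y 0) z) :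
    |logIncr μ q G x n y - logIncr μ q' G' x n y| ≤ t + 3 * Real.log (C / c) := by
  have : Nonempty 𝒳 := ⟨x⟩
  have hc := hq.pos
  have hC := hq.upper_pos
  obtain ⟨u, v⟩ := abs_logIncr_sub_log_le (μ := μ) hq hG n y x
  obtain ⟨u', v'⟩ := abs_logIncr_sub_log_le (μ := μ) hq' hG' n y x
  have g := (hG.weight (y 0)).integral_pos (μ := μ)
  have g' := (hG'.weight (y 0)).integral_pos (μ := μ)
  have i1 := Real.log_le_log g
    (weight_ratio_le_of_le (μ := μ) (hG.weight (y 0)).toBddMeas (hG'.weight (y 0)).toBddMeas h)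
  have i2 := Real.log_le_log g'
    (weight_ratio_le_of_le (μ := μ) (hG'.weight (y 0)).toBddMeas (hG.weight (y 0)).toBddMeas h')
  rw [Real.log_mul (Real.exp_pos _).ne' g'.ne', Real.log_exp] at i1
  rw [Real.log_mul (Real.exp_pos _).ne' g.ne', Real.log_exp] at i2
  rw [Real.log_div (by positivity) hc.ne', Real.log_pow] at u u'
  rw [Real.log_div (by positivity) hC.ne', Real.log_pow] at v v'
  rw [Real.log_div hC.ne' hc.ne', abs_le]
  push_cast at *
  constructor <;> linarith

/-- A common integrable bound for the differences of the increments of two log-likelihoods. -/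
def IncrBound (μ : Measure 𝒳) (q q' : 𝒳 → 𝒳 → ℝ) (G G' : 𝒴 → 𝒳 → ℝ) (x : 𝒳) (Φ : 𝒴 → ℝ) : Prop :=
  ∀ n y, |logIncr μ q G x n y - logIncr μ q' G' x n y| ≤ Φ (y 0)

variable {Φ : 𝒴 → ℝ}

lemma IncrBound.integrable (h : IncrBound μ q q' G G' x Φ) (hq : IsMixing c C q)
    (hG : IsEmission A G) (hq' : IsMixing c C q') (hG' : IsEmission A G')
    (hΦ : Integrable (fun y : ℕ → 𝒴 => Φ (y 0)) Q) (n : ℕ) :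
    Integrable (fun y => logIncr μ q G x n y - logIncr μ q' G' x n y) Q :=
  hΦ.mono' ((measurable_logIncr hq hG n x).sub (measurable_logIncr hq' hG' n x)).aestronglyMeasurable
    (ae_of_all _ fun y => h n y)

lemma IncrBound.abs_mean_sub_limValue_le (h : IncrBound μ q q' G G' x Φ) (hq : IsMixing c C q)
    (hG : IsEmission A G) (hq' : IsMixing c C q') (hG' : IsEmission A G')
    (hΦ : Integrable (fun y : ℕ → 𝒴 => Φ (y 0)) Q) (n : ℕ) :
    |∫ y, (logIncr μ q G x n y - logIncr μ q' G' x n y) ∂Q - limValue Q μ q G q' G' x| ≤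
      2 * (C / c - 1) * (1 - c / C) ^ n / (1 - (1 - c / C)) := by
  have : Nonempty 𝒳 := ⟨x⟩
  refine norm_sub_limUnder_le hq.rho_lt_one
    (f := fun n => ∫ y, (logIncr μ q G x n y - logIncr μ q' G' x n y) ∂Q) (fun n => ?_) n
  rw [← integral_sub (h.integrable hq hG hq' hG' hΦ (n + 1)) (h.integrable hq hG hq' hG' hΦ n)]
  refine (norm_integral_le_of_norm_le_const (C := 2 * horizonRate c C n)
    (ae_of_all _ fun y => ?_)).trans (le_of_eq ?_)
  · have h1 := abs_log_incr_sub_le (μ := μ) hq hG n y x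
    have h2 := abs_log_incr_sub_le (μ := μ) hq' hG' n y x
    rw [Real.norm_eq_abs]
    simp only [logIncr]
    rw [abs_le] at h1 h2 ⊢
    constructor <;> linarith
  · rw [probReal_univ, horizonRate]; ring

/-! ### First and second derivatives -/

lemma scoreIncr_integrable (hq : IsMixing c C q) (hG : IsEmission A G) (hs : IsScore b s)
    (hM : Moments Q b e) (hS : MeasurePreserving seqShift Q Q) (n : ℕ) :
    Integrable (fun y : ℕ → 𝒴 => b (y 0) + scoreOsc (1 - c / C) b n (seqShift y)) Q ∧
    Integrable (scoreIncr μ q G s x n) Q := by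
  have : Nonempty 𝒳 := ⟨x⟩
  have h1 := SqRate.meanRate (Q := Q) (κ := 1) (by
      simpa using hM.sqRate_b.add ((hM.scoreOsc hS hq.rho_nonneg hq.rho_lt_one).comp_seqShift hS))
      one_pos
  exact ⟨h1.int n, (h1.int n).mono' (stronglyMeasurable_scoreIncr hq hG hs n x).aestronglyMeasurable
    (ae_of_all _ fun y => norm_score_incr_le hq hG hs n y x)⟩

lemma hessIncr_integrable (hB : IsTensor B) (hq : IsMixing c C q) (hG : IsEmission A G)
    (hs : IsScore b s) (hs₂ : IsScore e s₂)
    (hM : Moments Q b e) (hS : MeasurePreserving seqShift Q Q) (n : ℕ) :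
    Integrable (fun y : ℕ → 𝒴 => e (y 0) + hessOsc (1 - c / C) b e n (seqShift y) +
        2 * (b (y 0) + scoreOsc (1 - c / C) b n (seqShift y)) ^ 2) Q ∧
    Integrable (hessIncr μ B q G s s₂ x n) Q := by
  have : Nonempty 𝒳 := ⟨x⟩
  have h1 := (hM.meanRate_e.add ((hM.hessOsc hS hq.rho_nonneg hq.rho_lt_one).comp_seqShift hS)).add
    ((hM.sqRate_b.add
      ((hM.scoreOsc hS hq.rho_nonneg hq.rho_lt_one).comp_seqShift hS)).sq.const_mul two_pos.le)
  exact ⟨h1.int n, (h1.int n).mono'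
    (stronglyMeasurable_hessIncr hq hG hs hs₂ n x).aestronglyMeasurable
    (ae_of_all _ fun y => norm_hess_incr_le hB hq hG hs hs₂ n y x)⟩

/-- `K κⁿ` bounds the mean effect of the horizon on first and second derivatives. -/
structure ForgetRate (Q : Measure (ℕ → 𝒴)) (c C : ℝ) (b e : 𝒴 → ℝ) (κ K : ℝ) : Prop where
  pos : 0 < κ
  lt_one : κ < 1
  int : ∀ n, Integrable (fun y : ℕ → 𝒴 => horizonRate c C n *
        (2 * b (y 0) + scoreOsc (1 - c / C) b n (seqShift y)) +
        scoreForget c C b n (seqShift y)) Q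
  le : ∀ n, ∫ y, (horizonRate c C n *
        (2 * b (y 0) + scoreOsc (1 - c / C) b n (seqShift y)) +
        scoreForget c C b n (seqShift y)) ∂Q ≤ K * κ ^ n
  int₂ : ∀ n, Integrable (fun y : ℕ → 𝒴 => hessForgetStep c C b e n y +
        hessForget c C b e n (seqShift y)) Q
  le₂ : ∀ n, ∫ y, (hessForgetStep c C b e n y +
        hessForget c C b e n (seqShift y)) ∂Q ≤ K * κ ^ n

lemma Moments.exists_forgetRate (hM : Moments Q b e) (hS : MeasurePreserving seqShift Q Q)
    (hq : IsMixing c C q) [Nonempty 𝒳] : ∃ κ K, ForgetRate Q c C b e κ K := by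
  obtain ⟨κ, h0, h1, r1, r2⟩ := hM.exists_rate hS hq.rho_nonneg hq.rho_lt_one
    (sub_nonneg.2 ((one_le_div hq.pos).2 hq.le))
  obtain ⟨K, hK⟩ := r1.rate
  obtain ⟨K', hK'⟩ := r2.rate
  exact ⟨κ, max K K', h0, h1, r1.int, fun n => (hK n).trans
    (mul_le_mul_of_nonneg_right (le_max_left _ _) (pow_pos h0 n).le), r2.int, fun n =>
    (hK' n).trans (mul_le_mul_of_nonneg_right (le_max_right _ _) (pow_pos h0 n).le)⟩

variable {κ K : ℝ}

lemma ForgetRate.norm_mean_sub_limScore_le (hR : ForgetRate Q c C b e κ K) (hq : IsMixing c C q)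
    (hG : IsEmission A G) (hs : IsScore b s) (hM : Moments Q b e)
    (hS : MeasurePreserving seqShift Q Q) (n : ℕ) :
    ‖∫ y, scoreIncr μ q G s x n y ∂Q - limScore Q μ q G s x‖ ≤ K * κ ^ n / (1 - κ) := by
  refine norm_sub_limUnder_le hR.lt_one
    (f := fun n => ∫ y, scoreIncr μ q G s x n y ∂Q) (fun n => ?_) n
  rw [← integral_sub (scoreIncr_integrable hq hG hs hM hS (n + 1)).2
    (scoreIncr_integrable hq hG hs hM hS n).2]
  exact (norm_integral_le_of_norm_le (hR.int n) (ae_of_all _ fun y =>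
    norm_score_incr_forget hq hG hs n y x)).trans (hR.le n)

lemma ForgetRate.norm_mean_sub_limHess_le (hR : ForgetRate Q c C b e κ K) (hB : IsTensor B)
    (hq : IsMixing c C q)
    (hG : IsEmission A G) (hs : IsScore b s) (hs₂ : IsScore e s₂) (hM : Moments Q b e)
    (hS : MeasurePreserving seqShift Q Q) (n : ℕ) :
    ‖∫ y, hessIncr μ B q G s s₂ x n y ∂Q - limHess Q μ B q G s s₂ x‖ ≤
      K * κ ^ n / (1 - κ) := by
  refine norm_sub_limUnder_le hR.lt_one
    (f := fun n => ∫ y, hessIncr μ B q G s s₂ x n y ∂Q) (fun n => ?_) n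
  rw [← integral_sub (hessIncr_integrable hB hq hG hs hs₂ hM hS (n + 1)).2
    (hessIncr_integrable hB hq hG hs hs₂ hM hS n).2]
  exact (norm_integral_le_of_norm_le (hR.int₂ n) (ae_of_all _ fun y =>
    norm_hess_incr_forget hB hq hG hs hs₂ n y x)).trans (hR.le₂ n)

/-- First order perturbations of the emission densities change the limit score by the same
order. -/
lemma norm_limScore_sub_le (hR : ForgetRate Q c C b e κ K) (hq : IsMixing c C q)
    (hG : IsEmission A G) (hG' : IsEmission A G') (hs : IsScore b s) (hs' : IsScore b s')
    (hM : Moments Q b e) (hS : MeasurePreserving seqShift Q Q) {β : 𝒴 → ℝ} {t K' : ℝ}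
    (ht : 0 ≤ t) (hβ : ∀ y, 0 ≤ β y)
    (h : ∀ y, t * β y < 1 → RatioBound (G y) (G' y) (t * β y))
    (hσ : ∀ y x z, ‖s' y x z - s y x z‖ ≤ t * σ y)
    (hint : ∀ n, Integrable (fun y => weightPert c C β n y *
      (2 * b (y 0) + scoreOsc (1 - c / C) b n (seqShift y)) + σ (y 0) +
        scorePert c C b β σ n (seqShift y)) Q)
    (hK' : ∀ n, ∫ y, (weightPert c C β n y *
      (2 * b (y 0) + scoreOsc (1 - c / C) b n (seqShift y)) + σ (y 0) +
        scorePert c C b β σ n (seqShift y)) ∂Q ≤ K') :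
    ‖limScore Q μ q G' s' x - limScore Q μ q G s x‖ ≤ t * K' := by
  have h1 (n : ℕ) : ‖∫ y, scoreIncr μ q G' s' x n y ∂Q - ∫ y, scoreIncr μ q G s x n y ∂Q‖ ≤
      t * K' := by
    rw [← integral_sub (scoreIncr_integrable hq hG' hs' hM hS n).2
      (scoreIncr_integrable hq hG hs hM hS n).2]
    refine (norm_integral_le_of_norm_le ((hint n).const_mul t) (ae_of_all _ fun y => ?_)).trans ?_
    · have := norm_score_incr_pert (μ := μ) hq hG hG' hs hs' (fun y => mul_nonneg ht (hβ y)) h hσ n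
        y x
      rw [weightPert_smul, scorePert_smul] at this
      refine this.trans (le_of_eq ?_)
      ring
    · rw [integral_const_mul]
      exact mul_le_mul_of_nonneg_left (hK' n) ht
  have t1 : Tendsto (fun n => ∫ y, scoreIncr μ q G' s' x n y ∂Q) atTop
      (𝓝 (limScore Q μ q G' s' x)) :=
    tendsto_iff_norm_sub_tendsto_zero.2 (squeeze_zero (fun _ => norm_nonneg _)
      (hR.norm_mean_sub_limScore_le hq hG' hs' hM hS) (tendsto_rate hR.pos.le hR.lt_one))
  have t2 : Tendsto (fun n => ∫ y, scoreIncr μ q G s x n y ∂Q) atTop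
      (𝓝 (limScore Q μ q G s x)) :=
    tendsto_iff_norm_sub_tendsto_zero.2 (squeeze_zero (fun _ => norm_nonneg _)
      (hR.norm_mean_sub_limScore_le hq hG hs hM hS) (tendsto_rate hR.pos.le hR.lt_one))
  exact le_of_tendsto (t1.sub t2).norm (Eventually.of_forall h1)

end MeanIncrements

/-! ### Differentiability of the limit surface -/

section Surface

variable {𝒳 𝒴 : Type*} [MeasurableSpace 𝒳] [MeasurableSpace 𝒴]
  {V : Type*} [NormedAddCommGroup V] [NormedSpace ℝ V]
  {Q : Measure (ℕ → 𝒴)} [IsProbabilityMeasure Q] {μ : Measure 𝒳} [IsFiniteMeasure μ] [NeZero μ]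
  {O : Set V} {c C A κ K : ℝ} {b e Φ : 𝒴 → ℝ}
  {q : V → 𝒳 → 𝒳 → ℝ} {G : V → 𝒴 → 𝒳 → ℝ} {s : V → 𝒴 → 𝒳 → 𝒳 → V →L[ℝ] ℝ}
  {s₂ : V → 𝒴 → 𝒳 → 𝒳 → V →L[ℝ] V →L[ℝ] ℝ} {q' : 𝒳 → 𝒳 → ℝ} {G' : 𝒴 → 𝒳 → ℝ} {θ : V} {x : 𝒳}

namespace SmoothFamily

lemma hasFDerivAt_mean_logIncr (h : SmoothFamily O c C A b e q G s s₂) (hq' : IsMixing c C q')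
    (hG' : IsEmission A G') (hM : Moments Q b e) (hS : MeasurePreserving seqShift Q Q)
    (hΦ : Integrable (fun y : ℕ → 𝒴 => Φ (y 0)) Q)
    (hb : ∀ t ∈ O, IncrBound μ (q t) q' (G t) G' x Φ) (hθ : θ ∈ O) (n : ℕ) :
    HasFDerivAt (fun t => ∫ y, (logIncr μ (q t) (G t) x n y - logIncr μ q' G' x n y) ∂Q)
      (∫ y, scoreIncr μ (q θ) (G θ) (s θ) x n y ∂Q) θ := by
  have hi (t) (ht : t ∈ O) :=
    (hb t ht).integrable (h.mixing t ht) (h.emission t ht) hq' hG' hΦ n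
  refine hasFDerivAt_integral_of_dominated_of_fderiv_le (𝕜 := ℝ) (s := O)
    (F' := fun t y => scoreIncr μ (q t) (G t) (s t) x n y)
    (h.isOpen.mem_nhds hθ) ?_ (hi θ hθ)
    (stronglyMeasurable_scoreIncr (h.mixing θ hθ) (h.emission θ hθ) (h.isScore θ hθ) n
      x).aestronglyMeasurable
    (ae_of_all _ fun y t ht =>
      norm_score_incr_le (h.mixing t ht) (h.emission t ht) (h.isScore t ht) n y x)
    (scoreIncr_integrable (μ := μ) (x := x) (h.mixing θ hθ) (h.emission θ hθ) (h.isScore θ hθ) hM hS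
      n).1
    (ae_of_all _ fun y t ht => ((h.hasFDerivAt_log_lik (n + 1) y ht x).sub
      (h.hasFDerivAt_log_lik n (seqShift y) ht x)).sub_const _)
  filter_upwards [h.isOpen.mem_nhds hθ] with t ht using (hi t ht).aestronglyMeasurable

lemma hasFDerivAt_mean_scoreIncr (h : SmoothFamily O c C A b e q G s s₂)
    (hM : Moments Q b e) (hS : MeasurePreserving seqShift Q Q) (hθ : θ ∈ O) (n : ℕ) :
    HasFDerivAt (fun t => ∫ y, scoreIncr μ (q t) (G t) (s t) x n y ∂Q)
      (∫ y, hessIncr μ (formTensor V) (q θ) (G θ) (s θ) (s₂ θ) x n y ∂Q) θ := by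
  have hi (t) (ht : t ∈ O) :=
    (scoreIncr_integrable (μ := μ) (x := x) (h.mixing t ht) (h.emission t ht) (h.isScore t ht) hM hS
      n).2
  refine hasFDerivAt_integral_of_dominated_of_fderiv_le (𝕜 := ℝ) (s := O)
    (F' := fun t y => hessIncr μ (formTensor V) (q t) (G t) (s t) (s₂ t) x n y)
    (h.isOpen.mem_nhds hθ) ?_ (hi θ hθ)
    (stronglyMeasurable_hessIncr (h.mixing θ hθ) (h.emission θ hθ) (h.isScore θ hθ)
      (h.isScore₂ θ hθ) n x).aestronglyMeasurable
    (ae_of_all _ fun y t ht => norm_hess_incr_le isTensor_formTensor (h.mixing t ht)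
      (h.emission t ht) (h.isScore t ht) (h.isScore₂ t ht) n y x)
    (hessIncr_integrable (μ := μ) (x := x) isTensor_formTensor (h.mixing θ hθ) (h.emission θ hθ)
      (h.isScore θ hθ) (h.isScore₂ θ hθ) hM hS n).1
    (ae_of_all _ fun y t ht => ((h.hasFDerivAt_score (n + 1) y ht x).sub
      (h.hasFDerivAt_score n (seqShift y) ht x)))
  filter_upwards [h.isOpen.mem_nhds hθ] with t ht using (hi t ht).aestronglyMeasurable

lemma tendstoUniformlyOn_of_rate {E : Type*} [NormedAddCommGroup E] {f : ℕ → V → E} {g : V → E}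
    (h0 : 0 ≤ κ) (h1 : κ < 1) (h : ∀ n, ∀ t ∈ O, ‖f n t - g t‖ ≤ K * κ ^ n / (1 - κ)) :
    TendstoUniformlyOn f g atTop O := by
  rw [Metric.tendstoUniformlyOn_iff]
  intro ε hε
  filter_upwards [(tendsto_rate (A := K) h0 h1).eventually (gt_mem_nhds hε)] with n hn t ht
  rw [dist_comm, dist_eq_norm]
  exact (h n t ht).trans_lt hn

lemma hasFDerivAt_limValue (h : SmoothFamily O c C A b e q G s s₂) (hq' : IsMixing c C q')
    (hG' : IsEmission A G') (hM : Moments Q b e) (hS : MeasurePreserving seqShift Q Q)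
    (hR : ForgetRate Q c C b e κ K) (hΦ : Integrable (fun y : ℕ → 𝒴 => Φ (y 0)) Q)
    (hb : ∀ t ∈ O, IncrBound μ (q t) q' (G t) G' x Φ) (hθ : θ ∈ O) :
    HasFDerivAt (fun t => limValue Q μ (q t) (G t) q' G' x)
      (limScore Q μ (q θ) (G θ) (s θ) x) θ := by
  have : Nonempty 𝒳 := ⟨x⟩
  refine hasFDerivAt_of_tendstoUniformlyOn
    (f' := fun n t => ∫ y, scoreIncr μ (q t) (G t) (s t) x n y ∂Q)
    (g' := fun t => limScore Q μ (q t) (G t) (s t) x) h.isOpen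
    (tendstoUniformlyOn_of_rate hR.pos.le hR.lt_one fun n t ht => hR.norm_mean_sub_limScore_le
      (h.mixing t ht) (h.emission t ht) (h.isScore t ht) hM hS n)
    (fun n t ht => h.hasFDerivAt_mean_logIncr hq' hG' hM hS hΦ hb ht n) (fun t ht => ?_) hθ
  refine tendsto_iff_norm_sub_tendsto_zero.2 (squeeze_zero (fun _ => norm_nonneg _)
    (fun n => (hb t ht).abs_mean_sub_limValue_le (h.mixing t ht) (h.emission t ht) hq' hG' hΦ n)
    (tendsto_rate hq'.rho_nonneg hq'.rho_lt_one))

lemma hasFDerivAt_limScore (h : SmoothFamily O c C A b e q G s s₂)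
    (hM : Moments Q b e) (hS : MeasurePreserving seqShift Q Q)
    (hR : ForgetRate Q c C b e κ K) (hθ : θ ∈ O) :
    HasFDerivAt (fun t => limScore Q μ (q t) (G t) (s t) x)
      (limHess Q μ (formTensor V) (q θ) (G θ) (s θ) (s₂ θ) x) θ := by
  refine hasFDerivAt_of_tendstoUniformlyOn
    (f' := fun n t => ∫ y, hessIncr μ (formTensor V) (q t) (G t) (s t) (s₂ t) x n y ∂Q)
    (g' := fun t => limHess Q μ (formTensor V) (q t) (G t) (s t) (s₂ t) x) h.isOpen
    (tendstoUniformlyOn_of_rate hR.pos.le hR.lt_one fun n t ht =>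
      hR.norm_mean_sub_limHess_le isTensor_formTensor
      (h.mixing t ht) (h.emission t ht) (h.isScore t ht) (h.isScore₂ t ht) hM hS n)
    (fun n t ht => h.hasFDerivAt_mean_scoreIncr hM hS ht n) (fun t ht => ?_) hθ
  refine tendsto_iff_norm_sub_tendsto_zero.2 (squeeze_zero (fun _ => norm_nonneg _)
    (fun n => hR.norm_mean_sub_limScore_le (h.mixing t ht) (h.emission t ht) (h.isScore t ht) hM hS n)
    (tendsto_rate hR.pos.le hR.lt_one))

end SmoothFamily

end Surface

/-! ### Continuity of the limits in the densities -/

section Continuity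

variable {𝒳 𝒴 : Type*} [MeasurableSpace 𝒳] [MeasurableSpace 𝒴]
  {F : Type*} [NormedAddCommGroup F] [NormedSpace ℝ F] [CompleteSpace F]
  {F₂ : Type*} [NormedAddCommGroup F₂] [NormedSpace ℝ F₂] [CompleteSpace F₂]
  {B : F →L[ℝ] F →L[ℝ] F₂}
  {ι : Type*} {l : Filter ι} [l.IsCountablyGenerated]
  {Q : Measure (ℕ → 𝒴)} [IsProbabilityMeasure Q] {μ : Measure 𝒳} [IsFiniteMeasure μ] [NeZero μ]
  {c C A κ K : ℝ} {b e Φ : 𝒴 → ℝ}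
  {q q' : ι → 𝒳 → 𝒳 → ℝ} {G G' : ι → 𝒴 → 𝒳 → ℝ} {s : ι → 𝒴 → 𝒳 → 𝒳 → F}
  {s₂ : ι → 𝒴 → 𝒳 → 𝒳 → F₂}
  {q₀ q₀' : 𝒳 → 𝒳 → ℝ} {G₀ G₀' : 𝒴 → 𝒳 → ℝ} {s₀ : 𝒴 → 𝒳 → 𝒳 → F} {s₂₀ : 𝒴 → 𝒳 → 𝒳 → F₂} {x : 𝒳}

lemma tendsto_logIncr (hq : ∀ k, IsMixing c C (q k)) (hG : ∀ k, IsEmission A (G k))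
    (hq₀ : IsMixing c C q₀) (hG₀ : IsEmission A G₀)
    (hlq : ∀ x z, Tendsto (fun k => q k x z) l (𝓝 (q₀ x z)))
    (hlG : ∀ y z, Tendsto (fun k => G k y z) l (𝓝 (G₀ y z))) (n : ℕ) (y : ℕ → 𝒴) :
    Tendsto (fun k => logIncr μ (q k) (G k) x n y) l (𝓝 (logIncr μ q₀ G₀ x n y)) :=
  ((tendsto_lik hq hG hlq hlG _ _ _).log (lik_pos_and_le hq₀ hG₀ _ _ _).1.ne').sub
    ((tendsto_lik hq hG hlq hlG _ _ _).log (lik_pos_and_le hq₀ hG₀ _ _ _).1.ne')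

lemma tendsto_limValue (hq : ∀ k, IsMixing c C (q k)) (hG : ∀ k, IsEmission A (G k))
    (hq' : ∀ k, IsMixing c C (q' k)) (hG' : ∀ k, IsEmission A (G' k))
    (hq₀ : IsMixing c C q₀) (hG₀ : IsEmission A G₀) (hq₀' : IsMixing c C q₀')
    (hG₀' : IsEmission A G₀')
    (hlq : ∀ x z, Tendsto (fun k => q k x z) l (𝓝 (q₀ x z)))
    (hlG : ∀ y z, Tendsto (fun k => G k y z) l (𝓝 (G₀ y z)))
    (hlq' : ∀ x z, Tendsto (fun k => q' k x z) l (𝓝 (q₀' x z)))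
    (hlG' : ∀ y z, Tendsto (fun k => G' k y z) l (𝓝 (G₀' y z)))
    (hΦ : Integrable (fun y : ℕ → 𝒴 => Φ (y 0)) Q)
    (hb : ∀ k, IncrBound μ (q k) (q' k) (G k) (G' k) x Φ) (hb₀ : IncrBound μ q₀ q₀' G₀ G₀' x Φ) :
    Tendsto (fun k => limValue Q μ (q k) (G k) (q' k) (G' k) x) l
      (𝓝 (limValue Q μ q₀ G₀ q₀' G₀' x)) := by
  have : Nonempty 𝒳 := ⟨x⟩
  refine tendsto_of_uniform_approx (tendsto_rate (A := 2 * (C / c - 1)) hq₀.rho_nonneg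
    hq₀.rho_lt_one)
    (fun n k => (hb k).abs_mean_sub_limValue_le (hq k) (hG k) (hq' k) (hG' k) hΦ n)
    (fun n => hb₀.abs_mean_sub_limValue_le hq₀ hG₀ hq₀' hG₀' hΦ n) fun n => ?_
  exact tendsto_integral_filter_of_dominated_convergence _
    (Eventually.of_forall fun k =>
      ((hb k).integrable (hq k) (hG k) (hq' k) (hG' k) hΦ n).aestronglyMeasurable)
    (Eventually.of_forall fun k => ae_of_all _ (hb k n)) hΦ
    (ae_of_all _ fun y => (tendsto_logIncr hq hG hq₀ hG₀ hlq hlG n y).sub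
      (tendsto_logIncr hq' hG' hq₀' hG₀' hlq' hlG' n y))

lemma tendsto_limHess (hB : IsTensor B) (hq : ∀ k, IsMixing c C (q k))
    (hG : ∀ k, IsEmission A (G k))
    (hs : ∀ k, IsScore b (s k)) (hs₂ : ∀ k, IsScore e (s₂ k))
    (hq₀ : IsMixing c C q₀) (hG₀ : IsEmission A G₀) (hs₀ : IsScore b s₀) (hs₂₀ : IsScore e s₂₀)
    (hlq : ∀ x z, Tendsto (fun k => q k x z) l (𝓝 (q₀ x z)))
    (hlG : ∀ y z, Tendsto (fun k => G k y z) l (𝓝 (G₀ y z)))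
    (hls : ∀ y x z, Tendsto (fun k => s k y x z) l (𝓝 (s₀ y x z)))
    (hls₂ : ∀ y x z, Tendsto (fun k => s₂ k y x z) l (𝓝 (s₂₀ y x z)))
    (hM : Moments Q b e) (hS : MeasurePreserving seqShift Q Q)
    (hR : ForgetRate Q c C b e κ K) :
    Tendsto (fun k => limHess Q μ B (q k) (G k) (s k) (s₂ k) x) l
      (𝓝 (limHess Q μ B q₀ G₀ s₀ s₂₀ x)) := by
  refine tendsto_of_uniform_approx (tendsto_rate (A := K) hR.pos.le hR.lt_one)
    (fun n k => hR.norm_mean_sub_limHess_le hB (hq k) (hG k) (hs k) (hs₂ k) hM hS n)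
    (fun n => hR.norm_mean_sub_limHess_le hB hq₀ hG₀ hs₀ hs₂₀ hM hS n) fun n => ?_
  exact tendsto_integral_filter_of_dominated_convergence _
    (Eventually.of_forall fun k =>
      (hessIncr_integrable hB (hq k) (hG k) (hs k) (hs₂ k) hM hS n).2.aestronglyMeasurable)
    (Eventually.of_forall fun k => ae_of_all _ fun y =>
      norm_hess_incr_le hB (hq k) (hG k) (hs k) (hs₂ k) n y x)
    (hessIncr_integrable (μ := μ) (x := x) hB hq₀ hG₀ hs₀ hs₂₀ hM hS n).1
    (ae_of_all _ fun y =>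
      (tendsto_hess hB hq hG hs hs₂ hq₀ hG₀ hlq hlG hls hls₂ (n + 1) y x).sub
        (tendsto_hess hB hq hG hs hs₂ hq₀ hG₀ hlq hlG hls hls₂ n (seqShift y) x))

end Continuity


section Sequences

/-- The sequence `z, ω 0, ω 1, …`. -/
def seqCons {α : Type*} (z : α) (ω : ℕ → α) : ℕ → α
  | 0 => z
  | k + 1 => ω k

@[simp] lemma seqCons_zero {α : Type*} (z : α) (ω : ℕ → α) : seqCons z ω 0 = z := rfl

@[simp] lemma seqCons_succ {α : Type*} (z : α) (ω : ℕ → α) (k : ℕ) :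
    seqCons z ω (k + 1) = ω k := rfl

@[simp] lemma seqShift_seqCons {α : Type*} (z : α) (ω : ℕ → α) : seqShift (seqCons z ω) = ω := rfl

lemma seqCons_comp {α β : Type*} (f : α → β) (z : α) (ω : ℕ → α) :
    (fun k => f (seqCons z ω k)) = seqCons (f z) fun k => f (ω k) := by
  funext k; cases k <;> rfl

lemma measurable_seqCons {α β : Type*} [MeasurableSpace α] [MeasurableSpace β] {f : β → α}
    {g : β → ℕ → α} (hf : Measurable f) (hg : Measurable g) :
    Measurable fun b => seqCons (f b) (g b) := by
  refine measurable_pi_iff.2 fun k => ?_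
  cases k with
  | zero => exact hf
  | succ k => exact (measurable_pi_apply k).comp hg

/-- Extension of a finite sequence by an arbitrary constant. -/
def padSeq {α : Type*} [Nonempty α] {n : ℕ} (v : Fin n → α) : ℕ → α :=
  fun k => if h : k < n then v ⟨k, h⟩ else Classical.arbitrary α

lemma padSeq_apply {α : Type*} [Nonempty α] {n : ℕ} (v : Fin n → α) {k : ℕ} (h : k < n) :
    padSeq v k = v ⟨k, h⟩ := dif_pos h

lemma padSeq_fin {α : Type*} [Nonempty α] {n : ℕ} (v : Fin n → α) (k : Fin n) :
    padSeq v k = v k := padSeq_apply v k.2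

lemma padSeq_cons {α : Type*} [Nonempty α] {n : ℕ} (z : α) (v : Fin n → α) :
    padSeq (Fin.cons z v : Fin (n + 1) → α) = seqCons z (padSeq v) := by
  funext k
  cases k with
  | zero => rw [padSeq_apply _ (Nat.succ_pos n)]; rfl
  | succ k =>
    by_cases h : k < n
    · rw [padSeq_apply _ (Nat.succ_lt_succ h), seqCons_succ, padSeq_apply _ h]; rfl
    · rw [seqCons_succ]
      simp [padSeq, h]

lemma measurable_padSeq {α : Type*} [MeasurableSpace α] [Nonempty α] (n : ℕ) :
    Measurable (padSeq : (Fin n → α) → ℕ → α) := by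
  refine measurable_pi_iff.2 fun k => ?_
  by_cases h : k < n
  · simp only [padSeq, h, dif_pos]; exact measurable_pi_apply _
  · simp only [padSeq, h, dif_neg, not_false_eq_true]; exact measurable_const

end Sequences

section PathIntegrals

universe u v

variable {𝒳 : Type v} [MeasurableSpace 𝒳] {S : Type u} [MeasurableSpace S] [Nonempty S]

/-- The integral of `F (z₀, z₁, …) T (pr zₙ₋₁)` over paths with `n` steps of weights
`w (pr zₖ₋₁) zₖ`, started from `x`. -/
def pathMean (ν : Measure S) (w : 𝒳 → S → ℝ≥0∞) (pr : S → 𝒳) :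
    ℕ → ((ℕ → S) → ℝ≥0∞) → (𝒳 → ℝ≥0∞) → 𝒳 → ℝ≥0∞
  | 0, F, T, x => F (fun _ => Classical.arbitrary S) * T x
  | n + 1, F, T, x => ∫⁻ z, w x z * pathMean ν w pr n (fun ω => F (seqCons z ω)) T (pr z) ∂ν

variable {ν : Measure S} [SigmaFinite ν] {w : 𝒳 → S → ℝ≥0∞} {pr : S → 𝒳}

lemma measurable_pathMean (hw : Measurable (Function.uncurry w)) (hpr : Measurable pr)
    {T : 𝒳 → ℝ≥0∞} (hT : Measurable T) (n : ℕ) {α : Type u} [MeasurableSpace α]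
    {F : α → (ℕ → S) → ℝ≥0∞} (hF : Measurable (Function.uncurry F)) :
    Measurable fun p : α × 𝒳 => pathMean ν w pr n (F p.1) T p.2 := by
  induction n generalizing α with
  | zero =>
    exact (hF.comp (measurable_fst.prodMk measurable_const)).mul (hT.comp measurable_snd)
  | succ n ih =>
    have h1 : Measurable (Function.uncurry fun (a : α × S) (ω : ℕ → S) => F a.1 (seqCons a.2 ω)) :=
      hF.comp ((measurable_fst.comp measurable_fst).prodMk
        (measurable_seqCons (measurable_snd.comp measurable_fst) measurable_snd))
    have h2 := ih h1
    refine Measurable.lintegral_prod_right'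
      (f := fun r : (α × 𝒳) × S => w r.1.2 r.2 *
        pathMean ν w pr n (fun ω => F r.1.1 (seqCons r.2 ω)) T (pr r.2)) ?_
    refine (hw.comp ((measurable_snd.comp measurable_fst).prodMk measurable_snd)).mul ?_
    exact h2.comp (((measurable_fst.comp measurable_fst).prodMk measurable_snd).prodMk
      (hpr.comp measurable_snd))

lemma measurable_pathMean_state (hw : Measurable (Function.uncurry w)) (hpr : Measurable pr)
    {T : 𝒳 → ℝ≥0∞} (hT : Measurable T) (n : ℕ) {F : (ℕ → S) → ℝ≥0∞} (hF : Measurable F) :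
    Measurable (pathMean ν w pr n F T) :=
  (measurable_pathMean (α := PUnit) (F := fun _ => F) hw hpr hT n (hF.comp measurable_snd)).comp
    (measurable_const (a := PUnit.unit) |>.prodMk measurable_id)

lemma measurable_pathMean_cons (hw : Measurable (Function.uncurry w)) (hpr : Measurable pr)
    {T : 𝒳 → ℝ≥0∞} (hT : Measurable T) (n : ℕ) {F : (ℕ → S) → ℝ≥0∞} (hF : Measurable F) (x : 𝒳) :
    Measurable fun z => w x z * pathMean ν w pr n (fun ω => F (seqCons z ω)) T (pr z) :=
  (hw.comp measurable_prodMk_left).mul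
    ((measurable_pathMean (F := fun z ω => F (seqCons z ω)) hw hpr hT n
      (hF.comp (measurable_seqCons measurable_fst measurable_snd))).comp
      (measurable_id.prodMk hpr))

lemma pathMean_const_mul (a : ℝ≥0∞) (ha : a ≠ ∞) (n : ℕ) (F : (ℕ → S) → ℝ≥0∞) (T : 𝒳 → ℝ≥0∞)
    (x : 𝒳) : pathMean ν w pr n (fun ω => a * F ω) T x = a * pathMean ν w pr n F T x := by
  induction n generalizing F x with
  | zero => simp only [pathMean, mul_assoc]
  | succ n ih =>
    simp only [pathMean]
    rw [← lintegral_const_mul' _ _ ha]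
    refine lintegral_congr fun z => ?_
    rw [ih]; ring

lemma pathMean_mul_const (a : ℝ≥0∞) (ha : a ≠ ∞) (n : ℕ) (F : (ℕ → S) → ℝ≥0∞) (T : 𝒳 → ℝ≥0∞)
    (x : 𝒳) : pathMean ν w pr n F (fun x => a * T x) x = a * pathMean ν w pr n F T x := by
  induction n generalizing F x with
  | zero => simp only [pathMean]; ring
  | succ n ih =>
    simp only [pathMean]
    rw [← lintegral_const_mul' _ _ ha]
    refine lintegral_congr fun z => ?_
    rw [ih]; ring

lemma pathMean_mono (n : ℕ) (F : (ℕ → S) → ℝ≥0∞) {T T' : 𝒳 → ℝ≥0∞} (h : ∀ x, T x ≤ T' x)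
    (x : 𝒳) : pathMean ν w pr n F T x ≤ pathMean ν w pr n F T' x := by
  induction n generalizing F x with
  | zero => exact mul_le_mul_right (h x) _
  | succ n ih => exact lintegral_mono fun z => mul_le_mul_right (ih _ _) _

lemma pathMean_succ_le {a : ℝ≥0∞} (ha : a ≠ ∞) {x x' : 𝒳} (h : ∀ z, w x z ≤ a * w x' z) (n : ℕ)
    (F : (ℕ → S) → ℝ≥0∞) (T : 𝒳 → ℝ≥0∞) :
    pathMean ν w pr (n + 1) F T x ≤ a * pathMean ν w pr (n + 1) F T x' := by
  simp only [pathMean]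
  rw [← lintegral_const_mul' _ _ ha]
  refine lintegral_mono fun z => ?_
  rw [← mul_assoc]
  exact mul_le_mul_left (h z) _

/-- The Markov property. -/
lemma pathMean_add (N n : ℕ) {F₁ F₂ : (ℕ → S) → ℝ≥0∞} (h : DependsOn F₁ (Iio N))
    (hF₁ : ∀ ω, F₁ ω ≠ ∞) (T : 𝒳 → ℝ≥0∞) (x : 𝒳) :
    pathMean ν w pr (N + n) (fun ω => F₁ ω * F₂ (fun k => ω (k + N))) T x =
      pathMean ν w pr N F₁ (pathMean ν w pr n F₂ T) x := by
  induction N generalizing F₁ x with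
  | zero =>
    have e : ∀ ω, F₁ ω = F₁ (fun _ => Classical.arbitrary S) := fun ω => h (by simp)
    simp only [Nat.zero_add, Nat.add_zero]
    have : (fun ω => F₁ ω * F₂ (fun k => ω k)) =
        fun ω => F₁ (fun _ => Classical.arbitrary S) * F₂ ω := by funext ω; rw [e ω]
    rw [this, pathMean_const_mul _ (hF₁ _)]
    rfl
  | succ N ih =>
    rw [Nat.add_right_comm]
    simp only [pathMean]
    refine lintegral_congr fun z => ?_
    congr 1
    exact ih (F₁ := fun ω => F₁ (seqCons z ω)) (fun ω ω' hω => h fun i hi => by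
      cases i with
      | zero => rfl
      | succ i => exact hω i (by simpa using hi)) (fun ω => hF₁ _) _

lemma prod_prevState_succ {n : ℕ} (x : 𝒳) (z : S) (v : Fin n → S) :
    ∏ k : Fin (n + 1), w (prevState x (fun j => pr ((Fin.cons z v : Fin (n + 1) → S) j)) k)
        ((Fin.cons z v : Fin (n + 1) → S) k) =
      w x z * ∏ k : Fin n, w (prevState (pr z) (fun j => pr (v j)) k) (v k) := by
  rw [Fin.prod_univ_succ]
  congr 1
  refine Finset.prod_congr rfl fun k _ => ?_
  have : prevState x (fun j => pr ((Fin.cons z v : Fin (n + 1) → S) j)) k.succ =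
      prevState (pr z) (fun j => pr (v j)) k := by
    unfold prevState
    rw [← Fin.succ_castSucc, Fin.cons_succ]
    cases n with
    | zero => exact k.elim0
    | succ n =>
      refine Fin.cases ?_ (fun i => ?_) k
      · simp
      · rw [← Fin.succ_castSucc, Fin.cons_succ, Fin.cons_succ]
  rw [this, Fin.cons_succ]

lemma measurable_prevState {n : ℕ} (k : Fin n) {β : Type*} [MeasurableSpace β] {f : β → 𝒳}
    {g : β → Fin n → 𝒳} (hf : Measurable f) (hg : Measurable g) :
    Measurable fun b => prevState (f b) (g b) k := by
  unfold prevState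
  cases n with
  | zero => exact k.elim0
  | succ n =>
    refine Fin.cases ?_ (fun i => ?_) k
    · simpa using hf
    · simp only [← Fin.succ_castSucc, Fin.cons_succ]
      exact (measurable_pi_apply _).comp hg

lemma measurable_prod_prevState (hw : Measurable (Function.uncurry w)) (hpr : Measurable pr)
    (n : ℕ) : Measurable fun p : 𝒳 × (Fin n → S) =>
      ∏ k : Fin n, w (prevState p.1 (fun j => pr (p.2 j)) k) (p.2 k) := by
  refine Finset.measurable_fun_prod _ fun k _ => ?_
  exact hw.comp ((measurable_prevState k measurable_fst (measurable_pi_iff.2 fun j =>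
    hpr.comp ((measurable_pi_apply j).comp measurable_snd))).prodMk
      ((measurable_pi_apply k).comp measurable_snd))

lemma lintegral_pi_succ (n : ℕ) {f : (Fin (n + 1) → S) → ℝ≥0∞} (hf : Measurable f) :
    ∫⁻ v, f v ∂(Measure.pi fun _ => ν) =
      ∫⁻ z, ∫⁻ v : Fin n → S, f (Fin.cons z v) ∂(Measure.pi fun _ => ν) ∂ν := by
  have h := (measurePreserving_piFinSuccAbove (fun _ : Fin (n + 1) => ν) 0).symm
  rw [← h.lintegral_comp_emb (MeasurableEquiv.measurableEmbedding _), lintegral_prod]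
  · refine lintegral_congr fun z => lintegral_congr fun v => ?_
    congr 1
    exact Fin.insertNth_zero' z v
  · exact (hf.comp (MeasurableEquiv.measurable _)).aemeasurable

lemma lintegral_pi_eq_pathMean (hw : Measurable (Function.uncurry w)) (hpr : Measurable pr)
    (n : ℕ) {F : (ℕ → S) → ℝ≥0∞} (hF : Measurable F) (x : 𝒳) :
    ∫⁻ v : Fin n → S, (∏ k : Fin n, w (prevState x (fun j => pr (v j)) k) (v k)) * F (padSeq v)
      ∂(Measure.pi fun _ => ν) = pathMean ν w pr n F 1 x := by
  induction n generalizing F x with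
  | zero =>
    rw [Measure.pi_of_empty, lintegral_dirac]
    · simp only [Finset.univ_eq_empty, Finset.prod_empty, one_mul, pathMean, Pi.one_apply, mul_one]
      rfl
  | succ n ih =>
    have m1 : Measurable fun v : Fin (n + 1) → S =>
        (∏ k, w (prevState x (fun j => pr (v j)) k) (v k)) * F (padSeq v) :=
      ((measurable_prod_prevState hw hpr (n + 1)).comp
        (measurable_const (a := x) |>.prodMk measurable_id)).mul
        (hF.comp (measurable_padSeq _))
    rw [lintegral_pi_succ n m1]
    simp only [pathMean]
    refine lintegral_congr fun z => ?_
    have hF' : Measurable fun ω => F (seqCons z ω) :=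
      hF.comp (measurable_seqCons measurable_const measurable_id)
    rw [← ih hF', ← lintegral_const_mul]
    · refine lintegral_congr fun v => ?_
      rw [prod_prevState_succ, padSeq_cons, mul_assoc]
    · exact ((measurable_prod_prevState hw hpr n).comp
        (measurable_const (a := pr z) |>.prodMk measurable_id)).mul
        (hF'.comp (measurable_padSeq _))

/-- Path integrals of products. -/
def prodMean (ν : Measure S) (w : 𝒳 → S → ℝ≥0∞) (pr : S → 𝒳) :
    ℕ → (ℕ → S → ℝ≥0∞) → 𝒳 → ℝ≥0∞
  | 0, _, _ => 1
  | n + 1, f, x => ∫⁻ z, w x z * (f 0 z * prodMean ν w pr n (seqShift f) (pr z)) ∂ν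

lemma pathMean_prod (n : ℕ) (f : ℕ → S → ℝ≥0∞) (hf : ∀ k z, f k z ≠ ∞) (x : 𝒳) :
    pathMean ν w pr n (fun ω => ∏ k ∈ Finset.range n, f k (ω k)) 1 x = prodMean ν w pr n f x := by
  induction n generalizing f x with
  | zero => simp [pathMean, prodMean]
  | succ n ih =>
    simp only [pathMean, prodMean]
    refine lintegral_congr fun z => ?_
    congr 1
    rw [← ih (seqShift f) (fun k z => hf _ _), ← pathMean_const_mul _ (hf 0 z)]
    congr 1
    funext ω
    rw [Finset.prod_range_succ', mul_comm]
    rfl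

lemma prod_range_eq_prod_fin {n : ℕ} (f : ℕ → S → ℝ≥0∞) (v : Fin n → S) :
    ∏ k ∈ Finset.range n, f k (padSeq v k) = ∏ k : Fin n, f k (v k) := by
  rw [Finset.prod_range]
  exact Finset.prod_congr rfl fun k _ => by rw [padSeq_fin]

end PathIntegrals


section ChainLaw

variable {𝒳 𝒴 : Type*} [MeasurableSpace 𝒳] [MeasurableSpace 𝒴]

/-- The density of one step of a hidden Markov model. -/
def hmmWeight (q : 𝒳 → 𝒳 → ℝ) (g : 𝒴 → 𝒳 → ℝ) (x : 𝒳) (z : 𝒳 × 𝒴) : ℝ≥0∞ :=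
  ENNReal.ofReal (q x z.1) * ENNReal.ofReal (g z.2 z.1)

lemma measurable_hmmWeight {q : 𝒳 → 𝒳 → ℝ} {g : 𝒴 → 𝒳 → ℝ} (hq : Measurable (Function.uncurry q))
    (hg : Measurable (Function.uncurry g)) : Measurable (Function.uncurry (hmmWeight q g)) :=
  (ENNReal.measurable_ofReal.comp
    (hq.comp (measurable_fst.prodMk (measurable_fst.comp measurable_snd)))).mul
  (ENNReal.measurable_ofReal.comp
    (hg.comp ((measurable_snd.comp measurable_snd).prodMk (measurable_fst.comp measurable_snd))))

variable [Nonempty (𝒳 × 𝒴)]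

/-- `W` is the law of the states and observations at the times `1, 2, …` of the stationary hidden
Markov model with invariant distribution `π`. -/
structure IsChainLaw (μ : Measure 𝒳) (ν : Measure 𝒴) (q : 𝒳 → 𝒳 → ℝ) (g : 𝒴 → 𝒳 → ℝ)
    (π : Measure 𝒳) (W : Measure (ℕ → 𝒳 × 𝒴)) : Prop where
  law : ∀ (n : ℕ) (F : (ℕ → 𝒳 × 𝒴) → ℝ≥0∞), Measurable F → DependsOn F (Iio n) →
    ∫⁻ ω, F ω ∂W = ∫⁻ x, pathMean (μ.prod ν) (hmmWeight q g) Prod.fst n F 1 x ∂π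
  shift : MeasurePreserving seqShift W W

lemma seqShift_iterate {α : Type*} (n : ℕ) (ω : ℕ → α) : seqShift^[n] ω = fun k => ω (k + n) := by
  induction n generalizing ω with
  | zero => rfl
  | succ n ih =>
    rw [Function.iterate_succ_apply, ih]
    funext k
    rw [seqShift, Nat.add_assoc]

lemma measurePreserving_add {α : Type*} [MeasurableSpace α] {W : Measure (ℕ → α)}
    (h : MeasurePreserving seqShift W W) (n : ℕ) :
    MeasurePreserving (fun (ω : ℕ → α) k => ω (k + n)) W W := by
  have := h.iterate n
  convert this using 1
  funext ω
  exact (seqShift_iterate n ω).symm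

variable {μ : Measure 𝒳} [IsFiniteMeasure μ] [NeZero μ] {ν : Measure 𝒴} [SigmaFinite ν]
  {q : 𝒳 → 𝒳 → ℝ} {g : 𝒴 → 𝒳 → ℝ} {c C : ℝ} {π : Measure 𝒳} [IsProbabilityMeasure π]
  {W : Measure (ℕ → 𝒳 × 𝒴)}

lemma pathMean_one_succ (hq : IsMixing c C q) (hg : Measurable (Function.uncurry g))
    (hg1 : ∀ x, ∫⁻ y, ENNReal.ofReal (g y x) ∂ν = 1) {T : 𝒳 → ℝ≥0∞} (hT : Measurable T) (k : ℕ)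
    (x : 𝒳) :
    pathMean (μ.prod ν) (hmmWeight q g) Prod.fst (k + 1) (fun _ => 1) T x =
      ∫⁻ z, ENNReal.ofReal (q x z) *
        pathMean (μ.prod ν) (hmmWeight q g) Prod.fst k (fun _ => 1) T z ∂μ := by
  have hw := measurable_hmmWeight hq.meas hg
  rw [pathMean, lintegral_prod]
  · refine lintegral_congr fun z => ?_
    simp only [hmmWeight]
    have e : ∀ y, ENNReal.ofReal (q x z) * ENNReal.ofReal (g y z) *
        pathMean (μ.prod ν) (hmmWeight q g) Prod.fst k (fun _ => 1) T z =
        (ENNReal.ofReal (q x z) *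
        pathMean (μ.prod ν) (hmmWeight q g) Prod.fst k (fun _ => 1) T z) *
          ENNReal.ofReal (g y z) := fun y => by ring
    simp_rw [e]
    rw [lintegral_const_mul, hg1, mul_one]
    exact ENNReal.measurable_ofReal.comp (hg.comp measurable_prodMk_right)
  · exact (measurable_pathMean_cons hw measurable_fst hT k measurable_const x).aemeasurable

lemma exists_pathMean_one (hq : IsMixing c C q) (hq1 : ∀ x, ∫⁻ z, ENNReal.ofReal (q x z) ∂μ = 1)
    (hg : Measurable (Function.uncurry g))
    (hg1 : ∀ x, ∫⁻ y, ENNReal.ofReal (g y x) ∂ν = 1) {u : 𝒳 → ℝ} (hu : BddMeas u)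
    (hu0 : ∀ x, 0 ≤ u x) {o : ℝ} (ho : ∀ x x', |u x - u x'| ≤ o) (k : ℕ) :
    ∃ v : 𝒳 → ℝ, BddMeas v ∧ (∀ x, 0 ≤ v x) ∧ (∀ x x', |v x - v x'| ≤ (1 - c / C) ^ k * o) ∧
      ∀ x, pathMean (μ.prod ν) (hmmWeight q g) Prod.fst k (fun _ => 1)
        (fun x => ENNReal.ofReal (u x)) x = ENNReal.ofReal (v x) := by
  induction k with
  | zero => exact ⟨u, hu, hu0, by simpa using ho, fun x => by simp [pathMean]⟩
  | succ k ih =>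
    obtain ⟨v, hv, hv0, hvo, hve⟩ := ih
    have h1 (x : 𝒳) : ∫ z, q x z ∂μ = 1 := by
      have : Nonempty 𝒳 := ⟨x⟩
      rw [integral_eq_lintegral_of_nonneg_ae (ae_of_all _ fun z => hq.pos.le.trans (hq.lower x z))
        (hq.weight x).meas.aestronglyMeasurable, hq1]
      rfl
    have e (x : 𝒳) : wavg μ (fun z => q x z * 1) v = ∫ z, q x z * v z ∂μ := by
      simp only [wavg, mul_one, h1, inv_one, smul_eq_mul, one_mul]
    have hmeas : StronglyMeasurable fun x => ∫ z, q x z * v z ∂μ :=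
      StronglyMeasurable.integral_prod_right' (f := fun p : 𝒳 × 𝒳 => q p.1 p.2 * v p.2)
        (hq.meas.stronglyMeasurable.mul (hv.meas.comp_measurable measurable_snd))
    have hosc (x x' : 𝒳) : |∫ z, q x z * v z ∂μ - ∫ z, q x' z * v z ∂μ| ≤
        (1 - c / C) ^ (k + 1) * o := by
      have := hq.norm_wavg_sub_le (μ := μ) IsWeight.one hv
        (o := (1 - c / C) ^ k * o) (fun z w => by rw [Real.norm_eq_abs]; exact hvo z w) x x'
      rw [e, e, Real.norm_eq_abs] at this
      refine this.trans (le_of_eq ?_)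
      ring
    have hnn (x : 𝒳) : 0 ≤ ∫ z, q x z * v z ∂μ := by
      have : Nonempty 𝒳 := ⟨x⟩
      exact integral_nonneg fun z => mul_nonneg (hq.pos.le.trans (hq.lower x z)) (hv0 z)
    refine ⟨fun x => ∫ z, q x z * v z ∂μ, ⟨hmeas, ?_⟩, hnn, hosc, fun x => ?_⟩
    · obtain ⟨K, hK⟩ := hv.bdd
      refine ⟨K, fun x => ?_⟩
      have h0 : 0 ≤ K := (norm_nonneg _).trans (hK x)
      rw [← e]
      exact norm_wavg_le ((hq.weight x).mul IsWeight.one) fun z => hK z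
    · rw [pathMean_one_succ hq hg hg1 hu.meas.measurable.ennreal_ofReal,
        ofReal_integral_eq_lintegral_ofReal ((hq.weight x).toBddMeas.mul hv).integrable
          (ae_of_all _ fun z => mul_nonneg (hq.pos.le.trans (hq.lower x z)) (hv0 z))]
      refine lintegral_congr fun z => ?_
      rw [hve, ENNReal.ofReal_mul (hq.pos.le.trans (hq.lower x z))]

namespace IsChainLaw

/-- Exponential mixing. -/
lemma lintegral_mul_le (h : IsChainLaw μ ν q g π W) (hq : IsMixing c C q)
    (hq1 : ∀ x, ∫⁻ z, ENNReal.ofReal (q x z) ∂μ = 1)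
    (hg : Measurable (Function.uncurry g)) (hg1 : ∀ x, ∫⁻ y, ENNReal.ofReal (g y x) ∂ν = 1)
    {J : ℕ} {f : (ℕ → 𝒳 × 𝒴) → ℝ≥0∞} (hf : Measurable f) (hJ : DependsOn f (Iio (J + 1)))
    (hfin : ∀ ω, f ω ≠ ∞) (hI : ∫⁻ ω, f ω ∂W ≠ ∞) (k : ℕ) :
    ∫⁻ ω, f ω * f (fun i => ω (i + k + (J + 1))) ∂W ≤
      (1 + ENNReal.ofReal ((1 - c / C) ^ k * (C / c))) * (∫⁻ ω, f ω ∂W) ^ 2 := by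
  have hne : Nonempty 𝒳 := (inferInstance : Nonempty (𝒳 × 𝒴)).map Prod.fst
  have hC := hq.upper_pos
  have hc := hq.pos
  have hr0 : 0 ≤ C / c := by positivity
  have hw := measurable_hmmWeight hq.meas hg
  set I := ∫⁻ ω, f ω ∂W with hIdef
  set E := pathMean (μ.prod ν) (hmmWeight q g) Prod.fst with hE
  have hmeas : Measurable (E (J + 1) f 1) :=
    measurable_pathMean_state hw measurable_fst measurable_const _ hf
  have hH (x x' : 𝒳) : E (J + 1) f 1 x ≤ ENNReal.ofReal (C / c) * E (J + 1) f 1 x' := by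
    refine pathMean_succ_le ENNReal.ofReal_ne_top (fun z => ?_) _ _ _
    rw [hmmWeight, hmmWeight, ← mul_assoc, ← ENNReal.ofReal_mul hr0]
    refine mul_le_mul_left (ENNReal.ofReal_le_ofReal ?_) _
    rw [div_mul_eq_mul_div, le_div_iff₀ hc]
    exact mul_le_mul (hq.upper _ _) (hq.lower _ _) hc.le hC.le
  have hIE : ∫⁻ x, E (J + 1) f 1 x ∂π = I := (h.law _ f hf hJ).symm
  have hle (x : 𝒳) : E (J + 1) f 1 x ≤ ENNReal.ofReal (C / c) * I := by
    calc E (J + 1) f 1 x = ∫⁻ _, E (J + 1) f 1 x ∂π := by simp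
      _ ≤ ∫⁻ x', ENNReal.ofReal (C / c) * E (J + 1) f 1 x' ∂π := lintegral_mono fun x' => hH x x'
      _ = _ := by rw [lintegral_const_mul _ hmeas, hIE]
  have hfinE (x : 𝒳) : E (J + 1) f 1 x ≠ ∞ :=
    ((hle x).trans_lt (ENNReal.mul_lt_top ENNReal.ofReal_lt_top hI.lt_top)).ne
  set u : 𝒳 → ℝ := fun x => (E (J + 1) f 1 x).toReal with hu
  have hub (x : 𝒳) : u x ≤ C / c * I.toReal := by
    have := ENNReal.toReal_mono (ENNReal.mul_ne_top ENNReal.ofReal_ne_top hI) (hle x)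
    rwa [ENNReal.toReal_mul, ENNReal.toReal_ofReal (by positivity)] at this
  have hu0 (x : 𝒳) : 0 ≤ u x := ENNReal.toReal_nonneg
  have hue : (fun x => ENNReal.ofReal (u x)) = E (J + 1) f 1 := by
    funext x; exact ENNReal.ofReal_toReal (hfinE x)
  obtain ⟨v, hv, hv0, hvo, hve⟩ := exists_pathMean_one (μ := μ) (ν := ν) hq hq1 hg hg1
    (u := u) ⟨hmeas.ennreal_toReal.stronglyMeasurable, C / c * I.toReal, fun x => by
      rw [Real.norm_of_nonneg (hu0 x)]; exact hub x⟩ hu0 (o := C / c * I.toReal)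
    (fun x x' => by rw [abs_le]; constructor <;> linarith [hub x, hub x', hu0 x, hu0 x']) k
  rw [hue] at hve
  have hf' : Measurable fun ω : ℕ → 𝒳 × 𝒴 => f (fun i => ω (i + k)) :=
    hf.comp (measurable_pi_iff.2 fun i => measurable_pi_apply _)
  have hsplit (x : 𝒳) : E (k + (J + 1)) (fun ω => f (fun i => ω (i + k))) 1 x =
      ENNReal.ofReal (v x) := by
    rw [← hve, ← pathMean_add k (J + 1) (F₁ := fun _ => 1) (F₂ := f) (fun _ _ _ => rfl) (by simp)]
    simp only [one_mul]
    rfl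
  have hvI : ∫⁻ x, ENNReal.ofReal (v x) ∂π = I := by
    simp_rw [← hsplit]
    rw [← h.law _ _ hf' (fun ω ω' hω => hJ fun i hi => hω _ (by simp at hi ⊢; omega))]
    exact (measurePreserving_add h.shift k).lintegral_comp hf
  have hvle (x : 𝒳) : ENNReal.ofReal (v x) ≤
      (1 + ENNReal.ofReal ((1 - c / C) ^ k * (C / c))) * I := by
    have hr := pow_nonneg hq.rho_nonneg k
    calc ENNReal.ofReal (v x) = ∫⁻ _, ENNReal.ofReal (v x) ∂π := by simp
      _ ≤ ∫⁻ x', ENNReal.ofReal (v x') + ENNReal.ofReal ((1 - c / C) ^ k * (C / c * I.toReal)) ∂π :=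
          lintegral_mono fun x' => by
            rw [← ENNReal.ofReal_add (hv0 _) (mul_nonneg hr (by positivity))]
            exact ENNReal.ofReal_le_ofReal (by linarith [(abs_le.1 (hvo x x')).2])
      _ = _ := by
          rw [lintegral_add_right _ measurable_const, hvI, lintegral_const, measure_univ, mul_one,
            ← mul_assoc, ENNReal.ofReal_mul (mul_nonneg hr (by positivity)),
            ENNReal.ofReal_toReal hI]
          ring
  have hdep : DependsOn (fun ω : ℕ → 𝒳 × 𝒴 => f ω * f (fun i => ω (i + k + (J + 1))))
      (Iio (J + 1 + (k + (J + 1)))) := by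
    intro ω ω' hω
    have e1 : f ω = f ω' := hJ fun i hi => hω i (by simp at hi ⊢; omega)
    have e2 : f (fun i => ω (i + k + (J + 1))) = f (fun i => ω' (i + k + (J + 1))) :=
      hJ fun i hi => hω _ (by simp at hi ⊢; omega)
    simp only [e1, e2]
  have hmeas2 : Measurable fun ω : ℕ → 𝒳 × 𝒴 => f ω * f (fun i => ω (i + k + (J + 1))) :=
    hf.mul (hf.comp (measurable_pi_iff.2 fun i => measurable_pi_apply _))
  rw [h.law _ _ hmeas2 hdep]
  have hmk (x : 𝒳) : E (J + 1 + (k + (J + 1)))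
      (fun ω => f ω * f (fun i => ω (i + k + (J + 1)))) 1 x ≤
        ((1 + ENNReal.ofReal ((1 - c / C) ^ k * (C / c))) * I) * E (J + 1) f 1 x := by
    rw [hE, pathMean_add (J + 1) (k + (J + 1)) (F₁ := f) (F₂ := fun ω => f (fun i => ω (i + k)))
      hJ hfin, ← pathMean_mul_const _ (ENNReal.mul_ne_top (by simp) hI)]
    refine pathMean_mono _ _ (fun z => ?_) x
    rw [← hE, hsplit]
    simpa using hvle z
  refine (lintegral_mono hmk).trans (le_of_eq ?_)
  rw [lintegral_const_mul _ hmeas, hIE]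
  ring

end IsChainLaw

end ChainLaw

section LawOfLargeNumbers

variable {Ω : Type*} [MeasurableSpace Ω] {P : Measure Ω} [IsProbabilityMeasure P]

/-- A strong law of large numbers for nonnegative variables. -/
lemma tendsto_average_of_cov_le {ξ : ℕ → Ω → ℝ} (hm : ∀ i, Measurable (ξ i))
    (h0 : ∀ i ω, 0 ≤ ξ i ω) (h2 : ∀ i, MemLp (ξ i) 2 P) {m : ℝ} (hmean : ∀ i, ∫ ω, ξ i ω ∂P = m)
    {K κ : ℝ} (hκ : 0 ≤ κ) (hκ1 : κ < 1)
    (hcov : ∀ i k, ∫ ω, ξ i ω * ξ (i + k) ω ∂P - m ^ 2 ≤ K * κ ^ k) :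
    ∀ᵐ ω ∂P, Tendsto (fun n : ℕ => (n : ℝ)⁻¹ * ∑ i ∈ Finset.range n, ξ i ω) atTop (𝓝 m) := by
  have hint (i j) : Integrable (fun ω => ξ i ω * ξ j ω) P := (h2 i).integrable_mul (h2 j)
  have hi1 (i) : Integrable (ξ i) P := (h2 i).integrable (by norm_num)
  set S : ℕ → Ω → ℝ := fun n ω => ∑ i ∈ Finset.range n, (ξ i ω - m) with hS
  have hc2 (i) : MemLp (fun ω => ξ i ω - m) 2 P := (h2 i).sub (memLp_const m)
  have hS2 (n) : MemLp (S n) 2 P := memLp_finsetSum _ fun i _ => hc2 i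
  have hcc (i k) : ∫ ω, (ξ i ω - m) * (ξ (i + k) ω - m) ∂P ≤ K * κ ^ k := by
    have e : (fun ω => (ξ i ω - m) * (ξ (i + k) ω - m)) =
        fun ω => ξ i ω * ξ (i + k) ω - (m * ξ i ω + m * ξ (i + k) ω - m ^ 2) := by
      funext ω; ring
    have a1 : Integrable (fun ω => m * ξ i ω + m * ξ (i + k) ω) P :=
      ((hi1 _).const_mul _).add ((hi1 _).const_mul _)
    have a2 : Integrable (fun ω => m * ξ i ω + m * ξ (i + k) ω - m ^ 2) P :=
      a1.sub (integrable_const _)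
    rw [e, integral_sub (hint _ _) a2, integral_sub a1 (integrable_const _), integral_add ((hi1 _).const_mul _) ((hi1 _).const_mul _),
      integral_const_mul, integral_const_mul, hmean, hmean, integral_const, probReal_univ]
    have := hcov i k
    simp only [one_smul]
    linarith
  have hK : 0 ≤ K := by
    have := hcc 0 0
    simp only [pow_zero, mul_one, Nat.add_zero] at this
    exact (integral_nonneg fun ω => mul_self_nonneg _).trans this
  have hgeo (n : ℕ) : ∑ i ∈ Finset.range n, κ ^ i ≤ (1 - κ)⁻¹ := by
    have := (summable_geometric_of_lt_one hκ hκ1).sum_le_tsum (Finset.range n)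
      (fun i _ => pow_nonneg hκ i)
    rwa [tsum_geometric_of_lt_one hκ hκ1] at this
  have hvar (n : ℕ) : ∫ ω, S n ω ^ 2 ∂P ≤ n * (2 * K * (1 - κ)⁻¹) := by
    induction n with
    | zero => simp [hS]
    | succ n ih =>
      have e : (fun ω => S (n + 1) ω ^ 2) = fun ω => S n ω ^ 2 +
          (2 * ∑ i ∈ Finset.range n, (ξ i ω - m) * (ξ n ω - m) + (ξ n ω - m) * (ξ n ω - m)) := by
        funext ω
        simp only [hS]
        rw [Finset.sum_range_succ, ← Finset.sum_mul]
        ring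
      have hcp (i j) : Integrable (fun ω => (ξ i ω - m) * (ξ j ω - m)) P :=
        (hc2 i).integrable_mul (hc2 j)
      have hsum : Integrable (fun ω => ∑ i ∈ Finset.range n, (ξ i ω - m) * (ξ n ω - m)) P :=
        integrable_finsetSum _ fun i _ => hcp i n
      have hsum' : Integrable (fun ω => 2 * ∑ i ∈ Finset.range n, (ξ i ω - m) * (ξ n ω - m) +
          (ξ n ω - m) * (ξ n ω - m)) P := (hsum.const_mul 2).add (hcp n n)
      rw [e, integral_add (hS2 n).integrable_sq hsum', integral_add (hsum.const_mul 2) (hcp n n), integral_const_mul,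
        integral_finsetSum _ fun i _ => hcp i n]
      have b1 : ∑ i ∈ Finset.range n, ∫ ω, (ξ i ω - m) * (ξ n ω - m) ∂P + K ≤ K * (1 - κ)⁻¹ := by
        calc _ ≤ ∑ i ∈ Finset.range n, K * κ ^ (n - i) + K * κ ^ (n - n) := by
              refine add_le_add (Finset.sum_le_sum fun i hi => ?_) (by simp)
              have := hcc i (n - i)
              rwa [Nat.add_sub_cancel' (Finset.mem_range.1 hi).le] at this
          _ = K * ∑ i ∈ Finset.range (n + 1), κ ^ i := by
              rw [← Finset.sum_range_succ (fun i => K * κ ^ (n - i)), ← Finset.mul_sum]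
              congr 1
              rw [← Finset.sum_range_reflect]
              refine Finset.sum_congr rfl fun i hi => ?_
              have := Finset.mem_range.1 hi
              congr 1
              omega
          _ ≤ _ := mul_le_mul_of_nonneg_left (hgeo _) hK
      have b2 := hcc n 0
      simp only [pow_zero, mul_one, Nat.add_zero] at b2
      push_cast
      nlinarith
  set D := 2 * K * (1 - κ)⁻¹
  have hD : 0 ≤ D := mul_nonneg (mul_nonneg two_pos.le hK) (inv_nonneg.2 (by linarith))
  set Z : ℕ → Ω → ℝ := fun k ω => S (k ^ 2) ω / (k : ℝ) ^ 2 with hZ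
  have hZm (k) : Measurable (Z k) :=
    (Finset.measurable_fun_sum _ fun i _ => (hm i).sub_const m).div_const _
  have hZ1 (k : ℕ) : ∫⁻ ω, ENNReal.ofReal (Z k ω ^ 2) ∂P ≤ ENNReal.ofReal (D * ((k : ℝ) ^ 2)⁻¹) := by
    have e : (fun ω => Z k ω ^ 2) = fun ω => (((k : ℝ) ^ 2) ^ 2)⁻¹ * S (k ^ 2) ω ^ 2 := by
      funext ω; simp only [hZ]; rw [div_pow]; ring
    rw [← ofReal_integral_eq_lintegral_ofReal (by
      rw [e]; exact ((hS2 _).integrable_sq).const_mul _) (ae_of_all _ fun ω => sq_nonneg _), e,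
      integral_const_mul]
    refine ENNReal.ofReal_le_ofReal ?_
    have := mul_le_mul_of_nonneg_left (hvar (k ^ 2))
      (show (0 : ℝ) ≤ (((k : ℝ) ^ 2) ^ 2)⁻¹ by positivity)
    refine this.trans (le_of_eq ?_)
    rcases eq_or_ne (k : ℝ) 0 with h | h
    · push_cast; simp [h]
    · push_cast; field_simp
  have hsum : ∑' k, ∫⁻ ω, ENNReal.ofReal (Z k ω ^ 2) ∂P ≠ ∞ := by
    refine ne_top_of_le_ne_top ?_ (ENNReal.tsum_le_tsum hZ1)
    have : Summable fun k : ℕ => D * ((k : ℝ) ^ 2)⁻¹ :=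
      (Real.summable_nat_pow_inv.2 (by norm_num)).mul_left _
    exact this.tsum_ofReal_ne_top
  rw [← lintegral_tsum fun k => ((hZm k).pow_const 2).ennreal_ofReal.aemeasurable] at hsum
  filter_upwards [ae_lt_top (Measurable.tsum fun k => ((hZm k).pow_const 2).ennreal_ofReal)
    hsum] with ω hω
  have t1 := ENNReal.tendsto_atTop_zero_of_tsum_ne_top hω.ne
  have t2 : Tendsto (fun k => Z k ω ^ 2) atTop (𝓝 0) := by
    have := (ENNReal.tendsto_toReal ENNReal.zero_ne_top).comp t1
    simpa [Function.comp_def, ENNReal.toReal_ofReal, sq_nonneg] using this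
  have t3 : Tendsto (fun k => Z k ω) atTop (𝓝 0) := by
    have := t2.sqrt
    simp only [Real.sqrt_sq_eq_abs, Real.sqrt_zero] at this
    exact (tendsto_zero_iff_abs_tendsto_zero _).2 this
  have hmono : Monotone fun n => ∑ i ∈ Finset.range n, ξ i ω := fun a b hab =>
    Finset.sum_le_sum_of_subset_of_nonneg (Finset.range_mono hab) fun i _ _ => h0 i ω
  have key := tendsto_div_of_monotone_of_exists_subseq_tendsto_div
    (fun n => ∑ i ∈ Finset.range n, ξ i ω) m hmono fun a ha => ⟨fun k => k ^ 2, ?_, ?_, ?_⟩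
  · simpa [div_eq_inv_mul] using key
  · have : Tendsto (fun k : ℕ => (1 + 1 / (k : ℝ)) ^ 2) atTop (𝓝 1) := by
      simpa using ((tendsto_one_div_atTop_nhds_zero_nat (𝕜 := ℝ)).const_add 1).pow 2
    filter_upwards [this.eventually (gt_mem_nhds ha), eventually_gt_atTop 0] with k hk hk0
    have hk0' : (0 : ℝ) < k := by exact_mod_cast hk0
    push_cast
    calc ((k : ℝ) + 1) ^ 2 = (1 + 1 / (k : ℝ)) ^ 2 * (k : ℝ) ^ 2 := by field_simp
      _ ≤ _ := mul_le_mul_of_nonneg_right hk.le (by positivity)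
  · exact tendsto_pow_atTop two_ne_zero
  · have : Tendsto (fun k => Z k ω + m) atTop (𝓝 (0 + m)) := t3.add_const m
    rw [zero_add] at this
    refine this.congr' ?_
    filter_upwards [eventually_gt_atTop 0] with k hk0
    have hk0' : (k : ℝ) ≠ 0 := by exact_mod_cast hk0.ne'
    simp only [hZ, hS]
    rw [Finset.sum_sub_distrib, Finset.sum_const, Finset.card_range]
    push_cast
    rw [nsmul_eq_mul]
    push_cast
    field_simp
    ring

end LawOfLargeNumbers


section ErgodicAverages

variable {𝒴 : Type*} [MeasurableSpace 𝒴]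

/-- Exponential mixing of a stationary law on sequences. -/
structure IsMixingLaw (κ K : ℝ) (Q : Measure (ℕ → 𝒴)) : Prop where
  shift : MeasurePreserving seqShift Q Q
  nonneg : 0 ≤ κ
  lt_one : κ < 1
  const_nonneg : 0 ≤ K
  mix : ∀ (J : ℕ) (f : (ℕ → 𝒴) → ℝ≥0∞), Measurable f → DependsOn f (Iio (J + 1)) →
    (∀ y, f y ≠ ∞) → ∫⁻ y, f y ∂Q ≠ ∞ → ∀ k,
    ∫⁻ y, f y * f (fun i => y (i + k + (J + 1))) ∂Q ≤
      (1 + ENNReal.ofReal (κ ^ k * K)) * (∫⁻ y, f y ∂Q) ^ 2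

/-- The average of `f` along the first `n` shifts of `y`. -/
def seqAverage (f : (ℕ → 𝒴) → ℝ) (n : ℕ) (y : ℕ → 𝒴) : ℝ :=
  (n : ℝ)⁻¹ * ∑ i ∈ Finset.range n, f (fun k => y (k + i))

lemma seqAverage_mono {f g : (ℕ → 𝒴) → ℝ} (h : ∀ y, f y ≤ g y) (n : ℕ) (y : ℕ → 𝒴) :
    seqAverage f n y ≤ seqAverage g n y :=
  mul_le_mul_of_nonneg_left (Finset.sum_le_sum fun _ _ => h _) (by positivity)

lemma seqAverage_sub (f g : (ℕ → 𝒴) → ℝ) (n : ℕ) (y : ℕ → 𝒴) :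
    seqAverage (fun y => f y - g y) n y = seqAverage f n y - seqAverage g n y := by
  simp only [seqAverage, Finset.sum_sub_distrib, mul_sub]

lemma abs_seqAverage_le (f : (ℕ → 𝒴) → ℝ) (n : ℕ) (y : ℕ → 𝒴) :
    |seqAverage f n y| ≤ seqAverage (fun y => |f y|) n y := by
  rw [seqAverage, abs_mul, abs_of_nonneg (by positivity : (0 : ℝ) ≤ (n : ℝ)⁻¹)]
  exact mul_le_mul_of_nonneg_left (Finset.abs_sum_le_sum_abs _ _) (by positivity)

variable {Q : Measure (ℕ → 𝒴)} [IsProbabilityMeasure Q] {κ K : ℝ}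

lemma IsMixingLaw.tendsto_seqAverage_of_nonneg (hQ : IsMixingLaw κ K Q) {J : ℕ}
    {f : (ℕ → 𝒴) → ℝ} (hf : Measurable f) (hJ : DependsOn f (Iio (J + 1))) (h0 : ∀ y, 0 ≤ f y)
    (h2 : MemLp f 2 Q) :
    ∀ᵐ y ∂Q, Tendsto (fun n => seqAverage f n y) atTop (𝓝 (∫ y, f y ∂Q)) := by
  set ξ : ℕ → (ℕ → 𝒴) → ℝ := fun i y => f (fun k => y (k + i)) with hξ
  have sh := measurePreserving_add hQ.shift
  have hm (i) : Measurable (ξ i) := hf.comp (sh i).measurable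
  have hξ2 (i) : MemLp (ξ i) 2 Q := h2.comp_measurePreserving (sh i)
  have hcomp {g : (ℕ → 𝒴) → ℝ} (hg : Measurable g) (i : ℕ) :
      ∫ y, g (fun k => y (k + i)) ∂Q = ∫ y, g y ∂Q := by
    conv_rhs => rw [← (sh i).map_eq]
    rw [integral_map (sh i).measurable.aemeasurable hg.aestronglyMeasurable]
  set m := ∫ y, f y ∂Q with hmdef
  set V := ∫ y, f y ^ 2 ∂Q with hV
  have hV0 : 0 ≤ V := integral_nonneg fun y => sq_nonneg _
  have hfi : Integrable f Q := h2.integrable (by norm_num)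
  set κ₁ := max κ (1 / 2) with hκ₁
  have k0 : 0 < κ₁ := lt_max_of_lt_right (by norm_num)
  have k1 : κ₁ < 1 := max_lt hQ.lt_one (by norm_num)
  have hK := hQ.const_nonneg
  have hL : 0 ≤ (K * m ^ 2 + V) * (κ₁ ^ (J + 1))⁻¹ := by positivity
  refine tendsto_average_of_cov_le hm (fun i y => h0 _) hξ2 (fun i => hcomp hf i)
    (K := (K * m ^ 2 + V) * (κ₁ ^ (J + 1))⁻¹) k0.le k1 fun i k => ?_
  have e1 : ∫ y, ξ i y * ξ (i + k) y ∂Q = ∫ y, f y * ξ k y ∂Q := by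
    rw [← hcomp (g := fun y => f y * ξ k y) (hf.mul (hm k)) i]
    refine integral_congr_ae (ae_of_all _ fun y => ?_)
    simp only [hξ, Nat.add_comm, Nat.add_left_comm]
  rw [e1]
  rcases lt_or_ge k (J + 1) with hk | hk
  · have b1 : ∫ y, f y * ξ k y ∂Q ≤ V := by
      have b2 : ∫ y, f y * ξ k y ∂Q ≤ ∫ y, (2⁻¹ * f y ^ 2 + 2⁻¹ * ξ k y ^ 2) ∂Q :=
        integral_mono (h2.integrable_mul (hξ2 k))
          ((h2.integrable_sq.const_mul _).add ((hξ2 k).integrable_sq.const_mul _)) fun y => by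
            simp only
            nlinarith [sq_nonneg (f y - ξ k y)]
      rw [integral_add (h2.integrable_sq.const_mul _) ((hξ2 k).integrable_sq.const_mul _),
        integral_const_mul, integral_const_mul] at b2
      have b3 : ∫ y, ξ k y ^ 2 ∂Q = V := hcomp (hf.pow_const 2) k
      linarith
    have b4 : V ≤ (K * m ^ 2 + V) * (κ₁ ^ (J + 1))⁻¹ * κ₁ ^ k := by
      rw [mul_assoc]
      have : 1 ≤ (κ₁ ^ (J + 1))⁻¹ * κ₁ ^ k := by
        rw [← div_eq_inv_mul, one_le_div (pow_pos k0 _)]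
        exact pow_le_pow_of_le_one k0.le k1.le hk.le
      have h3 : V ≤ K * m ^ 2 + V := by nlinarith [mul_nonneg hK (sq_nonneg m)]
      exact h3.trans (le_mul_of_one_le_right (hV0.trans h3) this)
    linarith [sq_nonneg m]
  · obtain ⟨j, rfl⟩ := Nat.exists_eq_add_of_le' hk
    have hfin : ∫⁻ y, ENNReal.ofReal (f y) ∂Q = ENNReal.ofReal m :=
      (ofReal_integral_eq_lintegral_ofReal hfi (ae_of_all _ h0)).symm
    have hm0 : 0 ≤ m := integral_nonneg h0
    have b1 := hQ.mix J (fun y => ENNReal.ofReal (f y)) hf.ennreal_ofReal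
      (fun y y' h => by simp only [hJ h]) (by simp) (by rw [hfin]; simp) j
    have b2 : ∫ y, f y * ξ (j + (J + 1)) y ∂Q ≤ (1 + κ ^ j * K) * m ^ 2 := by
      rw [hfin] at b1
      have hii : Integrable (fun y => f y * ξ (j + (J + 1)) y) Q := h2.integrable_mul (hξ2 _)
      have hκK : 0 ≤ κ ^ j * K := mul_nonneg (pow_nonneg hQ.nonneg _) hK
      rw [← ENNReal.ofReal_one, ← ENNReal.ofReal_add zero_le_one hκK,
        ← ENNReal.ofReal_pow hm0, ← ENNReal.ofReal_mul (by positivity)] at b1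
      rw [← ENNReal.ofReal_le_ofReal_iff (by positivity),
        ofReal_integral_eq_lintegral_ofReal hii
          (ae_of_all _ fun y => mul_nonneg (h0 _) (h0 _))]
      refine le_trans (le_of_eq (lintegral_congr fun y => ?_)) b1
      rw [ENNReal.ofReal_mul (h0 _)]
      simp only [hξ, Nat.add_assoc]
    have b3 : κ ^ j * K * m ^ 2 ≤ (K * m ^ 2 + V) * (κ₁ ^ (J + 1))⁻¹ * κ₁ ^ (j + (J + 1)) := by
      have : (κ₁ ^ (J + 1))⁻¹ * κ₁ ^ (j + (J + 1)) = κ₁ ^ j := by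
        rw [pow_add κ₁ j, mul_comm (κ₁ ^ j), inv_mul_cancel_left₀ (pow_pos k0 _).ne']
      rw [mul_assoc (K * m ^ 2 + V), this]
      have h4 : κ ^ j ≤ κ₁ ^ j := pow_le_pow_left₀ hQ.nonneg (le_max_left _ _) j
      have h5 : 0 ≤ K * m ^ 2 := by positivity
      nlinarith [mul_le_mul_of_nonneg_left h4 h5, mul_nonneg hV0 (pow_pos k0 j).le]
    linarith

/-- The strong law of large numbers. -/
lemma IsMixingLaw.tendsto_seqAverage (hQ : IsMixingLaw κ K Q) {J : ℕ}
    {f : (ℕ → 𝒴) → ℝ} (hf : Measurable f) (hJ : DependsOn f (Iio (J + 1))) (h2 : MemLp f 2 Q) :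
    ∀ᵐ y ∂Q, Tendsto (fun n => seqAverage f n y) atTop (𝓝 (∫ y, f y ∂Q)) := by
  have p1 : MemLp (fun y => max (f y) 0) 2 Q :=
    h2.mono (hf.max measurable_const).aestronglyMeasurable (ae_of_all _ fun y => by
      rw [Real.norm_eq_abs, Real.norm_eq_abs, abs_of_nonneg (le_max_right _ _)]
      exact max_le (le_abs_self _) (abs_nonneg _))
  have p2 : MemLp (fun y => max (-f y) 0) 2 Q :=
    h2.mono (hf.neg.max measurable_const).aestronglyMeasurable (ae_of_all _ fun y => by
      rw [Real.norm_eq_abs, Real.norm_eq_abs, abs_of_nonneg (le_max_right _ _)]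
      exact max_le (neg_le_abs _) (abs_nonneg _))
  have e : f = fun y => max (f y) 0 - max (-f y) 0 := by
    funext y
    rcases le_total 0 (f y) with h | h
    · rw [max_eq_left h, max_eq_right (by linarith)]; ring
    · rw [max_eq_right h, max_eq_left (by linarith)]; ring
  filter_upwards [hQ.tendsto_seqAverage_of_nonneg (hf.max measurable_const)
      (J := J) (fun y y' h => by simp only [hJ h]) (fun y => le_max_right _ _) p1,
    hQ.tendsto_seqAverage_of_nonneg (hf.neg.max measurable_const)
      (J := J) (fun y y' h => by rw [Pi.neg_apply, Pi.neg_apply, hJ h])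
      (fun y => le_max_right _ _) p2] with y h1 h2'
  have h3 : Tendsto (fun n => seqAverage (fun y => max (f y) 0 - max (-f y) 0) n y) atTop
      (𝓝 (∫ y, (max (f y) 0 - max (-f y) 0) ∂Q)) := by
    rw [integral_sub (p1.integrable (by norm_num)) (p2.integrable (by norm_num))]
    exact (h1.sub h2').congr fun n => (seqAverage_sub (fun y => max (f y) 0)
      (fun y => max (-f y) 0) n y).symm
  rwa [← e] at h3

/-- The strong law of large numbers, uniformly over a compact set of functions. -/
lemma IsMixingLaw.tendstoUniformlyOn_seqAverage (hQ : IsMixingLaw κ K Q) {J : ℕ}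
    {V : Type*} [PseudoMetricSpace V] {T : Set V} (hT : IsCompact T)
    {f : V → (ℕ → 𝒴) → ℝ} (hf : ∀ t ∈ T, Measurable (f t))
    (hJ : ∀ t ∈ T, DependsOn (f t) (Iio (J + 1)))
    (hc : ∀ y, ContinuousOn (fun t => f t y) T)
    {Φ : (ℕ → 𝒴) → ℝ} (hΦ : MemLp Φ 2 Q) (hb : ∀ t ∈ T, ∀ y, |f t y| ≤ Φ y) :
    ∀ᵐ y ∂Q, TendstoUniformlyOn (fun n t => seqAverage (f t) n y) (fun t => ∫ y, f t y ∂Q)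
      atTop T := by
  have h2 (t) (ht : t ∈ T) : MemLp (f t) 2 Q :=
    hΦ.mono (hf t ht).aestronglyMeasurable (ae_of_all _ fun y => by
      rw [Real.norm_eq_abs, Real.norm_eq_abs]; exact (hb t ht y).trans (le_abs_self _))
  have hi (t) (ht : t ∈ T) : Integrable (f t) Q := (h2 t ht).integrable (by norm_num)
  obtain ⟨D, hDT, hDc, hD⟩ := hT.isSeparable.exists_countable_dense_subset
  have : Countable D := hDc
  set w : V → ℝ → (ℕ → 𝒴) → ℝ := fun t₀ r y =>
    ⨆ t : D, if dist t.1 t₀ < r then |f t y - f t₀ y| else 0 with hw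
  have hterm (t₀) (ht₀ : t₀ ∈ T) (r : ℝ) (y) (t : D) :
      (if dist t.1 t₀ < r then |f t y - f t₀ y| else 0) ≤ 2 * Φ y := by
    have h0 : 0 ≤ Φ y := (abs_nonneg _).trans (hb t₀ ht₀ y)
    split_ifs with h
    · have a := hb t (hDT t.2) y
      have b := hb t₀ ht₀ y
      rw [abs_le] at *
      constructor <;> linarith
    · linarith
  have hw0 (t₀ r y) : 0 ≤ w t₀ r y := Real.iSup_nonneg fun t => by split_ifs <;> positivity
  have hwle (t₀) (ht₀ : t₀ ∈ T) (r y) : w t₀ r y ≤ 2 * Φ y :=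
    Real.iSup_le (hterm t₀ ht₀ r y) (by linarith [(abs_nonneg _).trans (hb t₀ ht₀ y)])
  have hwm (t₀) (ht₀ : t₀ ∈ T) (r) : Measurable (w t₀ r) := by
    refine Measurable.iSup fun t => ?_
    split_ifs
    · exact ((hf t (hDT t.2)).sub (hf t₀ ht₀)).abs
    · exact measurable_const
  have hw2 (t₀) (ht₀ : t₀ ∈ T) (r) : MemLp (w t₀ r) 2 Q :=
    (hΦ.const_mul 2).mono (hwm t₀ ht₀ r).aestronglyMeasurable (ae_of_all _ fun y => by
      rw [Real.norm_eq_abs, Real.norm_eq_abs, abs_of_nonneg (hw0 _ _ _)]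
      exact (hwle t₀ ht₀ r y).trans (le_abs_self _))
  have hwJ (t₀) (ht₀ : t₀ ∈ T) (r) : DependsOn (w t₀ r) (Iio (J + 1)) := by
    intro y y' h
    simp only [hw]
    refine iSup_congr fun t => ?_
    rw [hJ t (hDT t.2) h, hJ t₀ ht₀ h]
  have hosc (t₀) (ht₀ : t₀ ∈ T) (r : ℝ) (t) (ht : t ∈ T) (hr : dist t t₀ < r) (y) :
      |f t y - f t₀ y| ≤ w t₀ r y := by
    have hcl : t ∈ closure (D ∩ Metric.ball t₀ r) :=
      mem_closure_iff_nhdsWithin_neBot.2 (by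
        rw [nhdsWithin_inter_of_mem' (mem_nhdsWithin_of_mem_nhds
          (Metric.isOpen_ball.mem_nhds hr))]
        exact mem_closure_iff_nhdsWithin_neBot.1 (hD ht))
    have hne := mem_closure_iff_nhdsWithin_neBot.1 hcl
    have hlim : Tendsto (fun t => |f t y - f t₀ y|) (𝓝[D ∩ Metric.ball t₀ r] t)
        (𝓝 |f t y - f t₀ y|) :=
      ((((hc y) t ht).mono (inter_subset_left.trans hDT)).sub_const _).abs
    refine le_of_tendsto hlim ?_
    filter_upwards [self_mem_nhdsWithin] with s hs
    have hs2 : dist s t₀ < r := hs.2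
    have := le_ciSup (f := fun t : D => if dist t.1 t₀ < r then |f t y - f t₀ y| else 0)
      ⟨2 * Φ y, by rintro _ ⟨t, rfl⟩; exact hterm t₀ ht₀ r y t⟩ ⟨s, hs.1⟩
    simpa only [hs2, if_true] using this
  have hlim (t₀) (ht₀ : t₀ ∈ T) :
      Tendsto (fun n : ℕ => ∫ y, w t₀ (1 / ((n : ℝ) + 1)) y ∂Q) atTop (𝓝 0) := by
    have := tendsto_integral_of_dominated_convergence (μ := Q) (f := fun _ => (0 : ℝ))
      (F := fun (n : ℕ) y => w t₀ (1 / ((n : ℝ) + 1)) y) (fun y => 2 * Φ y)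
      (fun n => (hwm t₀ ht₀ _).aestronglyMeasurable)
      ((hΦ.integrable (by norm_num)).const_mul 2)
      (fun n => ae_of_all _ fun y => by
        rw [Real.norm_eq_abs, abs_of_nonneg (hw0 _ _ _)]; exact hwle t₀ ht₀ _ y)
      (ae_of_all _ fun y => ?_)
    · simpa using this
    · rw [Metric.tendsto_atTop]
      intro ε hε
      obtain ⟨δ, hδ, hδ'⟩ := Metric.continuousOn_iff.1 (hc y) t₀ ht₀ (ε / 2) (by positivity)
      obtain ⟨N, hN⟩ := exists_nat_one_div_lt hδ
      refine ⟨N, fun n hn => ?_⟩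
      rw [Real.dist_eq, sub_zero, abs_of_nonneg (hw0 _ _ _)]
      refine lt_of_le_of_lt (Real.iSup_le (fun t => ?_) (by positivity)) (half_lt_self hε)
      split_ifs with h
      · have hn' : 1 / ((n : ℝ) + 1) ≤ 1 / ((N : ℝ) + 1) :=
          one_div_le_one_div_of_le (by positivity) (by exact_mod_cast Nat.succ_le_succ hn)
        have := hδ' t (hDT t.2) ((h.trans_le hn').trans hN)
        rw [Real.dist_eq] at this
        exact this.le
      · positivity
  have main (η : ℝ) (hη : 0 < η) : ∀ᵐ y ∂Q, ∀ᶠ n in atTop, ∀ t ∈ T, t ∈ T →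
      |seqAverage (f t) n y - ∫ y, f t y ∂Q| ≤ 4 * η := by
    refine hT.induction_on (p := fun s => ∀ᵐ y ∂Q, ∀ᶠ n in atTop, ∀ t ∈ s, t ∈ T →
      |seqAverage (f t) n y - ∫ y, f t y ∂Q| ≤ 4 * η) (by simp) ?_ ?_ ?_
    · intro s s' hss h
      filter_upwards [h] with y hy
      filter_upwards [hy] with n hn t ht using hn t (hss ht)
    · intro s s' h h'
      filter_upwards [h, h'] with y hy hy'
      filter_upwards [hy, hy'] with n hn hn' t ht
      exact ht.elim (hn t) (hn' t)
    · intro t₀ ht₀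
      obtain ⟨n₀, hn₀⟩ := ((hlim t₀ ht₀).eventually (gt_mem_nhds hη)).exists
      set r := 1 / ((n₀ : ℝ) + 1)
      have hr : 0 < r := by positivity
      refine ⟨Metric.ball t₀ r, mem_nhdsWithin_of_mem_nhds (Metric.ball_mem_nhds t₀ hr), ?_⟩
      filter_upwards [hQ.tendsto_seqAverage (hf t₀ ht₀) (hJ t₀ ht₀) (h2 t₀ ht₀),
        hQ.tendsto_seqAverage (hwm t₀ ht₀ r) (hwJ t₀ ht₀ r) (hw2 t₀ ht₀ r)] with y h3 h4
      filter_upwards [(Metric.tendsto_nhds.1 h3) η hη, (Metric.tendsto_nhds.1 h4) η hη]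
        with n h5 h6 t ht htT
      rw [Real.dist_eq] at h5 h6
      have b1 : |seqAverage (f t) n y - seqAverage (f t₀) n y| ≤ seqAverage (w t₀ r) n y := by
        rw [← seqAverage_sub]
        exact (abs_seqAverage_le _ n y).trans
          (seqAverage_mono (fun y => hosc t₀ ht₀ r t htT ht y) n y)
      have b2 : |∫ y, f t y ∂Q - ∫ y, f t₀ y ∂Q| ≤ ∫ y, w t₀ r y ∂Q := by
        rw [← integral_sub (hi t htT) (hi t₀ ht₀)]
        exact norm_integral_le_of_norm_le ((hw2 t₀ ht₀ r).integrable (by norm_num))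
          (ae_of_all _ fun y => by
            rw [Real.norm_eq_abs]; exact hosc t₀ ht₀ r t htT ht y)
      rw [abs_lt] at h5 h6
      rw [abs_le] at b1 b2 ⊢
      constructor <;> linarith
  have main' : ∀ᵐ y ∂Q, ∀ j : ℕ, ∀ᶠ n in atTop, ∀ t ∈ T, t ∈ T →
      |seqAverage (f t) n y - ∫ y, f t y ∂Q| ≤ 4 * (1 / ((j : ℝ) + 1)) :=
    ae_all_iff.2 fun j => main _ (by positivity)
  filter_upwards [main'] with y hy
  rw [Metric.tendstoUniformlyOn_iff]
  intro ε hε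
  obtain ⟨j, hj⟩ := exists_nat_one_div_lt (show 0 < ε / 4 by positivity)
  filter_upwards [hy j] with n hn t ht
  rw [dist_comm, Real.dist_eq]
  linarith [hn t ht ht]

end ErgodicAverages


section Windows

variable {S : Type*} [MeasurableSpace S]

lemma measurable_window (a : ℤ) (n : ℕ) :
    Measurable fun (ω : ℤ → S) (k : Fin n) => ω (a + 1 + (k : ℤ)) :=
  measurable_pi_iff.2 fun _ => measurable_pi_apply _

/-- A finite measure on two-sided sequences is determined by its images on windows. -/
lemma ext_of_window {P P' : Measure (ℤ → S)} [IsFiniteMeasure P] [IsFiniteMeasure P']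
    (h : ∀ (a : ℤ) (n : ℕ), P.map (fun ω (k : Fin n) => ω (a + 1 + (k : ℤ))) =
      P'.map fun ω (k : Fin n) => ω (a + 1 + (k : ℤ))) : P = P' := by
  refine IsProjectiveLimit.unique (P := fun I => P.map I.restrict) (fun I => rfl) fun I => ?_
  obtain ⟨A, hA⟩ : ∃ A : ℕ, ∀ i ∈ I, i.natAbs ≤ A :=
    ⟨I.sup Int.natAbs, fun i hi => Finset.le_sup (f := Int.natAbs) hi⟩
  have hidx (i : I) : (i.1 + A).toNat < 2 * A + 1 := by
    have := hA i i.2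
    omega
  set r : (Fin (2 * A + 1) → S) → (I → S) := fun v i => v ⟨_, hidx i⟩ with hr
  have hrm : Measurable r := measurable_pi_iff.2 fun _ => measurable_pi_apply _
  have e : I.restrict = r ∘ fun (ω : ℤ → S) (k : Fin (2 * A + 1)) => ω (-(A : ℤ) - 1 + 1 + (k : ℤ)) := by
    funext ω i
    simp only [hr, Finset.restrict, Function.comp]
    congr 1
    have := hA i i.2
    omega
  simp only [e]
  rw [← Measure.map_map hrm (measurable_window _ _), ← Measure.map_map hrm (measurable_window _ _),
    h]

end Windows

section LikelihoodFormulas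

variable {𝒳 𝒴 : Type*} [MeasurableSpace 𝒳] [MeasurableSpace 𝒴]
  {μ : Measure 𝒳} [IsFiniteMeasure μ] [NeZero μ] {q : 𝒳 → 𝒳 → ℝ} {c C A : ℝ} {G : 𝒴 → 𝒳 → ℝ}

lemma ofReal_lik_succ (hq : IsMixing c C q) (hG : IsEmission A G) (n : ℕ) (y : ℕ → 𝒴) (x : 𝒳) :
    ENNReal.ofReal (lik μ q G (n + 1) y x) = ∫⁻ z, ENNReal.ofReal (q x z) *
      (ENNReal.ofReal (G (y 0) z) * ENNReal.ofReal (lik μ q G n (seqShift y) z)) ∂μ := by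
  have ww := (hq.weight x).mul (isWeight_emission_lik (μ := μ) hq hG n y)
  have : Nonempty 𝒳 := ⟨x⟩
  rw [lik, ofReal_integral_eq_lintegral_ofReal ww.integrable (ae_of_all _ fun z => (ww.pos z).le)]
  refine lintegral_congr fun z => ?_
  rw [ENNReal.ofReal_mul (hq.pos.le.trans (hq.lower x z)), ENNReal.ofReal_mul (hG.pos _ _).le]

lemma prodMean_eq_ofReal_lik [Nonempty 𝒳] (hq : IsMixing c C q) (hG : IsEmission A G) (n : ℕ)
    (y : ℕ → 𝒴) (x : 𝒳) :
    prodMean μ (fun x z => ENNReal.ofReal (q x z)) id n (fun k z => ENNReal.ofReal (G (y k) z)) x =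
      ENNReal.ofReal (lik μ q G n y x) := by
  induction n generalizing y x with
  | zero => simp [prodMean, lik]
  | succ n ih =>
    rw [prodMean, ofReal_lik_succ hq hG]
    refine lintegral_congr fun z => ?_
    rw [← ih (seqShift y)]
    rfl

lemma integral_prod_prevState_eq_lik (hq : IsMixing c C q) (hG : IsEmission A G) (n : ℕ)
    (y : ℕ → 𝒴) (x : 𝒳) :
    ∫ w : Fin n → 𝒳, ∏ k : Fin n, (q (prevState x w k) (w k) * G (y k) (w k))
      ∂(Measure.pi fun _ => μ) = lik μ q G n y x := by
  have : Nonempty 𝒳 := ⟨x⟩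
  have hq0 (x z) : 0 ≤ q x z := hq.pos.le.trans (hq.lower x z)
  have hGm (k : ℕ) : Measurable (G (y k)) := (hG.weight (y k)).meas.measurable
  have hm : Measurable fun w : Fin n → 𝒳 =>
      ∏ k : Fin n, (q (prevState x w k) (w k) * G (y k) (w k)) :=
    Finset.measurable_fun_prod _ fun k _ => (hq.meas.comp ((measurable_prevState k measurable_const
      measurable_id).prodMk (measurable_pi_apply k))).mul ((hGm k).comp (measurable_pi_apply k))
  rw [integral_eq_lintegral_of_nonneg_ae (ae_of_all _ fun w => Finset.prod_nonneg fun k _ =>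
    mul_nonneg (hq0 _ _) (hG.pos _ _).le) hm.aestronglyMeasurable]
  have hF : Measurable fun ω : ℕ → 𝒳 => ∏ k ∈ Finset.range n, ENNReal.ofReal (G (y k) (ω k)) :=
    Finset.measurable_fun_prod _ fun k _ =>
      ENNReal.measurable_ofReal.comp ((hGm k).comp (measurable_pi_apply k))
  have hw : Measurable (Function.uncurry fun x z => ENNReal.ofReal (q x z)) :=
    ENNReal.measurable_ofReal.comp hq.meas
  have h1 := lintegral_pi_eq_pathMean (ν := μ) hw measurable_id n hF x
  rw [pathMean_prod n (fun k z => ENNReal.ofReal (G (y k) z)) (by simp),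
    prodMean_eq_ofReal_lik hq hG] at h1
  rw [← ENNReal.toReal_ofReal (lik_pos_and_le (μ := μ) hq hG n y x).1.le, ← h1]
  congr 1
  refine lintegral_congr fun w => ?_
  rw [ENNReal.ofReal_prod_of_nonneg fun k _ => mul_nonneg (hq0 _ _) (hG.pos _ _).le]
  rw [prod_range_eq_prod_fin (fun k z => ENNReal.ofReal (G (y k) z)), ← Finset.prod_mul_distrib]
  exact Finset.prod_congr rfl fun k _ => ENNReal.ofReal_mul (hq0 _ _)

/-- The density of the observations. -/
lemma pathMean_obs_eq {𝒳 : Type*} {𝒴 : Type} [MeasurableSpace 𝒳] [MeasurableSpace 𝒴]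
    [Nonempty (𝒳 × 𝒴)] [Nonempty 𝒴] {μ : Measure 𝒳} [IsFiniteMeasure μ] [NeZero μ]
    {q : 𝒳 → 𝒳 → ℝ} {G : 𝒴 → 𝒳 → ℝ} {ν : Measure 𝒴} [SigmaFinite ν]
    (hq : IsMixing c C q) (hG : IsEmission A G) (n : ℕ) {F : (ℕ → 𝒴) → ℝ≥0∞}
    (hF : Measurable F) (hn : DependsOn F (Iio n)) (x : 𝒳) :
    pathMean (μ.prod ν) (hmmWeight q G) Prod.fst n (fun ω => F fun k => (ω k).2) 1 x =
      ∫⁻ v : Fin n → 𝒴, F (padSeq v) * ENNReal.ofReal (lik μ q G n (padSeq v) x)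
        ∂(Measure.pi fun _ => ν) := by
  induction n generalizing F x with
  | zero =>
    rw [Measure.pi_of_empty, lintegral_dirac]
    simp only [pathMean, Pi.one_apply, mul_one, lik, ENNReal.ofReal_one]
    exact hn (by simp)
  | succ n ih =>
    have hw := measurable_hmmWeight hq.meas hG.meas
    have hFo : Measurable fun ω : ℕ → 𝒳 × 𝒴 => F fun k => (ω k).2 :=
      hF.comp (measurable_pi_iff.2 fun k => measurable_snd.comp (measurable_pi_apply k))
    have hlik (n : ℕ) : Measurable fun p : 𝒳 × (Fin n → 𝒴) => lik μ q G n (padSeq p.2) p.1 :=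
      ((stronglyMeasurable_lik hq hG n).comp_measurable
        (((measurable_padSeq n).comp measurable_snd).prodMk measurable_fst)).measurable
    have hliks : Measurable fun v : Fin (n + 1) → 𝒴 => F (padSeq v) *
        ENNReal.ofReal (lik μ q G (n + 1) (padSeq v) x) :=
      (hF.comp (measurable_padSeq _)).mul (ENNReal.measurable_ofReal.comp
        ((hlik (n + 1)).comp measurable_prodMk_left))
    rw [lintegral_pi_succ n hliks, pathMean, lintegral_prod_symm]
    swap
    · exact (measurable_pathMean_cons hw measurable_fst measurable_const n hFo x).aemeasurable
    refine lintegral_congr fun y => ?_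
    have hFy : Measurable fun y' : ℕ → 𝒴 => F (seqCons y y') :=
      hF.comp (measurable_seqCons measurable_const measurable_id)
    have e1 (z : 𝒳) : hmmWeight q G x (z, y) * pathMean (μ.prod ν) (hmmWeight q G) Prod.fst n
        (fun ω => F fun k => (seqCons (z, y) ω k).2) 1 z =
        ∫⁻ v : Fin n → 𝒴, hmmWeight q G x (z, y) * (F (seqCons y (padSeq v)) *
          ENNReal.ofReal (lik μ q G n (padSeq v) z)) ∂(Measure.pi fun _ => ν) := by
      rw [lintegral_const_mul]
      · rw [← ih hFy fun y₁ y₂ h => hn fun i hi => by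
          cases i with
          | zero => rfl
          | succ i => exact h i (by simpa using hi)]
        congr 2
        funext ω
        rw [seqCons_comp Prod.snd]
      · exact (hFy.comp (measurable_padSeq _)).mul (ENNReal.measurable_ofReal.comp
          ((hlik n).comp measurable_prodMk_left))
    simp only [e1]
    rw [lintegral_lintegral_swap]
    · refine lintegral_congr fun v => ?_
      rw [padSeq_cons, ofReal_lik_succ hq hG, seqShift_seqCons, seqCons_zero,
        ← lintegral_const_mul]
      · refine lintegral_congr fun z => ?_
        rw [hmmWeight]; ring
      · refine (ENNReal.measurable_ofReal.comp (hq.meas.comp measurable_prodMk_left)).mul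
          ((ENNReal.measurable_ofReal.comp (hG.meas.comp measurable_prodMk_left)).mul
          (ENNReal.measurable_ofReal.comp ((hlik n).comp measurable_prodMk_right)))
    · refine Measurable.aemeasurable ?_
      refine (hw.comp (measurable_const.prodMk (measurable_fst.prodMk measurable_const))).mul
        (((hFy.comp (measurable_padSeq _)).comp measurable_snd).mul
        (ENNReal.measurable_ofReal.comp (hlik n)))

end LikelihoodFormulas

namespace HMMFamily

variable {𝒳 : Type*} [MeasurableSpace 𝒳] {d m : ℕ} (M : HMMFamily 𝒳 d m)

instance : IsFiniteMeasure M.μ := M.finite_dominating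

/-- The observations at the times `1, 2, …`. -/
def obsSeq (ω : ℤ → 𝒳 × Euc m) : ℕ → Euc m := fun k => (ω ((k : ℤ) + 1)).2

lemma measurable_obsSeq : Measurable (obsSeq : (ℤ → 𝒳 × Euc m) → ℕ → Euc m) :=
  measurable_pi_iff.2 fun _ => measurable_snd.comp (measurable_pi_apply _)

lemma lintegral_jointLaw [Nonempty (𝒳 × Euc m)] {θ : Euc d} (hθ : θ ∈ M.Θ) (π : Measure 𝒳)
    [IsProbabilityMeasure π] (n : ℕ) {F : (ℕ → 𝒳 × Euc m) → ℝ≥0∞} (hF : Measurable F) :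
    ∫⁻ p, F (padSeq p.2) ∂(M.jointLaw θ π n) =
      ∫⁻ x, pathMean (M.μ.prod volume) (hmmWeight (M.q θ) (M.g θ)) Prod.fst n F 1 x ∂π := by
  have hw := measurable_hmmWeight (M.measurable_q θ hθ) (M.measurable_g θ hθ)
  have hm1 := measurable_prod_prevState hw measurable_fst n
  have hm2 : Measurable fun p : 𝒳 × (Fin n → 𝒳 × Euc m) => F (padSeq p.2) :=
    hF.comp ((measurable_padSeq n).comp measurable_snd)
  have e : M.jointLaw θ π n = (π.prod (Measure.pi fun _ => M.μ.prod volume)).withDensity fun p =>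
      ∏ k : Fin n, hmmWeight (M.q θ) (M.g θ) (prevState p.1 (fun j => (p.2 j).1) k) (p.2 k) := rfl
  rw [e, lintegral_withDensity_eq_lintegral_mul _ hm1 hm2, lintegral_prod]
  · exact lintegral_congr fun x => lintegral_pi_eq_pathMean hw measurable_fst n hF x
  · exact (hm1.mul hm2).aemeasurable

variable {M} {θ : Euc d} {P : Measure (ℤ → 𝒳 × Euc m)}

lemma IsStationaryLaw.isProbabilityMeasure (h : M.IsStationaryLaw θ P) (hθ : θ ∈ M.Θ)
    [Nonempty (𝒳 × Euc m)] : IsProbabilityMeasure P := by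
  obtain ⟨π, hπ, hw⟩ := h
  have h1 := M.lintegral_jointLaw hθ π 0 (F := fun _ => 1) measurable_const
  rw [← hw 0 0] at h1
  simp only [lintegral_const, one_mul, pathMean, Pi.one_apply, measure_univ, mul_one] at h1
  rw [Measure.map_apply (by
    exact (measurable_fst.comp (measurable_pi_apply _)).prodMk (measurable_window _ _))
    MeasurableSet.univ] at h1
  exact ⟨by simpa using h1⟩

lemma IsStationaryLaw.map_window (h : M.IsStationaryLaw θ P) (a b : ℤ) (n : ℕ) :
    P.map (fun ω (k : Fin n) => ω (a + 1 + (k : ℤ))) =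
      P.map (fun ω (k : Fin n) => ω (b + 1 + (k : ℤ))) := by
  obtain ⟨π, hπ, hw⟩ := h
  have e (a : ℤ) : P.map (fun ω (k : Fin n) => ω (a + 1 + (k : ℤ))) =
      (M.jointLaw θ π n).map Prod.snd := by
    rw [← hw a n, Measure.map_map measurable_snd]
    · rfl
    · exact (measurable_fst.comp (measurable_pi_apply _)).prodMk (measurable_window _ _)
  rw [e a, e b]

lemma measurable_shift : Measurable fun (ω : ℤ → 𝒳 × Euc m) k => ω (k + 1) :=
  measurable_pi_iff.2 fun _ => measurable_pi_apply _

lemma IsStationaryLaw.map_shift (h : M.IsStationaryLaw θ P) [IsFiniteMeasure P] :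
    P.map (fun ω k => ω (k + 1)) = P := by
  refine ext_of_window fun a n => ?_
  rw [Measure.map_map (measurable_window a n) measurable_shift, ← h.map_window (a + 1) a n]
  congr 1
  funext ω k
  simp only [Function.comp]
  congr 1
  ring

lemma IsStationaryLaw.exists_isChainLaw (h : M.IsStationaryLaw θ P) (hθ : θ ∈ M.Θ)
    [Nonempty (𝒳 × Euc m)] :
    ∃ π : Measure 𝒳, IsProbabilityMeasure π ∧
      IsChainLaw M.μ volume (M.q θ) (M.g θ) π (P.map fun ω (k : ℕ) => ω ((k : ℤ) + 1)) := by
  have hPp := h.isProbabilityMeasure hθ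
  have hsh := h.map_shift
  obtain ⟨π, hπ, hw⟩ := h
  have hm : Measurable fun (ω : ℤ → 𝒳 × Euc m) (k : ℕ) => ω ((k : ℤ) + 1) :=
    measurable_pi_iff.2 fun _ => measurable_pi_apply _
  refine ⟨π, hπ, fun n F hF hn => ?_, measurable_seqShift, ?_⟩
  · rw [lintegral_map hF hm, ← M.lintegral_jointLaw hθ π n hF, ← hw 0 n, lintegral_map]
    · refine lintegral_congr fun ω => hn fun i hi => ?_
      rw [padSeq_apply _ hi]
      simp [add_comm]
    · exact hF.comp ((measurable_padSeq n).comp measurable_snd)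
    · exact (measurable_fst.comp (measurable_pi_apply _)).prodMk (measurable_window _ _)
  · conv_rhs => rw [← hsh]
    rw [Measure.map_map measurable_seqShift hm, Measure.map_map hm measurable_shift]
    rfl

lemma IsStationaryLaw.isMixingLaw (h : M.IsStationaryLaw θ P) (hθ : θ ∈ M.Θ)
    [Nonempty (𝒳 × Euc m)] [NeZero M.μ] {c C : ℝ} (hq : IsMixing c C (M.q θ)) :
    IsMixingLaw (1 - c / C) (C / c) (P.map obsSeq) := by
  have : Nonempty 𝒳 := (inferInstance : Nonempty (𝒳 × Euc m)).map Prod.fst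
  obtain ⟨π, hπ, hR⟩ := h.exists_isChainLaw hθ
  set R := P.map fun ω (k : ℕ) => ω ((k : ℤ) + 1) with hRdef
  have hm : Measurable fun (ω : ℤ → 𝒳 × Euc m) (k : ℕ) => ω ((k : ℤ) + 1) :=
    measurable_pi_iff.2 fun _ => measurable_pi_apply _
  have hs : Measurable fun (ω : ℕ → 𝒳 × Euc m) k => (ω k).2 :=
    measurable_pi_iff.2 fun _ => measurable_snd.comp (measurable_pi_apply _)
  have hQ : P.map obsSeq = R.map fun ω k => (ω k).2 := by
    rw [hRdef, Measure.map_map hs hm]; rfl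
  rw [hQ]
  refine ⟨⟨measurable_seqShift, ?_⟩, hq.rho_nonneg, hq.rho_lt_one,
    (div_pos hq.upper_pos hq.pos).le, fun J f hf hJ hfin hI k => ?_⟩
  · conv_rhs => rw [← hR.shift.map_eq]
    rw [Measure.map_map measurable_seqShift hs, Measure.map_map hs measurable_seqShift]
    rfl
  · have hf' : Measurable fun ω : ℕ → 𝒳 × Euc m => f fun k => (ω k).2 := hf.comp hs
    rw [lintegral_map hf hs] at hI ⊢
    have hm3 : Measurable fun y : ℕ → Euc m => f y * f (fun i => y (i + k + (J + 1))) :=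
      hf.mul (hf.comp (measurable_pi_iff.2 fun i => measurable_pi_apply _))
    rw [lintegral_map hm3 hs]
    exact hR.lintegral_mul_le hq (M.lintegral_q θ hθ) (M.measurable_g θ hθ) (M.lintegral_g θ hθ) hf'
      (fun ω ω' hω => hJ fun i hi => by rw [hω i hi]) (fun ω => hfin _) hI k

lemma likelihood_data [NeZero M.μ] {c C A : ℝ} {ε : ℝ} (hq : IsMixing c C (M.q θ))
    (hG : IsEmission A (M.pertG ε θ)) (n : ℕ) (ω : ℤ → 𝒳 × Euc m) (x : 𝒳) :
    M.likelihood ε θ x (data n ω) = lik M.μ (M.q θ) (M.pertG ε θ) n (obsSeq ω) x :=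
  integral_prod_prevState_eq_lik hq hG n (obsSeq ω) x

/-- The indicators that the observations are `ε`-close to those in `y`. -/
def ballInd (𝒳 : Type*) (ε : ℝ) (y : ℕ → Euc m) (k : ℕ) (z : 𝒳 × Euc m) : ℝ≥0∞ :=
  (Metric.closedBall (y k) ε).indicator 1 z.2

lemma lintegral_mul_indicator_one {A ε : ℝ} (hε : 0 < ε) (hg : IsEmission A (M.g θ)) (y : Euc m)
    (x : 𝒳) : ∫⁻ u, ENNReal.ofReal (M.g θ u x) * (Metric.closedBall y ε).indicator 1 u =
      volume (Metric.closedBall (0 : Euc m) ε) * ENNReal.ofReal (M.pertG ε θ y x) := by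
  have hbtop : volume (Metric.closedBall (0 : Euc m) ε) ≠ ∞ := measure_closedBall_lt_top.ne
  have hb0 : volume (Metric.closedBall (0 : Euc m) ε) ≠ 0 :=
    (Metric.measure_closedBall_pos _ _ hε).ne'
  have hmz : Measurable fun u => M.g θ u x := hg.meas.comp measurable_prodMk_right
  have e : (fun u => ENNReal.ofReal (M.g θ u x) * (Metric.closedBall y ε).indicator 1 u) =
      (Metric.closedBall y ε).indicator fun u => ENNReal.ofReal (M.g θ u x) := by
    funext u
    by_cases h : u ∈ Metric.closedBall y ε
    · rw [indicator_of_mem h, indicator_of_mem h, Pi.one_apply, mul_one]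
    · rw [indicator_of_notMem h, indicator_of_notMem h, mul_zero]
  rw [e, lintegral_indicator Metric.isClosed_closedBall.measurableSet, pertG, if_neg hε.ne',
    setAverage_eq, smul_eq_mul, ENNReal.ofReal_mul (by positivity),
    ← ofReal_integral_eq_lintegral_ofReal]
  · rw [Measure.real, Measure.addHaar_closedBall_center volume y, ← mul_assoc, ENNReal.ofReal_inv_of_pos
      (ENNReal.toReal_pos hb0 hbtop), ENNReal.ofReal_toReal hbtop,
      ENNReal.mul_inv_cancel hb0 hbtop, one_mul]
  · refine Measure.integrableOn_of_bounded (M := A) measure_closedBall_lt_top.ne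
      hmz.aestronglyMeasurable (ae_of_all _ fun u => ?_)
    rw [Real.norm_of_nonneg (hg.pos u x).le]
    exact hg.le u x
  · exact ae_of_all _ fun u => (hg.pos u x).le

lemma lintegral_hmmWeight_mul {𝒴 : Type*} [MeasurableSpace 𝒴] {μ : Measure 𝒳} [SFinite μ]
    {ν : Measure 𝒴} [SFinite ν] {q : 𝒳 → 𝒳 → ℝ} {g : 𝒴 → 𝒳 → ℝ}
    (hq : Measurable (Function.uncurry q)) (hg : Measurable (Function.uncurry g))
    {f : 𝒴 → ℝ≥0∞} (hf : Measurable f) {T : 𝒳 → ℝ≥0∞} (hT : Measurable T) (x : 𝒳) :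
    ∫⁻ z, hmmWeight q g x z * (f z.2 * T z.1) ∂(μ.prod ν) =
      ∫⁻ z, ENNReal.ofReal (q x z) * ((∫⁻ u, ENNReal.ofReal (g u z) * f u ∂ν) * T z) ∂μ := by
  have hm : Measurable fun z => hmmWeight q g x z * (f z.2 * T z.1) :=
    ((measurable_hmmWeight hq hg).comp measurable_prodMk_left).mul
      ((hf.comp measurable_snd).mul (hT.comp measurable_fst))
  rw [lintegral_prod _ hm.aemeasurable]
  refine lintegral_congr fun z => ?_
  have hgz : Measurable fun u => ENNReal.ofReal (g u z) * f u :=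
    (ENNReal.measurable_ofReal.comp (hg.comp measurable_prodMk_right)).mul hf
  rw [← lintegral_mul_const _ hgz, ← lintegral_const_mul _ (hgz.mul_const _)]
  refine lintegral_congr fun u => ?_
  rw [hmmWeight]
  ring

lemma prodMean_ballInd [NeZero M.μ] [Nonempty 𝒳] {c C A : ℝ} {ε : ℝ}
    (hε : 0 < ε) (hq : IsMixing c C (M.q θ)) (hg : IsEmission A (M.g θ))
    (hG : IsEmission A (M.pertG ε θ)) (n : ℕ) (y : ℕ → Euc m) (x : 𝒳) :
    prodMean (M.μ.prod volume) (hmmWeight (M.q θ) (M.g θ)) Prod.fst n (ballInd 𝒳 ε y) x =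
      volume (Metric.closedBall (0 : Euc m) ε) ^ n *
        ENNReal.ofReal (lik M.μ (M.q θ) (M.pertG ε θ) n y x) := by
  induction n generalizing y x with
  | zero => simp [prodMean, lik]
  | succ n ih =>
    have hs : seqShift (ballInd 𝒳 ε y) = ballInd 𝒳 ε (seqShift y) := rfl
    have ml : Measurable fun z => lik M.μ (M.q θ) (M.pertG ε θ) n (seqShift y) z :=
      ((stronglyMeasurable_lik hq hG n).comp_measurable measurable_prodMk_left).measurable
    rw [prodMean, hs]
    simp only [ih]
    refine (lintegral_hmmWeight_mul hq.meas hg.meas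
      (f := (Metric.closedBall (y 0) ε).indicator 1)
      (measurable_one.indicator Metric.isClosed_closedBall.measurableSet)
      (T := fun z => volume (Metric.closedBall (0 : Euc m) ε) ^ n *
        ENNReal.ofReal (lik M.μ (M.q θ) (M.pertG ε θ) n (seqShift y) z))
        (ml.ennreal_ofReal.const_mul _) x).trans ?_
    rw [ofReal_lik_succ hq hG, ← lintegral_const_mul']
    · refine lintegral_congr fun z => ?_
      rw [lintegral_mul_indicator_one hε hg]
      ring
    · exact ENNReal.pow_ne_top measure_closedBall_lt_top.ne

lemma abcLikelihood_data [NeZero M.μ] [Nonempty (𝒳 × Euc m)] (hθ : θ ∈ M.Θ) {c C A : ℝ} {ε : ℝ}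
    (hε : 0 < ε) (hq : IsMixing c C (M.q θ)) (hg : IsEmission A (M.g θ))
    (hG : IsEmission A (M.pertG ε θ)) (π : Measure 𝒳) [IsProbabilityMeasure π] (n : ℕ)
    (ω : ℤ → 𝒳 × Euc m) :
    M.abcLikelihood ε π θ (data n ω) = volume (Metric.closedBall (0 : Euc m) ε) ^ n *
      ∫⁻ x, ENNReal.ofReal (lik M.μ (M.q θ) (M.pertG ε θ) n (obsSeq ω) x) ∂π := by
  have : Nonempty 𝒳 := (inferInstance : Nonempty (𝒳 × Euc m)).map Prod.fst
  set f := ballInd 𝒳 ε (obsSeq ω) with hf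
  have hF : Measurable fun ω : ℕ → 𝒳 × Euc m => ∏ k ∈ Finset.range n, f k (ω k) :=
    Finset.measurable_fun_prod _ fun k _ =>
      ((measurable_one.indicator Metric.isClosed_closedBall.measurableSet).comp measurable_snd).comp
        (measurable_pi_apply k)
  have hfin (k z) : f k z ≠ ∞ := by
    simp only [hf, ballInd, indicator]; split_ifs <;> simp
  have h1 : M.abcLikelihood ε π θ (data n ω) =
      ∫⁻ p, (∏ k ∈ Finset.range n, f k (padSeq p.2 k)) ∂(M.jointLaw θ π n) := by
    have hs : MeasurableSet {p : 𝒳 × (Fin n → 𝒳 × Euc m) |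
        ∀ k, (p.2 k).2 ∈ Metric.closedBall (data n ω k) ε} := by
      rw [ofPred_forall]
      exact MeasurableSet.iInter fun k => (measurable_snd.comp
        ((measurable_pi_apply k).comp measurable_snd)) Metric.isClosed_closedBall.measurableSet
    rw [abcLikelihood, ← lintegral_indicator_one hs]
    refine lintegral_congr fun p => ?_
    rw [prod_range_eq_prod_fin f p.2]
    by_cases hp : ∀ k, (p.2 k).2 ∈ Metric.closedBall (data n ω k) ε
    · rw [indicator_of_mem (by exact hp)]
      refine (Finset.prod_eq_one fun k _ => ?_).symm
      exact indicator_of_mem (hp k) _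
    · rw [indicator_of_notMem (by exact hp)]
      push Not at hp
      obtain ⟨k, hk⟩ := hp
      exact (Finset.prod_eq_zero (Finset.mem_univ k) (indicator_of_notMem hk _)).symm
  rw [h1, M.lintegral_jointLaw hθ π n hF]
  rw [← lintegral_const_mul' _ _ (ENNReal.pow_ne_top
    (measure_closedBall_lt_top (μ := (volume : Measure (Euc m)))).ne)]
  exact lintegral_congr fun x =>
    (pathMean_prod n f hfin x).trans (prodMean_ballInd hε hq hg hG n _ x)

end HMMFamily


section LogLikelihoodLimits

variable {𝒳 𝒴 : Type*} [MeasurableSpace 𝒳] [MeasurableSpace 𝒴]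
  {Q : Measure (ℕ → 𝒴)} {μ : Measure 𝒳} [IsFiniteMeasure μ] [NeZero μ] {q q' : 𝒳 → 𝒳 → ℝ}
  {c C A : ℝ} {G G' : 𝒴 → 𝒳 → ℝ} {Φ : 𝒴 → ℝ} {x : 𝒳}

lemma dependsOn_lik (n : ℕ) (x : 𝒳) :
    DependsOn (fun y : ℕ → 𝒴 => lik μ q G n y x) (Iio n) := by
  induction n generalizing x with
  | zero => exact fun _ _ _ => rfl
  | succ n ih =>
    intro y y' h
    simp only [lik]
    refine integral_congr_ae (ae_of_all _ fun z => ?_)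
    have e1 : y 0 = y' 0 := h 0 (by simp)
    have e2 : lik μ q G n (seqShift y) z = lik μ q G n (seqShift y') z :=
      ih z fun i hi => h (i + 1) (by simpa using hi)
    simp only [e1, e2]

lemma dependsOn_logIncr (n : ℕ) (x : 𝒳) : DependsOn (logIncr (𝒴 := 𝒴) μ q G x n) (Iio (n + 1)) := by
  intro y y' h
  have e1 : lik μ q G (n + 1) y x = lik μ q G (n + 1) y' x := dependsOn_lik (n + 1) x h
  have e2 : lik μ q G n (seqShift y) x = lik μ q G n (seqShift y') x :=
    dependsOn_lik n x fun i hi => h (i + 1) (by simpa using hi)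
  rw [logIncr, logIncr, e1, e2]

lemma log_lik_eq_sum (n : ℕ) (y : ℕ → 𝒴) (x : 𝒳) :
    Real.log (lik μ q G n y x) =
      ∑ k ∈ Finset.range n, logIncr μ q G x (n - 1 - k) (fun i => y (i + k)) := by
  induction n generalizing y with
  | zero => simp [lik]
  | succ n ih =>
    rw [Finset.sum_range_succ']
    have h := ih (seqShift y)
    have e : ∀ k, logIncr μ q G x (n + 1 - 1 - (k + 1)) (fun i => y (i + (k + 1))) =
        logIncr μ q G x (n - 1 - k) (fun i => seqShift y (i + k)) := fun k => by
      rw [show n + 1 - 1 - (k + 1) = n - 1 - k by omega]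
      rfl
    simp only [e, ← h]
    simp [logIncr]

/-- `incrRate c C n` bounds the effect of observations after the `n`-th one. -/
def incrRate (c C : ℝ) (n : ℕ) : ℝ := 2 * (C / c - 1) * (1 - c / C) ^ n / (1 - (1 - c / C))

lemma tendsto_incrRate [Nonempty 𝒳] (hq : IsMixing c C q) :
    Tendsto (incrRate c C) atTop (𝓝 0) := tendsto_rate hq.rho_nonneg hq.rho_lt_one

lemma sum_incrRate_le [Nonempty 𝒳] (hq : IsMixing c C q) (n : ℕ) :
    ∑ k ∈ Finset.range n, incrRate c C k ≤
      2 * (C / c - 1) / (1 - (1 - c / C)) * (1 - (1 - c / C))⁻¹ := by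
  have e : ∀ k, incrRate c C k = 2 * (C / c - 1) / (1 - (1 - c / C)) * (1 - c / C) ^ k := fun k => by
    rw [incrRate]; ring
  simp only [e]
  rw [← Finset.mul_sum]
  have h1 : 0 ≤ 2 * (C / c - 1) / (1 - (1 - c / C)) :=
    div_nonneg (mul_nonneg two_pos.le (sub_nonneg.2 ((one_le_div hq.pos).2 hq.le)))
      (sub_nonneg.2 hq.rho_lt_one.le)
  refine mul_le_mul_of_nonneg_left ?_ h1
  have := (summable_geometric_of_lt_one hq.rho_nonneg hq.rho_lt_one).sum_le_tsum (Finset.range n)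
    (fun i _ => pow_nonneg hq.rho_nonneg i)
  rwa [tsum_geometric_of_lt_one hq.rho_nonneg hq.rho_lt_one] at this

lemma abs_logIncr_diff_sub_le (hq : IsMixing c C q) (hG : IsEmission A G) (hq' : IsMixing c C q')
    (hG' : IsEmission A G') (n J : ℕ) (y : ℕ → 𝒴) :
    |(logIncr μ q G x n y - logIncr μ q' G' x n y) -
      (logIncr μ q G x J y - logIncr μ q' G' x J y)| ≤ incrRate c C n + incrRate c C J := by
  have : Nonempty 𝒳 := ⟨x⟩
  have h (n : ℕ) := norm_sub_limUnder_le hq.rho_lt_one (A := 2 * (C / c - 1))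
    (f := fun n => logIncr μ q G x n y - logIncr μ q' G' x n y) (fun n => by
      have h1 := abs_log_incr_sub_le (μ := μ) hq hG n y x
      have h2 := abs_log_incr_sub_le (μ := μ) hq' hG' n y x
      rw [Real.norm_eq_abs]
      simp only [logIncr]
      rw [horizonRate, abs_le] at h1 h2
      rw [abs_le]
      constructor <;> nlinarith) n
  have h1 := h n
  have h2 := h J
  rw [Real.norm_eq_abs, abs_le] at h1 h2
  simp only [incrRate]
  rw [abs_le]
  constructor <;> linarith

lemma abs_log_lik_sub_le (hq : IsMixing c C q) (hG : IsEmission A G) (hq' : IsMixing c C q')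
    (hG' : IsEmission A G') (n J : ℕ) (y : ℕ → 𝒴) :
    |(n : ℝ)⁻¹ * (Real.log (lik μ q G n y x) - Real.log (lik μ q' G' n y x)) -
      seqAverage (fun y => logIncr μ q G x J y - logIncr μ q' G' x J y) n y| ≤
      (n : ℝ)⁻¹ * (2 * (C / c - 1) / (1 - (1 - c / C)) * (1 - (1 - c / C))⁻¹) +
        (n : ℝ)⁻¹ * (n * incrRate c C J) := by
  have : Nonempty 𝒳 := ⟨x⟩
  rw [log_lik_eq_sum, log_lik_eq_sum, seqAverage, ← mul_sub, ← Finset.sum_sub_distrib,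
    ← Finset.sum_sub_distrib, abs_mul, abs_of_nonneg (by positivity : (0 : ℝ) ≤ (n : ℝ)⁻¹),
    ← mul_add]
  refine mul_le_mul_of_nonneg_left ?_ (by positivity)
  refine (Finset.abs_sum_le_sum_abs _ _).trans ?_
  refine (Finset.sum_le_sum fun k _ => abs_logIncr_diff_sub_le hq hG hq' hG' (n - 1 - k) J
    (fun i => y (i + k))).trans ?_
  rw [Finset.sum_add_distrib, Finset.sum_const, Finset.card_range, nsmul_eq_mul,
    Finset.sum_range_reflect (incrRate c C) n]
  exact add_le_add (sum_incrRate_le hq n) le_rfl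

variable [IsProbabilityMeasure Q]

/-- The normalised log-likelihood ratios converge almost surely, uniformly on compact sets. -/
lemma IsMixingLaw.tendstoUniformlyOn_log_lik {κ K : ℝ} (hQ : IsMixingLaw κ K Q)
    {V : Type*} [PseudoMetricSpace V] {T : Set V} (hT : IsCompact T)
    {q : V → 𝒳 → 𝒳 → ℝ} {G : V → 𝒴 → 𝒳 → ℝ}
    (hq : ∀ t ∈ T, IsMixing c C (q t)) (hG : ∀ t ∈ T, IsEmission A (G t))
    (hq' : IsMixing c C q') (hG' : IsEmission A G')
    (hcq : ∀ x z, ContinuousOn (fun t => q t x z) T)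
    (hcG : ∀ y z, ContinuousOn (fun t => G t y z) T)
    (hΦ : MemLp (fun y : ℕ → 𝒴 => Φ (y 0)) 2 Q)
    (hb : ∀ t ∈ T, IncrBound μ (q t) q' (G t) G' x Φ) :
    ∀ᵐ y ∂Q, TendstoUniformlyOn
      (fun (n : ℕ) t => (n : ℝ)⁻¹ *
        (Real.log (lik μ (q t) (G t) n y x) - Real.log (lik μ q' G' n y x)))
      (fun t => limValue Q μ (q t) (G t) q' G' x) atTop T := by
  have : Nonempty 𝒳 := ⟨x⟩
  have hΦi : Integrable (fun y : ℕ → 𝒴 => Φ (y 0)) Q := hΦ.integrable (by norm_num)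
  have hJ (J : ℕ) := hQ.tendstoUniformlyOn_seqAverage (J := J) hT
    (f := fun t y => logIncr μ (q t) (G t) x J y - logIncr μ q' G' x J y)
    (fun t ht => (measurable_logIncr (hq t ht) (hG t ht) J x).sub (measurable_logIncr hq' hG' J x))
    (fun t _ y y' h => by
      simp only [dependsOn_logIncr (μ := μ) (q := q t) (G := G t) J x h,
        dependsOn_logIncr (μ := μ) (q := q') (G := G') J x h])
    (fun y => by
      refine ContinuousOn.sub ?_ continuousOn_const
      rw [continuousOn_iff_continuous_domRestrict, continuous_iff_continuousAt]
      intro t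
      exact tendsto_logIncr (ι := T) (q := fun s => q s) (G := fun s => G s)
        (fun s => hq s s.2) (fun s => hG s s.2) (hq t t.2) (hG t t.2)
        (fun x z => (continuousOn_iff_continuous_domRestrict.1 (hcq x z)).continuousAt)
        (fun y z => (continuousOn_iff_continuous_domRestrict.1 (hcG y z)).continuousAt) J y)
    hΦ (fun t ht y => hb t ht J y)
  filter_upwards [ae_all_iff.2 hJ] with y hy
  rw [Metric.tendstoUniformlyOn_iff]
  intro ε hε
  obtain ⟨J, hJε⟩ := ((tendsto_incrRate hq').eventually
    (gt_mem_nhds (show (0 : ℝ) < ε / 4 by positivity))).exists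
  have hinv : Tendsto (fun n : ℕ => (n : ℝ)⁻¹ *
      (2 * (C / c - 1) / (1 - (1 - c / C)) * (1 - (1 - c / C))⁻¹)) atTop (𝓝 0) := by
    simpa using (tendsto_inv_atTop_nhds_zero_nat (𝕜 := ℝ)).mul_const
      (2 * (C / c - 1) / (1 - (1 - c / C)) * (1 - (1 - c / C))⁻¹)
  filter_upwards [Metric.tendstoUniformlyOn_iff.1 (hy J) (ε / 4) (by positivity),
    hinv.eventually (gt_mem_nhds (show (0 : ℝ) < ε / 4 by positivity)), eventually_gt_atTop 0]
    with n h1 h2 h3 t ht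
  have h4 := h1 t ht
  have h5 := abs_log_lik_sub_le (μ := μ) (x := x) (hq t ht) (hG t ht) hq' hG' n J y
  have h6 := (hb t ht).abs_mean_sub_limValue_le (hq t ht) (hG t ht) hq' hG' hΦi J
  have h7 : (n : ℝ)⁻¹ * (n * incrRate c C J) = incrRate c C J :=
    inv_mul_cancel_left₀ (by exact_mod_cast h3.ne') _
  rw [h7] at h5
  rw [← incrRate] at h6
  rw [Real.dist_eq, abs_lt] at h4 ⊢
  rw [abs_le] at h5 h6
  constructor <;> linarith

lemma neg_le_mean_log_lik (hS : MeasurePreserving seqShift Q Q)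
    (hq : IsMixing c C q) (hG : IsEmission A G) (hq' : IsMixing c C q')
    (hG' : IsEmission A G') (hΦ : Integrable (fun y : ℕ → 𝒴 => Φ (y 0)) Q)
    (hb : IncrBound μ q q' G G' x Φ) (h0 : 0 ≤ limValue Q μ q G q' G' x) (n : ℕ) :
    Integrable (fun y => Real.log (lik μ q G n y x) - Real.log (lik μ q' G' n y x)) Q ∧
    -(2 * (C / c - 1) / (1 - (1 - c / C)) * (1 - (1 - c / C))⁻¹) ≤
      ∫ y, (Real.log (lik μ q G n y x) - Real.log (lik μ q' G' n y x)) ∂Q := by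
  have : Nonempty 𝒳 := ⟨x⟩
  have sh := measurePreserving_add hS
  have e : (fun y => Real.log (lik μ q G n y x) - Real.log (lik μ q' G' n y x)) =
      fun y => ∑ k ∈ Finset.range n, (logIncr μ q G x (n - 1 - k) (fun i => y (i + k)) -
        logIncr μ q' G' x (n - 1 - k) (fun i => y (i + k))) := by
    funext y
    rw [log_lik_eq_sum, log_lik_eq_sum, Finset.sum_sub_distrib]
  have hi (j k : ℕ) : Integrable (fun y => logIncr μ q G x j (fun i => y (i + k)) -
        logIncr μ q' G' x j (fun i => y (i + k))) Q :=
    (sh k).integrable_comp_of_integrable (hb.integrable hq hG hq' hG' hΦ j)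
  have hmean (j k : ℕ) : ∫ y, (logIncr μ q G x j (fun i => y (i + k)) -
        logIncr μ q' G' x j (fun i => y (i + k))) ∂Q =
      ∫ y, (logIncr μ q G x j y - logIncr μ q' G' x j y) ∂Q := by
    conv_rhs => rw [← (sh k).map_eq]
    rw [integral_map (sh k).measurable.aemeasurable]
    exact ((measurable_logIncr hq hG j x).sub (measurable_logIncr hq' hG' j x)).aestronglyMeasurable
  rw [e]
  refine ⟨integrable_finsetSum _ fun k _ => hi _ _, ?_⟩
  rw [integral_finsetSum _ fun k _ => hi _ _]
  simp only [hmean]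
  rw [Finset.sum_range_reflect
    (fun j => ∫ y, (logIncr μ q G x j y - logIncr μ q' G' x j y) ∂Q) n]
  have h1 := sum_incrRate_le hq n
  have h2 : ∑ j ∈ Finset.range n, -incrRate c C j ≤
      ∑ j ∈ Finset.range n, ∫ y, (logIncr μ q G x j y - logIncr μ q' G' x j y) ∂Q := by
    refine Finset.sum_le_sum fun j _ => ?_
    have := hb.abs_mean_sub_limValue_le hq hG hq' hG' hΦ j
    rw [← incrRate, abs_le] at this
    linarith
  rw [Finset.sum_neg_distrib] at h2
  linarith

end LogLikelihoodLimits

section Identification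

variable {𝒳 : Type*} {𝒴 : Type} [MeasurableSpace 𝒳] [MeasurableSpace 𝒴] [Nonempty (𝒳 × 𝒴)]
  {μ : Measure 𝒳} [IsFiniteMeasure μ] [NeZero μ] {ν : Measure 𝒴} [SigmaFinite ν]
  {q q' : 𝒳 → 𝒳 → ℝ} {G G' : 𝒴 → 𝒳 → ℝ} {c C A : ℝ} {π π' : Measure 𝒳}
  {R R' : Measure (ℕ → 𝒳 × 𝒴)}

/-- The law of the observations. -/
def obsMarginal {𝒳 𝒴 : Type*} [MeasurableSpace 𝒳] [MeasurableSpace 𝒴]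
    (R : Measure (ℕ → 𝒳 × 𝒴)) : Measure (ℕ → 𝒴) := R.map fun ω k => (ω k).2

lemma measurable_obs {𝒳 𝒴 : Type*} [MeasurableSpace 𝒳] [MeasurableSpace 𝒴] :
    Measurable fun (ω : ℕ → 𝒳 × 𝒴) k => (ω k).2 :=
  measurable_pi_iff.2 fun _ => measurable_snd.comp (measurable_pi_apply _)

lemma IsChainLaw.lintegral_obs (h : IsChainLaw μ ν q G π R) (hq : IsMixing c C q)
    (hG : IsEmission A G) (n : ℕ) {F : (ℕ → 𝒴) → ℝ≥0∞} (hF : Measurable F)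
    (hn : DependsOn F (Iio n)) [Nonempty 𝒴] :
    ∫⁻ y, F y ∂(obsMarginal R) = ∫⁻ x, ∫⁻ v : Fin n → 𝒴,
      F (padSeq v) * ENNReal.ofReal (lik μ q G n (padSeq v) x) ∂(Measure.pi fun _ => ν) ∂π := by
  have hFo : Measurable fun ω : ℕ → 𝒳 × 𝒴 => F fun k => (ω k).2 := hF.comp measurable_obs
  rw [obsMarginal, lintegral_map hF measurable_obs, h.law n _ hFo]
  · exact lintegral_congr fun x => pathMean_obs_eq hq hG n hF hn x
  · exact fun ω ω' hω => hn fun i hi => by rw [hω i hi]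

/-- Change of measure between two hidden Markov models. -/
lemma IsChainLaw.lintegral_mul_lik_ratio_le (h : IsChainLaw μ ν q G π R)
    (h' : IsChainLaw μ ν q' G' π' R') [IsProbabilityMeasure π] [IsProbabilityMeasure π']
    (hq : IsMixing c C q) (hG : IsEmission A G) (hq' : IsMixing c C q') (hG' : IsEmission A G')
    (n : ℕ) {F : (ℕ → 𝒴) → ℝ≥0∞} (hF : Measurable F) (hn : DependsOn F (Iio n)) (x₀ : 𝒳) :
    ∫⁻ y, F y * ENNReal.ofReal (lik μ q G n y x₀ / lik μ q' G' n y x₀) ∂(obsMarginal R') ≤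
      ENNReal.ofReal ((C / c) ^ 2) * ∫⁻ y, F y ∂(obsMarginal R) := by
  have : Nonempty 𝒴 := (inferInstance : Nonempty (𝒳 × 𝒴)).map Prod.snd
  have : Nonempty 𝒳 := ⟨x₀⟩
  have hm : Measurable fun y : ℕ → 𝒴 =>
      F y * ENNReal.ofReal (lik μ q G n y x₀ / lik μ q' G' n y x₀) :=
    hF.mul ((measurable_lik hq hG n x₀).div (measurable_lik hq' hG' n x₀)).ennreal_ofReal
  have hd : DependsOn (fun y : ℕ → 𝒴 =>
      F y * ENNReal.ofReal (lik μ q G n y x₀ / lik μ q' G' n y x₀)) (Iio n) := fun y y' hy => by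
    have e1 : lik μ q G n y x₀ = lik μ q G n y' x₀ := dependsOn_lik n x₀ hy
    have e2 : lik μ q' G' n y x₀ = lik μ q' G' n y' x₀ := dependsOn_lik n x₀ hy
    simp only [e1, e2, hn hy]
  rw [h'.lintegral_obs hq' hG' n hm hd, h.lintegral_obs hq hG n hF hn]
  have hc := hq.pos
  have hC := hq.upper_pos
  have hCc : 0 ≤ C / c := by positivity
  have key (x x₁ : 𝒳) : ∫⁻ v : Fin n → 𝒴, F (padSeq v) *
      ENNReal.ofReal (lik μ q G n (padSeq v) x₀ / lik μ q' G' n (padSeq v) x₀) *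
        ENNReal.ofReal (lik μ q' G' n (padSeq v) x) ∂(Measure.pi fun _ => ν) ≤
      ENNReal.ofReal ((C / c) ^ 2) * ∫⁻ v : Fin n → 𝒴,
        F (padSeq v) * ENNReal.ofReal (lik μ q G n (padSeq v) x₁) ∂(Measure.pi fun _ => ν) := by
    rw [← lintegral_const_mul' _ _ ENNReal.ofReal_ne_top]
    refine lintegral_mono fun v => ?_
    have p1 := (lik_pos_and_le (μ := μ) hq hG n (padSeq v) x₀).1
    have p2 := (lik_pos_and_le (μ := μ) hq' hG' n (padSeq v) x₀).1
    have p3 := (lik_pos_and_le (μ := μ) hq' hG' n (padSeq v) x).1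
    have b1 := lik_le_mul (μ := μ) hq hG n (padSeq v) x₀ x₁
    have b2 := lik_le_mul (μ := μ) hq' hG' n (padSeq v) x x₀
    rw [mul_assoc, ← ENNReal.ofReal_mul (by positivity), mul_left_comm,
      ← ENNReal.ofReal_mul (by positivity)]
    refine mul_le_mul_right (ENNReal.ofReal_le_ofReal ?_) _
    rw [div_mul_eq_mul_div, div_le_iff₀ p2]
    calc _ ≤ (C / c * lik μ q G n (padSeq v) x₁) * (C / c * lik μ q' G' n (padSeq v) x₀) :=
          mul_le_mul b1 b2 p3.le (p1.le.trans b1)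
      _ = _ := by ring
  calc _ ≤ ∫⁻ _, (∫⁻ x₁, ENNReal.ofReal ((C / c) ^ 2) * ∫⁻ v : Fin n → 𝒴,
        F (padSeq v) * ENNReal.ofReal (lik μ q G n (padSeq v) x₁) ∂(Measure.pi fun _ => ν) ∂π) ∂π' := by
        refine lintegral_mono fun x => ?_
        calc _ = ∫⁻ _, ∫⁻ v : Fin n → 𝒴, F (padSeq v) *
              ENNReal.ofReal (lik μ q G n (padSeq v) x₀ / lik μ q' G' n (padSeq v) x₀) *
              ENNReal.ofReal (lik μ q' G' n (padSeq v) x) ∂(Measure.pi fun _ => ν) ∂π := by simp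
          _ ≤ _ := lintegral_mono fun x₁ => key x x₁
    _ = _ := by
        rw [lintegral_const, measure_univ, mul_one, lintegral_const_mul' _ _ ENNReal.ofReal_ne_top]

variable {x : 𝒳}

/-- An event which is likely for the true parameter is not too unlikely for parameters with
bounded relative entropy. -/
lemma IsChainLaw.mul_measureReal_le (h : IsChainLaw μ ν q G π R)
    (h' : IsChainLaw μ ν q' G' π' R') [IsProbabilityMeasure π] [IsProbabilityMeasure π']
    [IsProbabilityMeasure (obsMarginal R)] [IsProbabilityMeasure (obsMarginal R')]
    (hq : IsMixing c C q) (hG : IsEmission A G) (hq' : IsMixing c C q') (hG' : IsEmission A G')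
    (n : ℕ) {E : Set (ℕ → 𝒴)} (hE : MeasurableSet E)
    (hn : DependsOn (· ∈ E) (Iio n)) {k : ℝ}
    (hi : Integrable (fun y => Real.log (lik μ q G n y x) - Real.log (lik μ q' G' n y x))
      (obsMarginal R'))
    (hk : -k ≤ ∫ y, (Real.log (lik μ q G n y x) - Real.log (lik μ q' G' n y x)) ∂(obsMarginal R'))
    {t : ℝ} (ht : 0 ≤ t) :
    t * (obsMarginal R').real E ≤
      k + Real.log ((C / c) ^ 2 * (1 + (Real.exp t - 1) * (obsMarginal R).real E)) := by
  have : Nonempty 𝒳 := ⟨x⟩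
  set Q := obsMarginal R
  set Q' := obsMarginal R'
  have hc := hq.pos
  have hC := hq.upper_pos
  set φ : (ℕ → 𝒴) → ℝ := E.indicator fun _ => t with hφ
  have hφm : Measurable φ := measurable_const.indicator hE
  have hφi (Q : Measure (ℕ → 𝒴)) [IsProbabilityMeasure Q] : ∫ y, φ y ∂Q = t * Q.real E := by
    rw [hφ, integral_indicator_const _ hE, smul_eq_mul, mul_comm]
  have hexp : ∀ y, Real.exp (φ y) = 1 + E.indicator (fun _ => Real.exp t - 1) y := fun y => by
    by_cases hy : y ∈ E
    · simp [hφ, hy]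
    · simp [hφ, hy]
  have hind : ∀ (r : ℝ) (Q : Measure (ℕ → 𝒴)) [IsProbabilityMeasure Q],
      Integrable (E.indicator fun _ => r) Q := fun r Q _ => (integrable_const r).indicator hE
  have hexpi : Integrable (fun y => Real.exp (φ y)) Q := by
    simp only [hexp]; exact (integrable_const _).add (hind _ Q)
  have hexpI : ∫ y, Real.exp (φ y) ∂Q = 1 + (Real.exp t - 1) * Q.real E := by
    simp only [hexp]
    rw [integral_add (integrable_const _) (hind _ Q), integral_indicator_const _ hE]
    simp [mul_comm]
  set a := (C / c) ^ 2 * (1 + (Real.exp t - 1) * Q.real E) with ha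
  have het : 1 ≤ Real.exp t := Real.one_le_exp ht
  have ha0 : 0 < a := by
    have : 0 ≤ (Real.exp t - 1) * Q.real E := mul_nonneg (by linarith) measureReal_nonneg
    positivity
  set ρ : (ℕ → 𝒴) → ℝ := fun y => lik μ q G n y x / lik μ q' G' n y x with hρ
  have hρ0 (y) : 0 < ρ y :=
    div_pos (lik_pos_and_le (μ := μ) hq hG n y x).1 (lik_pos_and_le (μ := μ) hq' hG' n y x).1
  have hρm : Measurable ρ := (measurable_lik hq hG n x).div (measurable_lik hq' hG' n x)
  have hdep : DependsOn (fun y => ENNReal.ofReal (Real.exp (φ y))) (Iio n) := fun y y' hy => by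
    have : (y ∈ E) = (y' ∈ E) := hn hy
    by_cases h1 : y ∈ E
    · have h2 : y' ∈ E := this ▸ h1
      simp [hφ, h1, h2]
    · have h2 : y' ∉ E := this ▸ h1
      simp [hφ, h1, h2]
  have hbd := h.lintegral_mul_lik_ratio_le h' hq hG hq' hG' n
    (Real.measurable_exp.comp hφm).ennreal_ofReal hdep x
  have hprodm : Measurable fun y => Real.exp (φ y) * ρ y := (Real.measurable_exp.comp hφm).mul hρm
  have hlt : ∫⁻ y, ENNReal.ofReal (Real.exp (φ y) * ρ y) ∂Q' ≤ ENNReal.ofReal a := by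
    calc _ = ∫⁻ y, ENNReal.ofReal (Real.exp (φ y)) * ENNReal.ofReal (ρ y) ∂Q' :=
          lintegral_congr fun y => ENNReal.ofReal_mul (Real.exp_pos _).le
      _ ≤ _ := hbd
      _ = _ := by
          change _ * ∫⁻ y, ENNReal.ofReal (Real.exp (φ y)) ∂Q = _
          rw [← ofReal_integral_eq_lintegral_ofReal hexpi (ae_of_all _ fun y => (Real.exp_pos _).le),
            hexpI, ← ENNReal.ofReal_mul (by positivity)]
  have hprod0 : ∀ y, 0 ≤ Real.exp (φ y) * ρ y := fun y => (mul_pos (Real.exp_pos _) (hρ0 y)).le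
  have hprodi : Integrable (fun y => Real.exp (φ y) * ρ y) Q' :=
    ⟨hprodm.aestronglyMeasurable, by
      rw [hasFiniteIntegral_iff_ofReal (ae_of_all _ hprod0)]
      exact hlt.trans_lt ENNReal.ofReal_lt_top⟩
  have hprodI : ∫ y, Real.exp (φ y) * ρ y ∂Q' ≤ a := by
    rw [integral_eq_lintegral_of_nonneg_ae (ae_of_all _ hprod0) hprodm.aestronglyMeasurable]
    exact ENNReal.toReal_le_of_le_ofReal ha0.le hlt
  have hpt (y) : φ y + (Real.log (lik μ q G n y x) - Real.log (lik μ q' G' n y x)) ≤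
      a⁻¹ * (Real.exp (φ y) * ρ y) + (Real.log a - 1) := by
    have h1 := Real.log_le_sub_one_of_pos
      (show 0 < a⁻¹ * (Real.exp (φ y) * ρ y) from
        mul_pos (inv_pos.2 ha0) (mul_pos (Real.exp_pos _) (hρ0 y)))
    rw [Real.log_mul (inv_pos.2 ha0).ne' (mul_pos (Real.exp_pos _) (hρ0 y)).ne',
      Real.log_mul (Real.exp_pos _).ne' (hρ0 y).ne', Real.log_exp, Real.log_inv, hρ,
      Real.log_div (lik_pos_and_le (μ := μ) hq hG n y x).1.ne'
        (lik_pos_and_le (μ := μ) hq' hG' n y x).1.ne'] at h1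
    linarith
  have hfin := integral_mono ((hind t Q').add hi) ((hprodi.const_mul a⁻¹).add
    (integrable_const (Real.log a - 1))) hpt
  simp only [Pi.add_apply] at hfin
  rw [integral_add (hind t Q') hi, integral_add (hprodi.const_mul a⁻¹) (integrable_const _),
    integral_const_mul, integral_const, probReal_univ, one_smul] at hfin
  have h8 : ∫ y, φ y ∂Q' = t * Q'.real E := hφi Q'
  rw [hφ] at h8
  have h9 : a⁻¹ * ∫ y, Real.exp (φ y) * ρ y ∂Q' ≤ 1 := by
    rw [inv_mul_le_iff₀ ha0, mul_one]; exact hprodI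
  rw [h8] at hfin
  linarith

/-- If the relative entropies of the laws of `n` observations are bounded, then the laws of the
observations agree. -/
lemma IsChainLaw.integral_eq_of_bounded_entropy (h : IsChainLaw μ ν q G π R)
    (h' : IsChainLaw μ ν q' G' π' R') [IsProbabilityMeasure π] [IsProbabilityMeasure π']
    [IsProbabilityMeasure (obsMarginal R)] [IsProbabilityMeasure (obsMarginal R')]
    (hq : IsMixing c C q) (hG : IsEmission A G) (hq' : IsMixing c C q') (hG' : IsEmission A G')
    {κ K κ' K' : ℝ} (hQ : IsMixingLaw κ K (obsMarginal R))
    (hQ' : IsMixingLaw κ' K' (obsMarginal R'))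
    {k : ℝ} (hk : ∀ n,
      Integrable (fun y => Real.log (lik μ q G n y x) - Real.log (lik μ q' G' n y x))
        (obsMarginal R') ∧
      -k ≤ ∫ y, (Real.log (lik μ q G n y x) - Real.log (lik μ q' G' n y x)) ∂(obsMarginal R'))
    {J : ℕ} {f : (ℕ → 𝒴) → ℝ} (hf : Measurable f) (hJ : DependsOn f (Iio (J + 1)))
    {B : ℝ} (hB : ∀ y, |f y| ≤ B) :
    ∫ y, f y ∂(obsMarginal R) = ∫ y, f y ∂(obsMarginal R') := by
  by_contra hne
  have : Nonempty 𝒳 := ⟨x⟩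
  set Q := obsMarginal R
  set Q' := obsMarginal R'
  set b := ∫ y, f y ∂Q
  set a := ∫ y, f y ∂Q'
  have hf2 (Q : Measure (ℕ → 𝒴)) [IsProbabilityMeasure Q] : MemLp f 2 Q :=
    MemLp.of_bound hf.aestronglyMeasurable B (ae_of_all _ hB)
  have havm (n) : Measurable (seqAverage f n) :=
    (Finset.measurable_fun_sum _ fun i _ =>
      hf.comp (measurable_pi_iff.2 fun k => measurable_pi_apply _)).const_mul _
  set δ := |b - a| / 2 with hδ
  have hδ0 : 0 < δ := half_pos (abs_pos.2 (sub_ne_zero.2 hne))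
  set E : ℕ → Set (ℕ → 𝒴) := fun n => {y | dist (seqAverage f n y) a < δ} with hE
  have hEm (n) : MeasurableSet (E n) :=
    measurableSet_lt ((havm n).dist measurable_const) measurable_const
  have t1 := tendstoInMeasure_iff_measureReal_dist.1 (tendstoInMeasure_of_tendsto_ae
    (fun n => (havm n).aestronglyMeasurable) (hQ.tendsto_seqAverage hf hJ (hf2 Q))) δ hδ0
  have t2 := tendstoInMeasure_iff_measureReal_dist.1 (tendstoInMeasure_of_tendsto_ae
    (fun n => (havm n).aestronglyMeasurable) (hQ'.tendsto_seqAverage hf hJ (hf2 Q'))) δ hδ0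
  have t3 : Tendsto (fun n => Q.real (E n)) atTop (𝓝 0) := by
    refine squeeze_zero (fun _ => measureReal_nonneg) (fun n => measureReal_mono ?_) t1
    intro y hy
    have hy' : dist (seqAverage f n y) a < δ := hy
    have h1 : δ ≤ dist (seqAverage f n y) b := by
      have h2 := dist_triangle_left b a (seqAverage f n y)
      rw [Real.dist_eq b a] at h2
      linarith
    exact h1
  have t4 : Tendsto (fun n => Q'.real (E n)) atTop (𝓝 1) := by
    have e : ∀ n, Q'.real (E n) = 1 - Q'.real {y | δ ≤ dist (seqAverage f n y) a} := fun n => by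
      have e1 : {y | δ ≤ dist (seqAverage f n y) a} = (E n)ᶜ := by
        ext y
        exact (not_lt (a := dist (seqAverage f n y) a) (b := δ)).symm
      rw [e1, probReal_compl_eq_one_sub (hEm n)]
      ring
    simp only [e]
    simpa using t2.const_sub 1
  have bound (t : ℝ) (ht : 0 ≤ t) : t ≤ k + Real.log ((C / c) ^ 2) := by
    have hlim1 : Tendsto (fun n => t * Q'.real (E n)) atTop (𝓝 (t * 1)) := t4.const_mul t
    have hpos : 0 < (C / c) ^ 2 := pow_pos (div_pos hq.upper_pos hq.pos) 2
    have hlim2 : Tendsto (fun n => k + Real.log ((C / c) ^ 2 *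
        (1 + (Real.exp t - 1) * Q.real (E n)))) atTop
        (𝓝 (k + Real.log ((C / c) ^ 2 * (1 + (Real.exp t - 1) * 0)))) :=
      (((((t3.const_mul _).const_add 1).const_mul _).log (by simpa using hpos.ne')).const_add k)
    simp only [mul_one, mul_zero, add_zero] at hlim1 hlim2
    refine le_of_tendsto_of_tendsto' hlim1 hlim2 fun n => ?_
    obtain ⟨i1, i2⟩ := hk (n + (J + 1))
    refine h.mul_measureReal_le h' hq hG hq' hG' (n + (J + 1)) (hEm n) (fun y y' hy => ?_) i1 i2 ht
    have : seqAverage f n y = seqAverage f n y' := by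
      rw [seqAverage, seqAverage]
      congr 1
      refine Finset.sum_congr rfl fun i hi => hJ fun j hj => hy _ ?_
      have := Finset.mem_range.1 hi
      simp only [mem_Iio] at hj ⊢
      omega
    simp only [hE, mem_ofPred_eq, this]
  have := bound (|k + Real.log ((C / c) ^ 2)| + 1) (by positivity)
  linarith [le_abs_self (k + Real.log ((C / c) ^ 2))]

end Identification


section Calculus

variable {V : Type*} [NormedAddCommGroup V] [NormedSpace ℝ V]
  {E : Type*} [NormedAddCommGroup E] [NormedSpace ℝ E]

/-- A mean value inequality along Lipschitz paths. -/
lemma abs_sub_le_of_lipschitz_path {f : V → ℝ} {f' : V → V →L[ℝ] ℝ} {γ : ℝ → V} {L : ℝ≥0} {b : ℝ}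
    (hγ : LipschitzOnWith L γ (Icc 0 1)) (hf : ∀ t ∈ Icc (0 : ℝ) 1, HasFDerivAt f (f' (γ t)) (γ t))
    (hb : ∀ t ∈ Icc (0 : ℝ) 1, ‖f' (γ t)‖ ≤ b) : |f (γ 1) - f (γ 0)| ≤ L * b := by
  have hb0 : 0 ≤ b := (norm_nonneg _).trans (hb 0 (by simp))
  have hc : ContinuousOn (fun t => f (γ t)) (Icc 0 1) := fun t ht =>
    (hf t ht).continuousAt.comp_continuousWithinAt (hγ.continuousOn t ht)
  have key := image_le_of_liminf_slope_right_le_deriv_boundary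
    (f := fun t => |f (γ t) - f (γ 0)|) (B := fun t => L * b * t) (B' := fun _ => L * b)
    (a := 0) (b := 1) ((hc.sub continuousOn_const).abs) (by simp) (by fun_prop)
    (fun t _ => by simpa using ((hasDerivAt_id t).const_mul ((L : ℝ) * b)).hasDerivWithinAt) ?_
    (show (1 : ℝ) ∈ Icc 0 1 by simp)
  · simpa using key
  · intro t ht r hr
    have htI : t ∈ Icc (0 : ℝ) 1 := Ico_subset_Icc_self ht
    set δ := (r - L * b) / (L + 1) with hδ
    have hL0 : (0 : ℝ) ≤ L := L.2
    have hδ0 : 0 < δ := div_pos (by linarith) (by linarith)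
    have h1 : ∀ᶠ v in 𝓝 (γ t), ‖f v - f (γ t) - f' (γ t) (v - γ t)‖ ≤ δ * ‖v - γ t‖ :=
      (hasFDerivAt_iff_isLittleO.1 (hf t htI)).def hδ0
    have h4 : ∀ᶠ s in 𝓝[>] t, s ∈ Icc (0 : ℝ) 1 := by
      filter_upwards [Ioo_mem_nhdsGT ht.2] with s hs using ⟨ht.1.trans hs.1.le, hs.2.le⟩
    have h2 : Tendsto γ (𝓝[>] t) (𝓝 (γ t)) :=
      Tendsto.mono_left (hγ.continuousOn t htI) (nhdsWithin_le_of_mem h4)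
    refine Eventually.frequently ?_
    filter_upwards [h2.eventually h1, h4, self_mem_nhdsWithin] with s hs hsI hst
    have hst' : 0 < s - t := sub_pos.2 hst
    have h5 : ‖γ s - γ t‖ ≤ L * (s - t) := by
      have := hγ.dist_le_mul s hsI t htI
      rwa [dist_eq_norm, Real.dist_eq, abs_of_pos hst'] at this
    have h6 : |f (γ s) - f (γ t)| ≤ (b + δ) * (L * (s - t)) := by
      have h7 := norm_add_le (f (γ s) - f (γ t) - f' (γ t) (γ s - γ t)) (f' (γ t) (γ s - γ t))
      rw [sub_add_cancel, Real.norm_eq_abs] at h7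
      have h8 := ((f' (γ t)).le_opNorm (γ s - γ t)).trans
        (mul_le_mul_of_nonneg_right (hb t htI) (norm_nonneg _))
      have h9 : (b + δ) * ‖γ s - γ t‖ ≤ (b + δ) * (L * (s - t)) :=
        mul_le_mul_of_nonneg_left h5 (by linarith)
      linarith
    rw [slope_def_field, div_lt_iff₀ hst']
    have h10 : (b + δ) * L < r := by
      have : δ * (L + 1) = r - L * b := by rw [hδ]; field_simp
      nlinarith
    have h11 := abs_sub_abs_le_abs_sub (f (γ s) - f (γ 0)) (f (γ t) - f (γ 0))
    rw [sub_sub_sub_cancel_right] at h11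
    have h12 : (b + δ) * (L * (s - t)) < r * (s - t) := by
      rw [← mul_assoc]; exact mul_lt_mul_of_pos_right h10 hst'
    linarith

/-- Interpolation: a small function with Lipschitz derivative has a small derivative. -/
lemma norm_deriv_le_of_small_of_osc {h : V → E} {h' : V → V →L[ℝ] E} {θ : V} {r δ K : ℝ}
    (hd : ∀ v ∈ Metric.ball θ r, HasFDerivAt h (h' v) v)
    (hδ : ∀ v ∈ Metric.ball θ r, ‖h v‖ ≤ δ)
    (hK : ∀ v ∈ Metric.ball θ r, ‖h' v - h' θ‖ ≤ K) {t : ℝ} (ht : 0 < t) (htr : t < r) :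
    ‖h' θ‖ ≤ 2 * δ / t + K := by
  have hr : 0 < r := ht.trans htr
  have hK0 : 0 ≤ K := (norm_nonneg _).trans (hK θ (Metric.mem_ball_self hr))
  have hδ0 : 0 ≤ δ := (norm_nonneg _).trans (hδ θ (Metric.mem_ball_self hr))
  have key (v : V) (hv : ‖v‖ = t) : ‖h' θ v‖ ≤ (2 * δ / t + K) * ‖v‖ := by
    have hmem : θ + v ∈ Metric.ball θ r := by
      rw [Metric.mem_ball, dist_eq_norm, add_sub_cancel_left, hv]; exact htr
    have h1 := (convex_ball θ r).norm_image_sub_le_of_norm_hasFDerivWithin_le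
      (f := fun v => h v - h' θ v) (f' := fun v => h' v - h' θ) (C := K)
      (fun v hv => ((hd v hv).sub (h' θ).hasFDerivAt).hasFDerivWithinAt) hK
      (Metric.mem_ball_self hr) hmem
    rw [add_sub_cancel_left] at h1
    have e : h' θ v = (h (θ + v) - h θ) - ((h (θ + v) - h' θ (θ + v)) - (h θ - h' θ θ)) := by
      rw [map_add]; abel
    rw [e]
    have h2 := norm_sub_le (h (θ + v) - h θ) ((h (θ + v) - h' θ (θ + v)) - (h θ - h' θ θ))
    have h3 := norm_sub_le (h (θ + v)) (h θ)
    have h4 := hδ _ hmem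
    have h5 := hδ θ (Metric.mem_ball_self hr)
    have : (2 * δ / t + K) * ‖v‖ = 2 * δ + K * ‖v‖ := by rw [hv]; field_simp
    linarith
  refine ContinuousLinearMap.opNorm_le_bound _ (by positivity) fun v => ?_
  rcases eq_or_ne v 0 with rfl | hv
  · simp
  · have hv' : 0 < ‖v‖ := norm_pos_iff.2 hv
    have hn : ‖(t / ‖v‖) • v‖ = t := by
      rw [norm_smul, Real.norm_of_nonneg (by positivity), div_mul_cancel₀ _ hv'.ne']
    have h1 := key ((t / ‖v‖) • v) hn
    rw [map_smul, norm_smul, norm_smul, mul_left_comm] at h1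
    exact le_of_mul_le_mul_left h1 (by rw [Real.norm_of_nonneg (by positivity)]; positivity)

/-- Second order symmetric differences. -/
lemma norm_symm_diff_le {f : V → E} (hf : Differentiable ℝ f) (hf' : Differentiable ℝ (fderiv ℝ f))
    {y z : V} {ε K : ℝ} (hz : ‖z‖ ≤ ε)
    (hK : ∀ v ∈ Metric.closedBall (0 : V) ε, ‖iteratedFDeriv ℝ 2 f (y + v)‖ ≤ K) :
    ‖f (y + z) + f (y - z) - (2 : ℝ) • f y‖ ≤ 2 * K * ‖z‖ ^ 2 := by
  have hε : 0 ≤ ε := (norm_nonneg z).trans hz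
  have hK0 : 0 ≤ K := (norm_nonneg _).trans (hK 0 (by simpa using hε))
  have hball (s : ℝ) (hs : s ∈ Icc (0 : ℝ) 1) : y + s • z ∈ Metric.closedBall y ε ∧
      y - s • z ∈ Metric.closedBall y ε := by
    have h1 : ‖s • z‖ ≤ ε := by
      rw [norm_smul, Real.norm_of_nonneg hs.1]
      nlinarith [norm_nonneg z, hs.2]
    rw [Metric.mem_closedBall, Metric.mem_closedBall, dist_eq_norm, dist_eq_norm,
      add_sub_cancel_left, sub_sub_cancel_left, norm_neg]
    exact ⟨h1, h1⟩
  have hlip (u v : V) (hu : u ∈ Metric.closedBall y ε) (hv : v ∈ Metric.closedBall y ε) :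
      ‖fderiv ℝ f v - fderiv ℝ f u‖ ≤ K * ‖v - u‖ := by
    refine (convex_closedBall y ε).norm_image_sub_le_of_norm_fderiv_le (𝕜 := ℝ)
      (fun x _ => hf' x) (fun x hx => ?_) hu hv
    have h1 := hK (x - y) (by
      rw [Metric.mem_closedBall, dist_zero_right]; rwa [Metric.mem_closedBall, dist_eq_norm] at hx)
    rw [add_sub_cancel, ← norm_iteratedFDeriv_fderiv, norm_iteratedFDeriv_one] at h1
    exact h1
  have hder (s : ℝ) : HasDerivAt (fun s : ℝ => f (y + s • z) + f (y - s • z))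
      (fderiv ℝ f (y + s • z) z - fderiv ℝ f (y - s • z) z) s := by
    have e1 : HasDerivAt (fun s : ℝ => y + s • z) z s := by
      simpa using ((hasDerivAt_id s).smul_const z).const_add y
    have e2 : HasDerivAt (fun s : ℝ => y - s • z) (-z) s := by
      simpa using ((hasDerivAt_id s).smul_const z).const_sub y
    have h1 := (hf _).hasFDerivAt.comp_hasDerivAt s e1
    have h2 := (hf _).hasFDerivAt.comp_hasDerivAt s e2
    rw [map_neg] at h2
    rw [sub_eq_add_neg]
    exact h1.add h2
  have h1 := (convex_Icc (0 : ℝ) 1).norm_image_sub_le_of_norm_hasDerivWithin_le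
    (f := fun s : ℝ => f (y + s • z) + f (y - s • z)) (C := 2 * K * ‖z‖ ^ 2)
    (fun s _ => (hder s).hasDerivWithinAt) (fun s hs => ?_)
    (show (0 : ℝ) ∈ Icc 0 1 by simp) (show (1 : ℝ) ∈ Icc 0 1 by simp)
  · simpa [two_smul] using h1
  · rw [← _root_.sub_apply]
    refine (ContinuousLinearMap.le_opNorm _ _).trans ?_
    have h2 := hlip _ _ (hball s hs).2 (hball s hs).1
    have h3 : ‖y + s • z - (y - s • z)‖ ≤ 2 * ‖z‖ := by
      have : y + s • z - (y - s • z) = (2 * s) • z := by rw [mul_smul, two_smul]; abel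
      rw [this, norm_smul, Real.norm_of_nonneg (by linarith [hs.1])]
      exact mul_le_mul_of_nonneg_right (by linarith [hs.2]) (norm_nonneg _)
    calc _ ≤ (K * (2 * ‖z‖)) * ‖z‖ := mul_le_mul_of_nonneg_right
          (h2.trans (mul_le_mul_of_nonneg_left h3 hK0)) (norm_nonneg _)
      _ = _ := by ring

lemma norm_sub_le_of_fderiv_le {f : V → E} (hf : Differentiable ℝ f) {y z : V} {ε K : ℝ}
    (hz : ‖z‖ ≤ ε) (hK : ∀ v ∈ Metric.closedBall (0 : V) ε, ‖fderiv ℝ f (y + v)‖ ≤ K) :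
    ‖f (y + z) - f y‖ ≤ K * ‖z‖ := by
  have h := (convex_closedBall y ε).norm_image_sub_le_of_norm_fderiv_le (𝕜 := ℝ) (f := f) (C := K)
    (fun x _ => hf x) (fun x hx => ?_) (Metric.mem_closedBall_self ((norm_nonneg _).trans hz))
    (show y + z ∈ Metric.closedBall y ε by
      rw [Metric.mem_closedBall, dist_eq_norm, add_sub_cancel_left]; exact hz)
  · simpa using h
  · have h1 := hK (x - y) (by
      rw [Metric.mem_closedBall, dist_zero_right]; rwa [Metric.mem_closedBall, dist_eq_norm] at hx)
    rwa [add_sub_cancel] at h1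

end Calculus

section MeasurableDerivatives

variable {d : ℕ} {W : Type*} [MeasurableSpace W]
  {E : Type*} [NormedAddCommGroup E] [NormedSpace ℝ E]

lemma clm_eq_sum_smulRight (L : Euc d →L[ℝ] E) :
    L = ∑ i, (EuclideanSpace.proj (𝕜 := ℝ) i : Euc d →L[ℝ] ℝ).smulRight
      (L (EuclideanSpace.single i (1 : ℝ))) := by
  ext v
  have hv : v = ∑ i, v i • EuclideanSpace.single i (1 : ℝ) := by
    have := (EuclideanSpace.basisFun (Fin d) ℝ).sum_repr v
    simpa using this.symm
  conv_lhs => rw [hv]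
  simp

lemma stronglyMeasurable_clm {f : W → Euc d →L[ℝ] E}
    (hf : ∀ v, StronglyMeasurable fun w => f w v) : StronglyMeasurable f := by
  have e : f = fun w => ∑ i, ContinuousLinearMap.smulRightL ℝ (Euc d) E
      (EuclideanSpace.proj (𝕜 := ℝ) i) (f w (EuclideanSpace.single i (1 : ℝ))) := by
    funext w
    exact clm_eq_sum_smulRight (f w)
  rw [e]
  exact Finset.stronglyMeasurable_fun_sum _ fun i _ =>
    (ContinuousLinearMap.continuous _).comp_stronglyMeasurable (hf _)

/-- Derivatives in a parameter inherit measurability. -/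
lemma stronglyMeasurable_fderiv_param {O : Set (Euc d)} (hO : IsOpen O) {f : Euc d → W → E}
    {f' : Euc d → W → Euc d →L[ℝ] E} (hf : ∀ θ ∈ O, StronglyMeasurable (f θ))
    (hd : ∀ θ ∈ O, ∀ w, HasFDerivAt (fun t => f t w) (f' θ w) θ) {θ : Euc d} (hθ : θ ∈ O) :
    StronglyMeasurable (f' θ) := by
  classical
  refine stronglyMeasurable_clm fun v => ?_
  have hpt (n : ℕ) : StronglyMeasurable fun w =>
      if θ + ((n : ℝ) + 1)⁻¹ • v ∈ O then
        ((n : ℝ) + 1) • (f (θ + ((n : ℝ) + 1)⁻¹ • v) w - f θ w) else 0 := by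
    split_ifs with h
    · exact ((hf _ h).sub (hf θ hθ)).const_smul _
    · exact stronglyMeasurable_const
  refine stronglyMeasurable_of_tendsto atTop hpt ?_
  rw [tendsto_pi_nhds]
  intro w
  have ht : Tendsto (fun n : ℕ => ((n : ℝ) + 1)⁻¹) atTop (𝓝 0) := by
    simpa using tendsto_one_div_add_atTop_nhds_zero_nat (𝕜 := ℝ)
  have h0 : Tendsto (fun n : ℕ => ((n : ℝ) + 1)⁻¹ • v) atTop (𝓝 0) := by
    simpa using ht.smul_const v
  have hc : Tendsto (fun n : ℕ => ((n : ℝ) + 1) • ((n : ℝ) + 1)⁻¹ • v) atTop (𝓝 v) := by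
    refine tendsto_const_nhds.congr fun n => ?_
    rw [smul_smul, mul_inv_cancel₀ (by positivity), one_smul]
  have hlim := (hd θ hθ w).hasFDerivWithinAt (s := univ) |>.lim h0 (by simp) hc
  refine hlim.congr' ?_
  have hin : Tendsto (fun n : ℕ => θ + ((n : ℝ) + 1)⁻¹ • v) atTop (𝓝 θ) := by
    simpa using h0.const_add θ
  filter_upwards [hin.eventually (hO.mem_nhds hθ)] with n hn
  have hn' : θ + ((n : ℝ) + 1)⁻¹ • v ∈ O := hn
  rw [if_pos hn']

end MeasurableDerivatives

section LogDerivatives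

variable {V : Type*} [NormedAddCommGroup V] [NormedSpace ℝ V] {W : Type*}

/-- The gradient of `log f`. -/
def logGrad (f : V → W → ℝ) (θ : V) (w : W) : V →L[ℝ] ℝ := fderiv ℝ (fun t => Real.log (f t w)) θ

/-- The second derivative of `log f`. -/
def logHess (f : V → W → ℝ) (θ : V) (w : W) : V →L[ℝ] V →L[ℝ] ℝ :=
  fderiv ℝ (fun t => logGrad f t w) θ

variable {f : V → W → ℝ} {θ : V} {w : W}

lemma norm_logGrad_eq : ‖logGrad f θ w‖ = ‖iteratedFDeriv ℝ 1 (fun t => Real.log (f t w)) θ‖ :=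
  (norm_iteratedFDeriv_one _).symm

lemma norm_logHess_eq : ‖logHess f θ w‖ = ‖iteratedFDeriv ℝ 2 (fun t => Real.log (f t w)) θ‖ := by
  rw [← norm_iteratedFDeriv_fderiv, norm_iteratedFDeriv_one]
  rfl

lemma norm_fderiv_logHess_eq : ‖fderiv ℝ (fun t => logHess f t w) θ‖ =
    ‖iteratedFDeriv ℝ 3 (fun t => Real.log (f t w)) θ‖ := by
  rw [← norm_iteratedFDeriv_fderiv, ← norm_iteratedFDeriv_fderiv, norm_iteratedFDeriv_one]
  rfl

lemma contDiffAt_log_three (hp : 0 < f θ w) (hf : ContDiffAt ℝ 3 (fun t => f t w) θ) :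
    ContDiffAt ℝ 3 (fun t => Real.log (f t w)) θ := hf.log hp.ne'

lemma contDiffAt_logGrad (hp : 0 < f θ w) (hf : ContDiffAt ℝ 3 (fun t => f t w) θ) :
    ContDiffAt ℝ 2 (fun t => logGrad f t w) θ :=
  (contDiffAt_log_three hp hf).fderiv_right (by norm_num)

lemma contDiffAt_logHess (hp : 0 < f θ w) (hf : ContDiffAt ℝ 3 (fun t => f t w) θ) :
    ContDiffAt ℝ 1 (fun t => logHess f t w) θ :=
  (contDiffAt_logGrad hp hf).fderiv_right (by norm_num)

lemma hasFDerivAt_log_density (hp : 0 < f θ w) (hf : ContDiffAt ℝ 3 (fun t => f t w) θ) :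
    HasFDerivAt (fun t => Real.log (f t w)) (logGrad f θ w) θ :=
  ((contDiffAt_log_three hp hf).differentiableAt (by norm_num)).hasFDerivAt

lemma hasFDerivAt_density (hp : 0 < f θ w) (hf : ContDiffAt ℝ 3 (fun t => f t w) θ) :
    HasFDerivAt (fun t => f t w) (f θ w • logGrad f θ w) θ := by
  have h1 : HasFDerivAt (fun t => f t w) (fderiv ℝ (fun t => f t w) θ) θ :=
    (hf.differentiableAt (by norm_num)).hasFDerivAt
  have h2 := (hasFDerivAt_log_density hp hf).unique (h1.log hp.ne')
  rw [h2, smul_smul, mul_inv_cancel₀ hp.ne', one_smul]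
  exact h1

lemma hasFDerivAt_logGrad (hp : 0 < f θ w) (hf : ContDiffAt ℝ 3 (fun t => f t w) θ) :
    HasFDerivAt (fun t => logGrad f t w) (logHess f θ w) θ :=
  ((contDiffAt_logGrad hp hf).differentiableAt (by norm_num)).hasFDerivAt

lemma hasFDerivAt_logHess (hp : 0 < f θ w) (hf : ContDiffAt ℝ 3 (fun t => f t w) θ) :
    HasFDerivAt (fun t => logHess f t w) (fderiv ℝ (fun t => logHess f t w) θ) θ :=
  ((contDiffAt_logHess hp hf).differentiableAt (by norm_num)).hasFDerivAt

end LogDerivatives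

section MeasurableLogDerivatives

variable {d : ℕ} {W : Type*} [MeasurableSpace W] {O : Set (Euc d)} {f : Euc d → W → ℝ}

lemma stronglyMeasurable_logGrad (hO : IsOpen O) (hm : ∀ θ ∈ O, Measurable (f θ))
    (hp : ∀ θ ∈ O, ∀ w, 0 < f θ w) (hf : ∀ θ ∈ O, ∀ w, ContDiffAt ℝ 3 (fun t => f t w) θ)
    {θ : Euc d} (hθ : θ ∈ O) : StronglyMeasurable (logGrad f θ) :=
  stronglyMeasurable_fderiv_param hO (f := fun t w => Real.log (f t w))
    (fun θ hθ => (hm θ hθ).log.stronglyMeasurable)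
    (fun θ hθ w => hasFDerivAt_log_density (hp θ hθ w) (hf θ hθ w)) hθ

lemma stronglyMeasurable_logHess (hO : IsOpen O) (hm : ∀ θ ∈ O, Measurable (f θ))
    (hp : ∀ θ ∈ O, ∀ w, 0 < f θ w) (hf : ∀ θ ∈ O, ∀ w, ContDiffAt ℝ 3 (fun t => f t w) θ)
    {θ : Euc d} (hθ : θ ∈ O) : StronglyMeasurable (logHess f θ) :=
  stronglyMeasurable_fderiv_param hO (f := logGrad f)
    (fun _ hθ => stronglyMeasurable_logGrad hO hm hp hf hθ)
    (fun θ hθ w => hasFDerivAt_logGrad (hp θ hθ w) (hf θ hθ w)) hθ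

end MeasurableLogDerivatives


section BallAverages

variable {m : ℕ} {E : Type*} [NormedAddCommGroup E] [NormedSpace ℝ E]

/-- The identity on the closed unit ball, zero elsewhere. -/
def unitClip (z : Euc m) : Euc m := (Metric.closedBall 0 1).indicator id z

/-- The uniform distribution on the closed unit ball. -/
def ballMeasure (m : ℕ) : Measure (Euc m) :=
  ProbabilityTheory.cond volume (Metric.closedBall (0 : Euc m) 1)

lemma volume_unitBall_ne_zero : volume (Metric.closedBall (0 : Euc m) 1) ≠ 0 :=
  (Metric.measure_closedBall_pos _ _ one_pos).ne'

instance : IsProbabilityMeasure (ballMeasure m) :=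
  ProbabilityTheory.cond_isProbabilityMeasure_of_finite volume_unitBall_ne_zero
    measure_closedBall_lt_top.ne

lemma norm_unitClip_le (z : Euc m) : ‖unitClip z‖ ≤ 1 := by
  by_cases h : z ∈ Metric.closedBall (0 : Euc m) 1
  · rw [unitClip, indicator_of_mem h]
    simpa using h
  · rw [unitClip, indicator_of_notMem h]
    simp

lemma norm_smul_unitClip_le {ε : ℝ} (hε : 0 ≤ ε) (z : Euc m) : ‖ε • unitClip z‖ ≤ ε := by
  rw [norm_smul, Real.norm_of_nonneg hε]
  exact mul_le_of_le_one_right hε (norm_unitClip_le z)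

lemma measurable_unitClip : Measurable (unitClip : Euc m → Euc m) :=
  measurable_id.indicator Metric.isClosed_closedBall.measurableSet

lemma integral_ballMeasure (f : Euc m → E) : ∫ z, f z ∂(ballMeasure m) =
    (volume.real (Metric.closedBall (0 : Euc m) 1))⁻¹ • ∫ z in Metric.closedBall 0 1, f z := by
  rw [ballMeasure, ProbabilityTheory.cond, integral_smul_measure, ENNReal.toReal_inv]
  rfl

lemma integral_unitClip_neg (f : Euc m → E) :
    ∫ z, f (-unitClip z) ∂(ballMeasure m) = ∫ z, f (unitClip z) ∂(ballMeasure m) := by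
  rw [integral_ballMeasure, integral_ballMeasure]
  congr 1
  have h := (Measure.measurePreserving_neg (volume : Measure (Euc m))).setIntegral_preimage_emb
    (MeasurableEquiv.neg (Euc m)).measurableEmbedding (fun z => f (unitClip z))
    (Metric.closedBall 0 1)
  have h1 : (fun z : Euc m => -z) ⁻¹' Metric.closedBall 0 1 = Metric.closedBall 0 1 := by
    ext z; simp
  rw [h1] at h
  rw [← h]
  refine setIntegral_congr_fun Metric.isClosed_closedBall.measurableSet fun z hz => ?_
  have hz' : -z ∈ Metric.closedBall (0 : Euc m) 1 := by simpa using hz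
  simp only [unitClip, indicator_of_mem hz, indicator_of_mem hz', id]

lemma setAverage_closedBall_eq (f : Euc m → ℝ) (y : Euc m) {ε : ℝ} (hε : 0 < ε) :
    ⨍ y' in Metric.closedBall y ε, f y' = ∫ z, f (y + ε • unitClip z) ∂(ballMeasure m) := by
  rw [setAverage_eq, integral_ballMeasure]
  have h1 : ∫ z in Metric.closedBall (0 : Euc m) 1, f (y + ε • unitClip z) =
      ∫ z in Metric.closedBall (0 : Euc m) 1, f (y + ε • z) :=
    setIntegral_congr_fun Metric.isClosed_closedBall.measurableSet fun z hz => by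
      simp only [unitClip, indicator_of_mem hz, id]
  have h2 := Measure.setIntegral_comp_smul_of_pos (volume : Measure (Euc m)) (fun w => f (y + w))
    (Metric.closedBall 0 1) hε
  rw [smul_unitClosedBall, Real.norm_of_nonneg hε.le] at h2
  have h3 := (measurePreserving_add_left (volume : Measure (Euc m)) y).setIntegral_preimage_emb
    (MeasurableEquiv.addLeft y).measurableEmbedding f (Metric.closedBall y ε)
  have h4 : (fun w : Euc m => y + w) ⁻¹' Metric.closedBall y ε = Metric.closedBall 0 ε := by
    ext z; simp [dist_eq_norm]
  rw [h4] at h3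
  rw [h1, h2, h3, smul_smul, measureReal_def, measureReal_def, Measure.addHaar_closedBall' _ _ hε.le,
    ENNReal.toReal_mul, ENNReal.toReal_ofReal (by positivity), mul_inv_rev]

/-- Symmetrisation of averages over balls. -/
lemma norm_integral_unitClip_sub_le [CompleteSpace E] {f : Euc m → E} {y : Euc m} {ε K : ℝ}
    (hε : 0 ≤ ε) (hK0 : 0 ≤ K) (hf : Integrable (fun z => f (y + ε • unitClip z)) (ballMeasure m))
    (hf' : Integrable (fun z => f (y - ε • unitClip z)) (ballMeasure m))
    (hK : ∀ v : Euc m, ‖v‖ ≤ ε → ‖f (y + v) + f (y - v) - (2 : ℝ) • f y‖ ≤ 2 * K * ‖v‖ ^ 2) :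
    ‖∫ z, f (y + ε • unitClip z) ∂(ballMeasure m) - f y‖ ≤ ε ^ 2 * K := by
  have h1 : ∫ z, f (y - ε • unitClip z) ∂(ballMeasure m) =
      ∫ z, f (y + ε • unitClip z) ∂(ballMeasure m) := by
    rw [← integral_unitClip_neg fun v => f (y + ε • v)]
    simp only [smul_neg, sub_eq_add_neg]
  have h2 : ∫ z, (f (y + ε • unitClip z) + f (y - ε • unitClip z) - (2 : ℝ) • f y)
      ∂(ballMeasure m) = (2 : ℝ) • (∫ z, f (y + ε • unitClip z) ∂(ballMeasure m) - f y) := by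
    have h4 : Integrable (fun z => f (y + ε • unitClip z) + f (y - ε • unitClip z))
      (ballMeasure m) := hf.add hf'
    rw [integral_sub h4 (integrable_const _), integral_add hf hf', h1, integral_const,
      probReal_univ, one_smul, smul_sub, two_smul, two_smul]
  have h3 : ‖∫ z, (f (y + ε • unitClip z) + f (y - ε • unitClip z) - (2 : ℝ) • f y)
      ∂(ballMeasure m)‖ ≤ 2 * (ε ^ 2 * K) := by
    refine (norm_integral_le_of_norm_le_const (C := 2 * (ε ^ 2 * K))
      (ae_of_all _ fun z => ?_)).trans (by simp)
    have hz := norm_smul_unitClip_le hε z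
    refine (hK _ hz).trans ?_
    have := mul_le_mul_of_nonneg_right (pow_le_pow_left₀ (norm_nonneg _) hz 2) hK0
    linarith
  rw [h2, norm_smul, Real.norm_of_nonneg zero_le_two] at h3
  linarith

end BallAverages


lemma stronglyMeasurable_wcov {α Z F F₂ : Type*} [MeasurableSpace α] [MeasurableSpace Z]
    [NormedAddCommGroup F] [NormedSpace ℝ F] [NormedAddCommGroup F₂] [NormedSpace ℝ F₂]
    {μ : Measure Z} [IsFiniteMeasure μ] {B : F →L[ℝ] F →L[ℝ] F₂} {a : α → Z → ℝ} {f : α → Z → F}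
    (ha : StronglyMeasurable fun p : α × Z => a p.1 p.2)
    (hf : StronglyMeasurable fun p : α × Z => f p.1 p.2) :
    StronglyMeasurable fun t => wcov μ B (a t) (f t) :=
  have h := stronglyMeasurable_wavg (μ := μ) ha hf
  (stronglyMeasurable_wavg ha (B.continuous₂.comp_stronglyMeasurable (hf.prodMk hf))).sub
    (B.continuous₂.comp_stronglyMeasurable (h.prodMk h))

namespace HMMFamily

variable {𝒳 : Type*} [MeasurableSpace 𝒳] {d m : ℕ} (M : HMMFamily 𝒳 d m)

/-- The emission densities as functions of the parameter and the pair of observation and state. -/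
def dens (θ : Euc d) (p : Euc m × 𝒳) : ℝ := M.g θ p.1 p.2

/-- The transition densities as functions of the parameter and the pair of states. -/
def trans (θ : Euc d) (p : 𝒳 × 𝒳) : ℝ := M.q θ p.1 p.2

/-- Smoothness and uniform bounds. -/
structure Regular (c C : ℝ) : Prop where
  smooth : M.A2
  pos : 0 < c
  lower : ∀ θ ∈ M.Θ, ∀ x x', c ≤ M.q θ x x'
  upper : ∀ θ ∈ M.Θ, ∀ x x', M.q θ x x' ≤ C
  g_pos : ∀ θ ∈ M.Θ, ∀ y x, 0 < M.g θ y x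
  g_le : ∀ θ ∈ M.Θ, ∀ y x, M.g θ y x ≤ C
  q_grad : ∀ θ ∈ M.Θ, ∀ p, ‖logGrad M.trans θ p‖ ≤ C
  q_hess : ∀ θ ∈ M.Θ, ∀ p, ‖logHess M.trans θ p‖ ≤ C
  diff : ∀ θ ∈ M.Θ, ∀ x, Differentiable ℝ (fun y => M.g θ y x)
  diff_grad : ∀ θ ∈ M.Θ, ∀ x, Differentiable ℝ (M.gradG θ x)
  diff₂ : ∀ θ ∈ M.Θ, ∀ x, Differentiable ℝ (fderiv ℝ (fun y => M.g θ y x))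
  diff_grad₂ : ∀ θ ∈ M.Θ, ∀ x, Differentiable ℝ (fderiv ℝ (M.gradG θ x))

/-- Bounds near `y` for the first two derivatives of the log-densities. -/
structure LogBound (K b₁ b₂ : ℝ) (y : Euc m) : Prop where
  grad : ∀ θ ∈ M.Θ, ∀ x, ∀ z : Euc m, ‖z‖ ≤ K → ‖logGrad M.dens θ (y + z, x)‖ ≤ b₁
  hess : ∀ θ ∈ M.Θ, ∀ x, ∀ z : Euc m, ‖z‖ ≤ K → ‖logHess M.dens θ (y + z, x)‖ ≤ b₂

/-- Bounds near `y` for third derivatives of the log-densities, and for derivatives in the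
observation. -/
structure PertBound (R β β' : ℝ) (y : Euc m) : Prop where
  third : ∃ b, ∀ θ ∈ M.Θ, ∀ x, ∀ z : Euc m, ‖z‖ ≤ R →
    ‖fderiv ℝ (fun t => logHess M.dens t (y + z, x)) θ‖ ≤ b
  lip : ∃ b, ∀ θ ∈ M.Θ, ∀ x, ∀ z : Euc m, ‖z‖ ≤ R →
    ‖fderiv ℝ (fun y' => M.g θ y' x) (y + z)‖ ≤ b * M.g θ y x
  lip_grad : ∃ b, ∀ θ ∈ M.Θ, ∀ x, ∀ z : Euc m, ‖z‖ ≤ R →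
    ‖fderiv ℝ (M.gradG θ x) (y + z)‖ ≤ b * M.g θ y x
  snd : ∀ θ ∈ M.Θ, ∀ x, ∀ z : Euc m, ‖z‖ ≤ R →
    ‖iteratedFDeriv ℝ 2 (fun y' => M.g θ y' x) (y + z)‖ ≤ β * M.g θ y x
  snd_grad : ∀ θ ∈ M.Θ, ∀ x, ∀ z : Euc m, ‖z‖ ≤ R →
    ‖iteratedFDeriv ℝ 2 (M.gradG θ x) (y + z)‖ ≤ β' * M.g θ y x

/-- The gradient of the logarithm of the perturbed density. -/
def pertScore (ε : ℝ) (θ : Euc d) (y : Euc m) (x : 𝒳) : Euc d →L[ℝ] ℝ :=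
  wavg (ballMeasure m) (fun z => M.dens θ (y + ε • unitClip z, x))
    (fun z => logGrad M.dens θ (y + ε • unitClip z, x))

/-- The second derivative of the logarithm of the perturbed density. -/
def pertHess (ε : ℝ) (θ : Euc d) (y : Euc m) (x : 𝒳) : Euc d →L[ℝ] Euc d →L[ℝ] ℝ :=
  wavg (ballMeasure m) (fun z => M.dens θ (y + ε • unitClip z, x))
    (fun z => logHess M.dens θ (y + ε • unitClip z, x)) +
  wcov (ballMeasure m) (formTensor (Euc d)) (fun z => M.dens θ (y + ε • unitClip z, x))
    (fun z => logGrad M.dens θ (y + ε • unitClip z, x))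

variable {M} {c C K b₁ b₂ R β β' ε : ℝ} {θ : Euc d} {y : Euc m} {x : 𝒳}

lemma measurable_shift_arg (ε : ℝ) (x : 𝒳) (y : Euc m) :
    Measurable fun z : Euc m => (y + ε • unitClip z, x) :=
  ((measurable_unitClip.const_smul ε).const_add y).prodMk measurable_const

lemma measurable_shift_arg₂ (ε : ℝ) :
    Measurable fun p : (Euc m × 𝒳) × Euc m => (p.1.1 + ε • unitClip p.2, p.1.2) :=
  ((measurable_fst.comp measurable_fst).add
    ((measurable_unitClip.comp measurable_snd).const_smul ε)).prodMk
      (measurable_snd.comp measurable_fst)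

lemma pertG_eq (hε : 0 ≤ ε) :
    M.pertG ε θ y x = ∫ z, M.dens θ (y + ε • unitClip z, x) ∂(ballMeasure m) := by
  rcases hε.eq_or_lt with rfl | h
  · simp [pertG, dens]
  · rw [pertG, if_neg h.ne', setAverage_closedBall_eq _ _ h]
    rfl

namespace Regular

variable (hM : M.Regular c C)
include hM

lemma isMixing (hθ : θ ∈ M.Θ) : IsMixing c C (M.q θ) :=
  ⟨M.measurable_q θ hθ, hM.pos, hM.lower θ hθ, hM.upper θ hθ⟩

lemma isEmission_g (hθ : θ ∈ M.Θ) : IsEmission C (M.g θ) :=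
  ⟨M.measurable_g θ hθ, hM.g_pos θ hθ, hM.g_le θ hθ⟩

lemma dens_pos (hθ : θ ∈ M.Θ) (p : Euc m × 𝒳) : 0 < M.dens θ p := hM.g_pos θ hθ _ _

lemma isWeight (hθ : θ ∈ M.Θ) (ε : ℝ) (y : Euc m) (x : 𝒳) :
    IsWeight fun z => M.dens θ (y + ε • unitClip z, x) where
  meas := ((M.measurable_g θ hθ).comp (measurable_shift_arg ε x y)).stronglyMeasurable
  bdd := ⟨C, fun z => by
    rw [Real.norm_of_nonneg (hM.dens_pos hθ _).le]; exact hM.g_le θ hθ _ _⟩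
  pos z := hM.g_pos θ hθ _ _

lemma pertG_pos (hε : 0 ≤ ε) (hθ : θ ∈ M.Θ) (y : Euc m) (x : 𝒳) : 0 < M.pertG ε θ y x := by
  rw [pertG_eq hε]
  exact (hM.isWeight hθ ε y x).integral_pos

lemma isEmission (hε : 0 ≤ ε) (hθ : θ ∈ M.Θ) : IsEmission C (M.pertG ε θ) where
  meas := by
    have e : Function.uncurry (M.pertG ε θ) = fun p : Euc m × 𝒳 =>
        ∫ z, M.dens θ (p.1 + ε • unitClip z, p.2) ∂(ballMeasure m) := by
      funext p
      exact pertG_eq hε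
    rw [e]
    exact (StronglyMeasurable.integral_prod_right (ν := ballMeasure m)
      (f := fun (p : Euc m × 𝒳) z => M.dens θ (p.1 + ε • unitClip z, p.2)) ((M.measurable_g θ hθ).comp
        (measurable_shift_arg₂ ε)).stronglyMeasurable).measurable
  pos y x := hM.pertG_pos hε hθ y x
  le y x := by
    rw [pertG_eq hε]
    have h := integral_mono (hM.isWeight hθ ε y x).integrable (integrable_const C)
      (fun z => hM.g_le θ hθ (y + ε • unitClip z) x) (μ := ballMeasure m)
    rwa [integral_const, probReal_univ, one_smul] at h

lemma contDiffAt_dens (hθ : θ ∈ M.Θ) (p : Euc m × 𝒳) : ContDiffAt ℝ 3 (fun t => M.dens t p) θ :=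
  hM.smooth.2 p.1 p.2 θ hθ

lemma stronglyMeasurable_logGrad_dens (hθ : θ ∈ interior M.Θ) :
    StronglyMeasurable (logGrad M.dens θ) :=
  stronglyMeasurable_logGrad isOpen_interior
    (fun t ht => M.measurable_g t (interior_subset ht))
    (fun _ ht _ => hM.dens_pos (interior_subset ht) _)
    (fun _ ht p => hM.contDiffAt_dens (interior_subset ht) p) hθ

lemma stronglyMeasurable_logHess_dens (hθ : θ ∈ interior M.Θ) :
    StronglyMeasurable (logHess M.dens θ) :=
  stronglyMeasurable_logHess isOpen_interior
    (fun t ht => M.measurable_g t (interior_subset ht))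
    (fun _ ht _ => hM.dens_pos (interior_subset ht) _)
    (fun _ ht p => hM.contDiffAt_dens (interior_subset ht) p) hθ

lemma smoothWeights (hε : 0 ≤ ε) (hεK : ε ≤ K) (hy : M.LogBound K b₁ b₂ y) (x : 𝒳) :
    SmoothWeights (interior M.Θ) C b₁ b₂ (fun θ z => M.dens θ (y + ε • unitClip z, x))
      (fun θ z => logGrad M.dens θ (y + ε • unitClip z, x))
      (fun θ z => logHess M.dens θ (y + ε • unitClip z, x)) where
  isOpen := isOpen_interior
  weight _ hθ := hM.isWeight (interior_subset hθ) ε y x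
  le θ hθ _ := hM.g_le θ (interior_subset hθ) _ _
  meas _ hθ := (hM.stronglyMeasurable_logGrad_dens hθ).comp_measurable (measurable_shift_arg ε x y)
  bound θ hθ z := hy.grad θ (interior_subset hθ) x _ ((norm_smul_unitClip_le hε z).trans hεK)
  meas₂ _ hθ := (hM.stronglyMeasurable_logHess_dens hθ).comp_measurable (measurable_shift_arg ε x y)
  bound₂ θ hθ z := hy.hess θ (interior_subset hθ) x _ ((norm_smul_unitClip_le hε z).trans hεK)
  deriv _ hθ _ := hasFDerivAt_density (hM.dens_pos (interior_subset hθ) _)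
    (hM.contDiffAt_dens (interior_subset hθ) _)
  deriv₂ _ hθ _ := hasFDerivAt_logGrad (hM.dens_pos (interior_subset hθ) _)
    (hM.contDiffAt_dens (interior_subset hθ) _)

lemma hasFDerivAt_pertG (hε : 0 ≤ ε) (hεK : ε ≤ K) (hy : M.LogBound K b₁ b₂ y) (x : 𝒳)
    (hθ : θ ∈ interior M.Θ) :
    HasFDerivAt (fun t => M.pertG ε t y x) (M.pertG ε θ y x • M.pertScore ε θ y x) θ := by
  simp only [pertG_eq hε]
  exact (hM.smoothWeights hε hεK hy x).hasFDerivAt_integral hθ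

lemma hasFDerivAt_pertScore (hε : 0 ≤ ε) (hεK : ε ≤ K) (hy : M.LogBound K b₁ b₂ y) (x : 𝒳)
    (hθ : θ ∈ interior M.Θ) :
    HasFDerivAt (fun t => M.pertScore ε t y x) (M.pertHess ε θ y x) θ :=
  (hM.smoothWeights hε hεK hy x).hasFDerivAt_wavg hθ

lemma norm_pertScore_le (hε : 0 ≤ ε) (hεK : ε ≤ K) (hy : M.LogBound K b₁ b₂ y) (x : 𝒳)
    (hθ : θ ∈ M.Θ) : ‖M.pertScore ε θ y x‖ ≤ b₁ :=
  norm_wavg_le (hM.isWeight hθ ε y x) fun z =>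
    hy.grad θ hθ x _ ((norm_smul_unitClip_le hε z).trans hεK)

lemma norm_pertHess_le (hε : 0 ≤ ε) (hεK : ε ≤ K) (hy : M.LogBound K b₁ b₂ y) (x : 𝒳)
    (hθ : θ ∈ M.Θ) : ‖M.pertHess ε θ y x‖ ≤ b₂ + 2 * b₁ ^ 2 :=
  (norm_add_le _ _).trans (add_le_add
    (norm_wavg_le (hM.isWeight hθ ε y x) fun z =>
      hy.hess θ hθ x _ ((norm_smul_unitClip_le hε z).trans hεK))
    (norm_wcov_le isTensor_formTensor (hM.isWeight hθ ε y x) fun z =>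
      hy.grad θ hθ x _ ((norm_smul_unitClip_le hε z).trans hεK)))

lemma stronglyMeasurable_pertScore (hθ : θ ∈ interior M.Θ) :
    StronglyMeasurable fun p : Euc m × 𝒳 => M.pertScore ε θ p.1 p.2 :=
  stronglyMeasurable_wavg
    (((M.measurable_g θ (interior_subset hθ)).comp (measurable_shift_arg₂ ε)).stronglyMeasurable)
    ((hM.stronglyMeasurable_logGrad_dens hθ).comp_measurable (measurable_shift_arg₂ ε))

lemma stronglyMeasurable_pertHess (hθ : θ ∈ interior M.Θ) :
    StronglyMeasurable fun p : Euc m × 𝒳 => M.pertHess ε θ p.1 p.2 := by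
  have h0 := ((M.measurable_g θ (interior_subset hθ)).comp
    (measurable_shift_arg₂ (𝒳 := 𝒳) (m := m) ε)).stronglyMeasurable
  have h1 := (hM.stronglyMeasurable_logGrad_dens hθ).comp_measurable (measurable_shift_arg₂ ε)
  have h2 := (hM.stronglyMeasurable_logHess_dens hθ).comp_measurable (measurable_shift_arg₂ ε)
  exact (stronglyMeasurable_wavg
    (a := fun (p : Euc m × 𝒳) z => M.dens θ (p.1 + ε • unitClip z, p.2))
    (f := fun p z => logHess M.dens θ (p.1 + ε • unitClip z, p.2)) h0 h2).add
    (stronglyMeasurable_wcov (a := fun (p : Euc m × 𝒳) z => M.dens θ (p.1 + ε • unitClip z, p.2))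
      (f := fun p z => logGrad M.dens θ (p.1 + ε • unitClip z, p.2)) h0 h1)

/-! ### Comparison of parameters -/

lemma exists_dens_le_exp_mul : ∃ L : ℝ, 0 ≤ L ∧ ∀ (K b₁ b₂ : ℝ) (y z : Euc m) (x : 𝒳),
    M.LogBound K b₁ b₂ y → ‖z‖ ≤ K → ∀ θ ∈ M.Θ, ∀ θ' ∈ M.Θ,
      M.dens θ (y + z, x) ≤ Real.exp (L * b₁) * M.dens θ' (y + z, x) := by
  obtain ⟨L, hL⟩ := M.connected_param
  refine ⟨L, L.2, fun K b₁ b₂ y z x hy hz θ hθ θ' hθ' => ?_⟩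
  obtain ⟨γ, h1, h2, h3, h4⟩ := hL θ' hθ' θ hθ
  have h5 := abs_sub_le_of_lipschitz_path (f := fun t => Real.log (M.dens t (y + z, x)))
    (f' := fun t => logGrad M.dens t (y + z, x)) h1
    (fun t ht => hasFDerivAt_log_density (hM.g_pos _ (h2 ht) _ _) (hM.contDiffAt_dens (h2 ht) _))
    (fun t ht => hy.grad _ (h2 ht) x z hz)
  rw [h3, h4] at h5
  have p1 : 0 < M.dens θ (y + z, x) := hM.g_pos θ hθ _ _
  have p2 : 0 < M.dens θ' (y + z, x) := hM.g_pos θ' hθ' _ _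
  rw [← Real.log_le_log_iff p1 (mul_pos (Real.exp_pos _) p2),
    Real.log_mul (Real.exp_pos _).ne' p2.ne', Real.log_exp]
  linarith [le_abs_self (Real.log (M.dens θ (y + z, x)) - Real.log (M.dens θ' (y + z, x)))]

lemma exists_pertG_le_exp_mul : ∃ L : ℝ, 0 ≤ L ∧ ∀ (ε K b₁ b₂ : ℝ) (y : Euc m) (x : 𝒳), 0 ≤ ε →
    ε ≤ K → M.LogBound K b₁ b₂ y → ∀ θ ∈ M.Θ, ∀ θ' ∈ M.Θ,
      M.pertG ε θ y x ≤ Real.exp (L * b₁) * M.pertG ε θ' y x := by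
  obtain ⟨L, hL0, hL⟩ := hM.exists_dens_le_exp_mul
  refine ⟨L, hL0, fun ε K b₁ b₂ y x hε hεK hy θ hθ θ' hθ' => ?_⟩
  rw [pertG_eq hε, pertG_eq hε]
  exact weight_ratio_le_of_le (hM.isWeight hθ ε y x).toBddMeas (hM.isWeight hθ' ε y x).toBddMeas
    fun z => hL K b₁ b₂ y _ x hy ((norm_smul_unitClip_le hε z).trans hεK) θ hθ θ' hθ'

/-! ### Second order accuracy of the perturbation -/

lemma gradG_eq (hθ : θ ∈ M.Θ) (y : Euc m) (x : 𝒳) :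
    M.gradG θ x y = M.dens θ (y, x) • logGrad M.dens θ (y, x) :=
  (hasFDerivAt_density (f := M.dens) (w := (y, x)) (hM.g_pos θ hθ _ _)
    (hM.contDiffAt_dens hθ _)).fderiv

lemma abs_pertG_sub_le (hy : M.PertBound R β β' y) (hε : 0 ≤ ε) (hεR : ε ≤ R) (hθ : θ ∈ M.Θ)
    (x : 𝒳) : |M.pertG ε θ y x - M.g θ y x| ≤ ε ^ 2 * (β * M.g θ y x) := by
  have hK := hy.snd θ hθ x
  rw [pertG_eq hε]
  refine norm_integral_unitClip_sub_le (f := fun y' => M.g θ y' x) hε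
    ((norm_nonneg _).trans (hK 0 (by simpa using hε.trans hεR)))
    (hM.isWeight hθ ε y x).integrable ?_ fun v hv => ?_
  · have := (hM.isWeight hθ (-ε) y x).integrable (μ := ballMeasure m)
    simpa only [neg_smul, ← sub_eq_add_neg, dens] using this
  · exact norm_symm_diff_le (hM.diff θ hθ x) (hM.diff₂ θ hθ x) (hv.trans hεR)
      fun v hv => hK v (by simpa using hv)

lemma ratioBound_pertG (hy : M.PertBound R β β' y) (hβ : 0 ≤ β) (hε : 0 ≤ ε) (hεR : ε ≤ R)
    (hθ : θ ∈ M.Θ) (h1 : ε ^ 2 * (4 * β) < 1) :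
    RatioBound (M.pertG 0 θ y) (M.pertG ε θ y) (ε ^ 2 * (4 * β)) := by
  intro z w
  have e (x : 𝒳) : M.pertG 0 θ y x = M.g θ y x := by simp [pertG]
  rw [e, e]
  have hz := abs_le.1 (hM.abs_pertG_sub_le hy hε hεR hθ z)
  have hw := abs_le.1 (hM.abs_pertG_sub_le hy hε hεR hθ w)
  have pz := hM.g_pos θ hθ y z
  have pw := hM.g_pos θ hθ y w
  set η := ε ^ 2 * β with hη
  have hη0 : 0 ≤ η := by positivity
  have e4 : ε ^ 2 * (4 * β) = 4 * η := by rw [hη]; ring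
  have e5 (t : ℝ) : ε ^ 2 * (β * t) = η * t := by rw [hη]; ring
  rw [e4] at h1 ⊢
  rw [e5] at hz hw
  have i1 : M.pertG ε θ y z * M.g θ y w ≤ (1 + η) * (M.g θ y z * M.g θ y w) := by
    have := mul_le_mul_of_nonneg_right (show M.pertG ε θ y z ≤ (1 + η) * M.g θ y z by linarith) pw.le
    linarith
  have i2 : (1 - η) * (M.g θ y z * M.g θ y w) ≤ M.pertG ε θ y w * M.g θ y z := by
    have := mul_le_mul_of_nonneg_right (show (1 - η) * M.g θ y w ≤ M.pertG ε θ y w by linarith) pz.le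
    linarith
  have i3 := mul_le_mul_of_nonneg_left i2 (show 0 ≤ 1 + 4 * η by linarith)
  have i4 : (1 + η) * (M.g θ y z * M.g θ y w) ≤
      (1 + 4 * η) * ((1 - η) * (M.g θ y z * M.g θ y w)) := by
    rw [← mul_assoc (1 + 4 * η)]
    exact mul_le_mul_of_nonneg_right (by nlinarith) (mul_pos pz pw).le
  linarith

lemma norm_pertScore_sub_le (hy : M.PertBound R β β' y) (hy' : M.LogBound K b₁ b₂ y) (hε : 0 ≤ ε)
    (hεR : ε ≤ R) (hεK : ε ≤ K) (hθ : θ ∈ interior M.Θ) (x : 𝒳) :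
    ‖M.pertScore ε θ y x - M.pertScore 0 θ y x‖ ≤ ε ^ 2 * (β' + β * b₁) := by
  have hθ' := interior_subset hθ
  have hK := hy.snd_grad θ hθ' x
  have w := hM.isWeight hθ' ε y x
  have g0 := hM.g_pos θ hθ' y x
  have hI (δ : ℝ) (hδ : |δ| ≤ K) :
      Integrable (fun z => M.gradG θ x (y + δ • unitClip z)) (ballMeasure m) := by
    simp only [hM.gradG_eq hθ']
    refine BddMeas.integrable ((hM.isWeight hθ' δ y x).toBddMeas.smul
      ⟨(hM.stronglyMeasurable_logGrad_dens hθ).comp_measurable (measurable_shift_arg δ x y), b₁,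
        fun z => hy'.grad θ hθ' x _ ?_⟩)
    rw [norm_smul, Real.norm_eq_abs]
    exact (mul_le_of_le_one_right (abs_nonneg _) (norm_unitClip_le z)).trans hδ
  have h1 : ‖∫ z, M.gradG θ x (y + ε • unitClip z) ∂(ballMeasure m) - M.gradG θ x y‖ ≤
      ε ^ 2 * (β' * M.g θ y x) := by
    refine norm_integral_unitClip_sub_le hε
      ((norm_nonneg _).trans (hK 0 (by simpa using hε.trans hεR)))
      (hI ε (by rwa [abs_of_nonneg hε])) ?_ fun v hv => ?_
    · have := hI (-ε) (by rwa [abs_neg, abs_of_nonneg hε])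
      simpa only [neg_smul, ← sub_eq_add_neg] using this
    · exact norm_symm_diff_le (hM.diff_grad θ hθ' x) (hM.diff_grad₂ θ hθ' x) (hv.trans hεR)
        fun v hv => hK v (by simpa using hv)
  have e0 : M.pertScore 0 θ y x = logGrad M.dens θ (y, x) := by
    simp only [pertScore, zero_smul, add_zero]
    exact wavg_const ⟨BddMeas.const _, fun _ => g0⟩ _
  have e1 : ∫ z, M.gradG θ x (y + ε • unitClip z) ∂(ballMeasure m) =
      M.pertG ε θ y x • M.pertScore ε θ y x := by
    simp only [hM.gradG_eq hθ', pertScore, wavg, pertG_eq hε]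
    rw [smul_smul, mul_inv_cancel₀ w.integral_pos.ne', one_smul]
  rw [e1, hM.gradG_eq hθ', ← e0] at h1
  have h2 := hM.abs_pertG_sub_le hy hε hεR hθ' x
  have h3 := hM.norm_pertScore_le hε hεK hy' x hθ'
  have e2 : M.g θ y x • (M.pertScore ε θ y x - M.pertScore 0 θ y x) =
      (M.pertG ε θ y x • M.pertScore ε θ y x - M.dens θ (y, x) • M.pertScore 0 θ y x) -
        (M.pertG ε θ y x - M.g θ y x) • M.pertScore ε θ y x := by
    rw [sub_smul, smul_sub, dens]; abel
  have h4 : M.g θ y x * ‖M.pertScore ε θ y x - M.pertScore 0 θ y x‖ ≤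
      ε ^ 2 * (β' * M.g θ y x) + ε ^ 2 * (β * M.g θ y x) * b₁ := by
    rw [← abs_of_pos g0, ← Real.norm_eq_abs, ← norm_smul, e2, Real.norm_eq_abs, abs_of_pos g0]
    refine (norm_sub_le _ _).trans (add_le_add h1 ?_)
    rw [norm_smul]
    exact mul_le_mul h2 h3 (norm_nonneg _) ((abs_nonneg _).trans h2)
  refine le_of_mul_le_mul_left (h4.trans (le_of_eq ?_)) g0
  ring

/-! ### Continuity of the perturbation -/

variable {ι : Type*} {l : Filter ι} {t : ι → Euc d} {θ₀ : Euc d} {v : ι → Euc m}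

lemma tendsto_dens_left (ht : Tendsto t l (𝓝 θ₀)) (hθ₀ : θ₀ ∈ M.Θ) (p : Euc m × 𝒳) :
    Tendsto (fun k => M.dens (t k) p) l (𝓝 (M.dens θ₀ p)) :=
  (hM.contDiffAt_dens hθ₀ p).continuousAt.tendsto.comp ht

lemma tendsto_logGrad_left (ht : Tendsto t l (𝓝 θ₀)) (hθ₀ : θ₀ ∈ M.Θ) (p : Euc m × 𝒳) :
    Tendsto (fun k => logGrad M.dens (t k) p) l (𝓝 (logGrad M.dens θ₀ p)) :=
  (contDiffAt_logGrad (hM.dens_pos hθ₀ p)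
    (hM.contDiffAt_dens hθ₀ p)).continuousAt.tendsto.comp ht

lemma tendsto_logHess_left (ht : Tendsto t l (𝓝 θ₀)) (hθ₀ : θ₀ ∈ M.Θ) (p : Euc m × 𝒳) :
    Tendsto (fun k => logHess M.dens (t k) p) l (𝓝 (logHess M.dens θ₀ p)) :=
  (contDiffAt_logHess (hM.dens_pos hθ₀ p)
    (hM.contDiffAt_dens hθ₀ p)).continuousAt.tendsto.comp ht

lemma exists_abs_dens_sub_le (hy : M.PertBound R β β' y) (x : 𝒳) : ∃ D, ∀ θ ∈ M.Θ, ∀ v : Euc m,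
    ‖v‖ ≤ R → |M.dens θ (y + v, x) - M.dens θ (y, x)| ≤ D * M.g θ y x * ‖v‖ := by
  obtain ⟨D, hD⟩ := hy.lip
  exact ⟨D, fun θ hθ v hv => norm_sub_le_of_fderiv_le (hM.diff θ hθ x) hv
    fun z hz => hD θ hθ x z (by simpa using hz)⟩

lemma exists_norm_logGrad_sub_le (hy : M.PertBound R β β' y) (hy' : M.LogBound K b₁ b₂ y)
    (hRK : R ≤ K) (x : 𝒳) : ∃ D, ∀ θ ∈ M.Θ, ∀ v : Euc m,
    ‖v‖ ≤ R → ‖logGrad M.dens θ (y + v, x) - logGrad M.dens θ (y, x)‖ ≤ D * ‖v‖ := by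
  obtain ⟨D, hD⟩ := hM.exists_abs_dens_sub_le hy x
  obtain ⟨D', hD'⟩ := hy.lip_grad
  refine ⟨D' + D * b₁, fun θ hθ v hv => ?_⟩
  have g0 := hM.g_pos θ hθ y x
  have h1 : ‖M.gradG θ x (y + v) - M.gradG θ x y‖ ≤ D' * M.g θ y x * ‖v‖ :=
    norm_sub_le_of_fderiv_le (hM.diff_grad θ hθ x) hv fun z hz => hD' θ hθ x z (by simpa using hz)
  rw [hM.gradG_eq hθ, hM.gradG_eq hθ] at h1
  have h2 := hD θ hθ v hv
  have h3 := hy'.grad θ hθ x v (hv.trans hRK)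
  have e2 : M.g θ y x • (logGrad M.dens θ (y + v, x) - logGrad M.dens θ (y, x)) =
      (M.dens θ (y + v, x) • logGrad M.dens θ (y + v, x) -
        M.dens θ (y, x) • logGrad M.dens θ (y, x)) -
        (M.dens θ (y + v, x) - M.dens θ (y, x)) • logGrad M.dens θ (y + v, x) := by
    rw [sub_smul, smul_sub]; simp only [dens]; abel
  have h4 : M.g θ y x * ‖logGrad M.dens θ (y + v, x) - logGrad M.dens θ (y, x)‖ ≤
      D' * M.g θ y x * ‖v‖ + D * M.g θ y x * ‖v‖ * b₁ := by
    rw [← abs_of_pos g0, ← Real.norm_eq_abs, ← norm_smul, e2, Real.norm_eq_abs, abs_of_pos g0]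
    refine (norm_sub_le _ _).trans (add_le_add h1 ?_)
    rw [norm_smul]
    exact mul_le_mul h2 h3 (norm_nonneg _) ((abs_nonneg _).trans h2)
  refine le_of_mul_le_mul_left (h4.trans (le_of_eq ?_)) g0
  ring

lemma tendsto_dens (hy : M.PertBound R β β' y) (ht : Tendsto t l (𝓝 θ₀)) (htΘ : ∀ k, t k ∈ M.Θ)
    (hθ₀ : θ₀ ∈ M.Θ) (hv : Tendsto v l (𝓝 0)) (hvR : ∀ k, ‖v k‖ ≤ R) (x : 𝒳) :
    Tendsto (fun k => M.dens (t k) (y + v k, x)) l (𝓝 (M.dens θ₀ (y, x))) := by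
  obtain ⟨D, hD⟩ := hM.exists_abs_dens_sub_le hy x
  have h0 := hM.tendsto_dens_left ht hθ₀ (y, x)
  have h1 : Tendsto (fun k => D * M.dens (t k) (y, x) * ‖v k‖) l (𝓝 0) := by
    simpa using (h0.const_mul D).mul hv.norm
  have h2 := squeeze_zero_norm (f := fun k => M.dens (t k) (y + v k, x) - M.dens (t k) (y, x))
    (fun k => hD (t k) (htΘ k) (v k) (hvR k)) h1
  simpa using h2.add h0

lemma tendsto_logGrad (hy : M.PertBound R β β' y) (hy' : M.LogBound K b₁ b₂ y) (hRK : R ≤ K)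
    (ht : Tendsto t l (𝓝 θ₀)) (htΘ : ∀ k, t k ∈ M.Θ)
    (hθ₀ : θ₀ ∈ M.Θ) (hv : Tendsto v l (𝓝 0)) (hvR : ∀ k, ‖v k‖ ≤ R) (x : 𝒳) :
    Tendsto (fun k => logGrad M.dens (t k) (y + v k, x)) l (𝓝 (logGrad M.dens θ₀ (y, x))) := by
  obtain ⟨D, hD⟩ := hM.exists_norm_logGrad_sub_le hy hy' hRK x
  have h1 : Tendsto (fun k => D * ‖v k‖) l (𝓝 0) := by simpa using hv.norm.const_mul D
  have h2 := squeeze_zero_norm (fun k => hD (t k) (htΘ k) (v k) (hvR k)) h1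
  simpa using h2.add (hM.tendsto_logGrad_left ht hθ₀ (y, x))

lemma tendsto_logHess (hy : M.PertBound R β β' y) (hy' : M.LogBound K b₁ b₂ y) (hRK : R ≤ K)
    (ht : Tendsto t l (𝓝 θ₀)) (hθ₀ : θ₀ ∈ interior M.Θ) (hv : Tendsto v l (𝓝 0))
    (hvR : ∀ k, ‖v k‖ ≤ R) (x : 𝒳) :
    Tendsto (fun k => logHess M.dens (t k) (y + v k, x)) l (𝓝 (logHess M.dens θ₀ (y, x))) := by
  obtain ⟨D, hD⟩ := hM.exists_norm_logGrad_sub_le hy hy' hRK x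
  obtain ⟨b, hb⟩ := hy.third
  obtain ⟨r, hr, hball⟩ := Metric.isOpen_iff.1 isOpen_interior θ₀ hθ₀
  have key : Tendsto (fun k => logHess M.dens (t k) (y + v k, x) - logHess M.dens (t k) (y, x)) l
      (𝓝 0) := by
    rw [tendsto_zero_iff_norm_tendsto_zero, Metric.tendsto_nhds]
    intro δ hδ
    obtain ⟨τ, hτ, hτr, hτδ⟩ : ∃ τ : ℝ, 0 < τ ∧ 2 * τ < r / 2 ∧ 2 * b * (2 * τ) < δ / 2 := by
      refine ⟨min (r / 8) (δ / (8 * (|b| + 1))), by positivity, ?_, ?_⟩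
      · linarith [min_le_left (r / 8) (δ / (8 * (|b| + 1)))]
      · have h1 := min_le_right (r / 8) (δ / (8 * (|b| + 1)))
        rw [le_div_iff₀ (by positivity)] at h1
        have h0 : 0 < min (r / 8) (δ / (8 * (|b| + 1))) := by positivity
        nlinarith [le_abs_self b]
    have h1 : Tendsto (fun k => 2 * (D * ‖v k‖) / τ + 2 * b * (2 * τ)) l
        (𝓝 (2 * (D * ‖(0 : Euc m)‖) / τ + 2 * b * (2 * τ))) :=
      ((((hv.norm.const_mul D).const_mul 2).div_const τ).add_const _)
    rw [norm_zero, mul_zero, mul_zero, zero_div, zero_add] at h1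
    filter_upwards [h1.eventually (gt_mem_nhds (hτδ.trans (half_lt_self hδ))),
      ht.eventually (Metric.ball_mem_nhds θ₀ (half_pos hr))] with k hk hk'
    rw [Real.dist_eq, sub_zero, abs_norm]
    have hin : Metric.ball (t k) (2 * τ) ⊆ interior M.Θ := fun u hu => hball (by
      have h2 := dist_triangle u (t k) θ₀
      have h3 : dist u (t k) < 2 * τ := hu
      have h4 : dist (t k) θ₀ < r / 2 := hk'
      rw [Metric.mem_ball]; linarith)
    refine lt_of_le_of_lt (norm_deriv_le_of_small_of_osc (r := 2 * τ) (δ := D * ‖v k‖)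
      (K := 2 * b * (2 * τ)) (h := fun u => logGrad M.dens u (y + v k, x) - logGrad M.dens u (y, x))
      (h' := fun u => logHess M.dens u (y + v k, x) - logHess M.dens u (y, x))
      (fun u hu => ?_) (fun u hu => hD u (interior_subset (hin hu)) _ (hvR k)) (fun u hu => ?_)
      hτ (by linarith)) hk
    · have hu' := interior_subset (hin hu)
      exact (hasFDerivAt_logGrad (hM.dens_pos hu' _) (hM.contDiffAt_dens hu' _)).sub
        (hasFDerivAt_logGrad (hM.dens_pos hu' _) (hM.contDiffAt_dens hu' _))
    · have hlip (z : Euc m) (hz : ‖z‖ ≤ R) : ‖logHess M.dens u (y + z, x) -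
          logHess M.dens (t k) (y + z, x)‖ ≤ b * (2 * τ) := by
        have hb0 : 0 ≤ b := (norm_nonneg _).trans (hb θ₀ (interior_subset hθ₀) x z hz)
        refine ((convex_ball (t k) (2 * τ)).norm_image_sub_le_of_norm_hasFDerivWithin_le
          (f := fun u => logHess M.dens u (y + z, x))
          (fun w hw => (hasFDerivAt_logHess
            (hM.dens_pos (interior_subset (hin hw)) _)
            (hM.contDiffAt_dens (interior_subset (hin hw)) _)).hasFDerivWithinAt)
          (fun w hw => hb w (interior_subset (hin hw)) x z hz)
          (Metric.mem_ball_self (by linarith)) hu).trans ?_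
        have : ‖u - t k‖ < 2 * τ := by rwa [← dist_eq_norm]
        exact mul_le_mul_of_nonneg_left this.le hb0
      have h5 := hlip (v k) (hvR k)
      have h6 := hlip 0 (by simpa using (norm_nonneg _).trans (hvR k))
      rw [add_zero] at h6
      rw [sub_sub_sub_comm]
      refine (norm_sub_le _ _).trans ?_
      linarith
  simpa using key.add (hM.tendsto_logHess_left ht (interior_subset hθ₀) (y, x))

end Regular

end HMMFamily


lemma FiniteMean.exists_bound {S : Type*} [MeasurableSpace S] {ρ : Measure S} {F : S → ℝ≥0∞}
    (h : FiniteMean ρ F) {p : ℕ} (hp : p ≠ 0) : ∃ b : S → ℝ, Measurable b ∧ (∀ y, 0 ≤ b y) ∧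
      Integrable (fun y => b y ^ p) ρ ∧ ∃ T : Set S, MeasurableSet T ∧ (∀ᵐ y ∂ρ, y ∈ T) ∧
      ∀ y ∈ T, ∀ u, 0 ≤ u → ENNReal.ofReal (u ^ p) ≤ F y → u ≤ b y := by
  obtain ⟨B, hB, hFB, hfin⟩ := h
  have hpow (y : S) : ((B y).toReal ^ (p : ℝ)⁻¹) ^ p = (B y).toReal :=
    Real.rpow_inv_natCast_pow ENNReal.toReal_nonneg hp
  refine ⟨fun y => (B y).toReal ^ (p : ℝ)⁻¹, hB.ennreal_toReal.pow_const _,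
    fun y => Real.rpow_nonneg ENNReal.toReal_nonneg _, ?_, {y | B y < ∞},
    measurableSet_lt hB measurable_const, ae_lt_top hB hfin.ne, fun y hy u hu hFu => ?_⟩
  · simp only [hpow]
    exact integrable_toReal_of_lintegral_ne_top hB.aemeasurable hfin.ne
  · refine le_of_pow_le_pow_left₀ hp (Real.rpow_nonneg ENNReal.toReal_nonneg _) ?_
    rw [hpow]
    exact (ENNReal.ofReal_le_iff_le_toReal (ne_of_lt hy)).1 (hFu.trans (hFB y))

namespace HMMFamily

variable {𝒳 : Type*} [MeasurableSpace 𝒳] {d m : ℕ} (M : HMMFamily 𝒳 d m)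

/-- Integrable bounds for the derivatives of the log-densities. As these bounds hold only almost
everywhere, the observations are first mapped by a function `r` to values at which they hold. -/
structure Majorants (ρ : Measure (Euc m)) (r : Euc m → Euc m) (b₁ b₂ : ℕ → Euc m → ℝ) (R : ℝ)
    (β β' : Euc m → ℝ) : Prop where
  meas : Measurable r
  ae_eq : ∀ᵐ y ∂ρ, r y = y
  log : ∀ (K : ℕ) y, M.LogBound K (b₁ K y) (b₂ K y) (r y)
  meas₁ : ∀ K, Measurable (b₁ K)
  nonneg₁ : ∀ K y, 0 ≤ b₁ K y
  int₁ : ∀ K, Integrable (fun y => b₁ K y ^ 2) ρ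
  meas₂ : ∀ K, Measurable (b₂ K)
  nonneg₂ : ∀ K y, 0 ≤ b₂ K y
  int₂ : ∀ K, Integrable (b₂ K) ρ
  R_pos : 0 < R
  R_le : R ≤ 1
  pert : ∀ y, M.PertBound R (β y) (β' y) (r y)
  measβ : Measurable β
  nonnegβ : ∀ y, 0 ≤ β y
  intβ : Integrable (fun y => β y ^ 2) ρ
  measβ' : Measurable β'
  nonnegβ' : ∀ y, 0 ≤ β' y
  intβ' : Integrable (fun y => β' y ^ 2) ρ

variable {M} {ρ : Measure (Euc m)} {r : Euc m → Euc m} {b₁ b₂ : ℕ → Euc m → ℝ} {R c C : ℝ}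
  {β β' : Euc m → ℝ}

lemma le_supLogDeriv {j p : ℕ} {K : ℝ} {y z : Euc m} {θ : Euc d} {x : 𝒳} (hθ : θ ∈ M.Θ)
    (hz : ‖z‖ ≤ K) : ENNReal.ofReal
      (‖iteratedFDeriv ℝ j (fun t => Real.log (M.dens t (y + z, x))) θ‖ ^ p) ≤
      M.supLogDeriv j p K y :=
  le_iSup₂_of_le θ hθ (le_iSup_of_le x (le_iSup₂_of_le z (by simpa using hz) le_rfl))

lemma integrable_of_pow {b : Euc m → ℝ} [IsFiniteMeasure ρ] (hb : Measurable b) (h0 : ∀ y, 0 ≤ b y)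
    {n : ℕ} (h : Integrable (fun y => b y ^ (n + 1)) ρ) : Integrable (fun y => b y ^ n) ρ := by
  refine ((integrable_const (1 : ℝ)).add h).mono' (hb.pow_const n).aestronglyMeasurable
    (ae_of_all _ fun y => ?_)
  have hp := pow_nonneg (h0 y) n
  rw [Real.norm_of_nonneg hp]
  rcases le_total (b y) 1 with h1 | h1
  · exact (pow_le_one₀ (h0 y) h1).trans (le_add_of_nonneg_right (pow_nonneg (h0 y) _))
  · exact (pow_le_pow_right₀ h1 n.le_succ).trans (le_add_of_nonneg_left zero_le_one)

lemma exists_majorants [IsProbabilityMeasure ρ] (h6 : M.A6 ρ) (h7 : M.A7 ρ) (h8 : M.A8 ρ) :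
    ∃ r b₁ b₂ R β β', M.Majorants ρ r b₁ b₂ R β β' := by
  classical
  obtain ⟨hpos, h6⟩ := h6
  have h6' (K : ℕ) := h6 ((K : ℝ) + 1) (by positivity)
  choose a₁ ma₁ na₁ ia₁ S₁ mS₁ aS₁ hS₁ using fun K => (h6' K).1.exists_bound three_ne_zero
  choose a₂ ma₂ na₂ ia₂ S₂ mS₂ aS₂ hS₂ using fun K => (h6' K).2.1.exists_bound two_ne_zero
  obtain ⟨a₃, -, -, -, S₃, mS₃, aS₃, hS₃⟩ := (h6 1 one_pos).2.2.exists_bound one_ne_zero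
  obtain ⟨-, R₇, hR₇, h7⟩ := h7
  obtain ⟨-, R₈, hR₈, h8⟩ := h8
  set R := min 1 (min R₇ R₈) with hR
  have hR0 : 0 < R := lt_min one_pos (lt_min hR₇ hR₈)
  have h7' := h7 R hR0 ((min_le_right _ _).trans (min_le_left _ _))
  have h8' := h8 R hR0 ((min_le_right _ _).trans (min_le_right _ _))
  obtain ⟨p, -, -, -, T₁, mT₁, aT₁, hT₁⟩ := h7'.1.exists_bound two_ne_zero
  obtain ⟨p', -, -, -, T₂, mT₂, aT₂, hT₂⟩ := h7'.2.exists_bound two_ne_zero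
  obtain ⟨β, mβ, nβ, iβ, T₃, mT₃, aT₃, hT₃⟩ := h8'.1.exists_bound two_ne_zero
  obtain ⟨β', mβ', nβ', iβ', T₄, mT₄, aT₄, hT₄⟩ := h8'.2.exists_bound two_ne_zero
  set S : Set (Euc m) := (⋂ K, (S₁ K ∩ S₂ K)) ∩ S₃ ∩ T₁ ∩ T₂ ∩ T₃ ∩ T₄ with hS
  have mS : MeasurableSet S :=
    (((((MeasurableSet.iInter fun K => (mS₁ K).inter (mS₂ K)).inter mS₃).inter mT₁).inter
      mT₂).inter mT₃).inter mT₄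
  have aS : ∀ᵐ y ∂ρ, y ∈ S := by
    filter_upwards [ae_all_iff.2 aS₁, ae_all_iff.2 aS₂, aS₃, aT₁, aT₂, aT₃, aT₄] with
      y e1 e2 e3 e4 e5 e6 e7
    exact ⟨⟨⟨⟨⟨mem_iInter.2 fun K => ⟨e1 K, e2 K⟩, e3⟩, e4⟩, e5⟩, e6⟩, e7⟩
  obtain ⟨y₀, hy₀⟩ := aS.exists
  set r : Euc m → Euc m := fun y => if y ∈ S then y else y₀ with hr
  have mr : Measurable r := Measurable.ite mS measurable_id measurable_const
  have rS (y) : r y ∈ S := by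
    simp only [hr]; split_ifs with h
    exacts [h, hy₀]
  have ar : ∀ᵐ y ∂ρ, r y = y := by
    filter_upwards [aS] with y hy
    simp only [hr, if_pos hy]
  have hcongr {f : Euc m → ℝ} (hf : Integrable f ρ) : Integrable (fun y => f (r y)) ρ :=
    hf.congr (by filter_upwards [ar] with y hy; rw [hy])
  have hratio {u g b : ℝ} (hg : 0 < g) (h : u / g ≤ b) : u ≤ b * g := (div_le_iff₀ hg).1 h
  have hball {z : Euc m} {K : ℝ} (hz : ‖z‖ ≤ K) : z ∈ Metric.closedBall (0 : Euc m) K := by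
    simpa using hz
  refine ⟨r, fun K y => a₁ K (r y), fun K y => a₂ K (r y), R, fun y => β (r y), fun y => β' (r y),
    mr, ar, fun K y => ?_, fun K => (ma₁ K).comp mr, fun K y => na₁ K _,
    fun K => hcongr (integrable_of_pow (ma₁ K) (na₁ K) (ia₁ K)), fun K => (ma₂ K).comp mr,
    fun K y => na₂ K _, fun K => hcongr (by
      simpa using integrable_of_pow (n := 1) (ma₂ K) (na₂ K) (ia₂ K)),
    hR0, min_le_left _ _, fun y => ?_, mβ.comp mr, fun y => nβ _, hcongr iβ, mβ'.comp mr,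
    fun y => nβ' _, hcongr iβ'⟩
  · obtain ⟨⟨⟨⟨⟨e1, -⟩, -⟩, -⟩, -⟩, -⟩ := rS y
    refine ⟨fun θ hθ x z hz => ?_, fun θ hθ x z hz => ?_⟩
    · rw [norm_logGrad_eq]
      exact hS₁ K _ (mem_iInter.1 e1 K).1 _ (norm_nonneg _)
        (le_supLogDeriv hθ (hz.trans (by linarith)))
    · rw [norm_logHess_eq]
      exact hS₂ K _ (mem_iInter.1 e1 K).2 _ (norm_nonneg _)
        (le_supLogDeriv hθ (hz.trans (by linarith)))
  · obtain ⟨⟨⟨⟨⟨-, e2⟩, e3⟩, e4⟩, e5⟩, e6⟩ := rS y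
    have g0 {θ x} (hθ : θ ∈ M.Θ) := hpos θ hθ (r y) x
    refine ⟨⟨a₃ (r y), fun θ hθ x z hz => ?_⟩,
      ⟨p (r y), fun θ hθ x z hz => hratio (g0 hθ) ?_⟩,
      ⟨p' (r y), fun θ hθ x z hz => hratio (g0 hθ) ?_⟩, fun θ hθ x z hz => hratio (g0 hθ) ?_,
      fun θ hθ x z hz => hratio (g0 hθ) ?_⟩
    · rw [norm_fderiv_logHess_eq]
      exact hS₃ _ e2 _ (norm_nonneg _) (le_supLogDeriv hθ (hz.trans (min_le_left _ _)))
    · exact hT₁ _ e3 _ (div_nonneg (norm_nonneg _) (g0 hθ).le)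
        (le_iSup_of_le x (le_iSup₂_of_le θ hθ (le_iSup₂_of_le z (hball hz) le_rfl)))
    · exact hT₂ _ e4 _ (div_nonneg (norm_nonneg _) (g0 hθ).le)
        (le_iSup_of_le x (le_iSup₂_of_le θ hθ (le_iSup₂_of_le z (hball hz) le_rfl)))
    · exact hT₃ _ e5 _ (div_nonneg (norm_nonneg _) (g0 hθ).le)
        (le_iSup_of_le x (le_iSup₂_of_le θ hθ (le_iSup₂_of_le z (hball hz) le_rfl)))
    · exact hT₄ _ e6 _ (div_nonneg (norm_nonneg _) (g0 hθ).le)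
        (le_iSup_of_le x (le_iSup₂_of_le θ hθ (le_iSup₂_of_le z (hball hz) le_rfl)))

lemma exists_regular (hpos : ∀ θ ∈ M.Θ, ∀ y x, 0 < M.g θ y x) (h2 : M.A2) (h3 : M.A3) (h4 : M.A4)
    (h7 : M.A7 ρ) (h8 : M.A8 ρ) : ∃ c C, M.Regular c C := by
  obtain ⟨c, C, hc, -, h3⟩ := h3
  obtain ⟨C', -, h4⟩ := h4
  refine ⟨c, max C C', h2, hc, fun θ hθ x x' => (h3 θ hθ x x' 0).1,
    fun θ hθ x x' => (h3 θ hθ x x' 0).2.1.trans (le_max_left _ _), hpos,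
    fun θ hθ y x => (h3 θ hθ x x y).2.2.trans (le_max_left _ _), fun θ hθ p => ?_, fun θ hθ p => ?_,
    fun θ hθ x => (h7.1 θ hθ x).1, fun θ hθ x => (h7.1 θ hθ x).2,
    fun θ hθ x => (h8.1 θ hθ x).1, fun θ hθ x => (h8.1 θ hθ x).2⟩
  · rw [norm_logGrad_eq]
    exact (h4 θ hθ p.1 p.2).1.trans (le_max_right _ _)
  · rw [norm_logHess_eq]
    exact (h4 θ hθ p.1 p.2).2.trans (le_max_right _ _)

/-! ### The perturbed model as a smooth family -/

variable (M) in
/-- The perturbed emission density, with observations mapped by `r`. -/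
def emis (r : Euc m → Euc m) (ε : ℝ) (θ : Euc d) (y : Euc m) (x : 𝒳) : ℝ := M.pertG ε θ (r y) x

variable (M) in
/-- The gradient of the logarithm of the product of transition and perturbed emission density. -/
def stepScore (r : Euc m → Euc m) (ε : ℝ) (θ : Euc d) (y : Euc m) (x z : 𝒳) : Euc d →L[ℝ] ℝ :=
  logGrad M.trans θ (x, z) + M.pertScore ε θ (r y) z

variable (M) in
/-- The second derivative of the logarithm of the product of transition and perturbed emission
density. -/
def stepHess (r : Euc m → Euc m) (ε : ℝ) (θ : Euc d) (y : Euc m) (x z : 𝒳) :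
    Euc d →L[ℝ] Euc d →L[ℝ] ℝ :=
  logHess M.trans θ (x, z) + M.pertHess ε θ (r y) z

namespace Regular

variable (hM : M.Regular c C) {θ : Euc d}
include hM

lemma trans_pos (hθ : θ ∈ M.Θ) (p : 𝒳 × 𝒳) : 0 < M.trans θ p := hM.pos.trans_le (hM.lower θ hθ _ _)

lemma contDiffAt_trans (hθ : θ ∈ M.Θ) (p : 𝒳 × 𝒳) : ContDiffAt ℝ 3 (fun t => M.trans t p) θ :=
  hM.smooth.1 p.1 p.2 θ hθ

lemma stronglyMeasurable_logGrad_trans (hθ : θ ∈ interior M.Θ) :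
    StronglyMeasurable (logGrad M.trans θ) :=
  stronglyMeasurable_logGrad isOpen_interior (fun t ht => M.measurable_q t (interior_subset ht))
    (fun _ ht _ => hM.trans_pos (interior_subset ht) _)
    (fun _ ht _ => hM.contDiffAt_trans (interior_subset ht) _) hθ

lemma stronglyMeasurable_logHess_trans (hθ : θ ∈ interior M.Θ) :
    StronglyMeasurable (logHess M.trans θ) :=
  stronglyMeasurable_logHess isOpen_interior (fun t ht => M.measurable_q t (interior_subset ht))
    (fun _ ht _ => hM.trans_pos (interior_subset ht) _)
    (fun _ ht _ => hM.contDiffAt_trans (interior_subset ht) _) hθ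

end Regular

namespace Majorants

variable (hB : M.Majorants ρ r b₁ b₂ R β β') (hM : M.Regular c C) {ε : ℝ} {θ θ' : Euc d} {K : ℕ}
include hB hM

lemma isEmission (hε : 0 ≤ ε) (hθ : θ ∈ M.Θ) : IsEmission C (M.emis r ε θ) where
  meas := by
    have h := (hM.isEmission hε hθ).meas.comp
      ((hB.meas.comp measurable_fst).prodMk (measurable_snd : Measurable (Prod.snd : Euc m × 𝒳 → 𝒳)))
    exact h
  pos y x := hM.pertG_pos hε hθ (r y) x
  le y x := (hM.isEmission hε hθ).le (r y) x

lemma isScore (hε : 0 ≤ ε) (hK : ε ≤ K) (hθ : θ ∈ interior M.Θ) :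
    IsScore (fun y => b₁ K y + C) (M.stepScore r ε θ) where
  meas := by
    have h1 := (hM.stronglyMeasurable_logGrad_trans hθ).comp_measurable
      (measurable_snd : Measurable (Prod.snd : Euc m × 𝒳 × 𝒳 → 𝒳 × 𝒳))
    have h2 := (hM.stronglyMeasurable_pertScore (ε := ε) hθ).comp_measurable
      ((hB.meas.comp measurable_fst).prodMk
        (measurable_snd.comp
          (measurable_snd : Measurable (Prod.snd : Euc m × 𝒳 × 𝒳 → 𝒳 × 𝒳))))
    exact h1.add h2
  le y x z := by
    have h1 := hM.q_grad θ (interior_subset hθ) (x, z)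
    have h2 := hM.norm_pertScore_le hε hK (hB.log K y) z (interior_subset hθ)
    rw [stepScore]
    exact (norm_add_le _ _).trans (by linarith)

lemma isScore₂ (hε : 0 ≤ ε) (hK : ε ≤ K) (hθ : θ ∈ interior M.Θ) :
    IsScore (fun y => b₂ K y + 2 * b₁ K y ^ 2 + C) (M.stepHess r ε θ) where
  meas := by
    have h1 := (hM.stronglyMeasurable_logHess_trans hθ).comp_measurable
      (measurable_snd : Measurable (Prod.snd : Euc m × 𝒳 × 𝒳 → 𝒳 × 𝒳))
    have h2 := (hM.stronglyMeasurable_pertHess (ε := ε) hθ).comp_measurable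
      ((hB.meas.comp measurable_fst).prodMk
        (measurable_snd.comp
          (measurable_snd : Measurable (Prod.snd : Euc m × 𝒳 × 𝒳 → 𝒳 × 𝒳))))
    exact h1.add h2
  le y x z := by
    have h1 := hM.q_hess θ (interior_subset hθ) (x, z)
    have h2 := hM.norm_pertHess_le hε hK (hB.log K y) z (interior_subset hθ)
    rw [stepHess]
    exact (norm_add_le _ _).trans (by linarith)

lemma smoothFamily (hε : 0 ≤ ε) (hK : ε ≤ K) :
    SmoothFamily (interior M.Θ) c C C (fun y => b₁ K y + C)
      (fun y => b₂ K y + 2 * b₁ K y ^ 2 + C) M.q (M.emis r ε) (M.stepScore r ε)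
      (M.stepHess r ε) where
  isOpen := isOpen_interior
  mixing θ hθ := hM.isMixing (interior_subset hθ)
  emission θ hθ := hB.isEmission hM hε (interior_subset hθ)
  isScore θ hθ := hB.isScore hM hε hK hθ
  isScore₂ θ hθ := hB.isScore₂ hM hε hK hθ
  deriv θ hθ y x z := by
    have h1 := hasFDerivAt_density (hM.trans_pos (interior_subset hθ) (x, z))
      (hM.contDiffAt_trans (interior_subset hθ) _)
    have h2 := hM.hasFDerivAt_pertG hε hK (hB.log K y) z hθ
    refine (h1.mul h2).congr_fderiv ?_
    ext v
    simp only [stepScore, emis, trans, add_apply, smul_apply, smul_eq_mul]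
    ring
  deriv₂ θ hθ y x z := by
    have h1 := hasFDerivAt_logGrad (hM.trans_pos (interior_subset hθ) (x, z))
      (hM.contDiffAt_trans (interior_subset hθ) _)
    exact h1.add (hM.hasFDerivAt_pertScore hε hK (hB.log K y) z hθ)

variable {Q : Measure (ℕ → Euc m)} [IsProbabilityMeasure Q]

lemma moments (hQ : MeasurePreserving (fun y : ℕ → Euc m => y 0) Q ρ) (hC : 0 ≤ C) (K : ℕ) :
    Moments Q (fun y => b₁ K y + C) (fun y => b₂ K y + 2 * b₁ K y ^ 2 + C) where
  meas := (hB.meas₁ K).add_const C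
  nonneg y := add_nonneg (hB.nonneg₁ K y) hC
  int := by
    have h1 : MemLp (fun y : ℕ → Euc m => b₁ K (y 0)) 2 Q :=
      (memLp_two_iff_integrable_sq ((hB.meas₁ K).comp hQ.measurable).aestronglyMeasurable).2
        (hQ.integrable_comp_of_integrable (hB.int₁ K))
    exact (h1.add (memLp_const C)).integrable_sq
  meas₂ := ((hB.meas₂ K).add (((hB.meas₁ K).pow_const 2).const_mul 2)).add_const C
  nonneg₂ y := add_nonneg (add_nonneg (hB.nonneg₂ K y) (by positivity)) hC
  int₂ := ((hQ.integrable_comp_of_integrable (hB.int₂ K)).add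
    ((hQ.integrable_comp_of_integrable (hB.int₁ K)).const_mul 2)).add (integrable_const C)

lemma exists_incrBound [NeZero M.μ] : ∃ L : ℝ, ∀ (ε : ℝ) (K : ℕ), 0 ≤ ε → ε ≤ K →
    ∀ θ ∈ M.Θ, ∀ θ' ∈ M.Θ, ∀ x, IncrBound M.μ (M.q θ) (M.q θ') (M.emis r ε θ) (M.emis r ε θ') x
      (fun y => L * b₁ K y + 3 * Real.log (C / c)) := by
  obtain ⟨L, -, hL⟩ := hM.exists_pertG_le_exp_mul
  refine ⟨L, fun ε K hε hK θ hθ θ' hθ' x n y => ?_⟩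
  exact abs_logIncr_sub_le (hM.isMixing hθ) (hB.isEmission hM hε hθ) (hM.isMixing hθ')
    (hB.isEmission hM hε hθ') n y x
    (fun z => hL ε K _ _ (r (y 0)) z hε hK (hB.log K (y 0)) θ hθ θ' hθ')
    (fun z => hL ε K _ _ (r (y 0)) z hε hK (hB.log K (y 0)) θ' hθ' θ hθ)

lemma memLp_incrBound (hQ : MeasurePreserving (fun y : ℕ → Euc m => y 0) Q ρ) (K : ℕ) (L t : ℝ) :
    MemLp (fun y : ℕ → Euc m => L * b₁ K (y 0) + t) 2 Q := by
  have h1 : MemLp (fun y : ℕ → Euc m => b₁ K (y 0)) 2 Q :=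
    (memLp_two_iff_integrable_sq ((hB.meas₁ K).comp hQ.measurable).aestronglyMeasurable).2
      (hQ.integrable_comp_of_integrable (hB.int₁ K))
  exact (h1.const_mul L).add (memLp_const t)

end Majorants

end HMMFamily


section PerturbedMaximisers

variable {V : Type*} [NormedAddCommGroup V] [NormedSpace ℝ V]

/-- A negative definite form on a finite-dimensional space is uniformly negative definite. -/
lemma exists_neg_def_bound [ProperSpace V] {H : V →L[ℝ] V →L[ℝ] ℝ} (hH : ∀ v, v ≠ 0 → H v v < 0) :
    ∃ κ, 0 < κ ∧ ∀ v, H v v ≤ -(2 * κ) * ‖v‖ ^ 2 := by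
  obtain ⟨κ, hκ, hs⟩ : ∃ κ, 0 < κ ∧ ∀ v ∈ Metric.sphere (0 : V) 1, H v v ≤ -(2 * κ) := by
    rcases (Metric.sphere (0 : V) 1).eq_empty_or_nonempty with h | h
    · exact ⟨1, one_pos, fun v hv => by simp [h] at hv⟩
    · obtain ⟨v, hv, hmax⟩ := (isCompact_sphere (0 : V) 1).exists_isMaxOn h
        (f := fun v => H v v) (by fun_prop)
      have hv0 : v ≠ 0 := fun h0 => by simp [h0] at hv
      refine ⟨-(H v v) / 2, by linarith [hH v hv0], fun w hw => ?_⟩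
      have := hmax hw
      simp only [mem_ofPred_eq] at this
      linarith
  refine ⟨κ, hκ, fun v => ?_⟩
  rcases eq_or_ne v 0 with rfl | hv
  · simp
  · have hn : 0 < ‖v‖ := norm_pos_iff.2 hv
    have h1 := hs (‖v‖⁻¹ • v) (by simp [norm_smul, hn.ne'])
    simp only [map_smul, smul_apply, smul_eq_mul] at h1
    have h2 : H v v = ‖v‖ ^ 2 * (‖v‖⁻¹ * (‖v‖⁻¹ * H v v)) := by field_simp
    rw [h2]
    nlinarith [mul_le_mul_of_nonneg_left h1 (sq_nonneg ‖v‖)]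

/-- Maximisers of perturbed strictly concave functions. -/
theorem exists_perturbed_maximiser [ProperSpace V] {S : Set V} (hS : IsCompact S) {θs : V}
    (hθs : θs ∈ interior S) {l : ℝ → V → ℝ} {D : ℝ → V → V →L[ℝ] ℝ} {H : ℝ → V → V →L[ℝ] V →L[ℝ] ℝ}
    {R K : ℝ} (hR : 0 < R)
    (hD : ∀ ε ∈ Icc 0 R, ∀ θ ∈ interior S, HasFDerivAt (l ε) (D ε θ) θ)
    (hH : ∀ ε ∈ Icc 0 R, ∀ θ ∈ interior S, HasFDerivAt (D ε) (H ε θ) θ)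
    (hlε : ∀ ε ∈ Icc 0 R, ContinuousOn (l ε) S)
    (hl : ∀ θ ∈ S, ContinuousWithinAt (fun p : ℝ × V => l p.1 p.2) (Icc 0 R ×ˢ S) (0, θ))
    (hHc : ContinuousWithinAt (fun p : ℝ × V => H p.1 p.2) (Icc 0 R ×ˢ interior S) (0, θs))
    (hmax : ∀ θ ∈ S, θ ≠ θs → l 0 θ < l 0 θs)
    (hK : ∀ ε ∈ Icc 0 R, ‖D ε θs - D 0 θs‖ ≤ ε ^ 2 * K)
    (hneg : ∀ v, v ≠ 0 → H 0 θs v v < 0) :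
    ∃ t : ℝ → V, (∀ᶠ ε in 𝓝[>] (0 : ℝ), IsUniqueMaxOn (l ε) S (t ε)) ∧
      (fun ε => t ε - θs) =O[𝓝[>] (0 : ℝ)] fun ε => ε ^ 2 := by
  obtain ⟨κ, hκ, hκH⟩ := exists_neg_def_bound hneg
  have hS' := interior_subset hθs
  have h0R : (0 : ℝ) ∈ Icc 0 R := ⟨le_rfl, hR.le⟩
  obtain ⟨η, hη, r, hr, hball, hHκ⟩ : ∃ η, 0 < η ∧ ∃ r, 0 < r ∧ Metric.ball θs r ⊆ interior S ∧
      ∀ ε ∈ Icc 0 R, ε < η → ∀ θ ∈ Metric.ball θs r, ‖H ε θ - H 0 θs‖ ≤ κ := by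
    obtain ⟨r₁, hr₁, hb⟩ := Metric.isOpen_iff.1 isOpen_interior θs hθs
    obtain ⟨δ, hδ, hd⟩ := Metric.continuousWithinAt_iff.1 hHc κ hκ
    refine ⟨δ, hδ, min r₁ δ, lt_min hr₁ hδ,
      (Metric.ball_subset_ball (min_le_left _ _)).trans hb, fun ε hε hεη θ hθ => ?_⟩
    have h1 := hd (x := (ε, θ)) ⟨hε, hb (Metric.ball_subset_ball (min_le_left _ _) hθ)⟩ (by
      rw [Prod.dist_eq]
      refine max_lt ?_ (lt_of_lt_of_le hθ (min_le_right _ _))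
      rw [Real.dist_eq, sub_zero, abs_of_nonneg hε.1]
      exact hεη)
    rw [dist_eq_norm] at h1
    exact h1.le
  have hmono (ε) (hε : ε ∈ Icc 0 R) (hεη : ε < η) {θ θ' : V} (hθ : θ ∈ Metric.ball θs r)
      (hθ' : θ' ∈ Metric.ball θs r) :
      (D ε θ - D ε θ') (θ - θ') ≤ -κ * ‖θ - θ'‖ ^ 2 := by
    have h1 := (convex_ball θs r).norm_image_sub_le_of_norm_hasFDerivWithin_le
      (f := fun θ => D ε θ - H 0 θs θ) (f' := fun θ => H ε θ - H 0 θs)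
      (fun u hu => ((hH ε hε u (hball hu)).sub (H 0 θs).hasFDerivAt).hasFDerivWithinAt)
      (hHκ ε hε hεη) hθ' hθ
    have h2 := (ContinuousLinearMap.le_opNorm (D ε θ - H 0 θs θ - (D ε θ' - H 0 θs θ')) (θ - θ'))
    have h3 := mul_le_mul_of_nonneg_right h1 (norm_nonneg (θ - θ'))
    have h4 := hκH (θ - θ')
    have h5 : (D ε θ - H 0 θs θ - (D ε θ' - H 0 θs θ')) (θ - θ') =
        (D ε θ - D ε θ') (θ - θ') - H 0 θs (θ - θ') (θ - θ') := by
      rw [map_sub (H 0 θs)]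
      simp only [sub_apply]
      ring
    rw [h5, Real.norm_eq_abs] at h2
    have h6 := le_abs_self ((D ε θ - D ε θ') (θ - θ') - H 0 θs (θ - θ') (θ - θ'))
    nlinarith
  have hout : ∀ᶠ ε in 𝓝[Icc 0 R] (0 : ℝ), ∀ θ ∈ S \ Metric.ball θs r, l ε θ < l ε θs := by
    have hcomp : IsCompact (S \ Metric.ball θs r) := hS.diff Metric.isOpen_ball
    have h1 : ∀ θ ∈ S \ Metric.ball θs r, ∀ᶠ p : ℝ × V in 𝓝 ((0 : ℝ), θ),
        p.1 ∈ Icc 0 R → p.2 ∈ S → l p.1 p.2 < l p.1 θs := by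
      intro θ hθ
      have hne : θ ≠ θs := fun h => hθ.2 (h ▸ Metric.mem_ball_self hr)
      have c1 : ContinuousWithinAt (fun p : ℝ × V => l p.1 θs) (Icc 0 R ×ˢ S) (0, θ) :=
        ContinuousWithinAt.comp (x := ((0 : ℝ), θ)) (g := fun p : ℝ × V => l p.1 p.2)
          (f := fun p : ℝ × V => (p.1, θs)) (t := Icc 0 R ×ˢ S) (hl θs hS')
          (continuous_fst.prodMk continuous_const).continuousWithinAt fun p hp => ⟨hp.1, hS'⟩
      have := (hl θ hθ.1).eventually_lt c1 (hmax θ hθ.1 hne)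
      rw [eventually_nhdsWithin_iff] at this
      filter_upwards [this] with p hp h1 h2 using hp ⟨h1, h2⟩
    have h2 := hcomp.eventually_forall_of_forall_eventually
      (P := fun (ε : ℝ) θ => ε ∈ Icc 0 R → θ ∈ S → l ε θ < l ε θs) (x₀ := 0) h1
    rw [eventually_nhdsWithin_iff]
    filter_upwards [h2] with ε hε hεR θ hθ using hε θ hθ hεR hθ.1
  have hev : ∀ᶠ ε in 𝓝[>] (0 : ℝ), ε ∈ Icc 0 R ∧ ε < η ∧
      ∀ θ ∈ S \ Metric.ball θs r, l ε θ < l ε θs := by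
    have h1 : ∀ᶠ ε in 𝓝[>] (0 : ℝ), ε ∈ Icc 0 R :=
      mem_of_superset (Ioo_mem_nhdsGT hR) Ioo_subset_Icc_self
    have h2 : ∀ᶠ ε in 𝓝[>] (0 : ℝ), ε < η := mem_of_superset (Ioo_mem_nhdsGT hη) fun _ h => h.2
    rw [eventually_nhdsWithin_iff] at hout
    filter_upwards [h1, h2, hout.filter_mono nhdsWithin_le_nhds] with ε e1 e2 e3 using
      ⟨e1, e2, e3 e1⟩
  have hcrit (ε) (hε : ε ∈ Icc 0 R) {θ : V} (hθ : θ ∈ interior S) (hm : ∀ s ∈ S, l ε s ≤ l ε θ) :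
      D ε θ = 0 :=
    IsLocalMax.hasFDerivAt_eq_zero (mem_of_superset (isOpen_interior.mem_nhds hθ)
      fun s hs => hm s (interior_subset hs)) (hD ε hε θ hθ)
  have hex (ε : ℝ) : ∃ t, ε ∈ Icc 0 R → t ∈ S ∧ ∀ s ∈ S, l ε s ≤ l ε t := by
    by_cases hε : ε ∈ Icc 0 R
    · obtain ⟨t, ht, hm⟩ := hS.exists_isMaxOn ⟨θs, hS'⟩ (hlε ε hε)
      exact ⟨t, fun _ => ⟨ht, hm⟩⟩
    · exact ⟨θs, fun h => absurd h hε⟩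
  choose t ht using hex
  have hin (ε) (h : ε ∈ Icc 0 R ∧ ε < η ∧ ∀ θ ∈ S \ Metric.ball θs r, l ε θ < l ε θs) {s : V}
      (hs : s ∈ S) (hm : ∀ u ∈ S, l ε u ≤ l ε s) : s ∈ Metric.ball θs r := by
    by_contra hnot
    exact absurd (hm θs hS') (not_le.2 (h.2.2 s ⟨hs, hnot⟩))
  refine ⟨t, ?_, ?_⟩
  · filter_upwards [hev] with ε hε
    obtain ⟨h1, h2⟩ := ht ε hε.1
    refine ⟨h1, fun s hs hne => lt_of_le_of_ne (h2 s hs) fun heq => hne ?_⟩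
    have h3 : ∀ u ∈ S, l ε u ≤ l ε s := fun u hu => (h2 u hu).trans heq.ge
    have b1 := hin ε hε h1 h2
    have b2 := hin ε hε hs h3
    have h4 := hmono ε hε.1 hε.2.1 b2 b1
    rw [hcrit ε hε.1 (hball b1) h2, hcrit ε hε.1 (hball b2) h3, sub_zero, zero_apply] at h4
    have h5 : ‖s - t ε‖ ^ 2 ≤ 0 := by nlinarith [sq_nonneg ‖s - t ε‖]
    exact sub_eq_zero.1 (norm_eq_zero.1 (pow_eq_zero_iff two_ne_zero |>.1
      (le_antisymm h5 (sq_nonneg _))))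
  · refine Asymptotics.IsBigO.of_bound (K / κ) ?_
    filter_upwards [hev] with ε hε
    obtain ⟨h1, h2⟩ := ht ε hε.1
    have b1 := hin ε hε h1 h2
    have h4 := hmono ε hε.1 hε.2.1 b1 (Metric.mem_ball_self hr)
    have h5 : D 0 θs = 0 := hcrit 0 h0R hθs fun s hs => by
      rcases eq_or_ne s θs with rfl | hne
      exacts [le_rfl, (hmax s hs hne).le]
    have h6 := hK ε hε.1
    rw [h5, sub_zero] at h6
    rw [hcrit ε hε.1 (hball b1) h2, zero_sub, neg_apply] at h4
    have h7 := (le_abs_self _).trans ((D ε θs).le_opNorm (t ε - θs))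
    have h8 := mul_le_mul_of_nonneg_right h6 (norm_nonneg (t ε - θs))
    rw [Real.norm_of_nonneg (sq_nonneg ε), div_mul_eq_mul_div, le_div_iff₀ hκ]
    rcases (norm_nonneg (t ε - θs)).eq_or_lt with h0 | hpos
    · rw [← h0, zero_mul]
      have := (norm_nonneg _).trans h6
      linarith
    · have : κ * ‖t ε - θs‖ * ‖t ε - θs‖ ≤ ε ^ 2 * K * ‖t ε - θs‖ := by nlinarith
      have := le_of_mul_le_mul_right this hpos
      linarith

/-- Approximate maximisers of uniformly converging functions converge to a unique maximiser. -/
lemma tendsto_of_isUniqueMaxOn {S : Set V} (hS : IsCompact S) {l : V → ℝ} (hl : ContinuousOn l S)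
    {t : V} (ht : IsUniqueMaxOn l S t) {F : ℕ → V → ℝ} (hF : TendstoUniformlyOn F l atTop S)
    {a : ℕ → ℝ} (ha : Tendsto a atTop (𝓝 0)) {est : ℕ → V} (hest : ∀ n, est n ∈ S)
    (hFa : ∀ n, F n t - a n ≤ F n (est n)) : Tendsto est atTop (𝓝 t) := by
  rw [tendsto_nhds]
  intro U hU htU
  rcases (S \ U).eq_empty_or_nonempty with h | h
  · exact Eventually.of_forall fun n => by
      by_contra hn
      exact (h ▸ (⟨hest n, hn⟩ : est n ∈ S \ U) : est n ∈ (∅ : Set V))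
  · obtain ⟨s, hs, hm⟩ := (hS.diff hU).exists_isMaxOn h (hl.mono sdiff_subset)
    have hgap : l s < l t := ht.2 s hs.1 fun he => hs.2 (he ▸ htU)
    set δ := (l t - l s) / 3 with hδ
    have hδ0 : 0 < δ := by rw [hδ]; linarith
    filter_upwards [Metric.tendstoUniformlyOn_iff.1 hF δ hδ0,
      ha.eventually (gt_mem_nhds hδ0)] with n hn han
    by_contra hnot
    have h1 := hn t ht.1
    have h2 := hn (est n) (hest n)
    have h3 : l (est n) ≤ l s := hm ⟨hest n, hnot⟩
    have h4 := hFa n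
    rw [Real.dist_eq, abs_lt] at h1 h2
    linarith

end PerturbedMaximisers


namespace HMMFamily

variable {𝒳 : Type*} [MeasurableSpace 𝒳] {d m : ℕ} (M : HMMFamily 𝒳 d m)

/-! ### Convergence of the perturbed densities -/

/-- Tolerances which are constant, or which tend to zero within `[0, R]`. -/
def TolConv {ι : Type*} (l : Filter ι) (R : ℝ) (e : ι → ℝ) (e₀ : ℝ) : Prop :=
  (∀ k, e k = e₀) ∨ (e₀ = 0 ∧ Tendsto e l (𝓝 0) ∧ ∀ k, e k ≤ R)

variable {M}

namespace Regular

variable {c C R K b₁ b₂ β β' : ℝ} (hM : M.Regular c C) {ι : Type*} {l : Filter ι}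
  [l.IsCountablyGenerated] {e : ι → ℝ} {e₀ : ℝ} {t : ι → Euc d} {θ₀ : Euc d} {y : Euc m}
include hM

lemma tendsto_dens_tol (hy : M.PertBound R β β' y) (he : ∀ k, 0 ≤ e k) (h : TolConv l R e e₀)
    (ht : Tendsto t l (𝓝 θ₀)) (htΘ : ∀ k, t k ∈ M.Θ) (hθ₀ : θ₀ ∈ M.Θ) (x : 𝒳) (z : Euc m) :
    Tendsto (fun k => M.dens (t k) (y + e k • unitClip z, x)) l
      (𝓝 (M.dens θ₀ (y + e₀ • unitClip z, x))) := by
  rcases h with h | ⟨rfl, h0, hR⟩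
  · simp only [h]
    exact hM.tendsto_dens_left ht hθ₀ _
  · rw [zero_smul, add_zero]
    exact hM.tendsto_dens hy ht htΘ hθ₀ (by simpa using h0.smul_const (unitClip z))
      (fun k => (norm_smul_unitClip_le (he k) z).trans (hR k)) x

lemma tendsto_logGrad_tol (hy : M.PertBound R β β' y) (hy' : M.LogBound K b₁ b₂ y) (hRK : R ≤ K)
    (he : ∀ k, 0 ≤ e k) (h : TolConv l R e e₀) (ht : Tendsto t l (𝓝 θ₀))
    (htΘ : ∀ k, t k ∈ M.Θ) (hθ₀ : θ₀ ∈ M.Θ) (x : 𝒳) (z : Euc m) :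
    Tendsto (fun k => logGrad M.dens (t k) (y + e k • unitClip z, x)) l
      (𝓝 (logGrad M.dens θ₀ (y + e₀ • unitClip z, x))) := by
  rcases h with h | ⟨rfl, h0, hR⟩
  · simp only [h]
    exact hM.tendsto_logGrad_left ht hθ₀ _
  · rw [zero_smul, add_zero]
    exact hM.tendsto_logGrad hy hy' hRK ht htΘ hθ₀ (by simpa using h0.smul_const (unitClip z))
      (fun k => (norm_smul_unitClip_le (he k) z).trans (hR k)) x

lemma tendsto_logHess_tol (hy : M.PertBound R β β' y) (hy' : M.LogBound K b₁ b₂ y) (hRK : R ≤ K)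
    (he : ∀ k, 0 ≤ e k) (h : TolConv l R e e₀) (ht : Tendsto t l (𝓝 θ₀))
    (hθ₀ : θ₀ ∈ interior M.Θ) (x : 𝒳) (z : Euc m) :
    Tendsto (fun k => logHess M.dens (t k) (y + e k • unitClip z, x)) l
      (𝓝 (logHess M.dens θ₀ (y + e₀ • unitClip z, x))) := by
  rcases h with h | ⟨rfl, h0, hR⟩
  · simp only [h]
    exact hM.tendsto_logHess_left ht (interior_subset hθ₀) _
  · rw [zero_smul, add_zero]
    exact hM.tendsto_logHess hy hy' hRK ht hθ₀ (by simpa using h0.smul_const (unitClip z))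
      (fun k => (norm_smul_unitClip_le (he k) z).trans (hR k)) x

lemma tendsto_pertG (hy : M.PertBound R β β' y) (he : ∀ k, 0 ≤ e k) (he₀ : 0 ≤ e₀)
    (h : TolConv l R e e₀) (ht : Tendsto t l (𝓝 θ₀)) (htΘ : ∀ k, t k ∈ M.Θ) (hθ₀ : θ₀ ∈ M.Θ)
    (x : 𝒳) : Tendsto (fun k => M.pertG (e k) (t k) y x) l (𝓝 (M.pertG e₀ θ₀ y x)) := by
  simp only [pertG_eq he₀, pertG_eq (he _)]
  refine tendsto_integral_of_bddMeas (K := C) (fun k => (hM.isWeight (htΘ k) _ y x).toBddMeas)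
    (fun k z => ?_) (hM.tendsto_dens_tol hy he h ht htΘ hθ₀ x)
  rw [Real.norm_of_nonneg (hM.dens_pos (htΘ k) _).le]
  exact hM.g_le _ (htΘ k) _ _

variable (htΘ : ∀ k, t k ∈ interior M.Θ) (hθ₀ : θ₀ ∈ interior M.Θ) (heK : ∀ k, e k ≤ K)
include htΘ hθ₀ heK

lemma tendsto_pertScore (hy : M.PertBound R β β' y) (hy' : M.LogBound K b₁ b₂ y) (hRK : R ≤ K)
    (he : ∀ k, 0 ≤ e k) (h : TolConv l R e e₀) (ht : Tendsto t l (𝓝 θ₀)) (x : 𝒳) :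
    Tendsto (fun k => M.pertScore (e k) (t k) y x) l (𝓝 (M.pertScore e₀ θ₀ y x)) := by
  have htΘ' k := interior_subset (htΘ k)
  have hθ₀' := interior_subset hθ₀
  exact tendsto_wavg (A := C) (K := b₁) (fun k => hM.isWeight (htΘ' k) _ y x)
    (hM.isWeight hθ₀' _ y x) (fun k z => hM.g_le _ (htΘ' k) _ _)
    (fun k => (hM.smoothWeights (he k) (heK k) hy' x).bddMeas (htΘ k))
    (fun k => (hM.smoothWeights (he k) (heK k) hy' x).bound _ (htΘ k))
    (hM.tendsto_dens_tol hy he h ht htΘ' hθ₀' x)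
    (hM.tendsto_logGrad_tol hy hy' hRK he h ht htΘ' hθ₀' x)

lemma tendsto_pertHess (hy : M.PertBound R β β' y) (hy' : M.LogBound K b₁ b₂ y) (hRK : R ≤ K)
    (he : ∀ k, 0 ≤ e k) (h : TolConv l R e e₀) (ht : Tendsto t l (𝓝 θ₀)) (x : 𝒳) :
    Tendsto (fun k => M.pertHess (e k) (t k) y x) l (𝓝 (M.pertHess e₀ θ₀ y x)) := by
  have htΘ' k := interior_subset (htΘ k)
  have hθ₀' := interior_subset hθ₀
  have w k := hM.isWeight (htΘ' k) (e k) y x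
  have w₀ := hM.isWeight hθ₀' e₀ y x
  have hC (k) (z : Euc m) : M.dens (t k) (y + e k • unitClip z, x) ≤ C := hM.g_le _ (htΘ' k) _ _
  have hs k := hM.smoothWeights (he k) (heK k) hy' x
  have ha := hM.tendsto_dens_tol hy he h ht htΘ' hθ₀' x
  refine (tendsto_wavg w w₀ hC (fun k => (hs k).bddMeas₂ (htΘ k))
    (fun k => (hs k).bound₂ _ (htΘ k)) ha (hM.tendsto_logHess_tol hy hy' hRK he h ht hθ₀ x)).add
    (tendsto_wcov isTensor_formTensor w w₀ hC (fun k => (hs k).bddMeas (htΘ k))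
    (fun k => (hs k).bound _ (htΘ k)) ha (hM.tendsto_logGrad_tol hy hy' hRK he h ht htΘ' hθ₀' x))

end Regular

/-! ### The limit surfaces -/

variable (M) in
/-- The limiting relative mean log-likelihood. -/
def surface (Q : Measure (ℕ → Euc m)) (r : Euc m → Euc m) (x₀ : 𝒳) (θs : Euc d) (ε : ℝ)
    (θ : Euc d) : ℝ :=
  limValue Q M.μ (M.q θ) (M.emis r ε θ) (M.q θs) (M.emis r ε θs) x₀

variable (M) in
/-- The gradient of the limiting relative mean log-likelihood. -/
def surfaceScore (Q : Measure (ℕ → Euc m)) (r : Euc m → Euc m) (x₀ : 𝒳) (ε : ℝ) (θ : Euc d) :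
    Euc d →L[ℝ] ℝ :=
  limScore Q M.μ (M.q θ) (M.emis r ε θ) (M.stepScore r ε θ) x₀

variable (M) in
/-- The second derivative of the limiting relative mean log-likelihood. -/
def surfaceHess (Q : Measure (ℕ → Euc m)) (r : Euc m → Euc m) (x₀ : 𝒳) (ε : ℝ) (θ : Euc d) :
    Euc d →L[ℝ] Euc d →L[ℝ] ℝ :=
  limHess Q M.μ (formTensor (Euc d)) (M.q θ) (M.emis r ε θ) (M.stepScore r ε θ)
    (M.stepHess r ε θ) x₀

namespace Majorants

variable {ρ : Measure (Euc m)} {r : Euc m → Euc m} {b₁ b₂ : ℕ → Euc m → ℝ} {R c C : ℝ}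
  {β β' : Euc m → ℝ} (hB : M.Majorants ρ r b₁ b₂ R β β') (hM : M.Regular c C)
  {Q : Measure (ℕ → Euc m)} [IsProbabilityMeasure Q] [NeZero M.μ]
  (hQ : MeasurePreserving (fun y : ℕ → Euc m => y 0) Q ρ)
  (hS : MeasurePreserving seqShift Q Q) {x₀ : 𝒳} {ε : ℝ} {θ θs : Euc d} (hθs : θs ∈ M.Θ)

include hB hM hQ

lemma hasFDerivAt_surface (hS : MeasurePreserving seqShift Q Q) (hθs : θs ∈ M.Θ) (hε : 0 ≤ ε)
    (hθ : θ ∈ interior M.Θ) :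
    HasFDerivAt (M.surface Q r x₀ θs ε) (M.surfaceScore Q r x₀ ε θ) θ := by
  have : Nonempty 𝒳 := ⟨x₀⟩
  have hC := (hM.isMixing hθs).upper_pos
  have hMo := hB.moments hM hQ hC.le ⌈ε⌉₊
  obtain ⟨κ, K, hR⟩ := hMo.exists_forgetRate hS (hM.isMixing hθs)
  obtain ⟨L, hL⟩ := hB.exists_incrBound hM
  exact (hB.smoothFamily hM hε (Nat.le_ceil ε)).hasFDerivAt_limValue (hM.isMixing hθs)
    (hB.isEmission hM hε hθs) hMo hS hR
    ((hB.memLp_incrBound hM hQ ⌈ε⌉₊ L _).integrable (by norm_num))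
    (fun t ht => hL ε ⌈ε⌉₊ hε (Nat.le_ceil ε) t (interior_subset ht) θs hθs x₀) hθ

lemma hasFDerivAt_surfaceScore (hS : MeasurePreserving seqShift Q Q) (hε : 0 ≤ ε)
    (hθ : θ ∈ interior M.Θ) :
    HasFDerivAt (M.surfaceScore Q r x₀ ε) (M.surfaceHess Q r x₀ ε θ) θ := by
  have : Nonempty 𝒳 := ⟨x₀⟩
  have hq := hM.isMixing (interior_subset hθ)
  have hMo := hB.moments hM hQ hq.upper_pos.le ⌈ε⌉₊
  obtain ⟨κ, K, hR⟩ := hMo.exists_forgetRate hS hq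
  exact (hB.smoothFamily hM hε (Nat.le_ceil ε)).hasFDerivAt_limScore hMo hS hR hθ

section Continuity

variable {ι : Type*} {l : Filter ι} [l.IsCountablyGenerated] {e : ι → ℝ} {e₀ : ℝ} {t : ι → Euc d}
  {θ₀ : Euc d} {K : ℕ}

lemma tendsto_surface (hθs : θs ∈ M.Θ) (he : ∀ k, 0 ≤ e k) (he₀ : 0 ≤ e₀)
    (heK : ∀ k, e k ≤ K) (he₀K : e₀ ≤ K) (h : TolConv l R e e₀) (ht : Tendsto t l (𝓝 θ₀))
    (htΘ : ∀ k, t k ∈ M.Θ) (hθ₀ : θ₀ ∈ M.Θ) :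
    Tendsto (fun k => M.surface Q r x₀ θs (e k) (t k)) l (𝓝 (M.surface Q r x₀ θs e₀ θ₀)) := by
  obtain ⟨L, hL⟩ := hB.exists_incrBound hM
  have hq (x x' : 𝒳) : Tendsto (fun k => M.q (t k) x x') l (𝓝 (M.q θ₀ x x')) :=
    (hM.contDiffAt_trans hθ₀ (x, x')).continuousAt.tendsto.comp ht
  exact tendsto_limValue (fun k => hM.isMixing (htΘ k)) (fun k => hB.isEmission hM (he k) (htΘ k))
    (fun k => hM.isMixing hθs) (fun k => hB.isEmission hM (he k) hθs) (hM.isMixing hθ₀)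
    (hB.isEmission hM he₀ hθ₀) (hM.isMixing hθs) (hB.isEmission hM he₀ hθs) hq
    (fun y x => hM.tendsto_pertG (hB.pert y) he he₀ h ht htΘ hθ₀ x)
    (fun x x' => tendsto_const_nhds)
    (fun y x => hM.tendsto_pertG (hB.pert y) he he₀ h tendsto_const_nhds (fun _ => hθs) hθs x)
    ((hB.memLp_incrBound hM hQ K L _).integrable (by norm_num))
    (fun k => hL (e k) K (he k) (heK k) _ (htΘ k) θs hθs x₀)
    (hL e₀ K he₀ he₀K θ₀ hθ₀ θs hθs x₀)

lemma tendsto_surfaceHess (hS : MeasurePreserving seqShift Q Q) (he : ∀ k, 0 ≤ e k) (he₀ : 0 ≤ e₀)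
    (heK : ∀ k, e k ≤ K) (he₀K : e₀ ≤ K) (hRK : R ≤ K) (h : TolConv l R e e₀)
    (ht : Tendsto t l (𝓝 θ₀)) (htΘ : ∀ k, t k ∈ interior M.Θ) (hθ₀ : θ₀ ∈ interior M.Θ) :
    Tendsto (fun k => M.surfaceHess Q r x₀ (e k) (t k)) l (𝓝 (M.surfaceHess Q r x₀ e₀ θ₀)) := by
  have : Nonempty 𝒳 := ⟨x₀⟩
  have htΘ' k := interior_subset (htΘ k)
  have hθ₀' := interior_subset hθ₀
  have hq₀ := hM.isMixing hθ₀'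
  have hMo := hB.moments hM hQ hq₀.upper_pos.le K
  obtain ⟨κ, K', hR⟩ := hMo.exists_forgetRate hS hq₀
  have hq (x x' : 𝒳) : Tendsto (fun k => M.q (t k) x x') l (𝓝 (M.q θ₀ x x')) :=
    (hM.contDiffAt_trans hθ₀' (x, x')).continuousAt.tendsto.comp ht
  refine tendsto_limHess isTensor_formTensor (fun k => hM.isMixing (htΘ' k))
    (fun k => hB.isEmission hM (he k) (htΘ' k)) (fun k => hB.isScore hM (he k) (heK k) (htΘ k))
    (fun k => hB.isScore₂ hM (he k) (heK k) (htΘ k)) hq₀ (hB.isEmission hM he₀ hθ₀')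
    (hB.isScore hM he₀ he₀K hθ₀) (hB.isScore₂ hM he₀ he₀K hθ₀) hq
    (fun y x => hM.tendsto_pertG (hB.pert y) he he₀ h ht htΘ' hθ₀' x)
    (fun y x z => ?_) (fun y x z => ?_) hMo hS hR
  · have h1 := (contDiffAt_logGrad (hM.trans_pos hθ₀' (x, z))
      (hM.contDiffAt_trans hθ₀' (x, z))).continuousAt.tendsto.comp ht
    exact h1.add (hM.tendsto_pertScore htΘ hθ₀ heK (hB.pert y) (hB.log K y) hRK he h ht z)
  · have h1 := (contDiffAt_logHess (hM.trans_pos hθ₀' (x, z))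
      (hM.contDiffAt_trans hθ₀' (x, z))).continuousAt.tendsto.comp ht
    exact h1.add (hM.tendsto_pertHess htΘ hθ₀ heK (hB.pert y) (hB.log K y) hRK he h ht z)

end Continuity

lemma continuousOn_surface (hθs : θs ∈ M.Θ) (hε : 0 ≤ ε) :
    ContinuousOn (M.surface Q r x₀ θs ε) M.Θ := by
  intro θ hθ
  rw [ContinuousWithinAt, tendsto_nhdsWithin_iff_subtype hθ]
  exact hB.tendsto_surface hM hQ (e := fun _ => ε) hθs (fun _ => hε) hε (fun _ => Nat.le_ceil ε)
    (Nat.le_ceil ε) (.inl fun _ => rfl) continuous_subtype_val.continuousAt (fun k => k.2) hθ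

lemma contDiffOn_surface (hS : MeasurePreserving seqShift Q Q) (hθs : θs ∈ M.Θ) (hε : 0 ≤ ε) :
    ContDiffOn ℝ 2 (M.surface Q r x₀ θs ε) (interior M.Θ) := by
  have hO : IsOpen (interior M.Θ) := isOpen_interior
  have hc : ContinuousOn (M.surfaceHess Q r x₀ ε) (interior M.Θ) := fun θ hθ => by
    rw [ContinuousWithinAt, tendsto_nhdsWithin_iff_subtype hθ]
    have hK : ε ≤ (⌈ε⌉₊ + 1 : ℕ) := (Nat.le_ceil ε).trans (by push_cast; linarith)
    exact hB.tendsto_surfaceHess hM hQ (e := fun _ => ε) hS (fun _ => hε) hε (fun _ => hK) hK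
      (hB.R_le.trans (by push_cast; linarith [Nat.cast_nonneg (α := ℝ) ⌈ε⌉₊]))
      (.inl fun _ => rfl) continuous_subtype_val.continuousAt (fun k => k.2) hθ
  have h1 : ContDiffOn ℝ 1 (M.surfaceScore Q r x₀ ε) (interior M.Θ) := by
    rw [show (1 : WithTop ℕ∞) = 0 + 1 from rfl, contDiffOn_succ_iff_fderiv_of_isOpen hO]
    refine ⟨fun θ hθ => (hB.hasFDerivAt_surfaceScore hM hQ hS hε
      hθ).differentiableAt.differentiableWithinAt, by simp, contDiffOn_zero.2 ?_⟩
    exact hc.congr fun θ hθ => (hB.hasFDerivAt_surfaceScore hM hQ hS hε hθ).fderiv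
  rw [show (2 : WithTop ℕ∞) = 1 + 1 from rfl, contDiffOn_succ_iff_fderiv_of_isOpen hO]
  refine ⟨fun θ hθ => (hB.hasFDerivAt_surface hM hQ hS hθs hε
    hθ).differentiableAt.differentiableWithinAt, by simp, ?_⟩
  exact h1.congr fun θ hθ => (hB.hasFDerivAt_surface hM hQ hS hθs hε hθ).fderiv

lemma continuousWithinAt_surface (hθs : θs ∈ M.Θ) (hθ : θ ∈ M.Θ) :
    ContinuousWithinAt (fun p : ℝ × Euc d => M.surface Q r x₀ θs p.1 p.2) (Icc 0 R ×ˢ M.Θ)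
      (0, θ) := by
  have hmem : ((0 : ℝ), θ) ∈ Icc 0 R ×ˢ M.Θ := ⟨⟨le_rfl, hB.R_pos.le⟩, hθ⟩
  rw [ContinuousWithinAt, tendsto_nhdsWithin_iff_subtype hmem]
  have hv : Tendsto (Subtype.val : Icc 0 R ×ˢ M.Θ → ℝ × Euc d) (𝓝 ⟨_, hmem⟩) (𝓝 (0, θ)) :=
    continuous_subtype_val.continuousAt
  exact hB.tendsto_surface hM hQ (K := 1) hθs (fun k => k.2.1.1) le_rfl
    (fun k => (k.2.1.2.trans hB.R_le).trans (by simp)) (by simp)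
    (.inr ⟨rfl, (continuous_fst.tendsto _).comp hv, fun k => k.2.1.2⟩)
    ((continuous_snd.tendsto _).comp hv) (fun k => k.2.2) hθ

lemma continuousWithinAt_surfaceHess (hS : MeasurePreserving seqShift Q Q)
    (hθ : θ ∈ interior M.Θ) :
    ContinuousWithinAt (fun p : ℝ × Euc d => M.surfaceHess Q r x₀ p.1 p.2)
      (Icc 0 R ×ˢ interior M.Θ) (0, θ) := by
  have hmem : ((0 : ℝ), θ) ∈ Icc 0 R ×ˢ interior M.Θ := ⟨⟨le_rfl, hB.R_pos.le⟩, hθ⟩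
  rw [ContinuousWithinAt, tendsto_nhdsWithin_iff_subtype hmem]
  have hv : Tendsto (Subtype.val : Icc 0 R ×ˢ interior M.Θ → ℝ × Euc d) (𝓝 ⟨_, hmem⟩)
    (𝓝 (0, θ)) := continuous_subtype_val.continuousAt
  exact hB.tendsto_surfaceHess hM hQ (K := 1) hS (fun k => k.2.1.1) le_rfl
    (fun k => (k.2.1.2.trans hB.R_le).trans (by simp)) (by simp) (hB.R_le.trans (by simp))
    (.inr ⟨rfl, (continuous_fst.tendsto _).comp hv, fun k => k.2.1.2⟩)
    ((continuous_snd.tendsto _).comp hv) (fun k => k.2.2) hθ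

/-- Perturbations of size `ε` change the gradient of the limit surface by `O(ε²)`. -/
lemma exists_norm_surfaceScore_sub_le (hS : MeasurePreserving seqShift Q Q)
    (hθ : θ ∈ interior M.Θ) : ∃ K, ∀ ε ∈ Icc 0 R,
      ‖M.surfaceScore Q r x₀ ε θ - M.surfaceScore Q r x₀ 0 θ‖ ≤ ε ^ 2 * K := by
  have : Nonempty 𝒳 := ⟨x₀⟩
  have hθ' := interior_subset hθ
  have hq := hM.isMixing hθ'
  have hMo := hB.moments hM hQ hq.upper_pos.le 1
  obtain ⟨κ, K', hR⟩ := hMo.exists_forgetRate hS hq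
  have L2 {f : Euc m → ℝ} (hf : Measurable f) (h : Integrable (fun y => f y ^ 2) ρ) :
      MemLp (fun y : ℕ → Euc m => f (y 0)) 2 Q :=
    (memLp_two_iff_integrable_sq (hf.comp hQ.measurable).aestronglyMeasurable).2
      (hQ.integrable_comp_of_integrable h)
  have hβ2 := L2 hB.measβ hB.intβ
  have hpert := hMo.meanRate_pert hS hq.rho_nonneg hq.rho_lt_one (β := fun y => 4 * β y)
    (σ := fun y => β' y + β y * b₁ 1 y) (hB.measβ.const_mul 4)
    (fun y => mul_nonneg (by norm_num) (hB.nonnegβ y)) (hβ2.const_mul 4).integrable_sq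
    (hB.measβ'.add (hB.measβ.mul (hB.meas₁ 1)))
    (fun y => add_nonneg (hB.nonnegβ' y) (mul_nonneg (hB.nonnegβ y) (hB.nonneg₁ 1 y)))
    (((L2 hB.measβ' hB.intβ').integrable (by norm_num)).add
      (hβ2.integrable_mul (L2 (hB.meas₁ 1) (hB.int₁ 1))))
  obtain ⟨A, hA⟩ := hpert.rate
  refine ⟨A, fun ε hε => ?_⟩
  have hε1 : ε ≤ (1 : ℕ) := by simpa using hε.2.trans hB.R_le
  have h01 : (0 : ℝ) ≤ (1 : ℕ) := by simp
  refine norm_limScore_sub_le (σ := fun y => β' y + β y * b₁ 1 y) hR hq (hB.isEmission hM le_rfl hθ') (hB.isEmission hM hε.1 hθ')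
    (hB.isScore hM le_rfl h01 hθ) (hB.isScore hM hε.1 hε1 hθ) hMo hS (sq_nonneg ε)
    (fun y => mul_nonneg (by norm_num) (hB.nonnegβ y))
    (fun y hy => hM.ratioBound_pertG (hB.pert y) (hB.nonnegβ y) hε.1 hε.2 hθ' hy)
    (fun y x z => ?_) hpert.int (fun n => by simpa only [one_pow, mul_one] using hA n)
  rw [stepScore, stepScore, add_sub_add_left_eq_sub]
  exact hM.norm_pertScore_sub_le (hB.pert y) (hB.log 1 y) hε.1 hε.2 hε1 hθ z

end Majorants

end HMMFamily


section Likelihood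

variable {𝒳 𝒴 : Type*} [MeasurableSpace 𝒳] [MeasurableSpace 𝒴] {μ : Measure 𝒳}
  {q : 𝒳 → 𝒳 → ℝ} {c C A : ℝ} {G G' : 𝒴 → 𝒳 → ℝ}

lemma lik_congr {y : ℕ → 𝒴} (h : ∀ k, G (y k) = G' (y k)) (n : ℕ) (x : 𝒳) :
    lik μ q G n y x = lik μ q G' n y x := by
  induction n generalizing y x with
  | zero => rfl
  | succ n ih =>
    simp only [lik, h 0]
    refine integral_congr_ae (ae_of_all _ fun z => ?_)
    simp only [ih (y := seqShift y) (fun k => h (k + 1)) z]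

lemma abs_log_lik_sub_log_lik_le [IsFiniteMeasure μ] [NeZero μ] (hq : IsMixing c C q)
    (hG : IsEmission A G) (n : ℕ) (y : ℕ → 𝒴) (x x' : 𝒳) :
    |Real.log (lik μ q G n y x) - Real.log (lik μ q G n y x')| ≤ Real.log (C / c) := by
  have : Nonempty 𝒳 := ⟨x⟩
  have h (x x' : 𝒳) : Real.log (lik μ q G n y x) ≤
      Real.log (C / c) + Real.log (lik μ q G n y x') := by
    rw [← Real.log_mul (div_pos hq.upper_pos hq.pos).ne' (lik_pos_and_le hq hG n y x').1.ne']
    exact Real.log_le_log (lik_pos_and_le hq hG n y x).1 (lik_le_mul hq hG n y x x')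
  rw [abs_le]
  constructor <;> linarith [h x x', h x' x]

end Likelihood

namespace HMMFamily

variable {𝒳 : Type*} [MeasurableSpace 𝒳] {d m : ℕ} {M : HMMFamily 𝒳 d m}

namespace Majorants

variable {ρ : Measure (Euc m)} {r : Euc m → Euc m} {b₁ b₂ : ℕ → Euc m → ℝ} {R c C : ℝ}
  {β β' : Euc m → ℝ} (hB : M.Majorants ρ r b₁ b₂ R β β') (hM : M.Regular c C)
  {x₀ : 𝒳} {ε : ℝ} {θ θs : Euc d} {P P' : Measure (ℤ → 𝒳 × Euc m)}

lemma ae_lik_emis {Q : Measure (ℕ → Euc m)} (hB : M.Majorants ρ r b₁ b₂ R β β')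
    (hS : MeasurePreserving seqShift Q Q)
    (hQ : MeasurePreserving (fun y : ℕ → Euc m => y 0) Q ρ) (ε : ℝ) :
    ∀ᵐ y ∂Q, ∀ θ n x, lik M.μ (M.q θ) (M.emis r ε θ) n y x =
      lik M.μ (M.q θ) (M.pertG ε θ) n y x := by
  have h : ∀ᵐ y ∂Q, ∀ k, r (y k) = y k := ae_all_iff.2 fun k => by
    have := (hQ.comp (measurePreserving_add hS k)).quasiMeasurePreserving.ae hB.ae_eq
    simpa using this
  filter_upwards [h] with y hy θ n x
  refine lik_congr (fun k => ?_) n x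
  funext z
  rw [emis, hy k]

variable [Nonempty (𝒳 × Euc m)] [NeZero M.μ]

lemma isLimitSurface (hB : M.Majorants ρ r b₁ b₂ R β β') (hM : M.Regular c C)
    (hP : M.IsStationaryLaw θs P) (hθs : θs ∈ M.Θ)
    (hQ : MeasurePreserving (fun y : ℕ → Euc m => y 0) (P.map obsSeq) ρ) (hε : 0 ≤ ε) :
    M.IsLimitSurface P θs ε (M.surface (P.map obsSeq) r x₀ θs ε) := by
  intro x
  have : Nonempty 𝒳 := ⟨x⟩
  have hPp := hP.isProbabilityMeasure hθs
  have : IsProbabilityMeasure (P.map (obsSeq : (ℤ → 𝒳 × Euc m) → _)) :=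
    Measure.isProbabilityMeasure_map measurable_obsSeq.aemeasurable
  have hmix := hP.isMixingLaw hθs (hM.isMixing hθs)
  obtain ⟨L, hL⟩ := hB.exists_incrBound hM
  have key := hmix.tendstoUniformlyOn_log_lik (x := x₀) M.compact_param
    (fun t ht => hM.isMixing ht) (fun t ht => hB.isEmission hM hε ht) (hM.isMixing hθs)
    (hB.isEmission hM hε hθs)
    (fun x z t ht => (hM.contDiffAt_trans ht (x, z)).continuousAt.continuousWithinAt)
    (fun y z t ht => by
      rw [ContinuousWithinAt, tendsto_nhdsWithin_iff_subtype ht]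
      exact hM.tendsto_pertG (hB.pert y) (e := fun _ => ε) (fun _ => hε) hε (.inl fun _ => rfl)
        continuous_subtype_val.continuousAt (fun k => k.2) ht z)
    (hB.memLp_incrBound hM hQ ⌈ε⌉₊ L _)
    (fun t ht => hL ε ⌈ε⌉₊ hε (Nat.le_ceil ε) t ht θs hθs x₀)
  filter_upwards [ae_of_ae_map measurable_obsSeq.aemeasurable key,
    ae_of_ae_map measurable_obsSeq.aemeasurable (hB.ae_lik_emis hmix.shift hQ ε)] with ω h1 h2
  have h0 : Tendsto (fun n : ℕ => (n : ℝ)⁻¹ * (2 * Real.log (C / c))) atTop (𝓝 0) := by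
    simpa using (tendsto_inv_atTop_nhds_zero_nat (𝕜 := ℝ)).mul_const (2 * Real.log (C / c))
  rw [Metric.tendstoUniformlyOn_iff] at h1 ⊢
  intro δ hδ
  filter_upwards [h1 (δ / 2) (half_pos hδ), h0.eventually (gt_mem_nhds (half_pos hδ))] with n hn hn'
    t ht
  have h3 := hn t ht
  simp only [h2] at h3
  rw [likelihood_data (hM.isMixing ht) (hM.isEmission hε ht),
    likelihood_data (hM.isMixing hθs) (hM.isEmission hε hθs)]
  have h4 := abs_le.1 (abs_log_lik_sub_log_lik_le (μ := M.μ) (hM.isMixing ht)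
    (hM.isEmission hε ht) n (obsSeq ω) x x₀)
  have h5 := abs_le.1 (abs_log_lik_sub_log_lik_le (μ := M.μ) (hM.isMixing hθs)
    (hM.isEmission hε hθs) n (obsSeq ω) x x₀)
  have h6 : dist ((n : ℝ)⁻¹ * (Real.log (lik M.μ (M.q t) (M.pertG ε t) n (obsSeq ω) x₀) -
        Real.log (lik M.μ (M.q θs) (M.pertG ε θs) n (obsSeq ω) x₀)))
      ((n : ℝ)⁻¹ * (Real.log (lik M.μ (M.q t) (M.pertG ε t) n (obsSeq ω) x) -
        Real.log (lik M.μ (M.q θs) (M.pertG ε θs) n (obsSeq ω) x))) ≤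
      (n : ℝ)⁻¹ * (2 * Real.log (C / c)) := by
    rw [Real.dist_eq, ← mul_sub, abs_mul, abs_of_nonneg (by positivity : (0 : ℝ) ≤ (n : ℝ)⁻¹)]
    refine mul_le_mul_of_nonneg_left ?_ (by positivity)
    rw [abs_le]
    constructor <;> linarith [h4.1, h4.2, h5.1, h5.2]
  exact (dist_triangle _ _ _).trans_lt
    ((add_lt_add h3 (h6.trans_lt hn')).trans_eq (add_halves δ))

lemma surface_self : M.surface (P.map obsSeq) r x₀ θs ε θs = 0 := by
  simp only [surface, limValue, sub_self, integral_zero]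
  exact tendsto_const_nhds.limUnder_eq

/-- A parameter at which the unperturbed limit surface is not negative yields the law of the
observations. -/
lemma map_obs_eq_of_surface_nonneg (hB : M.Majorants ρ r b₁ b₂ R β β') (hM : M.Regular c C)
    (hP : M.IsStationaryLaw θ P) (hP' : M.IsStationaryLaw θs P') (hθ : θ ∈ M.Θ) (hθs : θs ∈ M.Θ)
    (hQ : MeasurePreserving (fun y : ℕ → Euc m => y 0) (P'.map obsSeq) ρ)
    (h0 : 0 ≤ M.surface (P'.map obsSeq) r x₀ θs 0 θ) :
    P.map (fun ω k => (ω k).2) = P'.map (fun ω k => (ω k).2) := by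
  have hPp := hP.isProbabilityMeasure hθ
  have hPp' := hP'.isProbabilityMeasure hθs
  obtain ⟨π, hπ, hR⟩ := hP.exists_isChainLaw hθ
  obtain ⟨π', hπ', hR'⟩ := hP'.exists_isChainLaw hθs
  have hm : Measurable fun (ω : ℤ → 𝒳 × Euc m) (k : ℕ) => ω ((k : ℤ) + 1) :=
    measurable_pi_iff.2 fun _ => measurable_pi_apply _
  have hobs (P : Measure (ℤ → 𝒳 × Euc m)) :
      obsMarginal (P.map fun ω (k : ℕ) => ω ((k : ℤ) + 1)) = P.map obsSeq := by
    rw [obsMarginal, Measure.map_map measurable_obs hm]; rfl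
  have hprob (P : Measure (ℤ → 𝒳 × Euc m)) [IsProbabilityMeasure P] :
      IsProbabilityMeasure (P.map (obsSeq : (ℤ → 𝒳 × Euc m) → _)) :=
    Measure.isProbabilityMeasure_map measurable_obsSeq.aemeasurable
  have hp := hprob P
  have hp' := hprob P'
  have hmix := hP.isMixingLaw hθ (hM.isMixing hθ)
  have hmix' := hP'.isMixingLaw hθs (hM.isMixing hθs)
  obtain ⟨L, hL⟩ := hB.exists_incrBound hM
  have hg (θ : Euc d) : M.pertG 0 θ = M.g θ := by
    funext y x; simp [pertG]
  have hk (n : ℕ) := neg_le_mean_log_lik hmix'.shift (hM.isMixing hθ) (hB.isEmission hM le_rfl hθ)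
    (hM.isMixing hθs) (hB.isEmission hM le_rfl hθs)
    ((hB.memLp_incrBound hM hQ 1 L _).integrable (by norm_num))
    (hL 0 1 le_rfl (by simp) θ hθ θs hθs x₀) h0 n
  have hae (n : ℕ) : (fun y => Real.log (lik M.μ (M.q θ) (M.emis r 0 θ) n y x₀) -
        Real.log (lik M.μ (M.q θs) (M.emis r 0 θs) n y x₀)) =ᵐ[P'.map obsSeq]
      fun y => Real.log (lik M.μ (M.q θ) (M.g θ) n y x₀) -
        Real.log (lik M.μ (M.q θs) (M.g θs) n y x₀) := by
    filter_upwards [hB.ae_lik_emis hmix'.shift hQ 0] with y hy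
    rw [hy, hy, hg, hg]
  have hint {J : ℕ} {f : (ℕ → Euc m) → ℝ} (hf : Measurable f) (hJ : DependsOn f (Iio (J + 1)))
      (hB1 : ∀ y, |f y| ≤ 1) : ∫ y, f y ∂(P.map obsSeq) = ∫ y, f y ∂(P'.map obsSeq) := by
    have : IsProbabilityMeasure (obsMarginal (P.map fun ω (k : ℕ) => ω ((k : ℤ) + 1))) := by
      rwa [hobs]
    have : IsProbabilityMeasure (obsMarginal (P'.map fun ω (k : ℕ) => ω ((k : ℤ) + 1))) := by
      rwa [hobs]
    have key := hR.integral_eq_of_bounded_entropy hR' (x := x₀) (hM.isMixing hθ)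
      (hM.isEmission_g hθ) (hM.isMixing hθs) (hM.isEmission_g hθs) (by rw [hobs]; exact hmix)
      (by rw [hobs]; exact hmix')
      (fun n => by
        rw [hobs]
        exact ⟨(hk n).1.congr (hae n), (hk n).2.trans_eq (integral_congr_ae (hae n))⟩) hf hJ hB1
    rwa [hobs, hobs] at key
  have hproj (n : ℕ) : Measurable fun (y : ℕ → Euc m) (k : Fin n) => y k :=
    measurable_pi_iff.2 fun _ => measurable_pi_apply _
  have hwin (n : ℕ) : (P.map obsSeq).map (fun (y : ℕ → Euc m) (k : Fin n) => y k) =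
      (P'.map obsSeq).map fun (y : ℕ → Euc m) (k : Fin n) => y k := by
    refine Measure.ext fun s hs => ?_
    have h1 := hint (J := n) (f := ((fun (y : ℕ → Euc m) (k : Fin n) => y k) ⁻¹' s).indicator 1)
      (measurable_one.indicator (hproj n hs)) (fun y y' h => by
        have e : (fun k : Fin n => y k) = fun k : Fin n => y' k :=
          funext fun k => h k (Nat.lt_succ_of_lt k.2)
        exact congrArg (s.indicator (1 : (Fin n → Euc m) → ℝ)) e) (fun y => by
        simp only [indicator]; split_ifs <;> simp)
    rw [integral_indicator_one (hproj n hs), integral_indicator_one (hproj n hs)] at h1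
    rw [Measure.map_apply (hproj n) hs, Measure.map_apply (hproj n) hs]
    exact (measureReal_eq_measureReal_iff).1 h1
  have hsnd (n : ℕ) : Measurable fun (w : Fin n → 𝒳 × Euc m) k => (w k).2 :=
    measurable_pi_iff.2 fun _ => measurable_snd.comp (measurable_pi_apply _)
  have hobsm : Measurable fun (ω : ℤ → 𝒳 × Euc m) k => (ω k).2 :=
    measurable_pi_iff.2 fun _ => measurable_snd.comp (measurable_pi_apply _)
  have e {θ : Euc d} {P : Measure (ℤ → 𝒳 × Euc m)} (hP : M.IsStationaryLaw θ P) (a : ℤ) (n : ℕ) :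
      (P.map fun ω k => (ω k).2).map (fun ω (k : Fin n) => ω (a + 1 + (k : ℤ))) =
        (P.map obsSeq).map fun (y : ℕ → Euc m) (k : Fin n) => y k := by
    have h2 := congrArg (Measure.map fun (w : Fin n → 𝒳 × Euc m) k => (w k).2)
      (hP.map_window a 0 n)
    rw [Measure.map_map (hsnd n) (measurable_window _ _),
      Measure.map_map (hsnd n) (measurable_window _ _)] at h2
    rw [Measure.map_map (measurable_window _ _) hobsm,
      Measure.map_map (hproj n) measurable_obsSeq]
    refine h2.trans ?_
    congr 1
    funext ω k
    simp [obsSeq, add_comm]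
  have hq1 := Measure.isProbabilityMeasure_map (μ := P) hobsm.aemeasurable
  have hq2 := Measure.isProbabilityMeasure_map (μ := P') hobsm.aemeasurable
  exact ext_of_window fun a n => by rw [e hP, e hP', hwin]

end Majorants

/-- Approximate maximality of the ABC maximum likelihood estimates for the likelihood started in a
fixed state. -/
lemma IsABCMLE.log_likelihood_le [Nonempty (𝒳 × Euc m)] [NeZero M.μ] {c C ε : ℝ}
    (hM : M.Regular c C) (hε : 0 < ε) {π₀ : Measure 𝒳} [IsProbabilityMeasure π₀] {n : ℕ}
    {ω : ℤ → 𝒳 × Euc m} {s t : Euc d} (h : M.IsABCMLE ε π₀ (data n ω) s) (ht : t ∈ M.Θ) (x₀ : 𝒳) :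
    Real.log (M.likelihood ε t x₀ (data n ω)) ≤
      2 * Real.log (C / c) + Real.log (M.likelihood ε s x₀ (data n ω)) := by
  have : Nonempty 𝒳 := ⟨x₀⟩
  obtain ⟨hs, h⟩ := h
  have hqs := hM.isMixing hs
  have hqt := hM.isMixing ht
  have hGs := hM.isEmission hε.le hs
  have hGt := hM.isEmission hε.le ht
  have hCc := div_pos hqs.upper_pos hqs.pos
  have h1 := h t ht
  rw [abcLikelihood_data ht hε hqt (hM.isEmission_g ht) hGt,
    abcLikelihood_data hs hε hqs (hM.isEmission_g hs) hGs] at h1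
  have h2 := (ENNReal.mul_le_mul_iff_right
    (pow_ne_zero n (Metric.measure_closedBall_pos volume (0 : Euc m) hε).ne')
    (ENNReal.pow_ne_top measure_closedBall_lt_top.ne)).1 h1
  rw [likelihood_data hqt hGt, likelihood_data hqs hGs]
  have h3 : ENNReal.ofReal (lik M.μ (M.q t) (M.pertG ε t) n (obsSeq ω) x₀) ≤
      ENNReal.ofReal (C / c * (C / c * lik M.μ (M.q s) (M.pertG ε s) n (obsSeq ω) x₀)) := by
    calc _ = ∫⁻ _, ENNReal.ofReal (lik M.μ (M.q t) (M.pertG ε t) n (obsSeq ω) x₀) ∂π₀ := by simp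
      _ ≤ ∫⁻ x, ENNReal.ofReal (C / c) *
          ENNReal.ofReal (lik M.μ (M.q t) (M.pertG ε t) n (obsSeq ω) x) ∂π₀ :=
        lintegral_mono fun x => by
          rw [← ENNReal.ofReal_mul hCc.le]
          exact ENNReal.ofReal_le_ofReal (lik_le_mul hqt hGt n _ _ _)
      _ = ENNReal.ofReal (C / c) *
          ∫⁻ x, ENNReal.ofReal (lik M.μ (M.q t) (M.pertG ε t) n (obsSeq ω) x) ∂π₀ :=
        lintegral_const_mul' _ _ ENNReal.ofReal_ne_top
      _ ≤ ENNReal.ofReal (C / c) *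
          ∫⁻ x, ENNReal.ofReal (lik M.μ (M.q s) (M.pertG ε s) n (obsSeq ω) x) ∂π₀ := by gcongr
      _ ≤ ENNReal.ofReal (C / c) * ∫⁻ _, ENNReal.ofReal
          (C / c * lik M.μ (M.q s) (M.pertG ε s) n (obsSeq ω) x₀) ∂π₀ := by
        gcongr with x
        exact lik_le_mul hqs hGs n _ _ _
      _ = _ := by simp [ENNReal.ofReal_mul hCc.le]
  have hps := (lik_pos_and_le (μ := M.μ) hqs hGs n (obsSeq ω) x₀).1
  have h4 := Real.log_le_log (lik_pos_and_le hqt hGt n (obsSeq ω) x₀).1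
    ((ENNReal.ofReal_le_ofReal_iff (by positivity)).1 h3)
  rw [Real.log_mul hCc.ne' (mul_pos hCc hps).ne', Real.log_mul hCc.ne' hps.ne'] at h4
  linarith

lemma IsLimitSurface.isABCMLELimit [Nonempty (𝒳 × Euc m)] [NeZero M.μ] {c C ε : ℝ}
    (hM : M.Regular c C) (hε : 0 < ε) {P : Measure (ℤ → 𝒳 × Euc m)} {θs t : Euc d}
    {l : Euc d → ℝ} (h : M.IsLimitSurface P θs ε l) (hl : ContinuousOn l M.Θ)
    (ht : IsUniqueMaxOn l M.Θ t) (x₀ : 𝒳) : M.IsABCMLELimit P ε t := by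
  intro π₀ hπ₀
  filter_upwards [h x₀] with ω hω est hest
  refine tendsto_of_isUniqueMaxOn M.compact_param hl ht hω
    (a := fun n : ℕ => (n : ℝ)⁻¹ * (2 * Real.log (C / c))) ?_ (fun n => (hest n).1) fun n => ?_
  · simpa using (tendsto_inv_atTop_nhds_zero_nat (𝕜 := ℝ)).mul_const (2 * Real.log (C / c))
  · have h1 := (hest n).log_likelihood_le hM hε ht.1 x₀
    rw [← mul_sub]
    exact mul_le_mul_of_nonneg_left (by linarith) (by positivity)

end HMMFamily

theorem theorem6 {𝒳 : Type*} [TopologicalSpace 𝒳] [PolishSpace 𝒳] [CompactSpace 𝒳]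
    [MeasurableSpace 𝒳] [BorelSpace 𝒳] {d m : ℕ} (hm : 1 ≤ m)
    (M : HMMFamily 𝒳 d m) (θs : Euc d)
    (P : Euc d → Measure (ℤ → 𝒳 × Euc m)) (hP : ∀ θ ∈ M.Θ, M.IsStationaryLaw θ (P θ))
    (h1 : M.A1 P θs) (h2 : M.A2) (h3 : M.A3) (h4 : M.A4) (h5 : M.A5)
    (h6 : M.A6 (HMMFamily.obsLaw (P θs)))
    (h7 : M.A7 (HMMFamily.obsLaw (P θs)))
    (h8 : M.A8 (HMMFamily.obsLaw (P θs))) :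
    ∃ l : ℝ → Euc d → ℝ,
      (∀ ε : ℝ, 0 ≤ ε →
        M.IsLimitSurface (P θs) θs ε (l ε) ∧ ContDiffOn ℝ 2 (l ε) (interior M.Θ)) ∧
      ((∀ v : Euc d, v ≠ 0 → fderiv ℝ (fderiv ℝ (l 0)) θs v v < 0) →
        ∃ θstar : ℝ → Euc d,
          (∀ᶠ ε in 𝓝[>] (0 : ℝ),
            IsUniqueMaxOn (l ε) M.Θ (θstar ε) ∧ M.IsABCMLELimit (P θs) ε (θstar ε)) ∧
          (fun ε => θstar ε - θs) =O[𝓝[>] (0 : ℝ)] (fun ε => ε ^ 2)) := by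
  obtain ⟨hθi, hid⟩ := h1
  have hθs : θs ∈ M.Θ := interior_subset hθi
  have hPs := hP θs hθs
  obtain ⟨x₀⟩ : Nonempty 𝒳 := by
    obtain ⟨π, hπ, -⟩ := hPs
    by_contra h
    rw [not_nonempty_iff] at h
    exact IsProbabilityMeasure.ne_zero π (Measure.eq_zero_of_isEmpty π)
  have : Nonempty (𝒳 × Euc m) := ⟨(x₀, 0)⟩
  have : NeZero M.μ := ⟨fun h => by simpa [h] using M.lintegral_q θs hθs x₀⟩
  have hPp := hPs.isProbabilityMeasure hθs
  have hρ : IsProbabilityMeasure (HMMFamily.obsLaw (P θs)) :=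
    Measure.isProbabilityMeasure_map (measurable_snd.comp (measurable_pi_apply _)).aemeasurable
  obtain ⟨c, C, hM⟩ := HMMFamily.exists_regular h6.1 h2 h3 h4 h7 h8
  obtain ⟨r, b₁, b₂, R, β, β', hB⟩ := HMMFamily.exists_majorants h6 h7 h8
  set Q := (P θs).map HMMFamily.obsSeq with hQdef
  have : IsProbabilityMeasure Q :=
    Measure.isProbabilityMeasure_map HMMFamily.measurable_obsSeq.aemeasurable
  have hS := (hPs.isMixingLaw hθs (hM.isMixing hθs)).shift
  have hQ : MeasurePreserving (fun y : ℕ → Euc m => y 0) Q (HMMFamily.obsLaw (P θs)) := by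
    refine ⟨measurable_pi_apply 0, ?_⟩
    rw [hQdef, Measure.map_map (measurable_pi_apply 0) HMMFamily.measurable_obsSeq,
      HMMFamily.obsLaw]
    conv_rhs => rw [← hPs.map_shift]
    refine Eq.trans ?_ (Measure.map_map (measurable_snd.comp (measurable_pi_apply 0))
      HMMFamily.measurable_shift).symm
    rfl
  have hlim (ε : ℝ) (hε : 0 ≤ ε) : M.IsLimitSurface (P θs) θs ε (M.surface Q r x₀ θs ε) :=
    hB.isLimitSurface hM hPs hθs hQ hε
  refine ⟨M.surface Q r x₀ θs, fun ε hε => ⟨hlim ε hε, hB.contDiffOn_surface hM hQ hS hθs hε⟩,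
    fun hneg => ?_⟩
  obtain ⟨K, hK⟩ := hB.exists_norm_surfaceScore_sub_le (x₀ := x₀) hM hQ hS hθi
  have hD {ε : ℝ} (hε : 0 ≤ ε) {θ : Euc d} (hθ : θ ∈ interior M.Θ) :=
    hB.hasFDerivAt_surface (x₀ := x₀) hM hQ hS hθs hε hθ
  have hH {ε : ℝ} (hε : 0 ≤ ε) {θ : Euc d} (hθ : θ ∈ interior M.Θ) :=
    hB.hasFDerivAt_surfaceScore (x₀ := x₀) hM hQ hS hε hθ
  have hHess : fderiv ℝ (fderiv ℝ (M.surface Q r x₀ θs 0)) θs = M.surfaceHess Q r x₀ 0 θs := by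
    rw [← (hH le_rfl hθi).fderiv]
    refine Filter.EventuallyEq.fderiv_eq ?_
    filter_upwards [isOpen_interior.mem_nhds hθi] with θ hθ using (hD le_rfl hθ).fderiv
  have hmax (θ : Euc d) (hθ : θ ∈ M.Θ) (hne : θ ≠ θs) :
      M.surface Q r x₀ θs 0 θ < M.surface Q r x₀ θs 0 θs := by
    rw [hQdef, HMMFamily.Majorants.surface_self]
    by_contra! h
    exact hne ((hid θ hθ).2 (hB.map_obs_eq_of_surface_nonneg hM (hP θ hθ) hPs hθ hθs hQ h))
  obtain ⟨t, ht, hO⟩ := exists_perturbed_maximiser M.compact_param hθi hB.R_pos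
    (fun ε hε θ hθ => hD hε.1 hθ) (fun ε hε θ hθ => hH hε.1 hθ)
    (fun ε hε => hB.continuousOn_surface hM hQ hθs hε.1)
    (fun θ hθ => hB.continuousWithinAt_surface hM hQ hθs hθ)
    (hB.continuousWithinAt_surfaceHess hM hQ hS hθi) hmax hK
    (fun v hv => by rw [← hHess]; exact hneg v hv)
  refine ⟨t, ?_, hO⟩
  filter_upwards [ht, self_mem_nhdsWithin] with ε hu hε
  have hε' : (0 : ℝ) < ε := hε
  exact ⟨hu, (hlim ε hε'.le).isABCMLELimit hM hε' (hB.continuousOn_surface hM hQ hθs hε'.le) hu x₀⟩
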